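/- Throughout, $\mathbb N$ is the set of positive integers and a monoid is a commutative cancellative semigroup $H$ with unit element; $H^\times$ is its group of units, $\mathsf q(H)$ its quotient group, and $(A:B)=\{x\in\mathsf q(H)\mid xB\subset A\}$ for $A,B\subset\mathsf q(H)$. For $a\in H$, $\mathsf L(a)$ is the set of all $k\ge 0$ such that $a$ is, up to a unit, a product of $k$ atoms, and $\Delta(H)$ is the set of all $d\in\mathbb N$ for which there are $a\in H$ and $k,l\in\mathsf L(a)$ with $d=l-k$ and $[k,l]\cap\mathsf L(a)=\{k,l\}$. An $s$-ideal of $H$ is a subset $I\subset H$ with $HI\subset I$; it is prime if $I\neq H$ and, for $a,b\in H$, $ab\in I$ implies $a\in I$ or $b\in I$. $\mathfrak X(H)$ is the set of minimal non-empty prime $s$-ideals, and $H_{\mathfrak p}=\{a/t\mid a\in H,\ t\in H\setminus\mathfrak p\}$. For $X\subset\mathsf q(H)$ put $X_v=(H:(H:X))$. A fractional $v$-ideal is a non-empty $A\subset\mathsf q(H)$ with $A_v=A$ and $cA\subset H$ for some $c\in H$. The $v$-class group $\mathcal C_v(H)$ is the group of $v$-invertible fractional $v$-ideals (with product $(AB)_v$)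 modulo the subgroup of principal fractional ideals $aH$, $a\in\mathsf q(H)$. The complete integral closure is $\widehat H=\{x\in\mathsf q(H)\mid \exists\,c\in H\ \forall n\in\mathbb N:\ cx^n\in H\}$, and the conductor is $\mathfrak f=(H:\widehat H)$. $H$ is seminormal if every $x\in\mathsf q(H)$ with $x^n\in H$ for all sufficiently large $n$ lies in $H$; $v$-noetherian if the ideals $I\subset H$ with $I_v=I$ satisfy the ascending chain condition; weakly Krull if $H=\bigcap_{\mathfrak p\in\mathfrak X(H)}H_{\mathfrak p}$ and each $a\in H$ lies in only finitely many $\mathfrak p\in\mathfrak X(H)$. A monoid $D$ is finitely primary if there are $s,\alpha\in\mathbb N$ such that $D$ is a submonoid of a factorial monoid $F=F^\times\times[q_1,\dots,q_s]$ with $s$ pairwise non-associated primes $q_1,\dots,q_s$, $D\setminus D^\times\subset q_1\cdots q_sF$, and $(q_1\cdots q_s)^\alpha F\subset D$. **Theorem 1.1.** Let $H$ be a seminormal $v$-noetherian weakly Krull monoid with conductor $\mathfrak f=(H:\widehat H)\neq\emptyset$. Suppose that $H_{\mathfrak p}$ is finitely primary for each $\mathfrak p\in\mathfrak X(H)$,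 and that every class of $G=\mathcal C_v(H)$ contains some $\mathfrak p\in\mathfrak X(H)$ with $\mathfrak p\not\supset\mathfrak f$. Then $\Delta(H)=\emptyset$ or $\min\Delta(H)=1$. Moreover: 1. If $|G|=1$, then $\Delta(H)\subset\{1\}$, and if $G$ is infinite, then $\Delta(H)=\mathbb N$. 2. Suppose that $G$ is finite. If there is at most one $\mathfrak p\in\mathfrak X(H)$ such that $|\{\mathfrak P\in\mathfrak X(\widehat H)\mid\mathfrak P\cap H=\mathfrak p\}|>1$, or if $G$ is an elementary $2$-group, then $\Delta(H)$ is a finite (possibly empty) interval of integers. -/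

import Mathlib

open scoped Pointwise

/-! ### Sets of lengths and sets of distances -/

section Arithmetic

variable {H : Type*} [CancelCommMonoid H]

/-- The set of lengths `L(a)`: all `k` such that, up to a unit, `a` is a product of `k` atoms.
In particular `L(a) = {0}` for a unit `a`. -/
def lengthSet (a : H) : Set ℕ :=
  {k | ∃ z : Multiset H, (∀ u ∈ z, Irreducible u) ∧ Associated z.prod a ∧ Multiset.card z = k}

/-- The set of distances `Δ(L)` of a set `L` of nonnegative integers: all `d ≥ 1` such that
`d = l - k` for some `k, l ∈ L` with `[k, l] ∩ L = {k, l}`. -/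
def distancesOfSet (L : Set ℕ) : Set ℕ :=
  {d | 0 < d ∧ ∃ k ∈ L, ∃ l ∈ L, l = k + d ∧ Set.Icc k l ∩ L = {k, l}}

variable (H) in
/-- The set of distances `Δ(H)` of a monoid `H`. -/
def distances : Set ℕ := ⋃ a : H, distancesOfSet (lengthSet a)

end Arithmetic

/-! ### Ideal theory of a monoid inside its quotient group

In what follows `Q` is an abelian group and `S` is a submonoid of `Q` whose quotient group is `Q`,
that is, every element of `Q` has the form `a / b` with `a, b ∈ S`.  This is the case for the image
of a cancellative commutative monoid in its quotient group, and then also for every submonoid of `Q`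
that contains `S` (the complete integral closure and the localizations of `S`). -/

section Ideals

variable {Q : Type*} [CommGroup Q]

/-- `(A : B) = {x ∈ Q | x B ⊆ A}`. -/
def colonSet (A B : Set Q) : Set Q := {x | ∀ b ∈ B, x * b ∈ A}

/-- The seminormal closure: all `x ∈ Q` with `x ^ n ∈ S` for all sufficiently large `n`. -/
def seminormalClosure (S : Submonoid Q) : Set Q := {x | ∃ N : ℕ, ∀ n ≥ N, x ^ n ∈ S}

/-- `S` is seminormal if it equals its seminormal closure. -/
def IsSeminormalMonoid (S : Submonoid Q) : Prop := (S : Set Q) = seminormalClosure S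

/-- The complete integral closure of `S`: all `x ∈ Q` for which there is `c ∈ S` with
`c x ^ n ∈ S` for all `n ≥ 1`. -/
def completeIntClosure (S : Submonoid Q) : Submonoid Q where
  carrier := {x | ∃ c ∈ S, ∀ n : ℕ, 0 < n → c * x ^ n ∈ S}
  one_mem' := ⟨1, S.one_mem, fun n _ => by simp [S.one_mem]⟩
  mul_mem' := by
    rintro x y ⟨c, hc, hx⟩ ⟨d, hd, hy⟩
    refine ⟨c * d, S.mul_mem hc hd, fun n hn => ?_⟩
    have h := S.mul_mem (hx n hn) (hy n hn)
    rwa [mul_mul_mul_comm, ← mul_pow] at h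

/-- The conductor of `S` (in its complete integral closure). -/
def conductorSet (S : Submonoid Q) : Set Q := colonSet S (completeIntClosure S)

/-- `I` is an `s`-ideal of `S`: a (possibly empty) subset of `S` with `S I ⊆ I`. -/
def IsSIdeal (S : Submonoid Q) (I : Set Q) : Prop :=
  I ⊆ S ∧ ∀ a ∈ S, ∀ x ∈ I, a * x ∈ I

/-- `p` is a prime `s`-ideal of `S`. -/
def IsPrimeSIdeal (S : Submonoid Q) (p : Set Q) : Prop :=
  IsSIdeal S p ∧ p ≠ S ∧ ∀ a ∈ S, ∀ b ∈ S, a * b ∈ p → a ∈ p ∨ b ∈ p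

/-- The set `𝔛(S)` of minimal non-empty prime `s`-ideals of `S`. -/
def minimalPrimeSIdeals (S : Submonoid Q) : Set (Set Q) :=
  {p | Minimal (fun I => I.Nonempty ∧ IsPrimeSIdeal S I) p}

theorem isPrimeSIdeal_of_mem {S : Submonoid Q} {p : Set Q} (hp : p ∈ minimalPrimeSIdeals S) :
    IsPrimeSIdeal S p := by
  have h : Minimal (fun I => I.Nonempty ∧ IsPrimeSIdeal S I) p := hp
  exact h.prop.2

/-- The localization of `S` at a prime `s`-ideal `p`: all fractions `a / t` with
`a ∈ S` and `t ∈ S \ p`. -/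
def localizationAtPrime (S : Submonoid Q) (p : Set Q) (hp : IsPrimeSIdeal S p) :
    Submonoid Q where
  carrier := {x | ∃ a ∈ S, ∃ t ∈ S, t ∉ p ∧ x = a / t}
  one_mem' := by
    refine ⟨1, S.one_mem, 1, S.one_mem, fun h1 => hp.2.1 ?_, by simp⟩
    refine Set.Subset.antisymm hp.1.1 fun x hx => ?_
    simpa using hp.1.2 x hx 1 h1
  mul_mem' := by
    rintro _ _ ⟨a, ha, t, ht, htp, rfl⟩ ⟨b, hb, r, hr, hrp, rfl⟩
    refine ⟨a * b, S.mul_mem ha hb, t * r, S.mul_mem ht hr, fun h => ?_, ?_⟩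
    · exact (hp.2.2 t ht r hr h).elim htp hrp
    · exact div_mul_div_comm a t b r

/-- `S` is a weakly Krull monoid: it is the intersection of its localizations at the minimal
non-empty primes, and each element of `S` lies in only finitely many of these primes. (An empty
intersection is the whole quotient group.) -/
def IsWeaklyKrull (S : Submonoid Q) : Prop :=
  (∀ x : Q, x ∈ S ↔
    ∀ (p : Set Q) (hp : p ∈ minimalPrimeSIdeals S),
      x ∈ localizationAtPrime S p (isPrimeSIdeal_of_mem hp)) ∧
  ∀ a ∈ S, {p ∈ minimalPrimeSIdeals S | a ∈ p}.Finite

/-- `D` is finitely primary: `D` is a submonoid of a factorial monoid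
`F = Fˣ × [q₁, …, qₛ]` with `s ≥ 1` pairwise non-associated primes `q₁, …, qₛ`, every non-unit
of `D` lies in `q₁ ⋯ qₛ F`, and `(q₁ ⋯ qₛ) ^ α F ⊆ D` for some `α ≥ 1`.  The last condition forces
`F` into the quotient group of `D`, so `F` is taken there.  The decomposition of `F` says that every
element of `F` is `ε q₁ ^ k₁ ⋯ qₛ ^ kₛ` with a unique unit `ε` of `F` and unique exponents. -/
def IsFinitelyPrimary (D : Submonoid Q) : Prop :=
  ∃ (F : Submonoid Q) (s α : ℕ) (q : Fin s → Q),
    D ≤ F ∧ 0 < s ∧ 0 < α ∧ (∀ i, q i ∈ F) ∧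
    (∀ x ∈ F, ∃! y : Q × (Fin s → ℕ), y.1 ∈ F ∧ y.1⁻¹ ∈ F ∧ x = y.1 * ∏ i, q i ^ y.2 i) ∧
    (∀ x ∈ D, x⁻¹ ∉ D → ∃ y ∈ F, x = (∏ i, q i) * y) ∧
    (∀ y ∈ F, (∏ i, q i) ^ α * y ∈ D)

/-! ### Divisorial ideals and the `v`-class group -/

/-- The `v`-closure `X_v = (S : (S : X))` of a subset `X` of the quotient group. -/
def vClosure (S : Submonoid Q) (X : Set Q) : Set Q := colonSet S (colonSet S X)

/-- `S` is `v`-noetherian: the `v`-ideals (divisorial ideals) of `S` satisfy the ascending chain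
condition. -/
def IsVNoetherian (S : Submonoid Q) : Prop :=
  WellFoundedGT {I : Set Q // I ⊆ S ∧ vClosure S I = I}

theorem subset_vClosure (S : Submonoid Q) (X : Set Q) : X ⊆ vClosure S X := by
  intro x hx y hy
  rw [mul_comm]
  exact hy x hx

theorem colonSet_anti (S : Submonoid Q) {X Y : Set Q} (h : X ⊆ Y) :
    colonSet (S : Set Q) Y ⊆ colonSet S X := fun _ hz x hx => hz x (h hx)

theorem colonSet_vClosure_mul (S : Submonoid Q) (X Y : Set Q) :
    colonSet (S : Set Q) (vClosure S X * Y) = colonSet S (X * Y) := by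
  apply Set.Subset.antisymm
  · exact colonSet_anti S (Set.mul_subset_mul_right (subset_vClosure S X))
  · rintro z hz _ ⟨w, hw, y, hy, rfl⟩
    have h : z * y ∈ colonSet (S : Set Q) X := fun x hx => by
      have := hz (x * y) ⟨x, hx, y, hy, rfl⟩
      rwa [mul_comm x y, ← mul_assoc] at this
    have h2 := hw _ h
    rwa [mul_left_comm] at h2

theorem vClosure_vClosure_mul (S : Submonoid Q) (X Y : Set Q) :
    vClosure S (vClosure S X * Y) = vClosure S (X * Y) := by
  rw [vClosure, colonSet_vClosure_mul, vClosure]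

theorem vClosure_mul_vClosure (S : Submonoid Q) (X Y : Set Q) :
    vClosure S (X * vClosure S Y) = vClosure S (X * Y) := by
  rw [mul_comm, vClosure_vClosure_mul, mul_comm]

theorem vClosure_idem (S : Submonoid Q) (X : Set Q) :
    vClosure S (vClosure S X) = vClosure S X := by
  simpa using vClosure_vClosure_mul S X 1

theorem colonSet_self (S : Submonoid Q) : colonSet (S : Set Q) S = S := by
  apply Set.Subset.antisymm
  · intro x hx
    simpa using hx 1 S.one_mem
  · exact fun x hx y hy => S.mul_mem hx hy

theorem vClosure_self (S : Submonoid Q) : vClosure S S = S := by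
  rw [vClosure, colonSet_self, colonSet_self]

theorem colonSet_smul (S : Submonoid Q) (a : Q) (X : Set Q) :
    colonSet (S : Set Q) (a • X) = a⁻¹ • colonSet (S : Set Q) X := by
  ext x
  rw [Set.mem_smul_set_iff_inv_smul_mem, inv_inv]
  constructor
  · intro h y hy
    have := h (a * y) ⟨y, hy, rfl⟩
    rwa [← mul_assoc, mul_comm x a] at this
  · rintro h _ ⟨y, hy, rfl⟩
    have := h y hy
    rwa [smul_eq_mul, mul_comm a x, mul_assoc] at this

theorem vClosure_smul (S : Submonoid Q) (a : Q) (X : Set Q) :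
    vClosure S (a • X) = a • vClosure S X := by
  rw [vClosure, colonSet_smul, colonSet_smul, inv_inv, vClosure]

/-- Fractional `v`-ideals of `S`: the non-empty subsets `A` of the quotient group with
`c A ⊆ S` for some `c ∈ S` and `A_v = A`. -/
@[ext]
structure FracVIdeal (S : Submonoid Q) where
  carrier : Set Q
  nonempty : carrier.Nonempty
  fractional : ∃ c ∈ S, ∀ x ∈ carrier, c * x ∈ S
  vClosure_eq : vClosure S carrier = carrier

namespace FracVIdeal

variable {S : Submonoid Q}

/-- The `v`-multiplication `A ·ᵥ B = (A B)_v`. -/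
instance : Mul (FracVIdeal S) where
  mul A B :=
    { carrier := vClosure S (A.carrier * B.carrier)
      nonempty := (A.nonempty.mul B.nonempty).mono (subset_vClosure S _)
      fractional := by
        obtain ⟨c, hc, hA⟩ := A.fractional
        obtain ⟨d, hd, hB⟩ := B.fractional
        refine ⟨c * d, S.mul_mem hc hd, fun x hx => ?_⟩
        rw [mul_comm]
        refine hx _ ?_
        rintro _ ⟨a, ha, b, hb, rfl⟩
        have h := S.mul_mem (hA a ha) (hB b hb)
        rwa [mul_mul_mul_comm] at h
      vClosure_eq := vClosure_idem S _ }

instance : One (FracVIdeal S) where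
  one :=
    { carrier := S
      nonempty := ⟨1, S.one_mem⟩
      fractional := ⟨1, S.one_mem, fun x hx => by simpa using hx⟩
      vClosure_eq := vClosure_self S }

theorem carrier_mul (A B : FracVIdeal S) :
    (A * B).carrier = vClosure S (A.carrier * B.carrier) := rfl

theorem carrier_one : (1 : FracVIdeal S).carrier = S := rfl

theorem carrier_mul_self (A : FracVIdeal S) : A.carrier * (S : Set Q) = A.carrier := by
  apply Set.Subset.antisymm
  · rintro _ ⟨a, ha, s, hs, rfl⟩
    rw [← A.vClosure_eq] at ha ⊢
    intro y hy
    have h := S.mul_mem (ha y hy) hs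
    rwa [mul_right_comm] at h
  · exact fun a ha => ⟨a, ha, 1, S.one_mem, mul_one a⟩

/-- The monoid of fractional `v`-ideals under `v`-multiplication. Its group of units consists of the
`v`-invertible fractional `v`-ideals. -/
instance : CommMonoid (FracVIdeal S) where
  mul_assoc A B C := by
    ext1
    simp only [carrier_mul, vClosure_vClosure_mul, vClosure_mul_vClosure, mul_assoc]
  one_mul A := by
    ext1
    rw [carrier_mul, carrier_one, mul_comm, carrier_mul_self, A.vClosure_eq]
  mul_one A := by
    ext1
    rw [carrier_mul, carrier_one, carrier_mul_self, A.vClosure_eq]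
  mul_comm A B := by
    ext1
    rw [carrier_mul, carrier_mul, mul_comm]

end FracVIdeal

/-- The subgroup of principal fractional ideals `a S`, `a ∈ Q`, in the group of `v`-invertible
fractional `v`-ideals. -/
def principalSubgroup (S : Submonoid Q) : Subgroup (FracVIdeal S)ˣ where
  carrier := {u | ∃ a : Q, (u : FracVIdeal S).carrier = a • (S : Set Q)}
  one_mem' := ⟨1, by simp [FracVIdeal.carrier_one]⟩
  mul_mem' := by
    rintro u w ⟨a, ha⟩ ⟨b, hb⟩
    refine ⟨a * b, ?_⟩
    rw [Units.val_mul, FracVIdeal.carrier_mul, ha, smul_mul_assoc, vClosure_smul, mul_comm,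
      FracVIdeal.carrier_mul_self, FracVIdeal.vClosure_eq, hb, smul_smul]
  inv_mem' := by
    rintro u ⟨a, ha⟩
    refine ⟨a⁻¹, ?_⟩
    have h : (u : FracVIdeal S) * ((u⁻¹ : (FracVIdeal S)ˣ) : FracVIdeal S) = 1 := u.mul_inv
    have h2 := congrArg FracVIdeal.carrier h
    rw [FracVIdeal.carrier_mul, ha, smul_mul_assoc, vClosure_smul, mul_comm,
      FracVIdeal.carrier_mul_self, FracVIdeal.vClosure_eq, FracVIdeal.carrier_one] at h2
    rw [← h2, inv_smul_smul]

/-- The `v`-class group: `v`-invertible fractional `v`-ideals modulo principal fractional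
ideals. -/
abbrev VClassGroup (S : Submonoid Q) : Type _ := (FracVIdeal S)ˣ ⧸ principalSubgroup S

end Ideals

/-- A cancellative commutative monoid `H`, viewed as a submonoid of its quotient group. -/
def insideQuotientGroup (H : Type*) [CancelCommMonoid H] :
    Submonoid (Algebra.GrothendieckGroup H) :=
  MonoidHom.mrange Algebra.GrothendieckGroup.of

/-! The proof transfers factorizations from $H$ to a combinatorial monoid, the $T$-block monoid over
$G$, and then studies gaps in sets of lengths there.

Transfer. Localizations of a seminormal monoid are seminormal, so every $H_{\mathfrak p}$ is
seminormal and finitely primary. Such a monoid consists of its units and of all elements of the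
quotient group whose exponents are all positive (`IsFinitelyPrimary.nonempty_exponentData`). If
$\mathfrak p\not\supset\mathfrak f$, there is one exponent and $H_{\mathfrak p}$ is given by its
being nonnegative; only finitely many $\mathfrak p$ contain $\mathfrak f$. A family $(x_{\mathfrak
p})$ that is a local unit almost everywhere defines a $v$-invertible fractional ideal, and an
element of $H$ is, up to units, such a family of local elements with trivial class. Keep only the
classes of the regular primes with multiplicity and, at each singular prime, the class and the
exponent vector. This maps $H$ onto the block monoid, because every class contains a regular prime,
and decompositions of an image lift to decompositions in $H$. Hence distances agree
(`WeaklyKrullData.distances_eq_block`).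

Gaps. Suppose that $d$ is not a distance although a larger number is. Then some element has a
non-maximal length $k$ followed by a gap larger than $d$; it is called wide, and one of least degree
is critical (`BlockData.exists_crit`). If a critical element can be contracted to an element of
smaller degree such that factorizations lift back with length growing by 0 or 1, then the
contraction is wide as well, a contradiction (`move_false`, `contract_false`). Admissible
contractions replace two group elements by their sum, an all-ones piece at an index by its class, or
the whole piece at an index by its class. They force the critical element to be $U+V$ with atoms
$U$, $V$ and $k=2$. Each of $U$, $V$ contains at most one group element; both meet the same indices;
there each has an entry 1 and an entry at least 2, joint entries are at least 3, and no prime has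
the class of a unit.

For $d=1$ explicit relations between products of two and of three atoms finish, so a nonempty set of
distances contains 1. For $d\ge2$ and an elementary 2-group, vectors with even entries have trivial
class and can be moved between atoms (`Crit.two_torsion`). If only one index has rank at least 2,
then $U$ and $V$ live at that index, and swapping a prime, possibly together with group elements,
for group elements restricts the classes of the primes until every case is contradictory
(`CritPair.elim`). In both situations distances form an initial segment of the positive integers.

The remaining assertions are independent of this descent. If $G$ is finite, gaps are bounded,
because an atom of one factorization is covered by boundedly many atoms of another one
(`exists_gap_bound`). If $G$ is infinite, suitably independent elements give sets of lengths
$\{2,r+1\}$ for all $r\ge2$. If $G$ is trivial, three atoms meeting a common index of rank at least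
2 regroup into two. -/

set_option linter.unusedSectionVars false
set_option linter.unusedSimpArgs false

/-! ### Lengths, distances and wide gaps in reduced monoids with a degree -/

section LengthTheory

variable {M : Type*} [AddCommMonoid M]

/-- Atoms of a reduced additive submonoid. -/
def IsAtomIn (B : AddSubmonoid M) (u : M) : Prop :=
  u ∈ B ∧ u ≠ 0 ∧ ∀ v ∈ B, ∀ w ∈ B, v + w = u → v = 0 ∨ w = 0

/-- Additive sets of lengths in a reduced submonoid. -/
def lengthsIn (B : AddSubmonoid M) (x : M) : Set ℕ :=
  {k | ∃ z : Multiset M, (∀ u ∈ z, IsAtomIn B u) ∧ z.sum = x ∧ Multiset.card z = k}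

/-- The set of distances of a reduced additive submonoid. -/
def distancesIn (B : AddSubmonoid M) : Set ℕ := ⋃ x ∈ B, distancesOfSet (lengthsIn B x)

/-- `k` is a length of `x` which is not maximal, and the next length exceeds `k + d`. -/
def Wide (B : AddSubmonoid M) (d : ℕ) (x : M) (k : ℕ) : Prop :=
  k ∈ lengthsIn B x ∧ (∃ l ∈ lengthsIn B x, k < l) ∧ ∀ l ∈ lengthsIn B x, k < l → k + d < l

variable {B : AddSubmonoid M}

theorem sum_mem_of_atoms {z : Multiset M} (hz : ∀ u ∈ z, IsAtomIn B u) : z.sum ∈ B :=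
  B.multiset_sum_mem z fun u hu => (hz u hu).1

theorem mem_of_mem_lengthsIn {x : M} {k : ℕ} (h : k ∈ lengthsIn B x) : x ∈ B := by
  obtain ⟨z, hz, rfl, -⟩ := h
  exact sum_mem_of_atoms hz

theorem add_mem_lengthsIn {x y : M} {k l : ℕ} (hk : k ∈ lengthsIn B x) (hl : l ∈ lengthsIn B y) :
    k + l ∈ lengthsIn B (x + y) := by
  obtain ⟨z, hz, rfl, rfl⟩ := hk
  obtain ⟨w, hw, rfl, rfl⟩ := hl
  refine ⟨z + w, fun u hu => ?_, by simp, by simp⟩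
  rcases Multiset.mem_add.1 hu with h | h
  exacts [hz u h, hw u h]

theorem card_mem_lengthsIn {z : Multiset M} (hz : ∀ u ∈ z, IsAtomIn B u) :
    Multiset.card z ∈ lengthsIn B z.sum := ⟨z, hz, rfl, rfl⟩

theorem IsAtomIn.one_mem_lengthsIn {u : M} (hu : IsAtomIn B u) : 1 ∈ lengthsIn B u :=
  ⟨{u}, by simpa using hu, by simp, by simp⟩

theorem length_pos {x : M} {l : ℕ} (hx : x ≠ 0) (h : l ∈ lengthsIn B x) : 0 < l := by
  obtain ⟨z, hz, rfl, rfl⟩ := h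
  rw [Multiset.card_pos]
  rintro rfl
  exact hx rfl

/-- If an element has a length at most `k`, a length above `k`, and all of the latter are at least
`k + d`, where `d` is not a distance, then it is wide. -/
theorem exists_wide {d k : ℕ} (hd : d ∉ distancesIn B) (hd1 : 1 ≤ d) {x : M} (hx : x ∈ B)
    (h1 : ∃ l ∈ lengthsIn B x, l ≤ k) (h2 : ∃ l ∈ lengthsIn B x, k < l)
    (h3 : ∀ l ∈ lengthsIn B x, k < l → k + d ≤ l) :
    ∃ k' ≤ k, Wide B d x k' ∧ ∀ l ∈ lengthsIn B x, l ≤ k → l ≤ k' := by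
  classical
  obtain ⟨l0, hl0, hl0k⟩ := h1
  set k' := Nat.findGreatest (fun l => l ∈ lengthsIn B x) k with hk'
  have hk'mem : k' ∈ lengthsIn B x := Nat.findGreatest_spec (P := fun l => l ∈ lengthsIn B x)
    hl0k hl0
  have hk'le : k' ≤ k := Nat.findGreatest_le k
  have hmax : ∀ l ∈ lengthsIn B x, l ≤ k → l ≤ k' := fun l hl hlk => Nat.le_findGreatest hlk hl
  refine ⟨k', hk'le, ⟨hk'mem, ?_, ?_⟩, hmax⟩
  · obtain ⟨l, hl, hkl⟩ := h2
    exact ⟨l, hl, by omega⟩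
  · intro l hl hkl
    have hl' : k < l := by
      by_contra h
      exact absurd (hmax l hl (by omega)) (by omega)
    have h4 := h3 l hl hl'
    -- Here `l ≥ k + d ≥ k' + d`. Equality would force `k' = k` and make `d` the gap directly above
    -- `k'`, hence a distance.
    by_contra hcon
    apply hd
    simp only [distancesIn, Set.mem_iUnion]
    refine ⟨x, hx, hd1, k', hk'mem, l, hl, by omega, ?_⟩
    ext m
    simp only [Set.mem_inter_iff, Set.mem_Icc, Set.mem_insert_iff, Set.mem_singleton_iff]
    constructor
    · rintro ⟨⟨hm1, hm2⟩, hm3⟩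
      by_cases hmk : m ≤ k
      · left; exact le_antisymm (hmax m hm3 hmk) hm1
      · right
        have := h3 m hm3 (by omega)
        omega
    · rintro (rfl | rfl)
      · exact ⟨⟨le_rfl, by omega⟩, hk'mem⟩
      · exact ⟨⟨by omega, le_rfl⟩, hl⟩

variable {f : M →+ ℕ} (hf : ∀ x ∈ B, f x = 0 → x = 0)
include hf

theorem eq_zero_of_add_eq_zero_in {x y : M} (hx : x ∈ B) (h : x + y = 0) : x = 0 := by
  apply hf x hx
  have := congrArg f h
  rw [map_add, map_zero] at this
  omega

theorem eq_zero_of_mem_of_sum_eq_zero {z : Multiset M} (hz : ∀ u ∈ z, IsAtomIn B u)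
    (h : z.sum = 0) : z = 0 := by
  rcases Multiset.empty_or_exists_mem z with h0 | ⟨u, hu⟩
  · exact h0
  · obtain ⟨t, rfl⟩ := Multiset.exists_cons_of_mem hu
    rw [Multiset.sum_cons] at h
    exact absurd (eq_zero_of_add_eq_zero_in hf (hz u hu).1 h) (hz u hu).2.1

theorem length_zero {l : ℕ} (h : l ∈ lengthsIn B (0 : M)) : l = 0 := by
  obtain ⟨z, hz, h0, rfl⟩ := h
  rw [eq_zero_of_mem_of_sum_eq_zero hf hz h0, Multiset.card_zero]

theorem length_atom {u : M} (hu : IsAtomIn B u) {l : ℕ} (h : l ∈ lengthsIn B u) : l = 1 := by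
  obtain ⟨z, hz, h0, rfl⟩ := h
  rcases Multiset.empty_or_exists_mem z with h1 | ⟨v, hv⟩
  · subst h1
    exact absurd h0.symm hu.2.1
  · obtain ⟨t, rfl⟩ := Multiset.exists_cons_of_mem hv
    rw [Multiset.sum_cons] at h0
    have ht : ∀ u ∈ t, IsAtomIn B u := fun u h => hz u (Multiset.mem_cons_of_mem h)
    rcases hu.2.2 v (hz v hv).1 _ (sum_mem_of_atoms ht) h0 with h | h
    · exact absurd h (hz v hv).2.1
    · rw [eq_zero_of_mem_of_sum_eq_zero hf ht h]
      simp

theorem exists_factorization {x : M} (hx : x ∈ B) :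
    ∃ z : Multiset M, (∀ u ∈ z, IsAtomIn B u) ∧ z.sum = x := by
  induction hn : f x using Nat.strong_induction_on generalizing x with
  | _ n ih =>
    by_cases h0 : x = 0
    · exact ⟨0, by simp, by simp [h0]⟩
    by_cases ha : IsAtomIn B x
    · exact ⟨{x}, by simpa using ha, by simp⟩
    · simp only [IsAtomIn, not_and, not_forall] at ha
      obtain ⟨v, hv, w, hw, hvw, hne⟩ := ha hx h0
      push Not at hne
      have hv' := mt (hf v hv) hne.1
      have hw' := mt (hf w hw) hne.2
      have hs : f v + f w = n := by rw [← hn, ← hvw, map_add]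
      obtain ⟨z1, h1, rfl⟩ := ih (f v) (by omega) hv rfl
      obtain ⟨z2, h2, rfl⟩ := ih (f w) (by omega) hw rfl
      refine ⟨z1 + z2, fun u hu => ?_, by simpa using hvw⟩
      rcases Multiset.mem_add.1 hu with h | h
      exacts [h1 u h, h2 u h]

theorem exists_length {x : M} (hx : x ∈ B) : ∃ l, l ∈ lengthsIn B x := by
  obtain ⟨z, hz, h⟩ := exists_factorization hf hx
  exact ⟨_, z, hz, h, rfl⟩

theorem exists_length_ge {y : Multiset M} (hy : ∀ u ∈ y, u ∈ B ∧ u ≠ 0) :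
    ∃ l ∈ lengthsIn B y.sum, Multiset.card y ≤ l := by
  induction y using Multiset.induction_on with
  | empty => exact ⟨0, ⟨0, by simp, by simp, by simp⟩, by simp⟩
  | cons a s ih =>
    obtain ⟨l, hl, hle⟩ := ih fun u hu => hy u (Multiset.mem_cons_of_mem hu)
    obtain ⟨ha, h0⟩ := hy a (Multiset.mem_cons_self a s)
    obtain ⟨m, hm⟩ := exists_length hf ha
    have := length_pos h0 hm
    rw [Multiset.sum_cons]
    exact ⟨m + l, add_mem_lengthsIn hm hl, by rw [Multiset.card_cons]; omega⟩

theorem length_le_deg {x : M} {l : ℕ} (h : l ∈ lengthsIn B x) : l ≤ f x := by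
  obtain ⟨z, hz, rfl, rfl⟩ := h
  induction z using Multiset.induction_on with
  | empty => simp
  | cons a s ih =>
    have h1 := ih fun u hu => hz u (Multiset.mem_cons_of_mem hu)
    have ha := hz a (Multiset.mem_cons_self a s)
    have h2 := mt (hf a ha.1) ha.2.1
    rw [Multiset.sum_cons, map_add, Multiset.card_cons]
    omega

end LengthTheory

/-! ### Descent along contractions -/

section CriticalElements

variable {M : Type*} [AddCommMonoid M] [IsCancelAdd M] {B : AddSubmonoid M} {f : M →+ ℕ}
  {d k : ℕ} {x : M}

/-- Every proper part of a factorization whose length is followed by a large gap has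
no longer factorization, provided that no smaller element is wide. -/
theorem length_le_card_of_proper (hf : ∀ x ∈ B, f x = 0 → x = 0) (hd : d ∉ distancesIn B)
    (hd1 : 1 ≤ d) (hw : Wide B d x k) (ih : ∀ y ∈ B, f y < f x → ∀ k', ¬Wide B d y k')
    {y w : Multiset M} (hz : ∀ u ∈ y + w, IsAtomIn B u) (hsum : (y + w).sum = x)
    (hcard : Multiset.card (y + w) = k) (hw0 : w ≠ 0) {l : ℕ} (hl : l ∈ lengthsIn B y.sum) :
    l ≤ Multiset.card y := by
  by_contra hlt
  have hy : ∀ u ∈ y, IsAtomIn B u := fun u hu => hz u (Multiset.mem_add.2 (Or.inl hu))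
  have hwa : ∀ u ∈ w, IsAtomIn B u := fun u hu => hz u (Multiset.mem_add.2 (Or.inr hu))
  rw [Multiset.sum_add] at hsum
  rw [Multiset.card_add] at hcard
  -- A length of the part above `|y|` extends by `w` to a length of `x` above `k`. So the part
  -- inherits the gap of `x`, although its degree is smaller.
  obtain ⟨k', -, hk', -⟩ := exists_wide (k := Multiset.card y) hd hd1 (sum_mem_of_atoms hy)
    ⟨_, card_mem_lengthsIn hy, le_rfl⟩ ⟨l, hl, by omega⟩ (by
      intro m hm hlt'
      have := hw.2.2 (m + Multiset.card w) (hsum ▸ add_mem_lengthsIn hm (card_mem_lengthsIn hwa))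
        (by omega)
      omega)
  refine ih _ (sum_mem_of_atoms hy) ?_ k' hk'
  rw [← hsum, map_add]
  have : f w.sum ≠ 0 := fun h =>
    hw0 (eq_zero_of_mem_of_sum_eq_zero hf hwa (hf _ (sum_mem_of_atoms hwa) h))
  omega

/-- A length of `x'` above `k` is at most one smaller than a length of `x` above `k`, and the latter
exceeds `k + d`. So `x'` has no length strictly between `k` and `k + d`; since `d` is not a
distance, `x'` is itself wide, against minimality. -/
theorem move_false (hd : d ∉ distancesIn B)
    (hd1 : 1 ≤ d) (hw : Wide B d x k) (ih : ∀ y ∈ B, f y < f x → ∀ k', ¬Wide B d y k')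
    {x' : M} (hx' : x' ∈ B) (hlt : f x' < f x) (h1 : ∃ l ∈ lengthsIn B x', l ≤ k)
    (h2 : ∃ l ∈ lengthsIn B x', k < l)
    (h3 : ∀ l' ∈ lengthsIn B x', k < l' → ∃ l ∈ lengthsIn B x, l' ≤ l ∧ l ≤ l' + 1) : False := by
  obtain ⟨k', -, hk', -⟩ := exists_wide hd hd1 hx' h1 h2 (by
    intro l' hl' hlt'
    obtain ⟨l, hl, h4, h5⟩ := h3 l' hl' hlt'
    have := hw.2.2 l hl (by omega)
    omega)
  exact ih x' hx' hlt k' hk'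

/-- This is the engine of the descent. The length at most `k` of `a + p'` comes from the proper part
`y`: a factorization of `b + p'` lifts to one of `y.sum` that is not shorter, and a proper part has
no length above `|y|`. The predicate `C` holds the side condition under which lifting is available.
-/
theorem contract_false (hf : ∀ x ∈ B, f x = 0 → x = 0) (hd : d ∉ distancesIn B)
    (hd1 : 1 ≤ d) (hw : Wide B d x k) (ih : ∀ y ∈ B, f y < f x → ∀ k', ¬Wide B d y k')
    {a b p p' : M} (C : M → Prop) (hx : x = a + p) (ha : a + p' ∈ B) (hfp : f p' < f p)
    (lift : ∀ b, C b → b + p ∈ B → b + p' ∈ B → ∀ l' ∈ lengthsIn B (b + p'),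
      ∃ l ∈ lengthsIn B (b + p), l' ≤ l ∧ l ≤ l' + 1) (hCa : C a) (hCb : C b)
    {y w : Multiset M} (hz : ∀ u ∈ y + w, IsAtomIn B u) (hsum : (y + w).sum = x)
    (hcard : Multiset.card (y + w) = k) (hw0 : w ≠ 0) (hy : y.sum = b + p) (hb : b + p' ∈ B)
    (hlong : ∃ l ∈ lengthsIn B (a + p'), k < l) : False := by
  have hya : ∀ u ∈ y, IsAtomIn B u := fun u hu => hz u (Multiset.mem_add.2 (Or.inl hu))
  have hwa : ∀ u ∈ w, IsAtomIn B u := fun u hu => hz u (Multiset.mem_add.2 (Or.inr hu))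
  have hxB : x ∈ B := mem_of_mem_lengthsIn hw.1
  refine move_false hd hd1 hw ih ha (by rw [hx, map_add, map_add]; omega) ?_ hlong ?_
  · obtain ⟨l', hl'⟩ := exists_length hf hb
    obtain ⟨l, hl, h4, -⟩ := lift b hCb (hy ▸ sum_mem_of_atoms hya) hb l' hl'
    rw [← hy] at hl
    have h5 := length_le_card_of_proper hf hd hd1 hw ih hz hsum hcard hw0 hl
    have h6 : a + p' = (b + p') + w.sum := by
      have : a + p = b + w.sum + p := by
        rw [← hx, ← hsum, Multiset.sum_add, hy]; abel
      rw [add_right_cancel this]; abel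
    rw [Multiset.card_add] at hcard
    exact ⟨_, h6 ▸ add_mem_lengthsIn hl' (card_mem_lengthsIn hwa), by omega⟩
  · intro l' hl' _
    rw [hx]
    exact lift a hCa (hx ▸ hxB) ha l' hl'

omit [IsCancelAdd M] in
theorem exists_long_length (hf : ∀ x ∈ B, f x = 0 → x = 0) {y : M} {w : Multiset M}
    (hw : ∀ u ∈ w, IsAtomIn B u) (hy : y ∈ B) (hy0 : y ≠ 0) :
    ∃ l ∈ lengthsIn B (y + w.sum), Multiset.card w + 1 ≤ l := by
  have := exists_length_ge hf (y := y ::ₘ w) (B := B) (by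
    intro u hu
    rcases Multiset.mem_cons.1 hu with rfl | hu
    · exact ⟨hy, hy0⟩
    · exact ⟨(hw u hu).1, (hw u hu).2.1⟩)
  simpa using this

/-- Only the atom containing `p'` has to be refactored after inserting `p`. It is replaced by one or
two atoms, so the length grows by 0 or 1. -/
theorem lift_of_atom (hf : ∀ x ∈ B, f x = 0 → x = 0) {b p p' w0 : M} {z : Multiset M}
    (hz : ∀ u ∈ z, IsAtomIn B u) (hsum : z.sum = b + p') (hmem : w0 + p' ∈ z)
    (hB : w0 + p ∈ B) (h0 : w0 + p ≠ 0)
    (h2 : ∀ zz : Multiset M, (∀ u ∈ zz, IsAtomIn B u) → zz.sum = w0 + p → Multiset.card zz ≤ 2) :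
    ∃ l ∈ lengthsIn B (b + p), Multiset.card z ≤ l ∧ l ≤ Multiset.card z + 1 := by
  obtain ⟨t, rfl⟩ := Multiset.exists_cons_of_mem hmem
  obtain ⟨zz, hzz, hzs⟩ := exists_factorization hf hB
  have h3 := h2 zz hzz hzs
  have hc : Multiset.card zz ≠ 0 := by
    intro h
    rw [Multiset.card_eq_zero] at h
    subst h
    exact h0 hzs.symm
  have ht : ∀ u ∈ t, IsAtomIn B u := fun u hu => hz u (Multiset.mem_cons_of_mem hu)
  have h4 : b + p = zz.sum + t.sum := by
    rw [Multiset.sum_cons] at hsum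
    have : b + p' = w0 + t.sum + p' := by rw [← hsum]; abel
    rw [add_right_cancel this, hzs]; abel
  refine ⟨_, h4 ▸ add_mem_lengthsIn (card_mem_lengthsIn hzz) (card_mem_lengthsIn ht), ?_, ?_⟩ <;>
  · rw [Multiset.card_cons]; omega

/-- If an atom `w0 + p'` arises by contracting `p` to `p'`, then a factorization of `w0 + p` cannot
have a proper part to which the contraction applies. -/
theorem not_contract_part {w0 p p' : M} {X : M} {zz : Multiset M} (hW : IsAtomIn B (w0 + p'))
    (hX : IsAtomIn B X) (hsum : (X ::ₘ zz).sum = w0 + p) {r0 : M} (hr : zz.sum = r0 + p)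
    (hrB : r0 + p' ∈ B) (hr0 : r0 + p' ≠ 0) : False := by
  rw [Multiset.sum_cons, hr] at hsum
  have : w0 = X + r0 := by
    have h : X + r0 + p = w0 + p := by rw [← hsum]; abel
    exact (add_right_cancel h).symm
  -- The atom `w0 + p'` would be the sum of the nonzero elements `X` and `r0 + p'`.
  rcases hW.2.2 X hX.1 (r0 + p') hrB (by rw [this]; abel) with h | h
  exacts [hX.2.1 h, hr0 h]

end CriticalElements

/-! ### The $T$-block monoid -/

/-- The data of a `T`-block monoid: for each index a seminormal finitely primary monoid, given by
its rank, the classes of its primes and the group of classes of its units. -/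
structure BlockData (G : Type*) [AddCommGroup G] (ι : Type*) where
  /-- the number of primes -/
  rank : ι → ℕ
  rank_pos : ∀ i, 0 < rank i
  /-- the classes of the primes -/
  cls : ∀ i, Fin (rank i) → G
  /-- the classes of units -/
  unitCls : ι → AddSubgroup G

namespace BlockData

variable {G : Type*} [AddCommGroup G] {ι : Type*} (T : BlockData G ι)

/-- The ambient monoid of a block monoid: sequences over the class group together with, for each
index, a class and an exponent vector. -/
abbrev Amb : Type _ := Multiset G × (∀ i, G × (Fin (T.rank i) → ℕ))

/-- The class of an exponent vector. -/
def phi (i : ι) : (Fin (T.rank i) → ℕ) →+ G where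
  toFun k := ∑ j, k j • T.cls i j
  map_zero' := by simp
  map_add' a b := by simp [add_smul, Finset.sum_add_distrib]

/-- A pair of a class and an exponent vector comes from the finitely primary monoid with index
`i`. -/
def Val (i : ι) (t : G × (Fin (T.rank i) → ℕ)) : Prop :=
  t = 0 ∨ ((∀ j, 0 < t.2 j) ∧ t.1 - T.phi i t.2 ∈ T.unitCls i)

variable {T}

theorem Val.add {i : ι} {s t : G × (Fin (T.rank i) → ℕ)} (hs : T.Val i s) (ht : T.Val i t) :
    T.Val i (s + t) := by
  rcases hs with rfl | ⟨h1, h2⟩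
  · simpa using ht
  rcases ht with rfl | ⟨h3, h4⟩
  · rw [add_zero]; exact Or.inr ⟨h1, h2⟩
  · refine Or.inr ⟨fun j => ?_, ?_⟩
    · have := h1 j
      simp only [Prod.snd_add, Pi.add_apply]; omega
    · have := (T.unitCls i).add_mem h2 h4
      rw [Prod.fst_add, Prod.snd_add, map_add]
      convert this using 1; abel

theorem Val.cls_mem {i : ι} {t : G × (Fin (T.rank i) → ℕ)} (h : T.Val i t) :
    t.1 - T.phi i t.2 ∈ T.unitCls i := by
  rcases h with rfl | h
  · simp
  · exact h.2

theorem Val.pos {i : ι} {t : G × (Fin (T.rank i) → ℕ)} (h : T.Val i t) (h0 : t ≠ 0)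
    (j : Fin (T.rank i)) : 0 < t.2 j := (h.resolve_left h0).1 j

theorem Val.eq_zero {i : ι} {t : G × (Fin (T.rank i) → ℕ)} (h : T.Val i t)
    {j : Fin (T.rank i)} (h0 : t.2 j = 0) : t = 0 := by
  by_contra h1
  exact absurd (h.pos h1 j) (by omega)

variable [Fintype ι]

variable (T) in
/-- The total class. -/
def tot : T.Amb →+ G where
  toFun x := x.1.sum + ∑ i, (x.2 i).1
  map_zero' := by simp
  map_add' a b := by simp [Finset.sum_add_distrib]; abel

variable (T) in
/-- The `T`-block monoid. -/
def block : AddSubmonoid T.Amb where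
  carrier := {x | (∀ i, T.Val i (x.2 i)) ∧ T.tot x = 0}
  zero_mem' := ⟨fun i => Or.inl rfl, map_zero _⟩
  add_mem' ha hb := ⟨fun i => (ha.1 i).add (hb.1 i), by rw [map_add, ha.2, hb.2, add_zero]⟩

variable (T) in
/-- A degree on the block monoid. -/
def deg : T.Amb →+ ℕ where
  -- The weight 2 ensures that trading even a single prime for one element of `G` lowers the degree.
  toFun x := Multiset.card x.1 + 2 * ∑ i, ∑ j, (x.2 i).2 j
  map_zero' := by simp
  map_add' a b := by simp [Finset.sum_add_distrib]; ring

theorem deg_apply (x : T.Amb) : T.deg x = Multiset.card x.1 + 2 * ∑ i, ∑ j, (x.2 i).2 j := rfl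

theorem tot_apply (x : T.Amb) : T.tot x = x.1.sum + ∑ i, (x.2 i).1 := rfl

theorem phi_apply (i : ι) (k : Fin (T.rank i) → ℕ) : T.phi i k = ∑ j, k j • T.cls i j := rfl

theorem mem_block {x : T.Amb} : x ∈ T.block ↔ (∀ i, T.Val i (x.2 i)) ∧ T.tot x = 0 := Iff.rfl

theorem eq_zero_of_deg (x : T.Amb) (hx : x ∈ T.block) (h : T.deg x = 0) : x = 0 := by
  rw [deg_apply] at h
  have h1 : x.1 = 0 := by rw [← Multiset.card_eq_zero]; omega
  have h2 : ∑ i, ∑ j, (x.2 i).2 j = 0 := by omega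
  refine Prod.ext h1 (funext fun i => ?_)
  have h3 := (Finset.sum_eq_zero_iff.1 h2) i (Finset.mem_univ i)
  have h4 := (Finset.sum_eq_zero_iff.1 h3) ⟨0, T.rank_pos i⟩ (Finset.mem_univ _)
  exact (hx.1 i).eq_zero h4

/-- Membership of a difference in the block monoid. -/
theorem mem_of_add_mem {x w : T.Amb} (hx : x ∈ T.block) (hxw : x + w ∈ T.block)
    (h : ∀ i, w.2 i = 0 ∨ ∀ j, 0 < (w.2 i).2 j) : w ∈ T.block := by
  refine ⟨fun i => ?_, ?_⟩
  · rcases h i with h | h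
    · exact Or.inl h
    · refine Or.inr ⟨h, ?_⟩
      have h1 := (hx.1 i).cls_mem
      have h2 := (hxw.1 i).cls_mem
      have := (T.unitCls i).sub_mem h2 h1
      rw [Prod.snd_add, Pi.add_apply, Prod.fst_add, Prod.snd_add, map_add] at this
      convert this using 1; abel
  · have := hxw.2
    rwa [map_add, hx.2, zero_add] at this

theorem mem_of_eq_off {x y : T.Amb} (i : ι) (hx : x ∈ T.block)
    (h : ∀ i', i' ≠ i → y.2 i' = x.2 i') (ht : T.tot y = 0) (hv : T.Val i (y.2 i)) :
    y ∈ T.block := by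
  refine ⟨fun i' => ?_, ht⟩
  by_cases hi : i' = i
  · subst hi; exact hv
  · rw [h i' hi]; exact hx.1 i'

/-- The exponents at `i` of a sum of elements that are all nontrivial at `i`. -/
theorem card_le_of_forall_ne {i : ι} {z : Multiset T.Amb}
    (hz : ∀ u ∈ z, u ∈ T.block ∧ u.2 i ≠ 0) (j : Fin (T.rank i)) :
    Multiset.card z ≤ (z.sum.2 i).2 j := by
  induction z using Multiset.induction_on with
  | empty => simp
  | cons a s ih =>
    have h1 := ih fun u hu => hz u (Multiset.mem_cons_of_mem hu)
    have h2 := hz a (Multiset.mem_cons_self a s)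
    have h3 := (h2.1.1 i).pos h2.2 j
    rw [Multiset.sum_cons, Multiset.card_cons]
    simp only [Prod.snd_add, Pi.add_apply]
    omega

theorem exists_mem_of_mem_sum {z : Multiset T.Amb} {g : G} (h : g ∈ z.sum.1) :
    ∃ u ∈ z, g ∈ u.1 := by
  induction z using Multiset.induction_on with
  | empty => simp at h
  | cons a s ih =>
    rw [Multiset.sum_cons, Prod.fst_add, Multiset.mem_add] at h
    rcases h with h | h
    · exact ⟨a, Multiset.mem_cons_self a s, h⟩
    · obtain ⟨u, hu, hg⟩ := ih h
      exact ⟨u, Multiset.mem_cons_of_mem hu, hg⟩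

theorem exists_ne_of_sum_ne {z : Multiset T.Amb} {i : ι} (h : z.sum.2 i ≠ 0) :
    ∃ u ∈ z, u.2 i ≠ 0 := by
  by_contra hcon
  push Not at hcon
  apply h
  induction z using Multiset.induction_on with
  | empty => rfl
  | cons a s ih =>
    have h1 := hcon a (Multiset.mem_cons_self a s)
    have h2 : s.sum.2 i = 0 := by
      by_contra h3
      exact h3 (ih h3 fun u hu => hcon u (Multiset.mem_cons_of_mem hu))
    rw [Multiset.sum_cons, Prod.snd_add, Pi.add_apply, h1, h2, add_zero]

theorem exists_eq_add_singleton {x : T.Amb} {g : G} (h : g ∈ x.1) :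
    ∃ a : T.Amb, x = a + ({g}, 0) := by
  obtain ⟨t, ht⟩ := Multiset.exists_cons_of_mem h
  exact ⟨(t, x.2), Prod.ext (by rw [ht, ← Multiset.singleton_add, add_comm]; rfl) (by simp)⟩

variable [DecidableEq ι]

variable (T) in
/-- The element of the ambient monoid concentrated at the index `i`. -/
def cel (i : ι) (g : G) (k : Fin (T.rank i) → ℕ) : T.Amb := (0, Pi.single i (g, k))

omit [Fintype ι] in
@[simp] theorem cel_fst (i : ι) (g : G) (k : Fin (T.rank i) → ℕ) : (T.cel i g k).1 = 0 := rfl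

omit [Fintype ι] in
@[simp] theorem cel_snd_self (i : ι) (g : G) (k : Fin (T.rank i) → ℕ) :
    (T.cel i g k).2 i = (g, k) := by simp [cel]

omit [Fintype ι] in
theorem cel_snd_ne {i i' : ι} (h : i' ≠ i) (g : G) (k : Fin (T.rank i) → ℕ) :
    (T.cel i g k).2 i' = 0 := by simp [cel, h]

@[simp] theorem tot_cel (i : ι) (g : G) (k : Fin (T.rank i) → ℕ) : T.tot (T.cel i g k) = g := by
  rw [tot_apply, Finset.sum_eq_single i]
  · simp
  · intro i' _ h; rw [cel_snd_ne h]; rfl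
  · simp

@[simp] theorem deg_cel (i : ι) (g : G) (k : Fin (T.rank i) → ℕ) :
    T.deg (T.cel i g k) = 2 * ∑ j, k j := by
  rw [deg_apply, Finset.sum_eq_single i]
  · simp
  · intro i' _ h; rw [cel_snd_ne h]; simp
  · simp

omit [DecidableEq ι] in
@[simp] theorem tot_seq (s : Multiset G) : T.tot ((s, 0) : T.Amb) = s.sum := by
  simp [tot_apply]

omit [DecidableEq ι] in
@[simp] theorem deg_seq (s : Multiset G) : T.deg ((s, 0) : T.Amb) = Multiset.card s := by
  simp [deg_apply]

omit [Fintype ι] in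
theorem exists_eq_add_cel {x : T.Amb} {i : ι} (g : G) {k : Fin (T.rank i) → ℕ}
    (h : ∀ j, k j ≤ (x.2 i).2 j) : ∃ a : T.Amb, x = a + T.cel i g k := by
  refine ⟨(x.1, Function.update x.2 i ((x.2 i).1 - g, (x.2 i).2 - k)), ?_⟩
  refine Prod.ext (by simp) (funext fun i' => ?_)
  by_cases hi : i' = i
  · subst hi
    refine Prod.ext (by simp) (funext fun j => ?_)
    have := h j
    simp; omega
  · simp [hi, cel_snd_ne hi]

end BlockData

/-! ### Contractions that concern at most two atoms -/

section Collapse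

variable {M : Type*} [AddCommMonoid M] [IsCancelAdd M] {B : AddSubmonoid M} {f : M →+ ℕ}
  {d k : ℕ} {x : M}

/-- Every factorization of `w + p` has a part of at most two atoms in which `p` can be replaced by
`p'`. -/
def Collapses (B : AddSubmonoid M) (p p' w : M) : Prop :=
  ∀ z : Multiset M, (∀ u ∈ z, IsAtomIn B u) → z.sum = w + p →
    ∃ y t : Multiset M, ∃ r : M, z = y + t ∧ Multiset.card y ≤ 2 ∧ y.sum = r + p ∧ r + p' ∈ B ∧
      r + p' ≠ 0

/-- The contractible part is the whole factorization of `w0 + p`: an atom outside of it would split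
off from the atom `w0 + p'`. So `w0 + p` only has factorizations with at most two atoms, and
`lift_of_atom` applies. -/
theorem Collapses.lift (hf : ∀ x ∈ B, f x = 0 → x = 0) {b p p' w0 : M} {z : Multiset M}
    (hz : ∀ u ∈ z, IsAtomIn B u) (hsum : z.sum = b + p') (hmem : w0 + p' ∈ z)
    (hB : w0 + p ∈ B) (h0 : w0 + p ≠ 0) (hc : Collapses B p p' w0) :
    ∃ l ∈ lengthsIn B (b + p), Multiset.card z ≤ l ∧ l ≤ Multiset.card z + 1 := by
  refine lift_of_atom hf hz hsum hmem hB h0 fun zz hzz hzs => ?_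
  by_contra hcard
  obtain ⟨y, t, r, rfl, hy, hr, hrB, hr0⟩ := hc zz hzz hzs
  have ht : t ≠ 0 := by
    rintro rfl
    rw [add_zero] at hcard
    exact hcard hy
  obtain ⟨X, hX⟩ := Multiset.exists_mem_of_ne_zero ht
  obtain ⟨t', rfl⟩ := Multiset.exists_cons_of_mem hX
  refine not_contract_part (p := p) (hz _ hmem) (hzz X (by simp)) (zz := y + t') (r0 := r + t'.sum) ?_ ?_ ?_ ?_
  · rw [← hzs]; simp only [Multiset.sum_cons, Multiset.sum_add]; abel
  · rw [Multiset.sum_add, hr]; abel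
  · rw [add_right_comm]
    exact B.add_mem hrB (sum_mem_of_atoms fun u hu => hzz u (by simp [hu]))
  · intro h
    rw [add_right_comm] at h
    exact hr0 (eq_zero_of_add_eq_zero_in hf hrB h)

/-- At most two atoms are contracted, and the result is nonzero and so contributes at least one
atom. Hence at most one atom is lost. -/
theorem Collapses.exists_length (hf : ∀ x ∈ B, f x = 0 → x = 0) {a p p' : M}
    (hc : Collapses B p p' a) {l : ℕ} (hl : l ∈ lengthsIn B (a + p)) :
    ∃ l' ∈ lengthsIn B (a + p'), l ≤ l' + 1 := by
  obtain ⟨z, hz, hzs, rfl⟩ := hl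
  obtain ⟨y, t, r, rfl, hy, hr, hrB, hr0⟩ := hc z hz hzs
  obtain ⟨l', hl', hle⟩ := exists_long_length hf (w := t)
    (fun u hu => hz u (Multiset.mem_add.2 (Or.inr hu))) hrB hr0
  have : r + p' + t.sum = a + p' := by
    have : r + t.sum + p = a + p := by rw [← hzs, Multiset.sum_add, hr]; abel
    rw [← add_right_cancel this]; abel
  exact ⟨l', this ▸ hl', by rw [Multiset.card_add]; omega⟩

/-- A length of `x` above `k` is at least `k + 2`, so it survives the loss of one atom. -/
theorem Collapses.exists_long (hf : ∀ x ∈ B, f x = 0 → x = 0) (hd1 : 1 ≤ d) (hw : Wide B d x k)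
    {a p p' : M} (hx : x = a + p) (hc : Collapses B p p' a) :
    ∃ l ∈ lengthsIn B (a + p'), k < l := by
  obtain ⟨l, hl, hkl⟩ := hw.2.1
  have := hw.2.2 l hl hkl
  rw [hx] at hl
  obtain ⟨l', hl', hle⟩ := hc.exists_length hf hl
  exact ⟨l', hl', by omega⟩

end Collapse

/-! ### The basic contractions of the block monoid -/

namespace BlockData

variable {G : Type*} [AddCommGroup G] {ι : Type*} {T : BlockData G ι} [Fintype ι]

/-- A part of a multiset of block monoid elements at a given index. -/
theorem exists_part_at {i : ι} {z : Multiset T.Amb} (h : z.sum.2 i ≠ 0) :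
    (∃ X t, z = X ::ₘ t ∧ X.2 i = z.sum.2 i ∧ t.sum.2 i = 0) ∨
      ∃ X Y t, z = X ::ₘ Y ::ₘ t ∧ X.2 i ≠ 0 ∧ Y.2 i ≠ 0 := by
  obtain ⟨X, hX, hXi⟩ := exists_ne_of_sum_ne h
  obtain ⟨t, rfl⟩ := Multiset.exists_cons_of_mem hX
  by_cases ht : t.sum.2 i = 0
  · exact Or.inl ⟨X, t, rfl, by simp [ht], ht⟩
  · obtain ⟨Y, hY, hYi⟩ := exists_ne_of_sum_ne ht
    obtain ⟨t', rfl⟩ := Multiset.exists_cons_of_mem hY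
    exact Or.inr ⟨X, Y, t', rfl, hXi, hYi⟩

theorem pair_eq_add (g h : G) : (({g, h}, 0) : T.Amb) = ({g}, 0) + ({h}, 0) := by
  refine Prod.ext ?_ (by simp)
  change ({g, h} : Multiset G) = {g} + {h}
  rw [Multiset.singleton_add]; rfl

theorem exists_pair_split {z : Multiset T.Amb} {w : T.Amb} {g h : G}
    (hz : z.sum = w + ({g, h}, 0)) :
    (∃ X t, z = (X + ({g, h}, 0)) ::ₘ t) ∨
      ∃ X Y t, z = (X + ({g}, 0)) ::ₘ (Y + ({h}, 0)) ::ₘ t := by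
  obtain ⟨X, hX, hgX⟩ := exists_mem_of_mem_sum (z := z) (g := g) (by rw [hz]; simp)
  obtain ⟨t, rfl⟩ := Multiset.exists_cons_of_mem hX
  obtain ⟨X0, rfl⟩ := exists_eq_add_singleton hgX
  have h1 : X0 + t.sum = w + ({h}, 0) := by
    rw [pair_eq_add, Multiset.sum_cons] at hz
    have : X0 + t.sum + ({g}, 0) = w + ({h}, 0) + ({g}, 0) := by
      rw [add_right_comm, hz]; abel
    exact add_right_cancel this
  have h2 : h ∈ X0.1 + t.sum.1 := by
    have := congrArg Prod.fst h1
    rw [Prod.fst_add] at this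
    rw [this]; simp
  rcases Multiset.mem_add.1 h2 with h2 | h2
  · obtain ⟨X1, rfl⟩ := exists_eq_add_singleton h2
    exact Or.inl ⟨X1, t, by rw [pair_eq_add, add_right_comm, add_assoc]⟩
  · obtain ⟨Y, hY, hhY⟩ := exists_mem_of_mem_sum h2
    obtain ⟨t', rfl⟩ := Multiset.exists_cons_of_mem hY
    obtain ⟨Y0, rfl⟩ := exists_eq_add_singleton hhY
    exact Or.inr ⟨X0, Y0, t', rfl⟩

theorem exists_part_pair {z : Multiset T.Amb} {w : T.Amb} {g h : G}
    (hz : z.sum = w + ({g, h}, 0)) :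
    ∃ y t : Multiset T.Amb, ∃ r : T.Amb, z = y + t ∧ Multiset.card y ≤ 2 ∧
      y.sum = r + ({g, h}, 0) := by
  rcases exists_pair_split hz with ⟨X, t, rfl⟩ | ⟨X, Y, t, rfl⟩
  · exact ⟨{X + ({g, h}, 0)}, t, X, by simp, by simp, by simp⟩
  · refine ⟨{X + ({g}, 0), Y + ({h}, 0)}, t, X + Y, ?_, by simp, ?_⟩
    · rw [Multiset.insert_eq_cons, Multiset.cons_add, Multiset.singleton_add]
    · rw [pair_eq_add]
      simp only [Multiset.insert_eq_cons, Multiset.sum_cons, Multiset.sum_singleton]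
      abel

theorem seq_mem_of_add_mem {r : T.Amb} {s s' : Multiset G} (hs : s.sum = s'.sum)
    (h : r + (s, 0) ∈ T.block) : r + (s', 0) ∈ T.block := by
  refine ⟨fun i => by simpa using h.1 i, ?_⟩
  have := h.2
  rw [map_add, tot_seq] at this ⊢
  rw [← hs, this]

theorem add_seq_ne_zero {r : T.Amb} {s : Multiset G} (hs : s ≠ 0) : r + (s, 0) ≠ 0 := by
  intro h
  have := congrArg (fun y : T.Amb => Multiset.card y.1) h
  simp only [Prod.fst_add, Multiset.card_add, Prod.fst_zero, Multiset.card_zero] at this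
  exact hs (Multiset.card_eq_zero.1 (by omega))

/-- Two group elements lie in at most two atoms, and replacing them by their sum does not change the
total class. -/
theorem collapses_pair (g h : G) (w : T.Amb) :
    Collapses T.block ({g, h}, 0) ({g + h}, 0) w := by
  intro z hz hsum
  obtain ⟨y, t, r, rfl, hy, hr⟩ := exists_part_pair hsum
  refine ⟨y, t, r, rfl, hy, hr, seq_mem_of_add_mem (s := {g, h}) (by simp) ?_,
    add_seq_ne_zero (by simp)⟩
  rw [← hr]
  exact sum_mem_of_atoms fun u hu => hz u (by simp [hu])

theorem lift_pair (g h : G) (b : T.Amb) (l' : ℕ)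
    (hl' : l' ∈ lengthsIn T.block (b + ({g + h}, 0))) :
    ∃ l ∈ lengthsIn T.block (b + ({g, h}, 0)), l' ≤ l ∧ l ≤ l' + 1 := by
  obtain ⟨z, hz, hsum, rfl⟩ := hl'
  obtain ⟨W, hW, hgW⟩ := exists_mem_of_mem_sum (z := z) (g := g + h) (by rw [hsum]; simp)
  obtain ⟨w0, rfl⟩ := exists_eq_add_singleton hgW
  exact (collapses_pair g h w0).lift eq_zero_of_deg hz hsum hW
    (seq_mem_of_add_mem (by simp) (hz _ hW).1) (add_seq_ne_zero (by simp))

variable [DecidableEq ι]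

/-- Replacing a piece at the index `i` by a sequence of the same class. -/
theorem replace_mem {r : T.Amb} {i : ι} {g : G} {ν : Fin (T.rank i) → ℕ} {s s' : Multiset G}
    (h : r + ((s, 0) + T.cel i g ν) ∈ T.block) (hs : s'.sum = s.sum + g)
    (hr : r.2 i = 0 ∨ ((∀ j, 0 < (r.2 i).2 j) ∧ g - T.phi i ν ∈ T.unitCls i)) :
    r + (s', 0) ∈ T.block := by
  refine mem_of_eq_off i h (fun i' hi => by simp [cel_snd_ne hi]) ?_ ?_
  · have := h.2
    rw [map_add, map_add, tot_seq, tot_cel] at this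
    rw [map_add, tot_seq, hs, this]
  · rcases hr with hr | ⟨hr, hg⟩
    · exact Or.inl (by simpa using hr)
    · refine Or.inr ⟨by simpa using hr, ?_⟩
      have := (T.unitCls i).sub_mem (h.1 i).cls_mem hg
      simp only [Prod.snd_add, Pi.add_apply, Prod.snd_zero, Pi.zero_apply, zero_add, cel_snd_self,
        Prod.fst_add, map_add] at this
      simp only [Prod.snd_add, Pi.add_apply, Pi.zero_apply, add_zero]
      convert this using 1; abel

/-- Conversely, inserting a piece at `i`. -/
theorem insert_mem {r : T.Amb} {i : ι} {g : G} {ν : Fin (T.rank i) → ℕ} {s s' : Multiset G}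
    (h : r + (s', 0) ∈ T.block) (hs : s'.sum = s.sum + g) (hg : g - T.phi i ν ∈ T.unitCls i)
    (hr : ∀ j, 0 < (r.2 i).2 j + ν j) : r + ((s, 0) + T.cel i g ν) ∈ T.block := by
  refine mem_of_eq_off i h (fun i' hi => by simp [cel_snd_ne hi]) ?_ (Or.inr ⟨by simpa using hr, ?_⟩)
  · have := h.2
    rw [map_add, tot_seq, hs] at this
    rw [map_add, map_add, tot_seq, tot_cel, this]
  · have := (T.unitCls i).add_mem (h.1 i).cls_mem hg
    simp only [Prod.snd_add, Pi.add_apply, Prod.snd_zero, Pi.zero_apply, zero_add, add_zero,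
      cel_snd_self, Prod.fst_add, map_add] at this ⊢
    convert this using 1; abel

theorem cel_ne_zero {r : T.Amb} {i : ι} {g : G} {ν : Fin (T.rank i) → ℕ} {j : Fin (T.rank i)}
    (hj : 0 < ν j) : r + T.cel i g ν ≠ 0 := by
  intro h
  have := congrArg (fun y : T.Amb => (y.2 i).2 j) h
  simp at this
  omega

/-- If one atom carries everything at `i`, then what remains there after removing `ν` is the piece
of `w`. Otherwise two atoms meet `i`; their joint entries are at least 2 and stay positive when `ν`
is removed. The sequence `s'` may be empty only if something remains at `i`. -/
theorem collapses_unit {i : ι} {g : G} {ν : Fin (T.rank i) → ℕ} {s' : Multiset G} {w : T.Amb}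
    (hν : ∀ j, ν j ≤ 1) {j₀ : Fin (T.rank i)} (hj₀ : 0 < ν j₀) (hg : g - T.phi i ν ∈ T.unitCls i)
    (hs : s'.sum = g) (hw : (w.2 i = 0 ∧ s' ≠ 0) ∨ ∀ j, 0 < (w.2 i).2 j) :
    Collapses T.block (T.cel i g ν) (s', 0) w := by
  intro z hz hsum
  have hzi : z.sum.2 i ≠ 0 := by
    intro h
    have := congrArg (fun t : G × (Fin (T.rank i) → ℕ) => t.2 j₀) h
    rw [hsum] at this
    simp at this
    omega
  have key : ∀ (y : Multiset T.Amb) (r : T.Amb), (∀ u ∈ y, IsAtomIn T.block u) →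
      y.sum = r + T.cel i g ν → ((r.2 i = 0 ∧ s' ≠ 0) ∨ ∀ j, 0 < (r.2 i).2 j) →
      r + (s', 0) ∈ T.block ∧ r + (s', 0) ≠ 0 := by
    intro y r hy hr h
    constructor
    · refine replace_mem (s := 0) (g := g) (ν := ν) (i := i) ?_ (by simpa using hs) ?_
      · have : ((0, 0) : T.Amb) = 0 := rfl
        rw [this, zero_add, ← hr]; exact sum_mem_of_atoms hy
      · rcases h with h | h
        exacts [Or.inl h.1, Or.inr ⟨h, hg⟩]
    · rcases h with h | h
      · exact add_seq_ne_zero h.2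
      · intro h0
        have := congrArg (fun y : T.Amb => (y.2 i).2 j₀) h0
        have h1 := h j₀
        simp at this
        omega
  rcases exists_part_at hzi with ⟨X, t, rfl, hX, ht⟩ | ⟨X, Y, t, rfl, hX, hY⟩
  · obtain ⟨r, hr⟩ := exists_eq_add_cel (x := X) (i := i) g (k := ν) (by
      intro j; rw [hX, hsum]; simp)
    have hri : r.2 i = w.2 i := by
      rw [hsum, hr] at hX
      simp only [Prod.snd_add, Pi.add_apply] at hX
      exact add_right_cancel hX
    have := key {X} r (by intro u hu; rw [Multiset.mem_singleton] at hu; subst hu; exact hz _ (by simp))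
      (by simpa using hr) (by rw [hri]; exact hw)
    exact ⟨{X}, t, r, by simp, by simp, by simpa using hr, this.1, this.2⟩
  · have hXv := (hz X (by simp)).1.1 i
    have hYv := (hz Y (by simp)).1.1 i
    obtain ⟨r, hr⟩ := exists_eq_add_cel (x := X + Y) (i := i) g (k := ν) (by
      intro j
      have := hXv.pos hX j
      have := hν j
      simp only [Prod.snd_add, Pi.add_apply]; omega)
    have hpos : ∀ j, 0 < (r.2 i).2 j := by
      intro j
      have h1 := hXv.pos hX j
      have h2 := hYv.pos hY j
      have h3 := hν j
      have h4 := congrArg (fun y : T.Amb => (y.2 i).2 j) hr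
      simp at h4
      omega
    have := key {X, Y} r (by intro u hu; apply hz; simp at hu ⊢; tauto) (by simpa using hr)
      (Or.inr hpos)
    exact ⟨{X, Y}, t, r, by simp [Multiset.insert_eq_cons], by simp, by simpa using hr, this.1, this.2⟩

/-- Since an entry of `κ` is at most 2, at most two atoms of a factorization meet `i`, and together
they carry the whole piece. -/
theorem collapses_whole {i : ι} {g : G} {κ : Fin (T.rank i) → ℕ} {s' : Multiset G} {w : T.Amb}
    {j₀ : Fin (T.rank i)} (hj₀ : 0 < κ j₀) (hj₂ : κ j₀ ≤ 2)
    (hs : s'.sum = g) (hs0 : s' ≠ 0) (hw : w.2 i = 0) :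
    Collapses T.block (T.cel i g κ) (s', 0) w := by
  intro z hz hsum
  have hzi' : z.sum.2 i = (g, κ) := by rw [hsum]; simp [hw]
  have hzi : z.sum.2 i ≠ 0 := by
    intro h
    rw [hzi'] at h
    have := congrArg (fun t : G × (Fin (T.rank i) → ℕ) => t.2 j₀) h
    simp at this
    omega
  have key : ∀ (y t : Multiset T.Amb), z = y + t → t.sum.2 i = 0 →
      ∃ r, y.sum = r + T.cel i g κ ∧ r + (s', 0) ∈ T.block ∧ r + (s', 0) ≠ 0 := by
    intro y t hyt ht
    have hyi : y.sum.2 i = (g, κ) := by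
      rw [← hzi', hyt, Multiset.sum_add, Prod.snd_add, Pi.add_apply, ht, add_zero]
    obtain ⟨r, hr⟩ := exists_eq_add_cel (x := y.sum) (i := i) g (k := κ) (by intro j; rw [hyi])
    have hri : r.2 i = 0 := by
      have h1 := congrArg (fun u : T.Amb => u.2 i) hr
      simp only [hyi, Prod.snd_add, Pi.add_apply, cel_snd_self] at h1
      exact (left_eq_add.1 (by rw [add_comm]; exact h1))
    refine ⟨r, hr, replace_mem (s := 0) (g := g) (ν := κ) (i := i) ?_ (by simpa using hs)
      (Or.inl hri), add_seq_ne_zero hs0⟩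
    have : ((0, 0) : T.Amb) = 0 := rfl
    rw [this, zero_add, ← hr]
    exact sum_mem_of_atoms fun u hu => hz u (by rw [hyt]; simp [hu])
  rcases exists_part_at hzi with ⟨X, t, hzt, hX, ht⟩ | ⟨X, Y, t, hzt, hX, hY⟩
  · obtain ⟨r, hr⟩ := key {X} t (by simpa using hzt) ht
    exact ⟨{X}, t, r, by simpa using hzt, by simp, hr⟩
  · have ht : t.sum.2 i = 0 := by
      have ht : t.sum ∈ T.block := sum_mem_of_atoms fun u hu => hz u (by rw [hzt]; simp [hu])
      apply (ht.1 i).eq_zero (j := j₀)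
      have h1 := ((hz X (by simp [hzt])).1.1 i).pos hX j₀
      have h2 := ((hz Y (by simp [hzt])).1.1 i).pos hY j₀
      have h3 := congrArg (fun t : G × (Fin (T.rank i) → ℕ) => t.2 j₀) hzi'
      rw [hzt] at h3
      simp at h3
      omega
    obtain ⟨r, hr⟩ := key {X, Y} t (by simpa [Multiset.insert_eq_cons] using hzt) ht
    exact ⟨{X, Y}, t, r, by simpa [Multiset.insert_eq_cons] using hzt, by simp, hr⟩

end BlockData

/-! ### Critical elements and the lifting of contracted factorizations -/

namespace BlockData

variable {G : Type*} [AddCommGroup G] {ι : Type*} {T : BlockData G ι} [Fintype ι]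

variable (T) in
/-- A wide element all of whose lower-degree companions are not wide. -/
structure Crit (d : ℕ) (x : T.Amb) (k : ℕ) : Prop where
  not_mem : d ∉ distancesIn T.block
  one_le : 1 ≤ d
  wide : Wide T.block d x k
  min : ∀ y ∈ T.block, T.deg y < T.deg x → ∀ k', ¬Wide T.block d y k'

theorem snd_eq_zero_of_mem {z : Multiset T.Amb} (hz : ∀ u ∈ z, u ∈ T.block) {i : ι}
    (h : z.sum.2 i = 0) {u : T.Amb} (hu : u ∈ z) : u.2 i = 0 := by
  obtain ⟨t, rfl⟩ := Multiset.exists_cons_of_mem hu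
  apply ((hz u hu).1 i).eq_zero (j := ⟨0, T.rank_pos i⟩)
  have := congrArg (fun t : G × (Fin (T.rank i) → ℕ) => t.2 ⟨0, T.rank_pos i⟩) h
  simp at this
  exact this.1

theorem singleton_zero_mem : (({0}, 0) : T.Amb) ∈ T.block :=
  ⟨fun _ => Or.inl rfl, by rw [tot_seq]; simp⟩

theorem singleton_ne_zero (g : G) : (({g}, 0) : T.Amb) ≠ 0 := by
  have := add_seq_ne_zero (T := T) (r := 0) (s := {g}) (by simp)
  rwa [zero_add] at this

theorem not_zero_mem_atom {W w0 : T.Amb} (hW : IsAtomIn T.block W) (h : W = w0 + ({0}, 0)) :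
    w0 = 0 := by
  have hw0 : w0 ∈ T.block := by
    refine ⟨fun i => ?_, ?_⟩
    · have := hW.1.1 i
      rw [h] at this
      simpa using this
    · have := hW.1.2
      rw [h, map_add, tot_seq] at this
      simpa using this
  exact (hW.2.2 w0 hw0 _ singleton_zero_mem h.symm).resolve_right (singleton_ne_zero 0)

/-- In a splitting of the contracted element both summands are trivial at `i` and one of them
contains `g`. Putting the piece back into that summand splits the given atom. -/
theorem atom_whole [DecidableEq ι] {w0 : T.Amb} {i : ι} {g : G} {κ : Fin (T.rank i) → ℕ}
    {j₀ : Fin (T.rank i)} (hj₀ : 0 < κ j₀)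
    (hW : IsAtomIn T.block (w0 + T.cel i g κ)) (h0 : w0.2 i = 0) :
    IsAtomIn T.block (w0 + ({g}, 0)) := by
  have hval := hW.1.1 i
  simp only [Prod.snd_add, Pi.add_apply, h0, cel_snd_self, zero_add] at hval
  have hmem : ∀ v : T.Amb, v + ({g}, 0) ∈ T.block → v.2 i = 0 → v + T.cel i g κ ∈ T.block := by
    intro v hv hv0
    refine mem_of_eq_off i hv (fun i' hi => by simp [cel_snd_ne hi]) ?_ (by simpa [hv0] using hval)
    have := hv.2
    rw [map_add, tot_seq] at this
    rw [map_add, tot_cel, ← this]; simp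
  refine ⟨?_, add_seq_ne_zero (by simp), ?_⟩
  · exact replace_mem (s := 0) (g := g) (ν := κ) (i := i)
      (by have : ((0, 0) : T.Amb) = 0 := rfl
          rw [this, zero_add]; exact hW.1) (by simp) (Or.inl h0)
  · have main : ∀ v ∈ T.block, ∀ w ∈ T.block, g ∈ v.1 → v + w = w0 + ({g}, 0) → w = 0 := by
      intro v hv w hw hg hvw
      obtain ⟨v0, rfl⟩ := exists_eq_add_singleton hg
      have hv0 : v0 + w = w0 := by
        rw [add_right_comm] at hvw
        exact add_right_cancel hvw
      have hv0i : v0.2 i = 0 := by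
        have h1 : (({v0 + ({g}, 0), w} : Multiset T.Amb).sum).2 i = 0 := by
          rw [Multiset.sum_pair, hvw]; simpa using h0
        have := snd_eq_zero_of_mem (u := v0 + ({g}, 0)) (by simp [hv, hw]) h1 (by simp)
        simpa using this
      rcases hW.2.2 (v0 + T.cel i g κ) (hmem v0 hv hv0i) w hw (by rw [← hv0]; abel) with h | h
      · exact absurd h (cel_ne_zero hj₀)
      · exact h
    intro v hv w hw hvw
    have hg : g ∈ v.1 + w.1 := by
      have := congrArg Prod.fst hvw
      rw [Prod.fst_add] at this
      rw [this]; simp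
    rcases Multiset.mem_add.1 hg with hg | hg
    · exact Or.inr (main v hv w hw hg hvw)
    · exact Or.inl (main w hw v hv hg (by rw [add_comm, hvw]))


/-- The entry 1 prevents two summands from sharing the piece at `i`, so a splitting would contract
to a splitting of the atom with `g`. -/
theorem whole_atom [DecidableEq ι] {w0 : T.Amb} {i : ι} {g : G} {κ : Fin (T.rank i) → ℕ}
    {j₀ : Fin (T.rank i)} (hj₀ : κ j₀ = 1) (hv : T.Val i (g, κ))
    (hW : IsAtomIn T.block (w0 + ({g}, 0))) (h0 : w0.2 i = 0) :
    IsAtomIn T.block (w0 + T.cel i g κ) := by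
  have hB : w0 + T.cel i g κ ∈ T.block := by
    refine mem_of_eq_off i hW.1 (fun i' hi => by simp [cel_snd_ne hi]) ?_ (by simpa [h0] using hv)
    have := hW.1.2
    rw [map_add, tot_seq] at this
    rw [map_add, tot_cel, ← this]; simp
  refine ⟨hB, cel_ne_zero (j := j₀) (by omega), ?_⟩
  have main : ∀ v ∈ T.block, ∀ w ∈ T.block, w.2 i = 0 → v + w = w0 + T.cel i g κ → w = 0 := by
    intro v hv w hw hwi hvw
    have hvi : v.2 i = (g, κ) := by
      have := congrArg (fun y : T.Amb => y.2 i) hvw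
      simpa [hwi, h0] using this
    obtain ⟨r, rfl⟩ := exists_eq_add_cel (x := v) (i := i) g (k := κ) (by intro j; rw [hvi])
    have hr : r.2 i = 0 := by simpa using hvi
    have h1 : r + ({g}, 0) ∈ T.block := replace_mem (s := 0) (g := g) (ν := κ) (i := i)
      (by have : ((0, 0) : T.Amb) = 0 := rfl
          rw [this, zero_add]; exact hv) (by simp) (Or.inl hr)
    have h2 : r + w = w0 := by
      rw [add_right_comm] at hvw
      exact add_right_cancel hvw
    exact (hW.2.2 _ h1 w hw (by rw [← h2]; abel)).resolve_left (add_seq_ne_zero (by simp))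
  intro v hv w hw hvw
  by_cases hwi : w.2 i = 0
  · exact Or.inr (main v hv w hw hwi hvw)
  by_cases hvi : v.2 i = 0
  · exact Or.inl (main w hw v hv hvi (by rw [add_comm, hvw]))
  · have h1 := (hv.1 i).pos hvi j₀
    have h2 := (hw.1 i).pos hwi j₀
    have h3 := congrArg (fun y : T.Amb => (y.2 i).2 j₀) hvw
    simp [h0] at h3
    omega

theorem lift_unit [DecidableEq ι] {i : ι} {g : G} {ν : Fin (T.rank i) → ℕ}
    (hν : ∀ j, ν j = 1) (hg : g - T.phi i ν ∈ T.unitCls i) (b : T.Amb) (l' : ℕ)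
    (hl' : l' ∈ lengthsIn T.block (b + ({g}, 0))) :
    ∃ l ∈ lengthsIn T.block (b + T.cel i g ν), l' ≤ l ∧ l ≤ l' + 1 := by
  obtain ⟨z, hz, hsum, rfl⟩ := hl'
  obtain ⟨W, hW, hgW⟩ := exists_mem_of_mem_sum (z := z) (g := g) (by rw [hsum]; simp)
  obtain ⟨w0, rfl⟩ := exists_eq_add_singleton hgW
  have hmem : w0 + T.cel i g ν ∈ T.block := by
    have := insert_mem (s := 0) (s' := {g}) (g := g) (ν := ν) (i := i) (hz _ hW).1 (by simp) hg
      (fun j => by rw [hν j]; omega)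
    have h0 : ((0, 0) : T.Amb) = 0 := rfl
    rwa [h0, zero_add] at this
  refine (collapses_unit (j₀ := ⟨0, T.rank_pos i⟩) (fun j => (hν j).le) (by rw [hν]; omega) hg
    (by simp) ?_).lift eq_zero_of_deg hz hsum hW hmem
    (cel_ne_zero (j := ⟨0, T.rank_pos i⟩) (by rw [hν]; omega))
  rcases (hz _ hW).1.1 i with h | h
  · exact Or.inl ⟨by simpa using h, by simp⟩
  · exact Or.inr (by simpa using h.1)

theorem lift_whole [DecidableEq ι] {i : ι} {g : G} {κ : Fin (T.rank i) → ℕ}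
    {j₀ : Fin (T.rank i)} (hj₀ : 0 < κ j₀) (hj₂ : κ j₀ ≤ 2) (hv : T.Val i (g, κ)) (b : T.Amb)
    (hb : b.2 i = 0) (l' : ℕ) (hl' : l' ∈ lengthsIn T.block (b + ({g}, 0))) :
    ∃ l ∈ lengthsIn T.block (b + T.cel i g κ), l' ≤ l ∧ l ≤ l' + 1 := by
  obtain ⟨z, hz, hsum, rfl⟩ := hl'
  obtain ⟨W, hW, hgW⟩ := exists_mem_of_mem_sum (z := z) (g := g) (by rw [hsum]; simp)
  obtain ⟨w0, rfl⟩ := exists_eq_add_singleton hgW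
  have hw0 : w0.2 i = 0 := by
    have := snd_eq_zero_of_mem (fun u hu => (hz u hu).1) (i := i) (by rw [hsum]; simpa using hb) hW
    simpa using this
  refine (collapses_whole hj₀ hj₂ (by simp) (by simp) hw0).lift eq_zero_of_deg hz hsum hW ?_
    (cel_ne_zero hj₀)
  refine mem_of_eq_off i (hz _ hW).1 (fun i' hi => by simp [cel_snd_ne hi]) ?_
    (by simpa [hw0] using hv)
  have := (hz _ hW).1.2
  rw [map_add, tot_seq] at this
  rw [map_add, tot_cel, ← this]; simp

/-- A unit contraction that leaves no sequence behind. -/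
theorem lift_absorb [DecidableEq ι] {i : ι} {ν : Fin (T.rank i) → ℕ} (hν : ∀ j, ν j ≤ 1)
    {j₀ : Fin (T.rank i)} (hj₀ : 0 < ν j₀) (hg : 0 - T.phi i ν ∈ T.unitCls i) (b : T.Amb)
    (hb : b.2 i ≠ 0) (l' : ℕ) (hl' : l' ∈ lengthsIn T.block (b + 0)) :
    ∃ l ∈ lengthsIn T.block (b + T.cel i 0 ν), l' ≤ l ∧ l ≤ l' + 1 := by
  obtain ⟨z, hz, hsum, rfl⟩ := hl'
  obtain ⟨W, hW, hWi⟩ := exists_ne_of_sum_ne (z := z) (i := i) (by rw [hsum, add_zero]; exact hb)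
  have hpos := ((hz W hW).1.1 i).pos hWi
  have h0 : ((0, 0) : T.Amb) = 0 := rfl
  have hc := collapses_unit (s' := 0) (w := W) hν hj₀ hg (by simp) (Or.inr hpos)
  refine hc.lift eq_zero_of_deg hz hsum (by simpa using hW) ?_ (cel_ne_zero hj₀)
  have := insert_mem (s := 0) (s' := 0) (g := 0) (ν := ν) (i := i) (r := W)
    (by rw [h0, add_zero]; exact (hz W hW).1) (by simp) hg (fun j => by have := hpos j; omega)
  rwa [h0, zero_add] at this

/-- Replacing the pieces at `i` of two atoms by elements of the class group. -/
theorem lift_two_whole [DecidableEq ι] {i : ι} {g g' : G} {κ κ' : Fin (T.rank i) → ℕ}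
    {j j' : Fin (T.rank i)} (hj : κ j = 1) (hj' : κ' j' = 1) (hv : T.Val i (g, κ))
    (hv' : T.Val i (g', κ')) (b : T.Amb) (hb : b.2 i = 0)
    (hboth : ∀ w0 : T.Amb, w0.2 i = 0 → IsAtomIn T.block (w0 + ({g, g'}, 0)) →
      w0 + T.cel i (g + g') (κ + κ') ∈ T.block →
      ∃ l ∈ lengthsIn T.block (w0 + T.cel i (g + g') (κ + κ')), 1 ≤ l ∧ l ≤ 2)
    (l' : ℕ) (hl' : l' ∈ lengthsIn T.block (b + ({g, g'}, 0))) :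
    ∃ l ∈ lengthsIn T.block (b + T.cel i (g + g') (κ + κ')), l' ≤ l ∧ l ≤ l' + 1 := by
  have hcel : T.cel i (g + g') (κ + κ') = T.cel i g κ + T.cel i g' κ' := by
    refine Prod.ext (by simp) (funext fun i' => ?_)
    by_cases hi : i' = i
    · subst hi; simp
    · simp [cel_snd_ne hi]
  obtain ⟨z, hz, hsum, rfl⟩ := hl'
  have hzi : ∀ u ∈ z, u.2 i = 0 := fun u hu =>
    snd_eq_zero_of_mem (fun u hu => (hz u hu).1) (i := i) (by rw [hsum]; simpa using hb) hu
  -- If `g` and `g'` lie in one atom, `hboth` refactors it. If they lie in two atoms, each gets back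
  -- its own piece and remains an atom because of the entries 1.
  rcases exists_pair_split hsum with ⟨X, t, rfl⟩ | ⟨X, Y, t, rfl⟩
  · have hX : X.2 i = 0 := by
      have h : X.2 i + 0 = 0 := hzi (X + ({g, g'}, 0)) (by simp)
      rwa [add_zero] at h
    have hXa := hz (X + ({g, g'}, 0)) (by simp)
    have hXB : X + T.cel i (g + g') (κ + κ') ∈ T.block := by
      refine mem_of_eq_off i hXa.1 (fun i' hi => by simp [cel_snd_ne hi]) ?_ ?_
      · have := hXa.1.2
        rw [map_add, tot_seq] at this
        rw [map_add, tot_cel, ← this]; simp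
      · have := hv.add hv'
        simpa [hX] using this
    obtain ⟨l, hl, h1, h2⟩ := hboth X hX hXa hXB
    refine ⟨l + Multiset.card t, ?_, by rw [Multiset.card_cons]; omega,
      by rw [Multiset.card_cons]; omega⟩
    have h3 : b + T.cel i (g + g') (κ + κ') = X + T.cel i (g + g') (κ + κ') + t.sum := by
      rw [Multiset.sum_cons] at hsum
      have : b + ({g, g'}, 0) = X + t.sum + ({g, g'}, 0) := by rw [← hsum]; abel
      rw [add_right_cancel this]; abel
    rw [h3]
    exact add_mem_lengthsIn hl (card_mem_lengthsIn fun u hu => hz u (by simp [hu]))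
  · have hX : X.2 i = 0 := by
      have h : X.2 i + 0 = 0 := hzi (X + ({g}, 0)) (by simp)
      rwa [add_zero] at h
    have hY : Y.2 i = 0 := by
      have h : Y.2 i + 0 = 0 := hzi (Y + ({g'}, 0)) (by simp)
      rwa [add_zero] at h
    have hXa := whole_atom hj hv (hz (X + ({g}, 0)) (by simp)) hX
    have hYa := whole_atom hj' hv' (hz (Y + ({g'}, 0)) (by simp)) hY
    refine ⟨_, ⟨(X + T.cel i g κ) ::ₘ (Y + T.cel i g' κ') ::ₘ t, ?_, ?_, rfl⟩, by simp, by simp⟩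
    · intro u hu
      simp only [Multiset.mem_cons] at hu
      rcases hu with rfl | rfl | hu
      exacts [hXa, hYa, hz u (by simp [hu])]
    · simp only [Multiset.sum_cons] at hsum ⊢
      rw [pair_eq_add] at hsum
      have : b + (({g}, 0) + ({g'}, 0)) = X + Y + t.sum + (({g}, 0) + ({g'}, 0)) := by
        rw [← hsum]; abel
      rw [add_right_cancel this, hcel]; abel

end BlockData

/-! ### The shape of a critical element -/

namespace BlockData

variable {G : Type*} [AddCommGroup G] {ι : Type*} {T : BlockData G ι} [Fintype ι]

theorem zero_pair : ((0, 0) : T.Amb) = 0 := rfl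

theorem add_pair_zero (v : T.Amb) : v + (0, 0) = v := add_zero v

theorem pair_zero_add (v : T.Amb) : (0, 0) + v = v := zero_add v

theorem exists_length_of_add_zero {a : T.Amb} {l : ℕ}
    (h : l ∈ lengthsIn T.block (a + ({0}, 0))) : ∃ m ∈ lengthsIn T.block a, l = m + 1 := by
  obtain ⟨z, hz, hsum, rfl⟩ := h
  obtain ⟨W, hW, hgW⟩ := exists_mem_of_mem_sum (z := z) (g := 0) (by rw [hsum]; simp)
  obtain ⟨w0, rfl⟩ := exists_eq_add_singleton hgW
  obtain ⟨t, rfl⟩ := Multiset.exists_cons_of_mem hW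
  have hw0 := not_zero_mem_atom (hz _ hW) rfl
  subst hw0
  rw [Multiset.sum_cons, zero_add, add_comm] at hsum
  exact ⟨_, ⟨t, fun u hu => hz u (Multiset.mem_cons_of_mem hu), add_right_cancel hsum, rfl⟩,
    Multiset.card_cons _ _⟩

theorem singleton_zero_atom : IsAtomIn T.block (({0}, 0) : T.Amb) := by
  refine ⟨singleton_zero_mem, singleton_ne_zero 0, fun v hv w hw hvw => ?_⟩
  have key : ∀ v ∈ T.block, ∀ w ∈ T.block, v + w = ({0}, 0) → 0 ∈ v.1 → w = 0 := by
    intro v hv w hw h h0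
    obtain ⟨a, rfl⟩ := exists_eq_add_singleton h0
    have : a + w + ({0}, 0) = 0 + (({0}, 0) : T.Amb) := by
      rw [zero_add, add_right_comm]; exact h
    have h1 := add_right_cancel this
    exact eq_zero_of_add_eq_zero_in eq_zero_of_deg hw (by rw [add_comm, h1])
  have h0 : (0 : G) ∈ v.1 + w.1 := by
    have := congrArg Prod.fst hvw
    rw [Prod.fst_add] at this
    rw [this]; simp
  rcases Multiset.mem_add.1 h0 with h | h
  exacts [Or.inr (key v hv w hw hvw h), Or.inl (key w hw v hv (by rw [add_comm, hvw]) h)]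

namespace Crit

variable {d k : ℕ} {x : T.Amb}

theorem pos (hc : T.Crit d x k) : 0 < k := by
  obtain ⟨l, hl, hkl⟩ := hc.wide.2.1
  rcases Nat.eq_zero_or_pos k with rfl | h
  · obtain ⟨z, -, hz, h0⟩ := hc.wide.1
    rw [Multiset.card_eq_zero] at h0
    subst h0
    rw [Multiset.sum_zero] at hz
    subst hz
    have := length_zero eq_zero_of_deg hl
    omega
  · exact h

/-- The sequence consisting of 0 is an atom that occurs in every factorization of an element
containing it. Removing it shifts all lengths by one and keeps the gaps. -/
theorem zero_notMem (hc : T.Crit d x k) : (0 : G) ∉ x.1 := by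
  intro h0
  obtain ⟨a, rfl⟩ := exists_eq_add_singleton h0
  obtain ⟨m, hm, rfl⟩ := exists_length_of_add_zero hc.wide.1
  refine hc.min a (mem_of_mem_lengthsIn hm) (by rw [map_add, deg_seq]; simp) m ⟨hm, ?_, ?_⟩
  · obtain ⟨l, hl, hlt⟩ := hc.wide.2.1
    obtain ⟨l', hl', rfl⟩ := exists_length_of_add_zero hl
    exact ⟨l', hl', by omega⟩
  · intro l hl hlt
    have := hc.wide.2.2 _ (add_mem_lengthsIn hl singleton_zero_atom.one_mem_lengthsIn) (by omega)
    omega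

section Proper

variable {y w : Multiset T.Amb} (hc : T.Crit d x k) (hz : ∀ u ∈ y + w, IsAtomIn T.block u)
  (hsum : (y + w).sum = x) (hcard : Multiset.card (y + w) = k) (hw0 : w ≠ 0)
include hc hz hsum hcard hw0

/-- Two group elements in a proper part could be contracted to their sum. -/
theorem seq_card_le : Multiset.card y.sum.1 ≤ 1 := by
  by_contra hlt
  obtain ⟨g, t, ht⟩ := Multiset.card_pos_iff_exists_mem.1
    (show 0 < Multiset.card y.sum.1 by omega) |>.imp fun g hg => Multiset.exists_cons_of_mem hg
  rw [ht, Multiset.card_cons] at hlt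
  obtain ⟨h, t', ht'⟩ := Multiset.card_pos_iff_exists_mem.1
    (show 0 < Multiset.card t by omega) |>.imp fun g hg => Multiset.exists_cons_of_mem hg
  have hy : y.sum = (t', y.sum.2) + ({g, h}, 0) := by
    refine Prod.ext ?_ (by simp)
    rw [ht, ht', Prod.fst_add]
    simp only [Multiset.insert_eq_cons, ← Multiset.singleton_add]
    abel
  have hyB : y.sum ∈ T.block := sum_mem_of_atoms fun u hu => hz u (by simp [hu])
  have hwB : w.sum ∈ T.block := sum_mem_of_atoms fun u hu => hz u (by simp [hu])
  have hx : x = (t', y.sum.2) + w.sum + ({g, h}, 0) := by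
    rw [← hsum, Multiset.sum_add, hy]; simp only [Prod.snd_add]; abel_nf
  have hb := seq_mem_of_add_mem (s := {g, h}) (s' := {g + h}) (by simp) (hy ▸ hyB)
  exact contract_false eq_zero_of_deg hc.not_mem hc.one_le hc.wide hc.min (fun _ => True) hx
    (by rw [add_right_comm]; exact T.block.add_mem hb hwB) (by simp)
    (fun b _ _ _ l' hl' => lift_pair g h b l' hl') trivial trivial hz hsum hcard hw0 hy hb
    ((collapses_pair g h _).exists_long eq_zero_of_deg hc.one_le hc.wide hx)

variable [DecidableEq ι]

/-- An all-ones piece that can be taken out of a proper part, leaving nothing or only positive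
entries at `i`, could be contracted to its class. -/
theorem not_unit {i : ι} {b : T.Amb} {g : G} {ν : Fin (T.rank i) → ℕ} (hν : ∀ j, ν j = 1)
    (hg : g - T.phi i ν ∈ T.unitCls i) (hy : y.sum = b + T.cel i g ν)
    (hb : b.2 i = 0 ∨ ∀ j, 0 < (b.2 i).2 j) : False := by
  have hyB : y.sum ∈ T.block := sum_mem_of_atoms fun u hu => hz u (by simp [hu])
  have hwB : w.sum ∈ T.block := sum_mem_of_atoms fun u hu => hz u (by simp [hu])
  have hx : x = b + w.sum + T.cel i g ν := by
    rw [← hsum, Multiset.sum_add, hy]; abel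
  have hbB : b + ({g}, 0) ∈ T.block := replace_mem (s := 0) (g := g) (ν := ν) (i := i)
    (by rw [pair_zero_add, ← hy]; exact hyB) (by simp) (hb.imp_right fun h => ⟨h, hg⟩)
  refine contract_false eq_zero_of_deg hc.not_mem hc.one_le hc.wide hc.min (fun _ => True) hx
    (by rw [add_right_comm]; exact T.block.add_mem hbB hwB) (by
      rw [deg_seq, deg_cel, Multiset.card_singleton]
      have := Finset.single_le_sum (f := ν) (fun _ _ => Nat.zero_le _)
        (Finset.mem_univ ⟨0, T.rank_pos i⟩)
      rw [hν] at this
      omega)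
    (fun b _ _ _ l' hl' => lift_unit hν hg b l' hl') trivial trivial hz hsum hcard hw0 hy hbB
    ((collapses_unit (j₀ := ⟨0, T.rank_pos i⟩) (fun j => (hν j).le) (by rw [hν]; omega) hg
    (by simp) ?_).exists_long eq_zero_of_deg hc.one_le hc.wide hx)
  simp only [Prod.snd_add, Pi.add_apply]
  rcases hb with hb | hb
  · rw [hb, zero_add]
    exact (hwB.1 i).imp (fun h => ⟨h, by simp⟩) fun h => by simpa using h.1
  · exact Or.inr fun j => by
      have := hb j
      omega

theorem not_all_one {i : ι} (hi : ∀ j, (y.sum.2 i).2 j = 1) : False := by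
  have hyB : y.sum ∈ T.block := sum_mem_of_atoms fun u hu => hz u (by simp [hu])
  obtain ⟨b, hb⟩ := exists_eq_add_cel (x := y.sum) (i := i) (y.sum.2 i).1 (k := (y.sum.2 i).2)
    fun _ => le_rfl
  refine hc.not_unit hz hsum hcard hw0 hi (hyB.1 i).cls_mem hb (Or.inl ?_)
  have := congrArg (fun u : T.Amb => u.2 i) hb
  simp only [Prod.snd_add, Pi.add_apply, cel_snd_self] at this
  exact left_eq_add.1 (by rw [add_comm]; exact this)

theorem not_all_two_le {i : ι} (hi : ∀ j, 2 ≤ (y.sum.2 i).2 j) : False := by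
  obtain ⟨b, hb⟩ := exists_eq_add_cel (x := y.sum) (i := i) (T.phi i fun _ => 1) (k := fun _ => 1)
    fun j => by have := hi j; omega
  refine hc.not_unit hz hsum hcard hw0 (fun _ => rfl) (by rw [sub_self]; exact zero_mem _) hb
    (Or.inr fun j => ?_)
  have := congrArg (fun u : T.Amb => (u.2 i).2 j) hb
  have h2 := hi j
  simp at this
  omega

theorem exists_one {i : ι} (hi : y.sum.2 i ≠ 0) : ∃ j, (y.sum.2 i).2 j = 1 := by
  by_contra h
  push Not at h
  have hyB : y.sum ∈ T.block := sum_mem_of_atoms fun u hu => hz u (by simp [hu])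
  refine hc.not_all_two_le hz hsum hcard hw0 (i := i) fun j => ?_
  have h1 := (hyB.1 i).pos hi j
  have h2 := h j
  omega

theorem exists_two_le {i : ι} (hi : y.sum.2 i ≠ 0) : ∃ j, 2 ≤ (y.sum.2 i).2 j := by
  by_contra h
  push Not at h
  have hyB : y.sum ∈ T.block := sum_mem_of_atoms fun u hu => hz u (by simp [hu])
  refine hc.not_all_one hz hsum hcard hw0 (i := i) fun j => ?_
  have h1 := (hyB.1 i).pos hi j
  have h2 := h j
  omega

/-- Otherwise the proper part carries the whole piece of `x` at `i`. That piece has an entry 1 by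
`exists_one`, so it could be contracted to its class. -/
theorem eq_zero_of_eq_zero {i : ι} (hi : w.sum.2 i = 0) : y.sum.2 i = 0 := by
  by_contra hne
  obtain ⟨j, hj⟩ := hc.exists_one hz hsum hcard hw0 hne
  have hyB : y.sum ∈ T.block := sum_mem_of_atoms fun u hu => hz u (by simp [hu])
  have hwB : w.sum ∈ T.block := sum_mem_of_atoms fun u hu => hz u (by simp [hu])
  obtain ⟨b, hb⟩ := exists_eq_add_cel (x := y.sum) (i := i) (y.sum.2 i).1 (k := (y.sum.2 i).2)
    fun _ => le_rfl
  have hbi : b.2 i = 0 := by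
    have := congrArg (fun u : T.Amb => u.2 i) hb
    simp only [Prod.snd_add, Pi.add_apply, cel_snd_self] at this
    exact left_eq_add.1 (by rw [add_comm]; exact this)
  have hv := hyB.1 i
  generalize hg : (y.sum.2 i).1 = g at *
  generalize hκ : (y.sum.2 i).2 = κ at *
  have hv : T.Val i (g, κ) := by rw [← hg, ← hκ]; exact hv
  have hx : x = b + w.sum + T.cel i g κ := by
    rw [← hsum, Multiset.sum_add, hb]; abel
  have hbB : b + ({g}, 0) ∈ T.block := replace_mem (s := 0) (g := g) (ν := κ) (i := i)
    (by rw [pair_zero_add, ← hb]; exact hyB) (by simp) (Or.inl hbi)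
  have hai : (b + w.sum).2 i = 0 := by simp [hbi, hi]
  refine contract_false eq_zero_of_deg hc.not_mem hc.one_le hc.wide hc.min (fun b => b.2 i = 0) hx
    (by rw [add_right_comm]; exact T.block.add_mem hbB hwB) (by
      rw [deg_seq, deg_cel, Multiset.card_singleton]
      have := Finset.single_le_sum (f := κ) (fun _ _ => Nat.zero_le _) (Finset.mem_univ j)
      omega)
    (fun b hb _ _ l' hl' => lift_whole (j₀ := j) (by omega) (by omega) hv b hb l' hl') hai hbi
    hz hsum hcard hw0 hb hbB
    ((collapses_whole (j₀ := j) (by omega) (by omega) (by simp) (by simp) hai).exists_long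
      eq_zero_of_deg hc.one_le hc.wide hx)

end Proper

/-- An atom has no second length, so `k ≠ 1`. If there are three or more atoms, single atoms and
pairs of atoms are proper parts. An index met by only one atom contradicts `eq_zero_of_eq_zero`; one
met by two atoms contradicts `not_all_two_le`. So `x` is a sequence, each of its atoms has a single
element, and this must be the excluded element 0. -/
theorem eq_two [DecidableEq ι] (hc : T.Crit d x k) : k = 2 := by
  obtain ⟨z, hz, hsum, hcard⟩ := hc.wide.1
  have hpos := hc.pos
  by_contra hk2
  rcases (show k = 1 ∨ 3 ≤ k by omega) with rfl | hk
  · obtain ⟨u, rfl⟩ := Multiset.card_eq_one.1 hcard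
    rw [Multiset.sum_singleton] at hsum
    subst hsum
    obtain ⟨l, hl, hlt⟩ := hc.wide.2.1
    have := length_atom eq_zero_of_deg (hz u (by simp)) hl
    omega
  · have hx0 : ∀ i, x.2 i = 0 := by
      intro i
      by_contra hi
      rw [← hsum] at hi
      rcases exists_part_at hi with ⟨X, t, rfl, hX, ht⟩ | ⟨X, Y, t, rfl, hX, hY⟩
      · rw [← Multiset.singleton_add] at hz hsum hcard
        have := hc.eq_zero_of_eq_zero hz hsum hcard (by rintro rfl; simp at hcard; omega) ht
        rw [Multiset.sum_singleton] at this
        exact hi (hX ▸ this)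
      · have e : X ::ₘ Y ::ₘ t = {X, Y} + t := by simp [Multiset.insert_eq_cons]
        rw [e] at hz hsum hcard
        refine hc.not_all_two_le hz hsum hcard (by rintro rfl; simp at hcard; omega) (i := i)
          fun j => ?_
        have h1 := ((hz X (by simp)).1.1 i).pos hX j
        have h2 := ((hz Y (by simp)).1.1 i).pos hY j
        simp only [Multiset.sum_pair, Prod.snd_add, Pi.add_apply]
        omega
    obtain ⟨X, hX⟩ := Multiset.card_pos_iff_exists_mem.1 (show 0 < Multiset.card z by omega)
    obtain ⟨t, rfl⟩ := Multiset.exists_cons_of_mem hX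
    have hXi : ∀ i, X.2 i = 0 := fun i =>
      snd_eq_zero_of_mem (fun u hu => (hz u hu).1) (by rw [hsum]; exact hx0 i) hX
    rw [← Multiset.singleton_add] at hz hsum hcard
    have h1 := hc.seq_card_le hz hsum hcard (by rintro rfl; simp at hcard; omega)
    rw [Multiset.sum_singleton] at h1
    have hXa := hz X (by simp)
    have hX2 : X.2 = 0 := funext hXi
    rcases (show Multiset.card X.1 = 0 ∨ Multiset.card X.1 = 1 by omega) with h | h
    · exact hXa.2.1 (Prod.ext (Multiset.card_eq_zero.1 h) hX2)
    · obtain ⟨g, hg⟩ := Multiset.card_eq_one.1 h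
      have hXe : X = ({g}, 0) := Prod.ext hg hX2
      have hg0 : g = 0 := by
        have := hXa.1.2
        rw [hXe, tot_seq] at this
        simpa using this
      apply hc.zero_notMem
      rw [← hsum, Multiset.sum_add, Multiset.sum_singleton, hXe, hg0]
      simp

section Two

variable {U V : T.Amb} (hc : T.Crit d (U + V) 2) (hU : IsAtomIn T.block U)
  (hV : IsAtomIn T.block V)
include hc hU hV

theorem symm : T.Crit d (V + U) 2 := by rwa [add_comm]

theorem pair_atoms : ∀ u ∈ ({U} + {V} : Multiset T.Amb), IsAtomIn T.block u := by
  intro u hu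
  simp at hu
  rcases hu with rfl | rfl
  exacts [hU, hV]

theorem card_fst_le : Multiset.card U.1 ≤ 1 := by
  have := hc.seq_card_le (y := {U}) (w := {V}) (hc.pair_atoms hU hV) (by simp) (by simp) (by simp)
  rwa [Multiset.sum_singleton] at this

variable [DecidableEq ι]

theorem exists_one_left {i : ι} (hi : U.2 i ≠ 0) : ∃ j, (U.2 i).2 j = 1 := by
  have := hc.exists_one (y := {U}) (w := {V}) (hc.pair_atoms hU hV) (by simp) (by simp) (by simp)
    (i := i) (by simpa using hi)
  rwa [Multiset.sum_singleton] at this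

theorem exists_two_le_left {i : ι} (hi : U.2 i ≠ 0) : ∃ j, 2 ≤ (U.2 i).2 j := by
  have := hc.exists_two_le (y := {U}) (w := {V}) (hc.pair_atoms hU hV) (by simp) (by simp)
    (by simp) (i := i) (by simpa using hi)
  rwa [Multiset.sum_singleton] at this

theorem right_ne_zero {i : ι} (hi : U.2 i ≠ 0) : V.2 i ≠ 0 := by
  intro h
  have := hc.eq_zero_of_eq_zero (y := {U}) (w := {V}) (hc.pair_atoms hU hV) (by simp) (by simp)
    (by simp) (i := i) (by simpa using h)
  rw [Multiset.sum_singleton] at this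
  exact hi this

theorem exists_ne_zero : ∃ i, U.2 i ≠ 0 := by
  by_contra h
  push Not at h
  have h1 := hc.card_fst_le hU hV
  have hX2 : U.2 = 0 := funext h
  rcases (show Multiset.card U.1 = 0 ∨ Multiset.card U.1 = 1 by omega) with h | h
  · exact hU.2.1 (Prod.ext (Multiset.card_eq_zero.1 h) hX2)
  · obtain ⟨g, hg⟩ := Multiset.card_eq_one.1 h
    have hXe : U = ({g}, 0) := Prod.ext hg hX2
    have hg0 : g = 0 := by
      have := hU.1.2
      rw [hXe, tot_seq] at this
      simpa using this
    apply hc.zero_notMem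
    rw [hXe, hg0]
    simp

/-- The pieces of `U` and `V` at `i` are traded simultaneously for their classes. By `atom_whole`
the result still has length 2. Lengths lift back except possibly when both classes fall into one
atom, the case left to `hboth`; then minimality is violated. -/
theorem le_add {i : ι} {b b' : T.Amb} {g g' : G} {κ κ' : Fin (T.rank i) → ℕ}
    (hUe : U = b + T.cel i g κ) (hVe : V = b' + T.cel i g' κ') (hb : b.2 i = 0) (hb' : b'.2 i = 0)
    (hlong : ∃ l ∈ lengthsIn T.block (b + b' + ({g, g'}, 0)), 2 < l)
    (hboth : ∀ w0 : T.Amb, w0.2 i = 0 → IsAtomIn T.block (w0 + ({g, g'}, 0)) →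
      w0 + T.cel i (g + g') (κ + κ') ∈ T.block →
      ∃ l ∈ lengthsIn T.block (w0 + T.cel i (g + g') (κ + κ')), 1 ≤ l ∧ l ≤ 2)
    (hi : U.2 i ≠ 0) : False := by
  have hUi : U.2 i = (g, κ) := by simp [hUe, hb]
  have hVi : V.2 i = (g', κ') := by simp [hVe, hb']
  obtain ⟨j, hj⟩ := hc.exists_one_left hU hV hi
  obtain ⟨j', hj'⟩ := (hc.symm hU hV).exists_one_left hV hU (hc.right_ne_zero hU hV hi)
  obtain ⟨j₂, hj₂⟩ := hc.exists_two_le_left hU hV hi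
  replace hj : κ j = 1 := by rw [hUi] at hj; exact hj
  replace hj₂ : 2 ≤ κ j₂ := by rw [hUi] at hj₂; exact hj₂
  replace hj' : κ' j' = 1 := by rw [hVi] at hj'; exact hj'
  have hUa := atom_whole (j₀ := j) (by rw [hj]; omega) (hUe ▸ hU) hb
  have hVa := atom_whole (j₀ := j') (by rw [hj']; omega) (hVe ▸ hV) hb'
  have hcel : T.cel i (g + g') (κ + κ') = T.cel i g κ + T.cel i g' κ' := by
    refine Prod.ext (by simp) (funext fun i' => ?_)
    by_cases hi : i' = i
    · subst hi; simp
    · simp [cel_snd_ne hi]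
  have hx : U + V = b + b' + T.cel i (g + g') (κ + κ') := by rw [hUe, hVe, hcel]; abel
  have hx' : b + b' + ({g, g'}, 0) = (b + ({g}, 0)) + (b' + ({g'}, 0)) := by
    rw [pair_eq_add]; abel
  have hbb : (b + b').2 i = 0 := by simp [hb, hb']
  refine move_false hc.not_mem hc.one_le hc.wide hc.min (x' := b + b' + ({g, g'}, 0)) ?_ ?_
    ⟨2, ?_, le_rfl⟩ hlong ?_
  · rw [hx']; exact T.block.add_mem hUa.1 hVa.1
  · rw [hx, map_add, map_add T.deg (b + b'), deg_seq, deg_cel]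
    have := Finset.single_le_sum (f := κ + κ') (fun _ _ => Nat.zero_le _) (Finset.mem_univ j₂)
    simp only [Pi.add_apply] at this
    simp only [Pi.add_apply, Multiset.card_pair]
    omega
  · rw [hx']
    exact add_mem_lengthsIn hUa.one_mem_lengthsIn hVa.one_mem_lengthsIn
  · intro l' hl' _
    rw [hx]
    exact lift_two_whole hj hj' (hUi ▸ hU.1.1 i) (hVi ▸ hV.1.1 i) _ hbb hboth l' hl'

omit hc in
theorem exists_split {i : ι} : ∃ b, U = b + T.cel i (U.2 i).1 (U.2 i).2 ∧ b.2 i = 0 := by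
  obtain ⟨b, hb⟩ := exists_eq_add_cel (x := U) (i := i) (U.2 i).1 (k := (U.2 i).2)
    fun _ => le_rfl
  refine ⟨b, hb, ?_⟩
  have := congrArg (fun u : T.Amb => u.2 i) hb
  simp only [Prod.snd_add, Pi.add_apply, cel_snd_self] at this
  exact left_eq_add.1 (by rw [add_comm]; exact this)

/-- If both entries at `j` were 1, the joint piece would have entry 2 there, and `collapses_whole`
would supply everything that `le_add` needs. -/
theorem three_le {i : ι} (hi : U.2 i ≠ 0) (j : Fin (T.rank i)) :
    3 ≤ (U.2 i).2 j + (V.2 i).2 j := by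
  by_contra hlt
  have hVi := hc.right_ne_zero hU hV hi
  have h1 := (hU.1.1 i).pos hi j
  have h2 := (hV.1.1 i).pos hVi j
  obtain ⟨b, hUe, hb⟩ := exists_split (i := i) hU hV
  obtain ⟨b', hVe, hb'⟩ := exists_split (i := i) hV hU
  generalize hg : (U.2 i).1 = g at *
  generalize hκ : (U.2 i).2 = κ at *
  generalize hg' : (V.2 i).1 = g' at *
  generalize hκ' : (V.2 i).2 = κ' at *
  have hcel : T.cel i (g + g') (κ + κ') = T.cel i g κ + T.cel i g' κ' := by
    refine Prod.ext (by simp) (funext fun i' => ?_)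
    by_cases hi : i' = i
    · subst hi; simp
    · simp [cel_snd_ne hi]
  have hx : U + V = b + b' + T.cel i (g + g') (κ + κ') := by rw [hUe, hVe, hcel]; abel
  have hbb : (b + b').2 i = 0 := by simp [hb, hb']
  have hcol : ∀ w0 : T.Amb, w0.2 i = 0 →
      Collapses T.block (T.cel i (g + g') (κ + κ')) ({g, g'}, 0) w0 := fun w0 hw0 =>
    collapses_whole (j₀ := j) (by simp; omega) (by simp; omega) (by simp) (by simp) hw0
  refine hc.le_add hU hV hUe hVe hb hb' ((hcol _ hbb).exists_long eq_zero_of_deg hc.one_le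
    hc.wide hx) (fun w0 hw0 hWa hWB => ?_) hi
  have := (hcol w0 hw0).lift (z := {w0 + ({g, g'}, 0)}) (b := w0) eq_zero_of_deg (by simpa using hWa)
    (by simp) (by simp) hWB (cel_ne_zero (j := j) (by simp; omega))
  simpa using this

/-- A prime with the class of a unit could be deleted from `U` without replacement; all entries stay
positive because its exponent is at least 2. This is a contraction to zero. -/
theorem cls_notMem_aux {i : ι} {j : Fin (T.rank i)} (h2 : 2 ≤ (U.2 i).2 j) (hi : U.2 i ≠ 0) :
    T.cls i j ∉ T.unitCls i := by
  intro hcls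
  set ν : Fin (T.rank i) → ℕ := Pi.single j 1 with hν
  have hν1 : ∀ j', ν j' ≤ 1 := by
    intro j'
    by_cases h : j' = j
    · subst h; simp [hν]
    · simp [hν, h]
  have hνj : ν j = 1 := by simp [hν]
  have hν0 : ∀ j', j' ≠ j → ν j' = 0 := fun j' h => by simp [hν, h]
  have hφ : T.phi i ν = T.cls i j := by
    rw [phi_apply, Finset.sum_eq_single j]
    · simp [hνj]
    · intro j' _ h; simp [hν0 j' h]
    · simp
  have hg : 0 - T.phi i ν ∈ T.unitCls i := by rw [hφ, zero_sub]; exact neg_mem hcls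
  have hpos := (hU.1.1 i).pos hi
  obtain ⟨b, hb⟩ := exists_eq_add_cel (x := U) (i := i) 0 (k := ν) fun j' => (hν1 j').trans (hpos j')
  have hbpos : ∀ j', 0 < (b.2 i).2 j' := by
    intro j'
    have := congrArg (fun u : T.Amb => (u.2 i).2 j') hb
    have h3 := hpos j'
    simp at this
    by_cases h : j' = j
    · subst h; omega
    · rw [hν0 j' h] at this; omega
  have hbB : b + 0 ∈ T.block := replace_mem (s := 0) (s' := 0) (g := 0) (ν := ν) (i := i)
    (by rw [pair_zero_add, ← hb]; exact hU.1) (by simp) (Or.inr ⟨hbpos, hg⟩)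
  have hx : U + V = b + V + T.cel i 0 ν := by rw [hb]; abel
  have hapos : ∀ j', 0 < ((b + V).2 i).2 j' := fun j' => by
    have := hbpos j'
    simp only [Prod.snd_add, Pi.add_apply]; omega
  have hne : ∀ {v : T.Amb}, (∀ j', 0 < (v.2 i).2 j') → v.2 i ≠ 0 := by
    intro v hv h0
    have := hv j
    rw [h0] at this
    simp at this
  exact contract_false eq_zero_of_deg hc.not_mem hc.one_le hc.wide hc.min (p := T.cel i 0 ν) (p' := 0)
    (fun b => b.2 i ≠ 0) hx
    (by rw [add_right_comm]; exact T.block.add_mem hbB hV.1) (by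
      rw [map_zero, deg_cel]
      have := Finset.single_le_sum (f := ν) (fun _ _ => Nat.zero_le _) (Finset.mem_univ j)
      omega)
    (fun b hb _ _ l' hl' => lift_absorb (j₀ := j) hν1 (by omega) hg b hb l' hl') (hne hapos)
    (hne hbpos) (y := {U}) (w := {V}) (hc.pair_atoms hU hV) (by simp) (by simp) (by simp)
    (by simpa using hb) hbB
    ((collapses_unit (s' := 0) (j₀ := j) hν1 (by omega) hg (by simp) (Or.inr hapos)).exists_long
      eq_zero_of_deg hc.one_le hc.wide hx)

theorem cls_notMem {i : ι} (hi : U.2 i ≠ 0) (j : Fin (T.rank i)) : T.cls i j ∉ T.unitCls i := by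
  have h := hc.three_le hU hV hi j
  by_cases h2 : 2 ≤ (U.2 i).2 j
  · exact hc.cls_notMem_aux hU hV h2 hi
  · exact (hc.symm hU hV).cls_notMem_aux hV hU (j := j) (by omega) (hc.right_ne_zero hU hV hi)

end Two

theorem exists_pair [DecidableEq ι] (hc : T.Crit d x k) :
    ∃ U V, IsAtomIn T.block U ∧ IsAtomIn T.block V ∧ x = U + V ∧ T.Crit d (U + V) 2 := by
  have h2 := hc.eq_two
  subst h2
  obtain ⟨z, hz, hsum, hcard⟩ := hc.wide.1
  obtain ⟨U, V, rfl⟩ := Multiset.card_eq_two.1 hcard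
  rw [Multiset.sum_pair] at hsum
  exact ⟨U, V, hz U (by simp), hz V (by simp), hsum.symm, hsum ▸ hc⟩

end Crit

/-- Outside the set of distances, no gaps occur unless there is a critical element. -/
theorem exists_crit {d : ℕ} (hd : d ∉ distancesIn T.block) (hd1 : 1 ≤ d) {x : T.Amb} {k : ℕ}
    (h : Wide T.block d x k) : ∃ x k, T.Crit d x k := by
  induction hn : T.deg x using Nat.strong_induction_on generalizing x k with
  | _ n ih =>
    by_cases hmin : ∀ y ∈ T.block, T.deg y < T.deg x → ∀ k', ¬Wide T.block d y k'
    · exact ⟨x, k, hd, hd1, h, hmin⟩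
    · push Not at hmin
      obtain ⟨y, -, hlt, k', hk'⟩ := hmin
      exact ih (T.deg y) (hn ▸ hlt) hk' rfl

end BlockData

/-! ### The least distance -/

theorem one_mem_distancesIn {M : Type*} [AddCommMonoid M] {B : AddSubmonoid M} {x : M} {k : ℕ}
    (h : k ∈ lengthsIn B x) (h1 : k + 1 ∈ lengthsIn B x) : 1 ∈ distancesIn B := by
  simp only [distancesIn, Set.mem_iUnion]
  refine ⟨x, mem_of_mem_lengthsIn h, Nat.one_pos, k, h, k + 1, h1, rfl, ?_⟩
  ext m
  simp only [Set.mem_inter_iff, Set.mem_Icc, Set.mem_insert_iff, Set.mem_singleton_iff]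
  constructor
  · rintro ⟨h, -⟩; omega
  · rintro (rfl | rfl)
    exacts [⟨by omega, h⟩, ⟨by omega, h1⟩]

theorem exists_wide_of_mem_distancesIn {M : Type*} [AddCommMonoid M] {B : AddSubmonoid M} {d D : ℕ}
    (hD : D ∈ distancesIn B) (h : d < D) : ∃ x k, Wide B d x k := by
  simp only [distancesIn, Set.mem_iUnion] at hD
  obtain ⟨x, -, hD0, k, hk, l, hl, rfl, hI⟩ := hD
  refine ⟨x, k, hk, ⟨_, hl, by omega⟩, fun m hm hkm => ?_⟩
  by_contra hlt
  have : m ∈ Set.Icc k (k + D) ∩ lengthsIn B x := ⟨⟨by omega, by omega⟩, hm⟩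
  rw [hI] at this
  simp at this
  omega

namespace BlockData

variable {G : Type*} [AddCommGroup G] {ι : Type*} {T : BlockData G ι} [Fintype ι]

theorem seq_mem {s : Multiset G} (h : s.sum = 0) : ((s, 0) : T.Amb) ∈ T.block :=
  ⟨fun _ => Or.inl rfl, by rw [tot_seq, h]⟩

theorem eq_zero_of_no_zero_sum {s : Multiset G} (h : ∀ t ≤ s, t.sum = 0 → t = 0) {v : T.Amb}
    (hv : v ∈ T.block) (hvs : v.1 ≤ s) (h2 : v.2 = 0) : v = 0 := by
  have h3 : v = (v.1, 0) := Prod.ext rfl h2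
  have h4 := hv.2
  rw [h3, tot_seq] at h4
  rw [h3, h _ hvs h4]
  rfl

/-- An element concentrated at one index with an exponent one there. -/
theorem atom_of_one {x : T.Amb} (hx : x ∈ T.block) {i : ι} {j : Fin (T.rank i)}
    (hj : (x.2 i).2 j = 1) (hi : ∀ i', i' ≠ i → x.2 i' = 0)
    (hs : ∀ t ≤ x.1, t.sum = 0 → t = 0) : IsAtomIn T.block x := by
  refine ⟨hx, ?_, ?_⟩
  · rintro rfl
    simp at hj
  have main : ∀ v ∈ T.block, ∀ w ∈ T.block, v + w = x → w.2 i = 0 → w = 0 := by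
    rintro v hv w hw rfl hwi
    refine eq_zero_of_no_zero_sum hs hw (by simp) (funext fun i' => ?_)
    by_cases h : i' = i
    · subst h; exact hwi
    · refine snd_eq_zero_of_mem (z := {v, w}) (by simp [hv, hw]) ?_ (by simp)
      rw [Multiset.sum_pair]; exact hi i' h
  rintro v hv w hw hvw
  by_cases hwi : w.2 i = 0
  · exact Or.inr (main v hv w hw hvw hwi)
  · refine Or.inl (main w hw v hv (by rw [add_comm, hvw]) ?_)
    apply (hv.1 i).eq_zero (j := j)
    have h1 := (hw.1 i).pos hwi j
    rw [← hvw] at hj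
    simp at hj
    omega

theorem atom_seq {s : Multiset G} (h0 : (0 : G) ∉ s) (hs0 : s ≠ 0) (hs : s.sum = 0)
    (hc : Multiset.card s ≤ 3) : IsAtomIn T.block ((s, 0) : T.Amb) := by
  refine ⟨seq_mem hs, fun h => hs0 (congrArg Prod.fst h), fun v hv w hw hvw => ?_⟩
  have hsnd : ∀ u ∈ ({v, w} : Multiset T.Amb), u.2 = 0 := by
    intro u hu
    refine funext fun i' => ?_
    refine snd_eq_zero_of_mem (z := {v, w}) (by simp [hv, hw]) ?_ hu
    rw [Multiset.sum_pair, hvw]; rfl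
  have h1 : ∀ u ∈ ({v, w} : Multiset T.Amb), Multiset.card u.1 ≤ 1 → u = 0 := by
    intro u hu hcard
    have hub : u ∈ T.block := by
      simp at hu
      rcases hu with h | h <;> rw [h]
      exacts [hv, hw]
    have hu1 : u.1 ≤ s := by
      have : s = v.1 + w.1 := by
        have := congrArg Prod.fst hvw
        exact this.symm
      rw [this]
      simp at hu
      rcases hu with h | h <;> simp [h]
    refine eq_zero_of_no_zero_sum (s := u.1) (fun t ht hts => ?_) hub le_rfl (hsnd u hu)
    rcases (show Multiset.card t = 0 ∨ Multiset.card t = 1 by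
      have := Multiset.card_le_card ht; omega) with h | h
    · exact Multiset.card_eq_zero.1 h
    · obtain ⟨g, rfl⟩ := Multiset.card_eq_one.1 h
      rw [Multiset.sum_singleton] at hts
      subst hts
      exact absurd (Multiset.mem_of_le (ht.trans hu1) (by simp)) h0
  have h2 : Multiset.card v.1 + Multiset.card w.1 = Multiset.card s := by
    rw [← Multiset.card_add, ← Prod.fst_add, hvw]
  rcases (show Multiset.card v.1 ≤ 1 ∨ Multiset.card w.1 ≤ 1 by omega) with h | h
  exacts [Or.inl (h1 v (by simp) h), Or.inr (h1 w (by simp) h)]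

/-- The atom on `g`, `h`, `-(g + h)` times its negative also factors into three pairs of opposite
elements, so 2 and 3 are lengths. -/
theorem one_mem_of_ne {g h : G} (hg : g ≠ 0) (hh : h ≠ 0) (hgh : g + h ≠ 0) :
    1 ∈ distancesIn T.block := by
  have hgh' : -(g + h) ≠ 0 := neg_ne_zero.2 hgh
  have h2 : ∀ a : G, a ≠ 0 → IsAtomIn T.block (({a, -a}, 0) : T.Amb) := fun a ha =>
    atom_seq (by simp [ha, ha.symm]) (by simp) (by simp) (by simp)
  have h3 : ∀ a b : G, a ≠ 0 → b ≠ 0 → a + b ≠ 0 →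
      IsAtomIn T.block (({a, b, -(a + b)}, 0) : T.Amb) := fun a b ha hb hab =>
    atom_seq (by
      have : (0 : G) ≠ -(a + b) := (neg_ne_zero.2 hab).symm
      simp only [Multiset.insert_eq_cons, Multiset.mem_cons, Multiset.mem_singleton, not_or]
      exact ⟨ha.symm, hb.symm, this⟩) (by simp) (by simp) (by simp)
  refine one_mem_distancesIn (x := (({g, h, -(g + h)}, 0) : T.Amb) + ({-g, -h, -(-g + -h)}, 0))
    (k := 2) (add_mem_lengthsIn (h3 g h hg hh hgh).one_mem_lengthsIn
      (h3 _ _ (neg_ne_zero.2 hg) (neg_ne_zero.2 hh) (by rw [← neg_add]; exact hgh')).one_mem_lengthsIn)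
    ?_
  have := add_mem_lengthsIn (add_mem_lengthsIn (h2 g hg).one_mem_lengthsIn
    (h2 h hh).one_mem_lengthsIn) (h2 _ hgh).one_mem_lengthsIn
  convert this using 1
  have e : ∀ s t : Multiset G, ((s, 0) : T.Amb) + (t, 0) = (s + t, 0) := fun s t =>
    Prod.ext rfl (add_zero _)
  rw [e, e, e]
  congr 1
  simp only [ Multiset.insert_eq_cons, ← Multiset.singleton_add]
  rw [show -(-g + -h) = g + h by abel]
  abel_nf

variable [DecidableEq ι]

theorem cel_add (i : ι) (g g' : G) (κ κ' : Fin (T.rank i) → ℕ) :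
    T.cel i (g + g') (κ + κ') = T.cel i g κ + T.cel i g' κ' := by
  refine Prod.ext (by simp) (funext fun i' => ?_)
  by_cases hi : i' = i
  · subst hi; simp
  · simp [cel_snd_ne hi]

theorem seq_add_cel_mem {s : Multiset G} {i : ι} {g : G} {κ : Fin (T.rank i) → ℕ}
    (hv : T.Val i (g, κ)) (hs : s.sum + g = 0) : (s, 0) + T.cel i g κ ∈ T.block := by
  refine mem_of_eq_off (x := 0) i (zero_mem _) (fun i' hi => by simp [cel_snd_ne hi]) ?_
    (by simpa using hv)
  rw [map_add, tot_seq, tot_cel, hs]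

theorem seq_add_cel_atom {s : Multiset G} {i : ι} {g : G} {κ : Fin (T.rank i) → ℕ}
    {j : Fin (T.rank i)} (hj : κ j = 1) (hv : T.Val i (g, κ)) (hs : s.sum + g = 0)
    (h0 : ∀ t ≤ s, t.sum = 0 → t = 0) : IsAtomIn T.block ((s, 0) + T.cel i g κ) :=
  atom_of_one (i := i) (j := j) (seq_add_cel_mem hv hs) (by simpa using hj)
    (fun i' hi => by simp [cel_snd_ne hi]) (by simpa using h0)

theorem phi_single (i : ι) (j : Fin (T.rank i)) (n : ℕ) :
    T.phi i (Pi.single j n) = n • T.cls i j := by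
  rw [phi_apply, Finset.sum_eq_single j]
  · simp
  · intro j' _ h; simp [h]
  · simp

/-- The vectors $1+be_j$ keep the entry 1 at `j'`, and their classes alternate between 0 and `c`.
Twice the atom with vector $1+(e+1)e_j$ and group element `c` equals the sum of the vectors
$1+(e+2)e_j$ and $1+e\,e_j$ without group elements and of the pair `c`, `c`. -/
theorem one_mem_of_two {c : G} (hc : c ≠ 0) (hcc : c + c = 0) {i : ι} {j j' : Fin (T.rank i)}
    (hjj : j ≠ j') (hcls : ∀ j, T.cls i j = c) : 1 ∈ distancesIn T.block := by
  -- The number `a` is 2 or 3 by the parity of the rank; being at least 2, it leaves room for the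
  -- vectors with `a - 1` and `a - 2`.
  have hodd : ∃ a, 2 ≤ a ∧ (T.rank i + a) • c = 0 := by
    have h2 : ∀ n : ℕ, (2 * n) • c = 0 := fun n => by
      rw [mul_comm, mul_smul, two_smul, hcc, smul_zero]
    rcases Nat.even_or_odd' (T.rank i) with ⟨n, hn | hn⟩
    · exact ⟨2, le_rfl, by rw [hn, show 2 * n + 2 = 2 * (n + 1) by ring, h2]⟩
    · exact ⟨3, by omega, by rw [hn, show 2 * n + 1 + 3 = 2 * (n + 2) by ring, h2]⟩
  obtain ⟨a, ha, hφ⟩ := hodd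
  set lam : ℕ → Fin (T.rank i) → ℕ := fun b => (fun _ => 1) + Pi.single j b with hlm
  have hlj' : ∀ b, lam b j' = 1 := fun b => by simp [hlm, hjj.symm]
  have hpos : ∀ b j, 0 < lam b j := fun b j => by simp [hlm]
  have hphi : ∀ b, T.phi i (lam b) = (T.rank i + b) • c := by
    intro b
    rw [hlm, map_add, phi_single, hcls, phi_apply]
    simp [hcls, add_smul]
  have hv : ∀ b g, g = T.phi i (lam b) → T.Val i (g, lam b) := by
    rintro b g rfl
    exact Or.inr ⟨hpos b, by simp⟩
  obtain ⟨e, rfl⟩ : ∃ e, a = e + 2 := ⟨a - 2, by omega⟩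
  have h0 : ∀ t ≤ (0 : Multiset G), t.sum = 0 → t = 0 := fun t ht _ => Multiset.le_zero.1 ht
  have h1 : ∀ t ≤ ({c} : Multiset G), t.sum = 0 → t = 0 := by
    intro t ht hts
    rcases Multiset.le_singleton.1 ht with h | h
    · exact h
    · rw [h, Multiset.sum_singleton] at hts; exact absurd hts hc
  have e1 : (T.rank i + (e + 1)) • c = c := by
    have : (T.rank i + (e + 1)) • c + c = 0 := by rw [← hφ, ← succ_nsmul]; congr 1
    exact add_right_cancel (this.trans hcc.symm)
  have e0 : (T.rank i + e) • c = 0 := by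
    have : (T.rank i + e) • c + c = 0 + c := by rw [zero_add, ← succ_nsmul]; exact e1
    exact add_right_cancel this
  have A := seq_add_cel_atom (T := T) (s := {c}) (hlj' (e + 1)) (hv (e + 1) c (by rw [hphi, e1]))
    (by simpa using hcc) h1
  have B := seq_add_cel_atom (T := T) (s := 0) (hlj' (e + 2)) (hv (e + 2) 0 (by rw [hphi, hφ]))
    (by simp) h0
  have C := seq_add_cel_atom (T := T) (s := 0) (hlj' e) (hv e 0 (by rw [hphi, e0]))
    (by simp) h0
  have D : IsAtomIn T.block (({c, c}, 0) : T.Amb) :=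
    atom_seq (by simp [hc.symm]) (by simp) (by simpa using hcc) (by simp)
  refine one_mem_distancesIn (k := 2) (add_mem_lengthsIn A.one_mem_lengthsIn A.one_mem_lengthsIn) ?_
  have := add_mem_lengthsIn (add_mem_lengthsIn B.one_mem_lengthsIn C.one_mem_lengthsIn)
    D.one_mem_lengthsIn
  convert this using 1
  rw [zero_pair, zero_add, zero_add, ← cel_add, pair_eq_add]
  rw [show lam (e + 2) + lam e = lam (e + 1) + lam (e + 1) by
    funext m
    by_cases h : m = j
    · subst h; simp [hlm]; ring
    · simp [hlm, h], show (0 : G) + 0 = c + c by rw [hcc, add_zero], cel_add]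
  abel_nf

/-- The minimum of a nonempty set of distances is one. -/
theorem not_crit_one {x : T.Amb} {k : ℕ} : ¬T.Crit 1 x k := by
  intro hc
  obtain ⟨U, V, hU, hV, -, hc⟩ := hc.exists_pair
  obtain ⟨i, hi⟩ := hc.exists_ne_zero hU hV
  obtain ⟨j, hj⟩ := hc.exists_one_left hU hV hi
  obtain ⟨j', hj'⟩ := hc.exists_two_le_left hU hV hi
  have hcls : ∀ j, T.cls i j ≠ 0 := fun j h => hc.cls_notMem hU hV hi j (h ▸ zero_mem _)
  -- If any two nonzero elements are opposite, there is at most one nonzero element and it has order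
  -- 2. The classes of the primes at `i` are nonzero and therefore all coincide.
  have h2 : ∀ g h : G, g ≠ 0 → h ≠ 0 → g + h = 0 := by
    intro g h hg hh
    by_contra hgh
    exact hc.not_mem (one_mem_of_ne hg hh hgh)
  have hcc := h2 _ _ (hcls j) (hcls j)
  refine hc.not_mem (one_mem_of_two (hcls j) hcc (j := j) (j' := j') ?_ fun j1 => ?_)
  · rintro rfl; omega
  · exact add_right_cancel ((h2 _ _ (hcls j1) (hcls j)).trans hcc.symm)

theorem one_mem_of_mem {D : ℕ} (hD : D ∈ distancesIn T.block) : 1 ∈ distancesIn T.block := by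
  have hD0 : 0 < D := by
    simp only [distancesIn, Set.mem_iUnion] at hD
    exact hD.choose_spec.choose_spec.1
  by_contra h
  obtain ⟨x, k, hw⟩ := exists_wide_of_mem_distancesIn (d := 1) hD
    (lt_of_le_of_ne hD0 fun h1 => h (h1 ▸ hD))
  obtain ⟨x, k, hc⟩ := exists_crit h le_rfl hw
  exact not_crit_one hc

/-- If there are no critical elements, then the set of distances is an initial segment. -/
theorem mem_of_mem_of_lt (hcrit : ∀ d x k, 2 ≤ d → ¬T.Crit d x k) {d D : ℕ}
    (hD : D ∈ distancesIn T.block) (hd : 0 < d) (hdD : d ≤ D) : d ∈ distancesIn T.block := by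
  by_contra h
  obtain ⟨x, k, hw⟩ := exists_wide_of_mem_distancesIn (d := d) hD
    (lt_of_le_of_ne hdD fun h1 => h (h1 ▸ hD))
  obtain ⟨x, k, hc⟩ := exists_crit h hd hw
  rcases (show d = 1 ∨ 2 ≤ d by omega) with rfl | h2
  · exact not_crit_one hc
  · exact hcrit d x k h2 hc

end BlockData

/-! ### Trivial class group -/

namespace BlockData

variable {G : Type*} [AddCommGroup G] {ι : Type*} {T : BlockData G ι} [Fintype ι]

section TrivialClassGroup

variable [Subsingleton G]

theorem mem_block_of_subsingleton {x : T.Amb} (h : ∀ i, x.2 i = 0 ∨ ∀ j, 0 < (x.2 i).2 j) :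
    x ∈ T.block :=
  ⟨fun i => (h i).imp id fun h => ⟨h, by
    rw [Subsingleton.elim ((x.2 i).1 - _) 0]; exact zero_mem _⟩, Subsingleton.elim _ _⟩

variable [DecidableEq ι]

/-- Without class conditions the piece at `i` splits off, so it is the entire atom. -/
theorem atom_eq_cel {u : T.Amb} (hu : IsAtomIn T.block u) {i : ι} (hi : u.2 i ≠ 0) :
    u = T.cel i 0 (u.2 i).2 := by
  obtain ⟨b, hb⟩ := exists_eq_add_cel (x := u) (i := i) 0 (k := (u.2 i).2) fun _ => le_rfl
  have hpos := (hu.1.1 i).pos hi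
  have hbi : b.2 i = 0 := by
    refine Prod.ext (Subsingleton.elim _ _) (funext fun j => ?_)
    have := congrArg (fun u : T.Amb => (u.2 i).2 j) hb
    simp at this
    simpa using this
  have hbB : b ∈ T.block := by
    refine mem_block_of_subsingleton fun i' => ?_
    by_cases h : i' = i
    · subst h; exact Or.inl hbi
    · have := congrArg (fun u : T.Amb => u.2 i') hb
      simp [cel_snd_ne h] at this
      rw [← this]
      exact (hu.1.1 i').imp id fun h => h.1
  have hcB : T.cel i 0 (u.2 i).2 ∈ T.block := by
    refine mem_block_of_subsingleton fun i' => ?_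
    by_cases h : i' = i
    · subst h; exact Or.inr (by simpa using hpos)
    · exact Or.inl (cel_snd_ne h _ _)
  rcases hu.2.2 b hbB _ hcB hb.symm with h | h
  · rw [h, zero_add] at hb; exact hb
  · exfalso
    have := congrArg (fun u : T.Amb => (u.2 i).2 ⟨0, T.rank_pos i⟩) h
    simp at this
    have := hpos ⟨0, T.rank_pos i⟩
    omega

theorem cel_atom {i : ι} {κ : Fin (T.rank i) → ℕ} (hpos : ∀ j, 0 < κ j) {j : Fin (T.rank i)}
    (hj : κ j = 1) : IsAtomIn T.block (T.cel i 0 κ) := by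
  have := seq_add_cel_atom (T := T) (s := 0) (g := 0) hj
    (Or.inr ⟨hpos, by rw [Subsingleton.elim (_ - _) 0]; exact zero_mem _⟩) (by simp)
    fun t ht _ => Multiset.le_zero.1 ht
  rwa [pair_zero_add] at this

/-- If all entries were at least 2, the all-ones piece would split off. -/
theorem atom_exists_one {u : T.Amb} (hu : IsAtomIn T.block u) {i : ι} (hi : u.2 i ≠ 0) :
    ∃ j, (u.2 i).2 j = 1 := by
  by_contra hne
  push Not at hne
  have hpos := (hu.1.1 i).pos hi
  have hue := atom_eq_cel hu hi
  generalize (u.2 i).2 = κ at *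
  have h : κ = (fun _ => 1) + fun j => κ j - 1 := by
    funext j; have := hpos j; simp; omega
  have hmem : ∀ κ : Fin (T.rank i) → ℕ, (∀ j, 0 < κ j) → T.cel i 0 κ ∈ T.block := by
    intro κ h
    refine mem_block_of_subsingleton fun i' => ?_
    by_cases h' : i' = i
    · subst h'; exact Or.inr (by simpa using h)
    · exact Or.inl (cel_snd_ne h' _ _)
  have hne0 : ∀ κ : Fin (T.rank i) → ℕ, (∀ j, 0 < κ j) → T.cel i 0 κ ≠ 0 := by
    intro κ h
    have := cel_ne_zero (T := T) (r := 0) (g := 0) (h ⟨0, T.rank_pos i⟩)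
    rwa [zero_add] at this
  have h2 : ∀ j, 0 < κ j - 1 := fun j => by have := hpos j; have := hne j; omega
  rcases hu.2.2 _ (hmem (fun _ => 1) fun _ => Nat.one_pos) _ (hmem (fun j => κ j - 1) h2)
    (by rw [← cel_add, add_zero, ← h, ← hue]) with h3 | h3
  exacts [hne0 _ (fun _ => Nat.one_pos) h3, hne0 _ h2 h3]

open Classical in
theorem card_factorization {z : Multiset T.Amb} (hz : ∀ u ∈ z, IsAtomIn T.block u) :
    Multiset.card z = Multiset.card z.sum.1 + ∑ i, z.countP (fun u => u.2 i ≠ 0) := by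
  induction z using Multiset.induction_on with
  | empty => simp
  | cons u z ih =>
    have h1 := ih fun v hv => hz v (Multiset.mem_cons_of_mem hv)
    have hu := hz u (Multiset.mem_cons_self u z)
    simp only [Multiset.countP_cons, Finset.sum_add_distrib, Multiset.card_cons,
      Multiset.sum_cons, Prod.fst_add, Multiset.card_add]
    have h2 : Multiset.card u.1 + ∑ i, (if u.2 i ≠ 0 then 1 else 0) = 1 := by
      by_cases h : ∃ i, u.2 i ≠ 0
      · obtain ⟨i, hi⟩ := h
        have hue := atom_eq_cel hu hi
        rw [Finset.sum_eq_single i]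
        · rw [if_pos hi, hue]; simp
        · intro i' _ h'
          rw [hue, cel_snd_ne h']; simp
        · simp
      · push Not at h
        have hs : u = (u.1, 0) := Prod.ext rfl (funext h)
        have h1 : u.1 ≠ 0 := fun h0 => hu.2.1 (by rw [hs, h0]; rfl)
        obtain ⟨g, hg⟩ := Multiset.exists_mem_of_ne_zero h1
        obtain rfl := Subsingleton.elim g 0
        obtain ⟨a, ha⟩ := exists_eq_add_singleton hg
        have := not_zero_mem_atom hu ha
        rw [this, zero_add] at ha
        simp [ha]
    omega

theorem sum_of_one {i : ι} {j : Fin (T.rank i)} {z : Multiset T.Amb}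
    (h : ∀ u ∈ z, (u.2 i).2 j = 1) : (z.sum.2 i).2 j = Multiset.card z := by
  induction z using Multiset.induction_on with
  | empty => simp
  | cons u z ih =>
    have h1 := ih fun v hv => h v (Multiset.mem_cons_of_mem hv)
    have h2 := h u (Multiset.mem_cons_self u z)
    simp only [Multiset.sum_cons, Multiset.card_cons, Prod.snd_add, Pi.add_apply]
    omega

/-- Let `z` be the longer of two factorizations with adjacent lengths. Sequence atoms are equally
many in both, so `z` has more atoms at some index. It has at least three there, since two atoms
cannot be matched by a single one with an entry 1. The rank is at least 2, since in rank one the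
number of atoms at the index is the exponent. Regrouping three atoms into two shows that `|z| - 1`
is a length. -/
theorem distances_of_subsingleton {d : ℕ} (hd : d ∈ distancesIn T.block) : d = 1 := by
  classical
  simp only [distancesIn, Set.mem_iUnion] at hd
  obtain ⟨x, -, hd0, k, ⟨z', hz', hs', hk⟩, l, ⟨z, hz, hs, hl⟩, hld, hI⟩ := hd
  by_contra hd1
  have h1 : Multiset.card z = Multiset.card z.sum.1 +
    ∑ i, z.countP (fun u => u.2 i ≠ 0) := by convert card_factorization hz
  have h2 : Multiset.card z' = Multiset.card z'.sum.1 +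
    ∑ i, z'.countP (fun u => u.2 i ≠ 0) := by convert card_factorization hz'
  rw [hs] at h1
  rw [hs'] at h2
  obtain ⟨i, -, hi⟩ : ∃ i ∈ Finset.univ, z'.countP (fun u => u.2 i ≠ 0) <
      z.countP (fun u => u.2 i ≠ 0) := by
    apply Finset.exists_lt_of_sum_lt
    omega
  have hsplit : ∀ (z : Multiset T.Amb), ∀ i : ι,
      ∃ t, z = z.filter (fun u => u.2 i ≠ 0) + t ∧ t.sum.2 i = 0 := by
    intro z i
    refine ⟨z.filter (fun u => ¬u.2 i ≠ 0), (Multiset.filter_add_not _ z).symm, ?_⟩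
    by_contra h
    obtain ⟨u, hu, h⟩ := exists_ne_of_sum_ne h
    exact (Multiset.mem_filter.1 hu).2 h
  obtain ⟨t, ht, ht0⟩ := hsplit z i
  obtain ⟨t', ht', ht0'⟩ := hsplit z' i
  rw [Multiset.countP_eq_card_filter, Multiset.countP_eq_card_filter] at hi
  set y := z.filter (fun u => u.2 i ≠ 0) with hy
  set y' := z'.filter (fun u => u.2 i ≠ 0) with hy'
  have hya : ∀ u ∈ y, IsAtomIn T.block u ∧ u.2 i ≠ 0 := fun u hu => by
    rw [hy, Multiset.mem_filter] at hu; exact ⟨hz u hu.1, hu.2⟩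
  have hya' : ∀ u ∈ y', IsAtomIn T.block u ∧ u.2 i ≠ 0 := fun u hu => by
    rw [hy', Multiset.mem_filter] at hu; exact ⟨hz' u hu.1, hu.2⟩
  have hyx : y.sum.2 i = x.2 i := by
    rw [← hs, ht, Multiset.sum_add, Prod.snd_add, Pi.add_apply, ht0, add_zero]
  have hyx' : y'.sum.2 i = x.2 i := by
    rw [← hs', ht', Multiset.sum_add, Prod.snd_add, Pi.add_apply, ht0', add_zero]
  have hc := fun j => card_le_of_forall_ne (i := i) (z := y) (fun u hu =>
    ⟨(hya u hu).1.1, (hya u hu).2⟩) j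
  by_cases h3 : Multiset.card y ≤ 2
  · rcases (show Multiset.card y' = 0 ∨ (Multiset.card y' = 1 ∧ Multiset.card y = 2) by omega) with
      h | ⟨h, h'⟩
    · rw [Multiset.card_eq_zero] at h
      rw [h] at hyx'
      have := hc ⟨0, T.rank_pos i⟩
      rw [hyx, ← hyx'] at this
      simp at this
      rw [this] at hi
      simp at hi
    · obtain ⟨u, hu⟩ := Multiset.card_eq_one.1 h
      obtain ⟨hua, hui⟩ := hya' u (by rw [hu]; simp)
      obtain ⟨j, hj⟩ := atom_exists_one hua hui
      have := hc j
      rw [hyx, ← hyx', hu, Multiset.sum_singleton] at this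
      omega
  push Not at h3
  by_cases hr : ∃ j₀ j₁ : Fin (T.rank i), j₀ ≠ j₁
  · obtain ⟨j₀, j₁, hj⟩ := hr
    obtain ⟨X, y1, h4⟩ := Multiset.card_pos_iff_exists_mem.1
      (show 0 < Multiset.card y by omega) |>.imp fun g hg => Multiset.exists_cons_of_mem hg
    obtain ⟨Y, y2, h5⟩ := Multiset.card_pos_iff_exists_mem.1
      (show 0 < Multiset.card y1 by rw [h4, Multiset.card_cons] at h3; omega) |>.imp
        fun g hg => Multiset.exists_cons_of_mem hg
    obtain ⟨W, y3, h6⟩ := Multiset.card_pos_iff_exists_mem.1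
      (show 0 < Multiset.card y2 by rw [h4, h5, Multiset.card_cons, Multiset.card_cons] at h3; omega)
        |>.imp fun g hg => Multiset.exists_cons_of_mem hg
    subst h6 h5
    have hX := hya X (by rw [h4]; simp)
    have hY := hya Y (by rw [h4]; simp)
    have hW := hya W (by rw [h4]; simp)
    have pX := (hX.1.1.1 i).pos hX.2
    have pY := (hY.1.1.1 i).pos hY.2
    have pW := (hW.1.1.1 i).pos hW.2
    have eX := atom_eq_cel hX.1 hX.2
    have eY := atom_eq_cel hY.1 hY.2
    have eW := atom_eq_cel hW.1 hW.2
    generalize (X.2 i).2 = a at *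
    generalize (Y.2 i).2 = b at *
    generalize (W.2 i).2 = c at *
    -- The first new atom has entry 1 at `j₀`, the second one has entry 1 everywhere else, and their
    -- sum is `a + b + c`.
    have hA := cel_atom (T := T) (κ := Function.update (fun j => a j + b j + c j - 1) j₀ 1) (j := j₀)
      (by
        intro j
        by_cases h : j = j₀
        · subst h; simp
        · have := pX j; have := pY j
          simp [h]; omega) (by simp)
    have hB := cel_atom (T := T) (κ := Function.update (fun j => 1) j₀ (a j₀ + b j₀ + c j₀ - 1))
      (j := j₁)
      (by
        intro j
        by_cases h : j = j₀
        · subst h; have := pX j; have := pY j; simp; omega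
        · simp [h]) (by simp [hj.symm])
    have hsum : Function.update (fun j => a j + b j + c j - 1) j₀ 1 +
        Function.update (fun j => 1) j₀ (a j₀ + b j₀ + c j₀ - 1) = a + b + c := by
      funext j
      have := pX j
      by_cases h : j = j₀
      · subst h; simp; omega
      · simp [h]; omega
    have hsum' : T.cel i 0 (a + b + c) = X + Y + W := by
      have : (0 : G) = 0 + 0 + 0 := by simp
      rw [this, cel_add, cel_add, ← eX, ← eY, ← eW]
    have hmem : Multiset.card (y3 + t) + 2 ∈ lengthsIn T.block x := by
      refine ⟨T.cel i 0 (Function.update (fun j => a j + b j + c j - 1) j₀ 1) ::ₘ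
        T.cel i 0 (Function.update (fun j => 1) j₀ (a j₀ + b j₀ + c j₀ - 1)) ::ₘ (y3 + t),
        ?_, ?_, by simp only [Multiset.card_cons]⟩
      · intro u hu
        rw [Multiset.mem_cons, Multiset.mem_cons] at hu
        rcases hu with rfl | rfl | hu
        · exact hA
        · exact hB
        · refine hz u ?_
          rw [ht, h4]
          rcases Multiset.mem_add.1 hu with h | h <;> simp [h]
      · rw [← hs, ht, h4]
        simp only [Multiset.sum_cons, Multiset.sum_add, Multiset.cons_add]
        rw [← add_assoc, ← cel_add, hsum, add_zero, hsum']
        abel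
    have hzc : Multiset.card z = Multiset.card (y3 + t) + 3 := by
      rw [ht, h4]
      simp only [Multiset.card_add, Multiset.card_cons]
      omega
    have : Multiset.card (y3 + t) + 2 ∈ Set.Icc k l ∩ lengthsIn T.block x :=
      ⟨⟨by omega, by omega⟩, hmem⟩
    rw [hI] at this
    simp only [Set.mem_insert_iff, Set.mem_singleton_iff] at this
    omega
  · push Not at hr
    set j₀ : Fin (T.rank i) := ⟨0, T.rank_pos i⟩
    have hone : ∀ u, IsAtomIn T.block u → u.2 i ≠ 0 → (u.2 i).2 j₀ = 1 := by
      intro u hu hi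
      obtain ⟨j, hj⟩ := atom_exists_one hu hi
      rwa [hr j j₀] at hj
    have e1 := sum_of_one (z := y) (j := j₀) fun u hu => hone u (hya u hu).1 (hya u hu).2
    have e2 := sum_of_one (z := y') (j := j₀) fun u hu => hone u (hya' u hu).1 (hya' u hu).2
    rw [hyx] at e1
    rw [hyx'] at e2
    omega

end TrivialClassGroup

end BlockData

/-! ### Changing the piece of an atom at one index -/

namespace BlockData

variable {G : Type*} [AddCommGroup G] {ι : Type*} {T : BlockData G ι} [Fintype ι]

theorem exists_parts_at (z : Multiset T.Amb) (i : ι) :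
    ∃ y t, z = y + t ∧ (∀ u ∈ y, u.2 i ≠ 0) ∧ t.sum.2 i = 0 := by
  classical
  refine ⟨z.filter (fun u => u.2 i ≠ 0), z.filter (fun u => ¬u.2 i ≠ 0),
    (Multiset.filter_add_not _ z).symm, fun u hu => (Multiset.mem_filter.1 hu).2, ?_⟩
  by_contra h
  obtain ⟨u, hu, h⟩ := exists_ne_of_sum_ne h
  exact (Multiset.mem_filter.1 hu).2 h

variable [DecidableEq ι]

theorem isAtomIn_of_one_mem {M : Type*} [AddCommMonoid M] {B : AddSubmonoid M} {x : M}
    (h : 1 ∈ lengthsIn B x) : IsAtomIn B x := by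
  obtain ⟨z, hz, rfl, h1⟩ := h
  obtain ⟨u, rfl⟩ := Multiset.card_eq_one.1 h1
  rw [Multiset.sum_singleton]
  exact hz u (by simp)

theorem exists_whole (u : T.Amb) (i : ι) :
    ∃ b, u = b + T.cel i (u.2 i).1 (u.2 i).2 ∧ b.2 i = 0 := by
  obtain ⟨b, hb⟩ := exists_eq_add_cel (x := u) (i := i) (u.2 i).1 (k := (u.2 i).2)
    fun _ => le_rfl
  refine ⟨b, hb, ?_⟩
  have := congrArg (fun u : T.Amb => u.2 i) hb
  simp only [Prod.snd_add, Pi.add_apply, cel_snd_self] at this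
  exact left_eq_add.1 (by rw [add_comm]; exact this)

theorem exists_whole' {u : T.Amb} {i : ι} {h : G} {κ : Fin (T.rank i) → ℕ} (hu : u.2 i = (h, κ)) :
    ∃ b, u = b + T.cel i h κ ∧ b.2 i = 0 := by
  have := exists_whole u i
  rwa [hu] at this

/-- Changing the piece at `i` of an atom, every part of a factorization of the result is nontrivial
at `i`. -/
theorem exists_length_change {i : ι} {r p : T.Amb} {h : G} {κ : Fin (T.rank i) → ℕ}
    (hW : IsAtomIn T.block (r + p)) (hr : r.2 i = 0) (hpos : ∀ j, 0 < κ j)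
    (hB : r + T.cel i h κ ∈ T.block)
    (hp : ∀ r0 : T.Amb, r0.2 i = 0 → r0 + T.cel i h κ ∈ T.block → r0 + p ∈ T.block ∧ r0 + p ≠ 0) :
    ∃ l ∈ lengthsIn T.block (r + T.cel i h κ), 1 ≤ l ∧ ∀ j, l ≤ κ j := by
  obtain ⟨z, hz, hzs⟩ := exists_factorization eq_zero_of_deg hB
  have hj₀ := hpos ⟨0, T.rank_pos i⟩
  obtain ⟨y, t, rfl, hy, ht⟩ := exists_parts_at z i
  -- Undoing the change in the part that meets `i` writes the atom `r + p` as a nonzero element plus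
  -- `t.sum`.
  have ht0 : t.sum = 0 := by
    have hys : y.sum.2 i = (h, κ) := by
      have := congrArg (fun u : T.Amb => u.2 i) hzs
      simpa [ht, hr] using this
    obtain ⟨r0, hr0, hri⟩ := exists_whole' hys
    have h1 : r0 + T.cel i h κ ∈ T.block := by
      rw [← hr0]; exact sum_mem_of_atoms fun u hu => hz u (by simp [hu])
    obtain ⟨h2, h3⟩ := hp r0 hri h1
    have h4 : r0 + t.sum = r := by
      rw [Multiset.sum_add, hr0, add_right_comm] at hzs
      exact add_right_cancel hzs
    exact (hW.2.2 _ h2 t.sum (sum_mem_of_atoms fun u hu => hz u (by simp [hu]))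
      (by rw [← h4]; abel)).resolve_left h3
  have ht1 := eq_zero_of_mem_of_sum_eq_zero (B := T.block) eq_zero_of_deg (z := t)
    (fun u hu => hz u (by simp [hu])) ht0
  subst ht1
  rw [add_zero] at hz hzs
  refine ⟨_, ⟨y, hz, hzs, rfl⟩, ?_, fun j => ?_⟩
  · rw [Nat.one_le_iff_ne_zero]
    intro h0
    rw [Multiset.card_eq_zero] at h0
    rw [h0] at hzs
    exact cel_ne_zero hj₀ hzs.symm
  · have := card_le_of_forall_ne (i := i) (z := y) (fun u hu => ⟨(hz u hu).1, hy u hu⟩) j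
    rw [hzs] at this
    simpa [hr] using this

/-- Positive exponent vectors whose classes agree modulo unit classes are interchangeable. All atoms
of the changed element meet `i`, so every entry of the new vector bounds the length. -/
theorem exists_length_change_cel {i : ι} {r : T.Amb} {h : G} {κ κ' : Fin (T.rank i) → ℕ}
    (hW : IsAtomIn T.block (r + T.cel i h κ')) (hr : r.2 i = 0) (hpos : ∀ j, 0 < κ j)
    (hpos' : ∀ j, 0 < κ' j) (hφ : T.phi i κ - T.phi i κ' ∈ T.unitCls i) :
    r + T.cel i h κ ∈ T.block ∧
      ∃ l ∈ lengthsIn T.block (r + T.cel i h κ), 1 ≤ l ∧ ∀ j, l ≤ κ j := by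
  have key : ∀ (κ κ' : Fin (T.rank i) → ℕ) (r0 : T.Amb), (∀ j, 0 < κ j) →
      T.phi i κ - T.phi i κ' ∈ T.unitCls i → r0.2 i = 0 →
      r0 + T.cel i h κ' ∈ T.block → r0 + T.cel i h κ ∈ T.block := by
    intro κ κ' r0 hpos hφ hr0 hB
    refine mem_of_eq_off i hB (fun i' hi => by simp [cel_snd_ne hi]) ?_ (Or.inr ⟨?_, ?_⟩)
    · have := hB.2
      rw [map_add, tot_cel] at this
      rw [map_add, tot_cel, this]
    · simpa [hr0] using hpos
    · have := (hB.1 i).cls_mem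
      simp only [Prod.snd_add, Pi.add_apply, hr0, cel_snd_self, zero_add] at this ⊢
      have := (T.unitCls i).sub_mem this hφ
      convert this using 1; abel
  have hB := key κ κ' r hpos hφ hr hW.1
  refine ⟨hB, exists_length_change hW hr hpos hB fun r0 hr0 h1 =>
    ⟨key κ' κ r0 hpos' ?_ hr0 h1, cel_ne_zero (hpos' ⟨0, T.rank_pos i⟩)⟩⟩
  rw [← neg_sub]; exact neg_mem hφ

theorem exists_length_change_seq {i : ι} {r : T.Amb} {s : Multiset G} {h : G}
    {κ : Fin (T.rank i) → ℕ}
    (hW : IsAtomIn T.block (r + (s, 0))) (hr : r.2 i = 0) (hs : s.sum = h) (hs0 : s ≠ 0)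
    (hpos : ∀ j, 0 < κ j) (hφ : h - T.phi i κ ∈ T.unitCls i) :
    r + T.cel i h κ ∈ T.block ∧
      ∃ l ∈ lengthsIn T.block (r + T.cel i h κ), 1 ≤ l ∧ ∀ j, l ≤ κ j := by
  have hB : r + T.cel i h κ ∈ T.block := by
    refine mem_of_eq_off i hW.1 (fun i' hi => by simp [cel_snd_ne hi]) ?_ (Or.inr ⟨?_, ?_⟩)
    · have := hW.1.2
      rw [map_add, tot_seq] at this
      rw [map_add, tot_cel, ← this, hs]
    · simpa [hr] using hpos
    · simpa [hr] using hφ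
  refine ⟨hB, exists_length_change hW hr hpos hB fun r0 hr0 h1 => ⟨?_, add_seq_ne_zero hs0⟩⟩
  refine replace_mem (s := 0) (g := h) (ν := κ) (i := i) ?_ (by simpa using hs) (Or.inl hr0)
  rwa [pair_zero_add]

/-- Removing a piece of trivial class from an atom. -/
theorem atom_of_add_cel {i : ι} {a : T.Amb} {ν : Fin (T.rank i) → ℕ}
    (hW : IsAtomIn T.block (a + T.cel i 0 ν)) (hφ : T.phi i ν ∈ T.unitCls i)
    (hpos : ∀ j, 0 < (a.2 i).2 j) : IsAtomIn T.block a := by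
  have key : ∀ v : T.Amb, v ∈ T.block → v.2 i ≠ 0 → v + T.cel i 0 ν ∈ T.block := by
    intro v hv hvi
    have hp := (hv.1 i).pos hvi
    have := insert_mem (s := 0) (s' := 0) (g := 0) (ν := ν) (i := i) (r := v)
      (by rw [add_pair_zero]; exact hv) (by simp) (by rw [zero_sub]; exact neg_mem hφ)
      (fun j => by have := hp j; omega)
    rwa [pair_zero_add] at this
  have hB : a ∈ T.block := by
    have := replace_mem (s := 0) (s' := 0) (g := 0) (ν := ν) (i := i) (r := a)
      (by rw [pair_zero_add]; exact hW.1) (by simp)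
      (Or.inr ⟨hpos, by rw [zero_sub]; exact neg_mem hφ⟩)
    rwa [add_pair_zero] at this
  have hj := hpos ⟨0, T.rank_pos i⟩
  have hne : ∀ v : T.Amb, v.2 i ≠ 0 → v ≠ 0 := by rintro v hv rfl; exact hv rfl
  have hai : a.2 i ≠ 0 := by intro h; rw [h] at hj; simp at hj
  refine ⟨hB, hne a hai, ?_⟩
  have main : ∀ v ∈ T.block, ∀ w ∈ T.block, v + w = a → v.2 i ≠ 0 → w = 0 := by
    intro v hv w hw hvw hvi
    refine (hW.2.2 (v + T.cel i 0 ν) (key v hv hvi) w hw (by rw [← hvw]; abel)).resolve_left ?_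
    intro h0
    exact hne v hvi (eq_zero_of_add_eq_zero_in eq_zero_of_deg hv h0)
  intro v hv w hw hvw
  by_cases hvi : v.2 i = 0
  · refine Or.inl (main w hw v hv (by rw [add_comm, hvw]) fun hwi => hai ?_)
    rw [← hvw]; simp [hvi, hwi]
  · exact Or.inr (main v hv w hw hvw hvi)

/-- Replacing the pieces at `i` of two atoms by two elements of the class group preserves
wideness. -/
theorem exists_wide_two_whole {d : ℕ} (hd : d ∉ distancesIn T.block) (hd1 : 1 ≤ d) {i : ι}
    {b b' : T.Amb} {g g' : G} {κ κ' : Fin (T.rank i) → ℕ}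
    (hw : Wide T.block d (b + b' + T.cel i (g + g') (κ + κ')) 2)
    (hU : IsAtomIn T.block (b + T.cel i g κ)) (hV : IsAtomIn T.block (b' + T.cel i g' κ'))
    (hb : b.2 i = 0) (hb' : b'.2 i = 0) {j j' : Fin (T.rank i)} (hj : κ j = 1) (hj' : κ' j' = 1)
    (hlong : ∃ l ∈ lengthsIn T.block (b + b' + ({g, g'}, 0)), 2 < l)
    (hboth : ∀ w0 : T.Amb, w0.2 i = 0 → IsAtomIn T.block (w0 + ({g, g'}, 0)) →
      w0 + T.cel i (g + g') (κ + κ') ∈ T.block →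
      ∃ l ∈ lengthsIn T.block (w0 + T.cel i (g + g') (κ + κ')), 1 ≤ l ∧ l ≤ 2) :
    ∃ k, Wide T.block d (b + b' + ({g, g'}, 0)) k := by
  have hUi : T.Val i (g, κ) := by simpa [hb] using hU.1.1 i
  have hVi : T.Val i (g', κ') := by simpa [hb'] using hV.1.1 i
  have hUa := atom_whole (j₀ := j) (by rw [hj]; omega) hU hb
  have hVa := atom_whole (j₀ := j') (by rw [hj']; omega) hV hb'
  have hx' : b + b' + ({g, g'}, 0) = (b + ({g}, 0)) + (b' + ({g'}, 0)) := by
    rw [pair_eq_add]; abel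
  have hbb : (b + b').2 i = 0 := by simp [hb, hb']
  have h2 : 2 ∈ lengthsIn T.block (b + b' + ({g, g'}, 0)) := by
    rw [hx']
    exact add_mem_lengthsIn hUa.one_mem_lengthsIn hVa.one_mem_lengthsIn
  obtain ⟨k', -, hk', -⟩ := exists_wide hd hd1 (mem_of_mem_lengthsIn h2) ⟨2, h2, le_rfl⟩ hlong (by
    intro l' hl' hlt
    obtain ⟨l, hl, h3, h4⟩ := lift_two_whole hj hj' hUi hVi _ hbb hboth l' hl'
    have := hw.2.2 l hl (by omega)
    omega)
  exact ⟨k', hk'⟩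

/-- At most `κ j` atoms meet `i`. They are merged into one nonzero element, so at most `κ j - 1`
atoms are lost. -/
theorem exists_long_whole {i : ι} {w : T.Amb} {g : G} {κ : Fin (T.rank i) → ℕ} {s : Multiset G}
    (hs : s.sum = g) (hs0 : s ≠ 0) (hw : w.2 i = 0) {j : Fin (T.rank i)} {l : ℕ}
    (hl : l ∈ lengthsIn T.block (w + T.cel i g κ)) :
    ∃ l' ∈ lengthsIn T.block (w + (s, 0)), l + 1 ≤ l' + κ j := by
  obtain ⟨z, hz, hzs, rfl⟩ := hl
  obtain ⟨y, t, rfl, hy, ht⟩ := exists_parts_at z i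
  have hys : y.sum.2 i = (g, κ) := by
    have := congrArg (fun u : T.Amb => u.2 i) hzs
    simpa [ht, hw] using this
  obtain ⟨r, hr, hri⟩ := exists_whole' hys
  have h1 := card_le_of_forall_ne (i := i) (z := y)
    (fun u hu => ⟨(hz u (by simp [hu])).1, hy u hu⟩) j
  rw [hys] at h1
  have h2 : r + (s, 0) ∈ T.block := by
    refine replace_mem (s := 0) (g := g) (ν := κ) (i := i) ?_ (by simpa using hs) (Or.inl hri)
    rw [pair_zero_add, ← hr]; exact sum_mem_of_atoms fun u hu => hz u (by simp [hu])
  obtain ⟨l', hl', h3⟩ := exists_long_length eq_zero_of_deg (w := t)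
    (fun u hu => hz u (by simp [hu])) h2 (add_seq_ne_zero hs0)
  refine ⟨l', ?_, ?_⟩
  · convert hl' using 1
    rw [Multiset.sum_add, hr, add_right_comm] at hzs
    rw [← add_right_cancel hzs]; abel_nf
  · rw [Multiset.card_add]
    simp only at h1
    omega

end BlockData

/-! ### Elementary 2-groups -/

namespace BlockData

variable {G : Type*} [AddCommGroup G] {ι : Type*} {T : BlockData G ι} [Fintype ι] [DecidableEq ι]

theorem phi_two (h2 : ∀ g : G, g + g = 0) (i : ι) (ν : Fin (T.rank i) → ℕ) :
    T.phi i (ν + ν) = 0 := by rw [map_add, h2]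

namespace Crit

variable {d : ℕ} {U V : T.Amb}

theorem three_notMem {x : T.Amb} {k : ℕ} (hc : T.Crit d x k) (hd : 2 ≤ d) {l : ℕ} (hl : k < l)
    (hl2 : l ≤ k + 2) : l ∉ lengthsIn T.block x := fun h => by
  have := hc.wide.2.2 l h hl
  omega

/-- Let `ν` mark the entries 1 of `U`. The vector `2ν` has trivial class and can be moved from `V`
to `U`. If no marked entry of `V` equals 2, they are all at least 3, so `V` remains an atom while
`U` loses all its entries 1. -/
theorem exists_one_two (hc : T.Crit d (U + V) 2) (hd : 2 ≤ d) (h2 : ∀ g : G, g + g = 0)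
    (hU : IsAtomIn T.block U) (hV : IsAtomIn T.block V) {i : ι} (hi : U.2 i ≠ 0) :
    ∃ j, (U.2 i).2 j = 1 ∧ (V.2 i).2 j = 2 := by
  classical
  by_contra hne
  push Not at hne
  have h3 := hc.three_le hU hV hi
  have hpU := (hU.1.1 i).pos hi
  obtain ⟨j₀, hj₀⟩ := hc.exists_one_left hU hV hi
  set ν : Fin (T.rank i) → ℕ := fun j => if (U.2 i).2 j = 1 then 1 else 0 with hν
  have hφ := phi_two h2 i ν
  obtain ⟨V', hV'⟩ := exists_eq_add_cel (x := V) (i := i) 0 (k := ν + ν) (by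
    intro j
    have := h3 j
    simp only [hν, Pi.add_apply]
    split_ifs with h <;> omega)
  have hV'i : ∀ j, (V.2 i).2 j = (V'.2 i).2 j + (ν j + ν j) := by
    intro j
    have := congrArg (fun u : T.Amb => (u.2 i).2 j) hV'
    simpa using this
  have hV'a : IsAtomIn T.block V' := by
    refine atom_of_add_cel (hV' ▸ hV) (by rw [hφ]; exact zero_mem _) fun j => ?_
    have h4 := hV'i j
    have h5 := h3 j
    have h6 := hne j
    have h7 := (hV.1.1 i).pos (hc.right_ne_zero hU hV hi) j
    simp only [hν] at h4
    split_ifs at h4 with h <;> omega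
  obtain ⟨b, hUe, hb⟩ := exists_whole U i
  obtain ⟨hU'B, l, hl, hl1, hl2⟩ := exists_length_change_cel (κ := (U.2 i).2 + (ν + ν))
    (hUe ▸ hU) hb (fun j => by have := hpU j; simp only [Pi.add_apply]; omega) hpU
    (by rw [map_add, hφ]; simp)
  set U' := b + T.cel i (U.2 i).1 ((U.2 i).2 + (ν + ν)) with hU'
  have hU'e : U' = U + T.cel i 0 (ν + ν) := by
    rw [hU', ← add_zero (U.2 i).1, cel_add, ← add_assoc, ← hUe]
  have hx : U' + V' = U + V := by rw [hU'e, hV']; abel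
  have hl3 := hl2 j₀
  simp only [hν, Pi.add_apply, hj₀, if_true] at hl3
  have hlx : l + 1 ∈ lengthsIn T.block (U + V) :=
    hx ▸ add_mem_lengthsIn hl hV'a.one_mem_lengthsIn
  -- The enlarged `U` has a length at most 3, and one more is a length of `U + V`. Lengths 3 and 4
  -- lie in the gap because `d ≥ 2`, so the enlarged `U` is an atom, yet without the entry 1 that
  -- criticality demands.
  by_cases hl0 : l = 1
  · subst hl0
    have hU'a := isAtomIn_of_one_mem hl
    rw [← hx] at hc
    obtain ⟨j, hj⟩ := hc.exists_one_left hU'a hV'a (i := i) (by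
      intro h
      have := congrArg (fun u => u.2 j₀) h
      rw [hU'e] at this
      simp [hj₀] at this)
    rw [hU'e] at hj
    have := hpU j
    simp [hν] at hj
    split_ifs at hj with h <;> omega
  · exact hc.three_notMem hd (l := l + 1) (by omega) (by omega) hlx

/-- By `exists_one_two` the joint piece has entry 3 at some `j`, just above the bound 2 under which
it could be contracted. The entry is lowered by splitting off an all-twos piece or by exchanging `V`
for an atom with an equivalent vector, according to whether the all-ones vector has the class of a
unit. -/
theorem two_torsion (h2 : ∀ g : G, g + g = 0) {x : T.Amb} {k : ℕ} (hd : 2 ≤ d) :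
    ¬T.Crit d x k := by
  intro hc
  obtain ⟨U, V, hU, hV, -, hc⟩ := hc.exists_pair
  obtain ⟨i, hi⟩ := hc.exists_ne_zero hU hV
  have hiV := hc.right_ne_zero hU hV hi
  obtain ⟨j, hj, hj'⟩ := hc.exists_one_two hd h2 hU hV hi
  obtain ⟨jV, hjV⟩ := (hc.symm hU hV).exists_one_left hV hU hiV
  obtain ⟨jU, hjU⟩ := hc.exists_two_le_left hU hV hi
  have h3 := hc.three_le hU hV hi
  have hpU := (hU.1.1 i).pos hi
  have hpV := (hV.1.1 i).pos hiV
  obtain ⟨b, hUe, hb⟩ := exists_whole U i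
  obtain ⟨b', hVe, hb'⟩ := exists_whole V i
  generalize hg : (U.2 i).1 = g at *
  generalize hκ : (U.2 i).2 = κ at *
  generalize hg' : (V.2 i).1 = g' at *
  generalize hκ' : (V.2 i).2 = κ' at *
  have hx : U + V = b + b' + T.cel i (g + g') (κ + κ') := by rw [hUe, hVe, cel_add]; abel
  have hbb : (b + b').2 i = 0 := by simp [hb, hb']
  have hval : T.Val i (g + g', κ + κ') := by
    have := (mem_of_mem_lengthsIn hc.wide.1).1 i
    rwa [hx, Prod.snd_add, Pi.add_apply, hbb, cel_snd_self, zero_add] at this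
  -- the long length survives
  obtain ⟨l, hl, hlt⟩ := hc.wide.2.1
  have hl5 := hc.wide.2.2 l hl hlt
  have hlong : ∃ l ∈ lengthsIn T.block (b + b' + ({g, g'}, 0)), 2 < l := by
    rw [hx] at hl
    obtain ⟨l', hl', h4⟩ := exists_long_whole (s := {g, g'}) (by simp) (by simp) hbb (j := j) hl
    refine ⟨l', hl', ?_⟩
    simp only [Pi.add_apply] at h4
    omega
  by_cases hφ : T.phi i (fun _ => 1) ∈ T.unitCls i
  swap
  · refine hc.le_add hU hV hUe hVe hb hb' hlong (fun w0 hw0 hWa hWB => ?_) hi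
    have hcls := hval.cls_mem
    simp only at hcls
    have hpos : ∀ j, 0 < (κ + κ' - ((fun _ => 1) + fun _ => 1) : Fin (T.rank i) → ℕ) j := by
      intro j
      have := h3 j
      simp only [Pi.sub_apply, Pi.add_apply]; omega
    have hadd : κ + κ' = κ + κ' - ((fun _ => 1) + fun _ => 1) + ((fun _ => 1) + fun _ => 1) := by
      funext j
      have := h3 j
      simp only [Pi.sub_apply, Pi.add_apply]; omega
    obtain ⟨h4, l, hl, hl1, hl2⟩ := exists_length_change_seq hWa hw0 (h := g + g') (by simp)
      (by simp) hpos (by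
        rw [hadd, map_add, phi_two h2, add_zero] at hcls
        exact hcls)
    have hl3 := hl2 j
    simp only [Pi.sub_apply, Pi.add_apply, hj, hj'] at hl3
    -- The all-twos piece could only split into two all-ones pieces of class 0, which are not
    -- admissible here. After it is removed the entry at `j` is 1, so the remainder has length 1 and
    -- two atoms suffice.
    have hR : IsAtomIn T.block (T.cel i 0 ((fun _ => 1) + fun _ => 1)) := by
      have hB : T.cel i 0 ((fun _ => 1) + fun _ => 1) ∈ T.block := by
        have := seq_add_cel_mem (T := T) (s := 0) (i := i) (g := 0) (κ := (fun _ => 1) + fun _ => 1)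
          (Or.inr ⟨fun j => by simp, by rw [phi_two h2]; simp⟩) (by simp)
        rwa [pair_zero_add] at this
      have hne : ∀ v : T.Amb, ∀ w : T.Amb, v ∈ T.block → w ∈ T.block →
          v + w = T.cel i 0 ((fun _ => 1) + fun _ => 1) → v.2 i = 0 → v = 0 := by
        intro v w hv hw hvw hvi
        refine Prod.ext ?_ (funext fun i' => ?_)
        · have := congrArg (fun u : T.Amb => Multiset.card u.1) hvw
          simp at this
          exact this.1
        · by_cases h : i' = i
          · subst h; exact hvi
          · refine snd_eq_zero_of_mem (z := {v, w}) (by simp [hv, hw]) ?_ (by simp)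
            rw [Multiset.sum_pair, hvw, cel_snd_ne h]
      refine ⟨hB, ?_, fun v hv w hw hvw => ?_⟩
      · have := cel_ne_zero (T := T) (i := i) (r := 0) (g := 0) (ν := (fun _ => 1) + fun _ => 1)
          (j := j) (by simp)
        rwa [zero_add] at this
      by_cases hvi : v.2 i = 0
      · exact Or.inl (hne v w hv hw hvw hvi)
      by_cases hwi : w.2 i = 0
      · exact Or.inr (hne w v hw hv (by rw [add_comm, hvw]) hwi)
      exfalso
      apply hφ
      have hv1 : (v.2 i).2 = fun _ => 1 := by
        funext j
        have h5 := (hv.1 i).pos hvi j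
        have h6 := (hw.1 i).pos hwi j
        have := congrArg (fun u : T.Amb => (u.2 i).2 j) hvw
        simp at this
        omega
      have hv0 : (v.2 i).1 = 0 := by
        have h5 := hv.2
        rw [tot_apply, Finset.sum_eq_single i] at h5
        · have h7 : v.1 = 0 := by
            have := congrArg (fun u : T.Amb => Multiset.card u.1) hvw
            simp at this
            exact this.1
          simpa [h7] using h5
        · intro i' _ h
          rw [snd_eq_zero_of_mem (z := {v, w}) (i := i') (u := v) (by simp [hv, hw])
            (by rw [Multiset.sum_pair, hvw, cel_snd_ne h]) (by simp)]
          rfl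
        · simp
      have := (hv.1 i).cls_mem
      rw [hv0, hv1, zero_sub] at this
      exact neg_mem_iff.1 this
    have hl1' : l = 1 := by omega
    subst hl1'
    refine ⟨2, ?_, by omega, le_rfl⟩
    have := add_mem_lengthsIn hl hR.one_mem_lengthsIn
    rwa [add_assoc, ← cel_add, add_zero, ← hadd] at this
  · set o : Fin (T.rank i) → ℕ := fun _ => 1 with ho
    set e : Fin (T.rank i) → ℕ := Pi.single j 1 with he
    have hej : e j = 1 := by simp [he]
    have hej' : ∀ m, m ≠ j → e m = 0 := fun m h => by simp [he, h]
    -- This is `κ'` plus the all-ones vector minus twice the unit vector at `j`, hence equivalent to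
    -- `κ'`. The joint entry at `j` becomes 2, and all other joint entries are at least 4.
    set κs : Fin (T.rank i) → ℕ := fun m => if m = j then 1 else κ' m + 1 with hκs
    have hκsj : κs j = 1 := by simp [hκs]
    have hsum : κs + (e + e) = κ' + o := by
      funext m
      by_cases h : m = j
      · subst h; simp [hκs, ho, hej, hj']
      · simp [hκs, h, ho, hej' m h]
    have hposs : ∀ m, 0 < κs m := fun m => by simp only [hκs]; split_ifs <;> omega
    have hφs : T.phi i κs = T.phi i κ' + T.phi i o := by
      rw [← map_add, ← hsum, map_add, phi_two h2, add_zero]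
    obtain ⟨-, l1, hl1, hl11, hl12⟩ := exists_length_change_cel (κ := κs) (hVe ▸ hV) hb' hposs hpV
      (by rw [hφs]; simpa using hφ)
    have hVs : IsAtomIn T.block (b' + T.cel i g' κs) := by
      have := hl12 j
      have : l1 = 1 := by omega
      exact isAtomIn_of_one_mem (this ▸ hl1)
    set xs := b + b' + T.cel i (g + g') (κ + κs) with hxs
    have hxO : U + V + T.cel i 0 o = xs + T.cel i 0 (e + e) := by
      rw [hx, hxs, add_assoc, add_assoc _ _ (T.cel i 0 (e + e)), ← cel_add, ← cel_add, add_assoc κ,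
        add_assoc κ, hsum]
    have h2s : 2 ∈ lengthsIn T.block xs := by
      have := add_mem_lengthsIn (hUe ▸ hU).one_mem_lengthsIn hVs.one_mem_lengthsIn
      convert this using 1
      rw [hxs, cel_add]; abel_nf
    have hKj : (κ + κs) j = 2 := by simp [hj, hκsj]
    have hK3 : ∀ m, m ≠ j → 4 ≤ (κ + κs) m := by
      intro m hm
      have := h3 m
      simp only [Pi.add_apply, hκs, if_neg hm]
      omega
    have hls : ∃ l ∈ lengthsIn T.block xs, 2 < l := by
      obtain ⟨z, hz, hzs, hzc⟩ := hl
      obtain ⟨y, t, rfl, hy, ht⟩ := exists_parts_at z i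
      rw [hx] at hzs
      have hys : y.sum.2 i = (g + g', κ + κ') := by
        have := congrArg (fun u : T.Amb => u.2 i) hzs
        simpa [ht, hb, hb'] using this
      obtain ⟨r, hr, hri⟩ := exists_whole' hys
      have h4 := card_le_of_forall_ne (i := i) (z := y)
        (fun u hu => ⟨(hz u (by simp [hu])).1, hy u hu⟩) j
      rw [hys] at h4
      have h5 : r + T.cel i (g + g') (κ + κs) ∈ T.block := by
        have hyB : r + T.cel i (g + g') (κ + κ') ∈ T.block := by
          rw [← hr]; exact sum_mem_of_atoms fun u hu => hz u (by simp [hu])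
        refine mem_of_eq_off i hyB (fun i' hi => by simp [cel_snd_ne hi]) ?_ (Or.inr ⟨?_, ?_⟩)
        · have := hyB.2
          rw [map_add, tot_cel] at this
          rw [map_add, tot_cel, this]
        · intro m
          have := hposs m
          simp [hri]; omega
        · have := (T.unitCls i).sub_mem hval.cls_mem hφ
          simp only [Prod.snd_add, Pi.add_apply, hri, cel_snd_self, zero_add, map_add] at this ⊢
          rw [hφs]
          convert this using 1; abel
      obtain ⟨l', hl', h6⟩ := exists_long_length eq_zero_of_deg (w := t)
        (fun u hu => hz u (by simp [hu])) h5 (cel_ne_zero (j := j) (by rw [hKj]; omega))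
      refine ⟨l', ?_, ?_⟩
      · convert hl' using 1
        rw [Multiset.sum_add, hr, add_right_comm] at hzs
        rw [hxs, ← add_right_cancel hzs]; abel_nf
      · rw [Multiset.card_add] at hzc
        simp only [Pi.add_apply, hj, hj'] at h4
        omega
    -- A factorization of `xs` is turned into one of `U + V` with at most one additional atom. At
    -- most two of its atoms meet `i`; a single one is impossible, since the all-ones piece would
    -- split off.
    have hgap : ∀ l' ∈ lengthsIn T.block xs, 2 < l' → 2 + d ≤ l' := by
      rintro l' ⟨z, hz, hzs, rfl⟩ hlt'
      obtain ⟨y, t, rfl, hy, ht⟩ := exists_parts_at z i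
      have hys : y.sum.2 i = (g + g', κ + κs) := by
        have := congrArg (fun u : T.Amb => u.2 i) hzs
        simpa [ht, hb, hb', hxs] using this
      have h4 := card_le_of_forall_ne (i := i) (z := y)
        (fun u hu => ⟨(hz u (by simp [hu])).1, hy u hu⟩) j
      rw [hys] at h4
      replace h4 : Multiset.card y ≤ 2 := h4.trans hKj.le
      rcases (show Multiset.card y = 0 ∨ Multiset.card y = 1 ∨ Multiset.card y = 2 by omega) with
        h5 | h5 | h5
      · rw [Multiset.card_eq_zero] at h5
        rw [h5] at hys
        have := congrArg (fun t : G × (Fin (T.rank i) → ℕ) => t.2 j) hys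
        simp [hj] at this; omega
      · obtain ⟨X, rfl⟩ := Multiset.card_eq_one.1 h5
        rw [Multiset.sum_singleton] at hys
        have hX := hz X (by simp)
        have hK2 : ∀ m, 2 ≤ (κ + κs) m := fun m => by
          by_cases h : m = j
          · rw [h, hKj]
          · have := hK3 m h; omega
        obtain ⟨a, ha⟩ := exists_eq_add_cel (x := X) (i := i) 0 (k := o) fun m => by
          rw [hys]; exact le_trans (by simp [ho]) (hK2 m)
        have hOB : T.cel i 0 o ∈ T.block := by
          have := seq_add_cel_mem (T := T) (s := 0) (i := i) (g := 0) (κ := o)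
            (Or.inr ⟨fun j => by simp [ho], by rw [zero_sub]; exact neg_mem hφ⟩) (by simp)
          rwa [pair_zero_add] at this
        have hapos : ∀ m, 0 < (a.2 i).2 m := by
          intro m
          have h6 := congrArg (fun u : T.Amb => (u.2 i).2 m) ha
          rw [hys] at h6
          have := hK2 m
          simp [ho] at h6 this
          omega
        have haB := replace_mem (s := 0) (s' := 0) (g := 0) (ν := o) (i := i) (r := a)
          (by rw [pair_zero_add, ← ha]; exact hX.1) (by simp)
          (Or.inr ⟨hapos, by rw [zero_sub]; exact neg_mem hφ⟩)
        rw [add_pair_zero] at haB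
        rcases hX.2.2 a haB _ hOB ha.symm with h | h
        · have := hapos j
          rw [h] at this
          simp at this
        · have := cel_ne_zero (T := T) (i := i) (r := 0) (g := 0) (ν := o) (j := j) (by simp [ho])
          rw [zero_add] at this
          exact absurd h this
      · obtain ⟨X, Y, rfl⟩ := Multiset.card_eq_two.1 h5
        rw [Multiset.sum_pair] at hys
        have hX := hz X (by simp)
        have hY := hz Y (by simp)
        have pX := (hX.1.1 i).pos (hy X (by simp))
        have pY := (hY.1.1 i).pos (hy Y (by simp))
        obtain ⟨bY, hYe, hbY⟩ := exists_whole Y i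
        generalize hhY : (Y.2 i).1 = hY1 at *
        generalize hlY : (Y.2 i).2 = lY at *
        have hXY : ∀ m, (X.2 i).2 m + lY m = (κ + κs) m := by
          intro m
          have := congrArg (fun t : G × (Fin (T.rank i) → ℕ) => t.2 m) hys
          simpa [hlY] using this
        have hlYj : lY j = 1 := by
          have h6 := hXY j
          have := pX j
          have := pY j
          omega
        -- Entries 1 of `Y` away from `j` are first raised by 2 at the expense of `X`, whose entries
        -- there are at least 3. Then the all-ones vector can be subtracted from `Y` in exchange for
        -- 2 at `j`.
        set ν : Fin (T.rank i) → ℕ := fun m => if m ≠ j ∧ lY m = 1 then 1 else 0 with hν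
        have hφν := phi_two h2 i ν
        obtain ⟨X1, hX1⟩ := exists_eq_add_cel (x := X) (i := i) 0 (k := ν + ν) (by
          intro m
          simp only [hν, Pi.add_apply]
          split_ifs with h
          · have := hXY m
            have := hK3 m h.1
            omega
          · omega)
        have hX1a : IsAtomIn T.block X1 := by
          refine atom_of_add_cel (hX1 ▸ hX) (by rw [hφν]; exact zero_mem _) fun m => ?_
          have h6 := congrArg (fun u : T.Amb => (u.2 i).2 m) hX1
          simp [hν] at h6
          split_ifs at h6 with h
          · have := hXY m
            have := hK3 m h.1
            omega
          · have := pX m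
            omega
        set μ : Fin (T.rank i) → ℕ := fun m => if m = j then 2 else lY m + (ν m + ν m) - 1 with hμ
        have hμpos : ∀ m, 0 < μ m := by
          intro m
          have := pY m
          simp only [hμ, hν]
          split_ifs <;> omega
        have hμs : μ + o = lY + ((ν + ν) + (e + e)) := by
          funext m
          by_cases h : m = j
          · subst h; simp [hμ, ho, hej, hlYj, hν]
          · have := pY m
            simp [hμ, ho, h, hej' m h]
            omega
        have hφμ : T.phi i μ - T.phi i lY = - T.phi i o := by
          have := congrArg (T.phi i) hμs
          rw [map_add, map_add, map_add, hφν, phi_two h2, add_zero, add_zero] at this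
          rw [← this]; abel
        obtain ⟨-, l2, hl2, hl21, hl22⟩ := exists_length_change_cel (κ := μ) (hYe ▸ hY) hbY hμpos
          pY (by rw [hφμ]; exact neg_mem hφ)
        have hl23 := hl22 j
        have hμj : μ j = 2 := by simp [hμ]
        rw [hμj] at hl23
        have hYO : bY + T.cel i hY1 μ + T.cel i 0 o = Y + (T.cel i 0 (ν + ν) + T.cel i 0 (e + e)) := by
          rw [add_assoc, ← cel_add, hμs, cel_add, ← add_assoc, ← hYe]
          conv_lhs => rw [← add_zero (0 : G)]
          rw [cel_add]
        have htot : U + V = X1 + (bY + T.cel i hY1 μ) + t.sum := by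
          apply add_right_cancel (b := T.cel i 0 o)
          rw [hxO, ← hzs, Multiset.sum_add, Multiset.sum_pair, hX1]
          calc _ = X1 + t.sum + (Y + (T.cel i 0 (ν + ν) + T.cel i 0 (e + e))) := by abel
            _ = _ := by rw [← hYO]; abel
        have hlx : 1 + l2 + Multiset.card t ∈ lengthsIn T.block (U + V) := by
          rw [htot]
          exact add_mem_lengthsIn (add_mem_lengthsIn hX1a.one_mem_lengthsIn hl2)
            (card_mem_lengthsIn fun u hu => hz u (by simp [hu]))
        rw [Multiset.card_add, h5] at hlt' ⊢
        have := hc.wide.2.2 _ hlx (by omega)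
        omega
    have hwide : Wide T.block d xs 2 := by
      obtain ⟨k', hk', hw, hmax⟩ := exists_wide hc.not_mem hc.one_le (mem_of_mem_lengthsIn h2s)
        ⟨2, h2s, le_rfl⟩ hls hgap
      have := hmax 2 h2s le_rfl
      have : k' = 2 := by omega
      exact this ▸ hw
    have hcol : ∀ w0 : T.Amb, w0.2 i = 0 →
        Collapses T.block (T.cel i (g + g') (κ + κs)) ({g, g'}, 0) w0 := fun w0 hw0 =>
      collapses_whole (j₀ := j) (by omega) (by omega) (by simp) (by simp) hw0
    obtain ⟨k, hk⟩ := exists_wide_two_whole hc.not_mem hc.one_le hwide (hUe ▸ hU) hVs hb hb' hj hκsj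
      ((hcol _ hbb).exists_long eq_zero_of_deg hc.one_le hwide rfl) (fun w0 hw0 hWa hWB => by
        have := (hcol w0 hw0).lift (z := {w0 + ({g, g'}, 0)}) (b := w0) eq_zero_of_deg
          (by simpa using hWa) (by simp) (by simp) hWB (cel_ne_zero (j := j) (by omega))
        simpa using this)
    -- The auxiliary element `xs` need not have smaller degree than `U + V`, but its contraction to
    -- two group elements has.
    refine hc.min _ (mem_of_mem_lengthsIn hk.1) ?_ k hk
    rw [hx, map_add, map_add T.deg (b + b'), deg_seq, deg_cel]
    have := Finset.single_le_sum (f := κ + κ') (fun _ _ => Nat.zero_le _) (Finset.mem_univ j)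
    simp only [Pi.add_apply] at this
    simp only [Pi.add_apply, Multiset.card_pair]
    omega

end Crit

end BlockData

/-! ### Reduction to a single index -/

section Transport

variable {M M' : Type*} [AddCommMonoid M] [AddCommMonoid M'] {B : AddSubmonoid M}
  {B' : AddSubmonoid M'} {f : M' →+ M}

/-- Lengths along an embedding with divisor-closed image. -/
theorem isAtomIn_map_iff (hinj : Function.Injective f) (hmem : ∀ a, f a ∈ B ↔ a ∈ B')
    (hdiv : ∀ a, ∀ v ∈ B, ∀ w ∈ B, v + w = f a → ∃ v', f v' = v) (u : M') :
    IsAtomIn B (f u) ↔ IsAtomIn B' u := by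
  constructor
  · rintro ⟨h1, h2, h3⟩
    refine ⟨(hmem u).1 h1, fun h => h2 (by rw [h, map_zero]), fun v hv w hw hvw => ?_⟩
    refine (h3 _ ((hmem v).2 hv) _ ((hmem w).2 hw) (by rw [← map_add, hvw])).imp ?_ ?_ <;>
    · intro h; exact hinj (by rw [h, map_zero])
  · rintro ⟨h1, h2, h3⟩
    refine ⟨(hmem u).2 h1, fun h => h2 (hinj (by rw [h, map_zero])), fun v hv w hw hvw => ?_⟩
    obtain ⟨v', rfl⟩ := hdiv u v hv w hw hvw
    obtain ⟨w', rfl⟩ := hdiv u w hw _ hv (by rw [add_comm, hvw])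
    rw [← map_add] at hvw
    refine (h3 v' ((hmem _).1 hv) w' ((hmem _).1 hw) (hinj hvw)).imp ?_ ?_ <;>
    · rintro rfl; exact map_zero f

theorem lengthsIn_map (hinj : Function.Injective f) (hmem : ∀ a, f a ∈ B ↔ a ∈ B')
    (hdiv : ∀ a, ∀ v ∈ B, ∀ w ∈ B, v + w = f a → ∃ v', f v' = v) (a : M') :
    lengthsIn B (f a) = lengthsIn B' a := by
  ext k
  constructor
  · rintro ⟨z, hz, hs, rfl⟩
    have hex : ∀ (z : Multiset M) (a : M'), (∀ u ∈ z, IsAtomIn B u) → z.sum = f a →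
        ∃ z' : Multiset M', z'.map f = z := by
      intro z
      induction z using Multiset.induction_on with
      | empty => exact fun _ _ _ => ⟨0, rfl⟩
      | cons u z ih =>
        intro a hz hs
        rw [Multiset.sum_cons] at hs
        have hzB := sum_mem_of_atoms fun v hv => hz v (Multiset.mem_cons_of_mem hv)
        obtain ⟨u', rfl⟩ := hdiv a u (hz u (by simp)).1 _ hzB hs
        obtain ⟨w', hw'⟩ := hdiv a _ hzB _ (hz (f u') (by simp)).1 (by rw [add_comm, hs])
        obtain ⟨z', rfl⟩ := ih w' (fun v hv => hz v (Multiset.mem_cons_of_mem hv)) hw'.symm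
        exact ⟨u' ::ₘ z', by simp⟩
    obtain ⟨z', rfl⟩ := hex z a hz hs
    refine ⟨z', fun u hu => (isAtomIn_map_iff hinj hmem hdiv u).1
      (hz _ (Multiset.mem_map_of_mem f hu)), hinj ?_, by simp⟩
    rw [← hs, map_multiset_sum]
  · rintro ⟨z, hz, rfl, rfl⟩
    refine ⟨z.map f, fun u hu => ?_, by rw [map_multiset_sum], by simp⟩
    obtain ⟨u', hu', rfl⟩ := Multiset.mem_map.1 hu
    exact (isAtomIn_map_iff hinj hmem hdiv u').2 (hz u' hu')

end Transport

namespace BlockData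

variable {G : Type*} [AddCommGroup G] {ι : Type*} (T : BlockData G ι) (i : ι)

/-- Sequences over the class group together with an exponent vector for the index `i`. -/
abbrev Comp : Type _ := Multiset G × (Fin (T.rank i) → ℕ)

/-- The block monoid of a single index. -/
def comp : AddSubmonoid (T.Comp i) where
  carrier := {a | (a.2 = 0 ∧ a.1.sum = 0) ∨ ((∀ j, 0 < a.2 j) ∧ a.1.sum + T.phi i a.2 ∈ T.unitCls i)}
  zero_mem' := Or.inl ⟨rfl, by simp⟩
  add_mem' := by
    rintro ⟨s, a⟩ ⟨t, b⟩ (⟨h1, h2⟩ | ⟨h1, h2⟩) (⟨h3, h4⟩ | ⟨h3, h4⟩)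
    all_goals simp only at h1 h2 h3 h4
    · left; simp [h1, h2, h3, h4]
    · right; subst h1; simpa [h2] using ⟨h3, h4⟩
    · right; subst h3; simpa [h4] using ⟨h1, h2⟩
    · right
      refine ⟨fun j => by have := h1 j; simp; omega, ?_⟩
      have := add_mem h2 h4
      simp only [Prod.fst_add, Prod.snd_add, Multiset.sum_add, map_add, Prod.mk_add_mk] at this ⊢
      convert this using 1; abel

/-- The degree of an element of the single index monoid. -/
def degC : T.Comp i →+ ℕ where
  toFun a := Multiset.card a.1 + 2 * ∑ j, a.2 j
  map_zero' := by simp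
  map_add' a b := by simp [Finset.sum_add_distrib]; ring

variable {T i}

theorem mem_comp {a : T.Comp i} : a ∈ T.comp i ↔ (a.2 = 0 ∧ a.1.sum = 0) ∨
    ((∀ j, 0 < a.2 j) ∧ a.1.sum + T.phi i a.2 ∈ T.unitCls i) := Iff.rfl

theorem degC_apply (a : T.Comp i) : T.degC i a = Multiset.card a.1 + 2 * ∑ j, a.2 j := rfl

theorem eq_zero_of_degC (a : T.Comp i) (_ : a ∈ T.comp i) (h : T.degC i a = 0) : a = 0 := by
  rw [degC_apply] at h
  refine Prod.ext (Multiset.card_eq_zero.1 (by omega)) (funext fun j => ?_)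
  exact (Finset.sum_eq_zero_iff.1 (show ∑ j, a.2 j = 0 by omega)) j (Finset.mem_univ j)

theorem comp_pos {a : T.Comp i} (ha : a ∈ T.comp i) (h : a.2 ≠ 0) (j : Fin (T.rank i)) :
    0 < a.2 j := (ha.resolve_left fun h' => h h'.1).1 j

theorem comp_cls {a : T.Comp i} (ha : a ∈ T.comp i) : a.1.sum + T.phi i a.2 ∈ T.unitCls i := by
  rcases ha with ⟨h1, h2⟩ | ⟨-, h⟩
  · rw [h1, h2]; simp
  · exact h

variable [Fintype ι] [DecidableEq ι]

variable (T i) in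
/-- The embedding of a single index monoid. -/
def embed : T.Comp i →+ T.Amb where
  -- Total class zero forces the class at `i`, so a component needs only the sequence and the
  -- exponents.
  toFun a := (a.1, 0) + T.cel i (-a.1.sum) a.2
  map_zero' := by
    simp [zero_pair]
    refine Prod.ext rfl (funext fun i' => ?_)
    by_cases h : i' = i
    · subst h; simp
    · simp [cel_snd_ne h]
  map_add' a b := by
    have : ∀ s t : Multiset G, ((s + t, 0) : T.Amb) = (s, 0) + (t, 0) := fun s t =>
      Prod.ext rfl (add_zero _).symm
    rw [Prod.fst_add, Prod.snd_add, this, Multiset.sum_add, neg_add, cel_add]; abel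

theorem embed_apply (a : T.Comp i) : T.embed i a = (a.1, 0) + T.cel i (-a.1.sum) a.2 := rfl

theorem embed_fst (a : T.Comp i) : (T.embed i a).1 = a.1 := by simp [embed_apply]

theorem embed_snd_self (a : T.Comp i) : (T.embed i a).2 i = (-a.1.sum, a.2) := by
  simp [embed_apply]

theorem embed_snd_ne (a : T.Comp i) {i' : ι} (h : i' ≠ i) : (T.embed i a).2 i' = 0 := by
  simp [embed_apply, cel_snd_ne h]

theorem embed_injective : Function.Injective (T.embed i) := by
  intro a b h
  refine Prod.ext ?_ ?_
  · rw [← embed_fst, h, embed_fst]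
  · have := congrArg (fun u : T.Amb => (u.2 i).2) h
    simpa only [embed_snd_self] using this

theorem tot_embed (a : T.Comp i) : T.tot (T.embed i a) = 0 := by
  rw [embed_apply, map_add, tot_seq, tot_cel, add_neg_cancel]

theorem embed_mem (a : T.Comp i) : T.embed i a ∈ T.block ↔ a ∈ T.comp i := by
  rw [mem_block, mem_comp]
  constructor
  · rintro ⟨h, -⟩
    have := h i
    rw [embed_snd_self] at this
    rcases this with h | ⟨h1, h2⟩
    · rw [Prod.ext_iff] at h
      exact Or.inl ⟨h.2, neg_eq_zero.1 h.1⟩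
    · refine Or.inr ⟨h1, ?_⟩
      have := neg_mem h2
      simp only at this
      convert this using 1; abel
  · intro h
    refine ⟨fun i' => ?_, tot_embed a⟩
    by_cases hi : i' = i
    · subst hi
      rw [embed_snd_self]
      rcases h with ⟨h1, h2⟩ | ⟨h1, h2⟩
      · left; rw [h1, h2]; simp
      · right
        refine ⟨h1, ?_⟩
        have := neg_mem h2
        simp only
        convert this using 1; abel
    · rw [embed_snd_ne a hi]; exact Or.inl rfl

theorem exists_embed {v : T.Amb} (hv : v ∈ T.block) (h : ∀ i', i' ≠ i → v.2 i' = 0) :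
    ∃ a, T.embed i a = v := by
  refine ⟨(v.1, (v.2 i).2), Prod.ext (embed_fst _) (funext fun i' => ?_)⟩
  by_cases hi : i' = i
  · subst hi
    rw [embed_snd_self]
    refine Prod.ext ?_ rfl
    have := hv.2
    rw [tot_apply, Finset.sum_eq_single i'] at this
    · simp only; rw [neg_eq_iff_add_eq_zero, this]
    · intro i'' _ hi; rw [h i'' hi]; rfl
    · simp
  · rw [embed_snd_ne _ hi, h i' hi]

theorem embed_div (a : T.Comp i) : ∀ v ∈ T.block, ∀ w ∈ T.block, v + w = T.embed i a →
    ∃ v', T.embed i v' = v := by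
  intro v hv w hw hvw
  refine exists_embed hv fun i' hi => ?_
  refine snd_eq_zero_of_mem (z := {v, w}) (by simp [hv, hw]) ?_ (by simp)
  rw [Multiset.sum_pair, hvw, embed_snd_ne a hi]

theorem lengthsIn_embed (a : T.Comp i) : lengthsIn T.block (T.embed i a) = lengthsIn (T.comp i) a :=
  lengthsIn_map embed_injective embed_mem embed_div a

theorem isAtomIn_embed (a : T.Comp i) : IsAtomIn T.block (T.embed i a) ↔ IsAtomIn (T.comp i) a :=
  isAtomIn_map_iff embed_injective embed_mem embed_div a

theorem deg_embed (a : T.Comp i) : T.deg (T.embed i a) = T.degC i a := by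
  rw [embed_apply, map_add, deg_seq, deg_cel, degC_apply]

/-- A critical element of length two in a single index monoid. -/
structure CritPair (d : ℕ) (U V : T.Comp i) : Prop where
  not_mem : d ∉ distancesIn (T.comp i)
  two_le : 2 ≤ d
  wide : Wide (T.comp i) d (U + V) 2
  min : ∀ y ∈ T.comp i, T.degC i y < T.degC i (U + V) → ∀ k', ¬Wide (T.comp i) d y k'
  left : IsAtomIn (T.comp i) U
  right : IsAtomIn (T.comp i) V
  card_left : Multiset.card U.1 ≤ 1
  card_right : Multiset.card V.1 ≤ 1
  zero_left : (0 : G) ∉ U.1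
  zero_right : (0 : G) ∉ V.1
  pos_left : ∀ j, 0 < U.2 j
  pos_right : ∀ j, 0 < V.2 j
  three_le : ∀ j, 3 ≤ U.2 j + V.2 j
  exists_one : ∃ j, U.2 j = 1
  exists_two : ∃ j, 2 ≤ U.2 j
  exists_one' : ∃ j, V.2 j = 1
  exists_two' : ∃ j, 2 ≤ V.2 j
  cls_notMem : ∀ j, T.cls i j ∉ T.unitCls i

/-- An index met by `U` shows both an entry 1 and an entry at least 2, so its rank is at least 2.
With only one such index, `U` and `V` live there alone. -/
theorem Crit.exists_critPair {d k : ℕ} {x : T.Amb} (hc : T.Crit d x k) (hd : 2 ≤ d)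
    (hrank : ∀ i i', 2 ≤ T.rank i → 2 ≤ T.rank i' → i = i') :
    ∃ i, ∃ U V : T.Comp i, CritPair d U V := by
  obtain ⟨U, V, hU, hV, -, hc⟩ := hc.exists_pair
  have hr : ∀ i, U.2 i ≠ 0 → 2 ≤ T.rank i := by
    intro i hi
    obtain ⟨j, hj⟩ := hc.exists_one_left hU hV hi
    obtain ⟨j', hj'⟩ := hc.exists_two_le_left hU hV hi
    by_contra h
    have hjj : j = j' := Fin.ext (by have := j.2; have := j'.2; omega)
    subst hjj
    omega
  obtain ⟨i, hi⟩ := hc.exists_ne_zero hU hV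
  have hi' := hc.right_ne_zero hU hV hi
  have hU0 : ∀ i', i' ≠ i → U.2 i' = 0 := fun i' h => by
    by_contra h0
    exact h (hrank _ _ (hr i' h0) (hr i hi))
  have hV0 : ∀ i', i' ≠ i → V.2 i' = 0 := fun i' h => by
    by_contra h0
    exact (hc.symm hU hV).right_ne_zero hV hU h0 (hU0 i' h)
  obtain ⟨u, rfl⟩ := exists_embed hU.1 hU0
  obtain ⟨v, rfl⟩ := exists_embed hV.1 hV0
  have e1 := embed_snd_self u
  have e2 := embed_snd_self v
  have h0 := hc.zero_notMem
  rw [Prod.fst_add, embed_fst, embed_fst, Multiset.mem_add, not_or] at h0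
  have hW : ∀ (a : T.Comp i) (k : ℕ), Wide T.block d (T.embed i a) k ↔ Wide (T.comp i) d a k := by
    intro a k
    simp only [Wide, lengthsIn_embed]
  refine ⟨i, u, v, ?_, hd, ?_, ?_, (isAtomIn_embed u).1 hU, (isAtomIn_embed v).1 hV, ?_, ?_, h0.1,
    h0.2, ?_, ?_, ?_, ?_, ?_, ?_, ?_, hc.cls_notMem hU hV hi⟩
  · intro h
    apply hc.not_mem
    simp only [distancesIn, Set.mem_iUnion] at h ⊢
    obtain ⟨a, ha, h⟩ := h
    exact ⟨T.embed i a, (embed_mem a).2 ha, by rwa [lengthsIn_embed]⟩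
  · rw [← hW, map_add]; exact hc.wide
  · intro y hy hlt k' hk'
    refine hc.min (T.embed i y) ((embed_mem y).2 hy) ?_ k' ((hW y k').2 hk')
    rwa [← map_add, deg_embed, deg_embed]
  · simpa [embed_fst] using hc.card_fst_le hU hV
  · simpa [embed_fst] using (hc.symm hU hV).card_fst_le hV hU
  · simpa [e1] using (hU.1.1 i).pos hi
  · simpa [e2] using (hV.1.1 i).pos hi'
  · simpa [e1, e2] using hc.three_le hU hV hi
  · simpa [e1] using hc.exists_one_left hU hV hi
  · simpa [e1] using hc.exists_two_le_left hU hV hi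
  · simpa [e2] using (hc.symm hU hV).exists_one_left hV hU hi'
  · simpa [e2] using (hc.symm hU hV).exists_two_le_left hV hU hi'

theorem CritPair.symm {d : ℕ} {U V : T.Comp i} (h : CritPair d U V) : CritPair d V U where
  not_mem := h.not_mem
  two_le := h.two_le
  wide := by rw [add_comm]; exact h.wide
  min := by rw [add_comm]; exact h.min
  left := h.right
  right := h.left
  card_left := h.card_right
  card_right := h.card_left
  zero_left := h.zero_right
  zero_right := h.zero_left
  pos_left := h.pos_right
  pos_right := h.pos_left
  three_le := fun j => by rw [add_comm]; exact h.three_le j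
  exists_one := h.exists_one'
  exists_two := h.exists_two'
  exists_one' := h.exists_one
  exists_two' := h.exists_two
  cls_notMem := h.cls_notMem

end BlockData

/-! ### Swapping a prime for group elements at a single index -/

namespace BlockData

variable {G : Type*} [AddCommGroup G] {ι : Type*} {T : BlockData G ι} {i : ι} [Fintype ι]
  [DecidableEq ι]

/-- The exponent vector of a single prime. -/
abbrev unitVec (T : BlockData G ι) (i : ι) (j : Fin (T.rank i)) : Fin (T.rank i) → ℕ := Pi.single j 1

theorem phi_unitVec (j : Fin (T.rank i)) : T.phi i (unitVec T i j) = T.cls i j := by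
  rw [phi_single, one_smul]

theorem unitVec_le {j m : Fin (T.rank i)} : unitVec T i j m ≤ 1 := by
  by_cases h : m = j
  · subst h; simp [unitVec]
  · simp [unitVec, h]

theorem unitVec_ne {j m : Fin (T.rank i)} (h : m ≠ j) : unitVec T i j m = 0 := by
  simp [unitVec, h]

theorem unitVec_self {j : Fin (T.rank i)} : unitVec T i j j = 1 := by simp [unitVec]

/-- Swapping `(P, e_j)` for `(P', 0)`. -/
theorem comp_swap {P P' : Multiset G} {j : Fin (T.rank i)}
    (hsw : P'.sum - P.sum - T.cls i j ∈ T.unitCls i) {r : T.Comp i} (hr : ∀ m, 0 < r.2 m) :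
    r + (P, unitVec T i j) ∈ T.comp i ↔ r + (P', 0) ∈ T.comp i := by
  have hne : ∀ q : Fin (T.rank i) → ℕ, r.2 + q ≠ 0 := fun q h => by
    have := congrFun h j
    have h1 := hr j
    simp at this; omega
  have hne' : r.2 ≠ 0 := by simpa using hne 0
  have hp : ∀ m, 0 < r.2 m + unitVec T i j m := fun m => by have := hr m; omega
  simp only [mem_comp, Prod.fst_add, Prod.snd_add, hne, hne', add_zero, false_and, false_or,
    Pi.add_apply, map_add, phi_unitVec, Multiset.sum_add]
  constructor
  · rintro ⟨-, h⟩
    refine ⟨hr, ?_⟩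
    have := add_mem h hsw
    convert this using 1; abel
  · rintro ⟨-, h⟩
    refine ⟨hp, ?_⟩
    have := sub_mem h hsw
    convert this using 1; abel

/-- A part of a factorization in which `(P, e_j)` can be swapped. -/
theorem exists_swap {P : Multiset G} {j : Fin (T.rank i)} {y : Multiset (T.Comp i)}
    (hy : ∀ u ∈ y, u ∈ T.comp i) (hP : P ≤ y.sum.1) (hj : 2 ≤ y.sum.2 j) :
    ∃ r : T.Comp i, y.sum = r + (P, unitVec T i j) ∧ ∀ m, 0 < r.2 m := by
  obtain ⟨Q, hQ⟩ := Multiset.le_iff_exists_add.1 hP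
  have hB := (T.comp i).multiset_sum_mem y hy
  have hpos := comp_pos hB (fun h => by rw [h] at hj; simp at hj)
  refine ⟨(Q, y.sum.2 - unitVec T i j), Prod.ext ?_ (funext fun m => ?_), fun m => ?_⟩
  · rw [hQ, add_comm]; rfl
  · have := hpos m
    have h1 := unitVec_le (j := j) (m := m)
    simp only [Prod.snd_add, Pi.add_apply, Pi.sub_apply]; omega
  · have := hpos m
    simp only [Pi.sub_apply]
    by_cases h : m = j
    · subst h; rw [unitVec_self]; omega
    · rw [unitVec_ne h]; omega

theorem comp_sum_snd {z : Multiset (T.Comp i)} {j : Fin (T.rank i)} (h : 0 < z.sum.2 j) :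
    ∃ u ∈ z, 0 < u.2 j := by
  by_contra hne
  push Not at hne
  have : ∀ z : Multiset (T.Comp i), (∀ u ∈ z, u.2 j ≤ 0) → z.sum.2 j = 0 := by
    intro z
    induction z using Multiset.induction_on with
    | empty => simp
    | cons u z ih =>
      intro hz
      have h1 := ih fun v hv => hz v (Multiset.mem_cons_of_mem hv)
      have h2 := hz u (by simp)
      simp only [Multiset.sum_cons, Prod.snd_add, Pi.add_apply]; omega
  have := this z hne
  omega

theorem comp_sum_fst {z : Multiset (T.Comp i)} {g : G} (h : g ∈ z.sum.1) : ∃ u ∈ z, g ∈ u.1 := by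
  induction z using Multiset.induction_on with
  | empty => simp at h
  | cons a s ih =>
    rw [Multiset.sum_cons, Prod.fst_add, Multiset.mem_add] at h
    rcases h with h | h
    · exact ⟨a, Multiset.mem_cons_self a s, h⟩
    · obtain ⟨u, hu, hg⟩ := ih h
      exact ⟨u, Multiset.mem_cons_of_mem hu, hg⟩

theorem comp_fst_le {z : Multiset (T.Comp i)} {u : T.Comp i} (hu : u ∈ z) : u.1 ≤ z.sum.1 := by
  obtain ⟨t, rfl⟩ := Multiset.exists_cons_of_mem hu
  rw [Multiset.sum_cons, Prod.fst_add]; exact Multiset.le_add_right _ _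

/-- Two atoms, one of which may be prescribed to be nontrivial, have `j`-exponent at least two. -/
theorem exists_cover_of_mem {z : Multiset (T.Comp i)} (hz : ∀ u ∈ z, u ∈ T.comp i)
    {j : Fin (T.rank i)} (hj : 2 ≤ z.sum.2 j) {X : T.Comp i} (hX : X ∈ z) (hX2 : X.2 ≠ 0) :
    ∃ y t, z = y + t ∧ X ∈ y ∧ Multiset.card y ≤ 2 ∧ 2 ≤ y.sum.2 j := by
  obtain ⟨t, rfl⟩ := Multiset.exists_cons_of_mem hX
  have hXj := comp_pos (hz X hX) hX2 j
  by_cases h : 2 ≤ X.2 j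
  · exact ⟨{X}, t, by simp, by simp, by simp, by simpa using h⟩
  · have : 0 < t.sum.2 j := by
      simp only [Multiset.sum_cons, Prod.snd_add, Pi.add_apply] at hj; omega
    obtain ⟨Y, hY, hYj⟩ := comp_sum_snd this
    obtain ⟨t', rfl⟩ := Multiset.exists_cons_of_mem hY
    refine ⟨{X, Y}, t', by simp [Multiset.insert_eq_cons], by simp, by simp, ?_⟩
    simp only [Multiset.sum_pair, Prod.snd_add, Pi.add_apply]; omega

theorem exists_cover {z : Multiset (T.Comp i)} (hz : ∀ u ∈ z, u ∈ T.comp i)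
    {j : Fin (T.rank i)} (hj : 2 ≤ z.sum.2 j) :
    ∃ y t, z = y + t ∧ Multiset.card y ≤ 2 ∧ 2 ≤ y.sum.2 j := by
  obtain ⟨X, hX, hXj⟩ := comp_sum_snd (z := z) (j := j) (by omega)
  obtain ⟨y, t, h1, -, h2, h3⟩ := exists_cover_of_mem hz hj hX (fun h => by rw [h] at hXj; simp at hXj)
  exact ⟨y, t, h1, h2, h3⟩

/-- The element `g` may lie in an atom without exponents; then two further atoms are needed to reach
exponent 2. -/
theorem exists_cover_fst {z : Multiset (T.Comp i)} (hz : ∀ u ∈ z, u ∈ T.comp i)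
    {j : Fin (T.rank i)} (hj : 2 ≤ z.sum.2 j) {g : G} (hg : g ∈ z.sum.1) :
    ∃ y t, z = y + t ∧ Multiset.card y ≤ 3 ∧ g ∈ y.sum.1 ∧ 2 ≤ y.sum.2 j := by
  obtain ⟨X, hX, hgX⟩ := comp_sum_fst hg
  by_cases hX2 : X.2 = 0
  · obtain ⟨t, rfl⟩ := Multiset.exists_cons_of_mem hX
    obtain ⟨y, t', rfl, h2, h3⟩ := exists_cover (z := t) (j := j) (fun u hu => hz u (by simp [hu])) (by
      simp only [Multiset.sum_cons, Prod.snd_add, Pi.add_apply, hX2, Pi.zero_apply] at hj; omega)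
    refine ⟨X ::ₘ y, t', by simp, by rw [Multiset.card_cons]; omega, by simp [hgX], ?_⟩
    simp only [Multiset.sum_cons, Prod.snd_add, Pi.add_apply]; omega
  · obtain ⟨y, t, h1, h2, h3, h4⟩ := exists_cover_of_mem hz hj hX hX2
    exact ⟨y, t, h1, by omega, Multiset.mem_of_le (comp_fst_le h2) hgX, h4⟩

theorem pos_ne_zero {r : T.Comp i} (hr : ∀ m, 0 < r.2 m) (p : T.Comp i) : r + p ≠ 0 := by
  intro h
  have := congrArg (fun u : T.Comp i => u.2 ⟨0, T.rank_pos i⟩) h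
  have h1 := hr ⟨0, T.rank_pos i⟩
  simp at this; omega

section Collapses

variable {P P' : Multiset G} {j : Fin (T.rank i)} {w : T.Comp i}
  (hsw : P'.sum - P.sum - T.cls i j ∈ T.unitCls i)
include hsw

theorem collapses_of_cover
    (h : ∀ z : Multiset (T.Comp i), (∀ u ∈ z, IsAtomIn (T.comp i) u) →
      z.sum = w + (P, unitVec T i j) →
      ∃ y t, z = y + t ∧ Multiset.card y ≤ 2 ∧ P ≤ y.sum.1 ∧ 2 ≤ y.sum.2 j) :
    Collapses (T.comp i) (P, unitVec T i j) (P', 0) w := by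
  intro z hz hs
  obtain ⟨y, t, rfl, h1, h2, h3⟩ := h z hz hs
  have hy : ∀ u ∈ y, u ∈ T.comp i := fun u hu => (hz u (by simp [hu])).1
  obtain ⟨r, hr, hpos⟩ := exists_swap hy h2 h3
  exact ⟨y, t, r, rfl, h1, hr, (comp_swap hsw hpos).1 (hr ▸ (T.comp i).multiset_sum_mem y hy),
    pos_ne_zero hpos _⟩

theorem collapses_zero (hP : P = 0) (hw : ∀ m, 0 < w.2 m) :
    Collapses (T.comp i) (P, unitVec T i j) (P', 0) w := by
  refine collapses_of_cover hsw fun z hz hs => ?_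
  obtain ⟨y, t, h1, h2, h3⟩ := exists_cover (z := z) (j := j) (fun u hu => (hz u hu).1) (by
    have := hw j
    rw [hs]; simp [unitVec_self]; omega)
  exact ⟨y, t, h1, h2, by simp [hP], h3⟩

/-- Since `h` completes to no zero-sum sequence, the atom containing it has positive exponents, and
one more atom suffices to reach exponent 2 at `j`. -/
theorem collapses_one {h : G} (hP : P = {h}) (hw : ∀ m, 0 < w.2 m)
    (hR : ∀ R ≤ w.1, h + R.sum ≠ 0) :
    Collapses (T.comp i) (P, unitVec T i j) (P', 0) w := by
  subst hP
  refine collapses_of_cover hsw fun z hz hs => ?_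
  obtain ⟨X, hX, hhX⟩ := comp_sum_fst (z := z) (g := h) (by rw [hs]; simp)
  obtain ⟨y, t, h1, h2, h3, h4⟩ := exists_cover_of_mem (j := j) (fun u hu => (hz u hu).1) (by
    have := hw j
    rw [hs]; simp [unitVec_self]; omega) hX (by
      intro hX2
      obtain ⟨R, hRX⟩ := Multiset.exists_cons_of_mem hhX
      refine hR R ?_ ?_
      · have := comp_fst_le hX
        rw [hs, hRX, Prod.fst_add, add_comm, Multiset.singleton_add, Multiset.cons_le_cons_iff] at this
        exact this
      · rcases (hz X hX).1 with h | h
        · have := h.2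
          rwa [hRX, Multiset.sum_cons] at this
        · have := h.1 j
          rw [hX2] at this
          simp at this)
  exact ⟨y, t, h1, h3, Multiset.singleton_le.2 (Multiset.mem_of_le (comp_fst_le h2) hhX), h4⟩

/-- No nonempty subsequence of `h₁`, `h₂` has sum zero, so every atom with a group element has
positive exponents. If the two elements lie in different atoms, these already have joint exponent 2
at `j`. -/
theorem collapses_two {h₁ h₂ : G} (hP : P = {h₁, h₂}) (hw : ∀ m, 0 < w.2 m) (hw1 : w.1 = 0)
    (h1 : h₁ ≠ 0) (h2 : h₂ ≠ 0) (h12 : h₁ + h₂ ≠ 0) :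
    Collapses (T.comp i) (P, unitVec T i j) (P', 0) w := by
  subst hP
  refine collapses_of_cover hsw fun z hz hs => ?_
  have hz2 : 2 ≤ z.sum.2 j := by
    have := hw j
    rw [hs]; simp [unitVec_self]; omega
  have hz1 : z.sum.1 = {h₁, h₂} := by rw [hs, Prod.fst_add, hw1, zero_add]
  have hne : ∀ X ∈ z, X.1 ≠ 0 → X.2 ≠ 0 := by
    intro X hX hX1 hX2
    have hle := comp_fst_le hX
    rw [hz1] at hle
    have hsum : X.1.sum = 0 := by
      rcases (hz X hX).1 with h | h
      · exact h.2
      · have := h.1 j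
        rw [hX2] at this
        simp at this
    obtain ⟨g, hg⟩ := Multiset.exists_mem_of_ne_zero hX1
    obtain ⟨R, hR⟩ := Multiset.exists_cons_of_mem hg
    have hcard := Multiset.card_le_card hle
    rcases (show Multiset.card X.1 = 2 ∨ Multiset.card X.1 = 1 by
      have := Multiset.card_pos.2 hX1
      simp at hcard; omega) with h | h
    · have : X.1 = {h₁, h₂} := Multiset.eq_of_le_of_card_le hle (by simp [h])
      rw [this] at hsum
      exact h12 (by simpa using hsum)
    · obtain ⟨g, hg⟩ := Multiset.card_eq_one.1 h
      rw [hg] at hsum hle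
      have := Multiset.singleton_le.1 hle
      simp at this hsum
      rcases this with rfl | rfl
      exacts [h1 hsum, h2 hsum]
  obtain ⟨X, hX, hhX⟩ := comp_sum_fst (z := z) (g := h₁) (by rw [hz1]; simp)
  have hXne := hne X hX (fun h => by rw [h] at hhX; simp at hhX)
  by_cases hX' : ({h₁, h₂} : Multiset G) ≤ X.1
  · obtain ⟨y, t, h1, h2, h3, h4⟩ := exists_cover_of_mem (j := j) (fun u hu => (hz u hu).1) hz2 hX hXne
    exact ⟨y, t, h1, h3, hX'.trans (comp_fst_le h2), h4⟩
  · obtain ⟨t, rfl⟩ := Multiset.exists_cons_of_mem hX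
    obtain ⟨R, hR⟩ := Multiset.exists_cons_of_mem hhX
    have hht : h₂ ∈ t.sum.1 := by
      have : R + t.sum.1 = {h₂} := by
        have h3 := hz1
        rw [Multiset.sum_cons, Prod.fst_add, hR, Multiset.cons_add, Multiset.insert_eq_cons,
          Multiset.cons_inj_right] at h3
        exact h3
      have h4 : h₂ ∈ R + t.sum.1 := by rw [this]; simp
      rcases Multiset.mem_add.1 h4 with h | h
      · exfalso
        apply hX'
        rw [hR, Multiset.insert_eq_cons, Multiset.cons_le_cons_iff]
        exact Multiset.singleton_le.2 h
      · exact h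
    obtain ⟨Y, hY, hhY⟩ := comp_sum_fst hht
    have hYne := hne Y (by simp [hY]) (fun h => by rw [h] at hhY; simp at hhY)
    obtain ⟨t', rfl⟩ := Multiset.exists_cons_of_mem hY
    refine ⟨{X, Y}, t', by simp [Multiset.insert_eq_cons], by simp, ?_, ?_⟩
    · rw [Multiset.sum_pair, Prod.fst_add, Multiset.insert_eq_cons, ← Multiset.singleton_add]
      exact add_le_add (Multiset.singleton_le.2 hhX) (Multiset.singleton_le.2 hhY)
    · have := comp_pos (hz X (by simp)).1 hXne j
      have := comp_pos (hz Y (by simp)).1 hYne j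
      simp only [Multiset.sum_pair, Prod.snd_add, Pi.add_apply]; omega

/-- Lifting a factorization along a swap. -/
theorem comp_lift {b w0 : T.Comp i} {z : Multiset (T.Comp i)}
    (hz : ∀ u ∈ z, IsAtomIn (T.comp i) u) (hsum : z.sum = b + (P', 0)) (hmem : w0 + (P', 0) ∈ z)
    (hw0 : ∀ m, 0 < w0.2 m)
    (hc : Collapses (T.comp i) (P, unitVec T i j) (P', 0) w0) :
    ∃ l ∈ lengthsIn (T.comp i) (b + (P, unitVec T i j)),
      Multiset.card z ≤ l ∧ l ≤ Multiset.card z + 1 :=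
  hc.lift eq_zero_of_degC hz hsum hmem ((comp_swap hsw hw0).2 (hz _ hmem).1) (pos_ne_zero hw0 _)

/-- No zero-sum condition is imposed here, so three atoms may have to be merged and two may be lost.
A gap with `d ≥ 2` tolerates this. -/
theorem comp_long {h : G} (hP : P ≤ {h}) {a : T.Comp i} (ha : ∀ m, 0 < a.2 m) {l : ℕ}
    (hl : l ∈ lengthsIn (T.comp i) (a + (P, unitVec T i j))) :
    ∃ l' ∈ lengthsIn (T.comp i) (a + (P', 0)), l ≤ l' + 2 := by
  obtain ⟨z, hz, hzs, rfl⟩ := hl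
  have hz2 : 2 ≤ z.sum.2 j := by
    have := ha j
    rw [hzs]; simp [unitVec_self]; omega
  have : ∃ y t, z = y + t ∧ Multiset.card y ≤ 3 ∧ P ≤ y.sum.1 ∧ 2 ≤ y.sum.2 j := by
    rcases Multiset.le_singleton.1 hP with rfl | rfl
    · obtain ⟨y, t, h1, h2, h3⟩ := exists_cover (fun u hu => (hz u hu).1) hz2
      exact ⟨y, t, h1, by omega, by simp, h3⟩
    · obtain ⟨y, t, h1, h2, h3, h4⟩ := exists_cover_fst (fun u hu => (hz u hu).1) hz2 (g := h)
        (by rw [hzs]; simp)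
      exact ⟨y, t, h1, h2, Multiset.singleton_le.2 h3, h4⟩
  obtain ⟨y, t, rfl, h1, h2, h3⟩ := this
  have hy : ∀ u ∈ y, u ∈ T.comp i := fun u hu => (hz u (by simp [hu])).1
  obtain ⟨r, hr, hpos⟩ := exists_swap hy h2 h3
  obtain ⟨l', hl', hle⟩ := exists_long_length eq_zero_of_degC (w := t)
    (fun u hu => hz u (by simp [hu])) ((comp_swap hsw hpos).1 (hr ▸ (T.comp i).multiset_sum_mem y hy))
    (pos_ne_zero hpos _)
  have : r + (P', 0) + t.sum = a + (P', 0) := by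
    have : r + t.sum + (P, unitVec T i j) = a + (P, unitVec T i j) := by
      rw [← hzs, Multiset.sum_add, hr]; abel
    rw [← add_right_cancel this]; abel
  exact ⟨l', this ▸ hl', by rw [Multiset.card_add]; omega⟩

end Collapses

namespace CritPair

variable {d : ℕ} {U V : T.Comp i} (hc : CritPair d U V)
include hc

theorem false_of_move {x' : T.Comp i} (hlt : T.degC i x' < T.degC i (U + V))
    (h1 : ∃ l ∈ lengthsIn (T.comp i) x', l ≤ 2) (h2 : ∃ l ∈ lengthsIn (T.comp i) x', 2 < l)
    (h3 : ∀ l' ∈ lengthsIn (T.comp i) x', 2 < l' → ∃ l ∈ lengthsIn (T.comp i) (U + V),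
      2 < l ∧ l ≤ l' + 1) : False := by
  have ⟨l0, hl0, _⟩ := h1
  obtain ⟨k', -, hk', -⟩ := exists_wide hc.not_mem (by have := hc.two_le; omega)
    (mem_of_mem_lengthsIn hl0) h1 h2 (by
      intro l' hl' hlt'
      obtain ⟨l, hl, h4, h5⟩ := h3 l' hl' hlt'
      have := hc.wide.2.2 l hl h4
      omega)
  exact hc.min x' (mem_of_mem_lengthsIn hl0) hlt k' hk'

/-- A swap inside of `U` is impossible. -/
theorem false_of_swap {P P' : Multiset G} {h : G} {j : Fin (T.rank i)}
    (hsw : P'.sum - P.sum - T.cls i j ∈ T.unitCls i) (hP : P ≤ {h}) (hP' : Multiset.card P' ≤ 1)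
    (hPU : P ≤ U.1) (hj : 2 ≤ U.2 j)
    (hb : ∀ b : T.Comp i, U = b + (P, unitVec T i j) → (∀ m, 0 < b.2 m) →
      ∀ z : Multiset (T.Comp i), (∀ u ∈ z, IsAtomIn (T.comp i) u) → z.sum = b + (P', 0) →
        ∃ w0 : T.Comp i, w0 + (P', 0) ∈ z ∧ (∀ m, 0 < w0.2 m) ∧
          Collapses (T.comp i) (P, unitVec T i j) (P', 0) w0)
    (ha : ∀ a : T.Comp i, U + V = a + (P, unitVec T i j) → (∀ m, 0 < a.2 m) →
      ∀ z : Multiset (T.Comp i), (∀ u ∈ z, IsAtomIn (T.comp i) u) → z.sum = a + (P', 0) →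
      2 < Multiset.card z →
      ∃ l ∈ lengthsIn (T.comp i) (U + V), 2 < l ∧ l ≤ Multiset.card z + 1) : False := by
  obtain ⟨b, hbU, hbpos⟩ := exists_swap (y := {U}) (P := P) (j := j)
    (by simpa using hc.left.1) (by simpa using hPU) (by simpa using hj)
  rw [Multiset.sum_singleton] at hbU
  have hx : U + V = b + V + (P, unitVec T i j) := by rw [hbU]; abel
  have hapos : ∀ m, 0 < (b + V).2 m := fun m => by
    have := hbpos m
    simp only [Prod.snd_add, Pi.add_apply]; omega
  have hbB : b + (P', 0) ∈ T.comp i := (comp_swap hsw hbpos).1 (hbU ▸ hc.left.1)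
  refine hc.false_of_move (x' := b + V + (P', 0)) ?_ ?_ ?_ ?_
  · rw [hx, map_add, map_add _ (b + V), degC_apply, degC_apply]
    have := Finset.single_le_sum (f := unitVec T i j) (fun _ _ => Nat.zero_le _) (Finset.mem_univ j)
    rw [unitVec_self] at this
    simp only [Pi.zero_apply, Finset.sum_const_zero]
    have hd1 : T.degC i (P, unitVec T i j) = Multiset.card P + 2 * ∑ m, unitVec T i j m := rfl
    omega
  · obtain ⟨z, hz, hs⟩ := exists_factorization eq_zero_of_degC hbB
    obtain ⟨w0, h1, h2, h3⟩ := hb b hbU hbpos z hz hs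
    obtain ⟨l, hl, h4, -⟩ := comp_lift hsw hz hs h1 h2 h3
    rw [← hbU] at hl
    -- As `U` is an atom, its contraction has a factorization with at most one atom; adding `V`
    -- gives a length at most 2.
    have := length_atom eq_zero_of_degC hc.left hl
    refine ⟨Multiset.card z + 1, ?_, by omega⟩
    rw [add_right_comm, ← hs]
    exact add_mem_lengthsIn (card_mem_lengthsIn hz) hc.right.one_mem_lengthsIn
  · obtain ⟨l, hl, hlt⟩ := hc.wide.2.1
    have h4 := hc.wide.2.2 l hl hlt
    rw [hx] at hl
    obtain ⟨l', hl', h5⟩ := comp_long hsw hP hapos hl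
    have := hc.two_le
    exact ⟨l', hl', by omega⟩
  · rintro l' ⟨z, hz, hs, rfl⟩ hlt
    exact ha _ hx hapos z hz hs hlt

omit hc in
theorem exists_mem_right {z : Multiset (T.Comp i)} (hz : ∀ u ∈ z, IsAtomIn (T.comp i) u) {g : G}
    {b : T.Comp i} (hs : z.sum = b + ({g}, 0)) (hR : ∀ R ≤ b.1, g + R.sum ≠ 0) :
    ∃ w0 : T.Comp i, w0 + ({g}, 0) ∈ z ∧ (∀ m, 0 < w0.2 m) ∧ w0.1 ≤ b.1 := by
  obtain ⟨W, hW, hgW⟩ := comp_sum_fst (z := z) (g := g) (by rw [hs]; simp)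
  obtain ⟨R, hRW⟩ := Multiset.exists_cons_of_mem hgW
  have hle : R ≤ b.1 := by
    have := comp_fst_le hW
    rwa [hs, hRW, Prod.fst_add, add_comm, Multiset.singleton_add, Multiset.cons_le_cons_iff] at this
  have hWe : W = (R, W.2) + ({g}, 0) := Prod.ext (by rw [hRW, Prod.fst_add, add_comm]; rfl) (by simp)
  refine ⟨(R, W.2), hWe ▸ hW, fun m => comp_pos (hz W hW).1 (fun h0 => ?_) m, hle⟩
  rcases (hz W hW).1 with h | h
  · apply hR R hle
    have := h.2
    rwa [hRW, Multiset.sum_cons] at this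
  · have := h.1 ⟨0, T.rank_pos i⟩
    rw [h0] at this
    simp at this

/-- Replacing a prime by an element of its class. -/
theorem exists_sum_eq_zero_left {c : G} {j : Fin (T.rank i)} (hcj : c - T.cls i j ∈ T.unitCls i)
    (hj : 2 ≤ U.2 j) : ∃ R ≤ (U + V).1, c + R.sum = 0 := by
  by_contra hR
  push Not at hR
  have hsw : ({c} : Multiset G).sum - (0 : Multiset G).sum - T.cls i j ∈ T.unitCls i := by simpa using hcj
  refine hc.false_of_swap (h := c) hsw (by simp) (by simp) (by simp) hj ?_ ?_
  · intro b hb _ z hz hs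
    obtain ⟨w0, h1, h2, -⟩ := exists_mem_right hz hs fun R hRb => hR R (hRb.trans (by
      rw [hb]; simp only [Prod.fst_add, add_zero]; exact Multiset.le_add_right _ _))
    exact ⟨w0, h1, h2, collapses_zero hsw rfl h2⟩
  · intro a ha _ z hz hs hlt
    obtain ⟨w0, h1, h2, -⟩ := exists_mem_right hz hs fun R hRb => hR R (hRb.trans (by
      rw [ha]; simp))
    obtain ⟨l, hl, h3, h4⟩ := comp_lift hsw hz hs h1 h2 (collapses_zero hsw rfl h2)
    exact ⟨l, ha ▸ hl, by omega, h4⟩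

/-- By `three_le` one of the two entries at `j` is at least 2, and the situation is symmetric. -/
theorem exists_sum_eq_zero {c : G} {j : Fin (T.rank i)} (hcj : c - T.cls i j ∈ T.unitCls i) :
    ∃ R ≤ U.1 + V.1, c + R.sum = 0 := by
  by_cases h : 2 ≤ U.2 j
  · exact hc.exists_sum_eq_zero_left hcj h
  · have := hc.three_le j
    have := hc.symm.exists_sum_eq_zero_left hcj (by omega)
    rwa [add_comm V U] at this

/-- Absorbing an element of the class group together with a prime. -/
theorem lt_two_of_neg {h : G} (hU : U.1 = {h}) {j : Fin (T.rank i)}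
    (hcj : -h - T.cls i j ∈ T.unitCls i) : U.2 j < 2 := by
  by_contra hj
  push Not at hj
  have h0 : h ≠ 0 := fun h0 => hc.zero_left (by rw [hU, h0]; simp)
  have hsw : (0 : Multiset G).sum - ({h} : Multiset G).sum - T.cls i j ∈ T.unitCls i := by simpa using hcj
  have hcol : ∀ W : T.Comp i, W.1 = 0 → (∀ m, 0 < W.2 m) →
      Collapses (T.comp i) ({h}, unitVec T i j) (0, 0) W := by
    intro W hW1 hW2
    refine collapses_one hsw rfl hW2 fun R hR => ?_
    rw [hW1] at hR
    rw [Multiset.le_zero.1 hR]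
    simpa using h0
  have hpos : ∀ W : T.Comp i, IsAtomIn (T.comp i) W → W.1 = 0 → ∀ m, 0 < W.2 m := by
    intro W hW hW1
    refine comp_pos hW.1 fun h => hW.2.1 (Prod.ext hW1 h)
  refine hc.false_of_swap (h := h) hsw le_rfl (by simp) (by simp [hU]) hj ?_ ?_
  · intro b hb hbpos z hz hs
    have hb1 : b.1 = 0 := by
      have := congrArg Prod.fst hb
      rw [hU, Prod.fst_add] at this
      have h2 := congrArg Multiset.card this
      simp at h2
      exact h2
    have hzne : z ≠ 0 := by
      rintro rfl
      exact pos_ne_zero hbpos _ hs.symm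
    obtain ⟨W, hW⟩ := Multiset.exists_mem_of_ne_zero hzne
    have hW1 : W.1 = 0 := by
      have := comp_fst_le hW
      rw [hs] at this
      simpa [hb1] using this
    exact ⟨W, (add_zero W).symm ▸ hW, hpos W (hz W hW) hW1, hcol W hW1 (hpos W (hz W hW) hW1)⟩
  · intro a ha hapos z hz hs hlt
    have ha1 : a.1 = V.1 := by
      have := congrArg Prod.fst ha
      rw [Prod.fst_add, hU, Prod.fst_add, add_comm] at this
      exact (add_right_cancel this).symm
    -- After the swap only the group element of `V` is left, at most one, and there are more than
    -- two atoms.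
    have : ∃ W ∈ z, W.1 = 0 := by
      by_contra hne
      push Not at hne
      have hcard : Multiset.card z ≤ Multiset.card z.sum.1 := by
        clear hs hz hlt
        induction z using Multiset.induction_on with
        | empty => simp
        | cons u z ih =>
          have h1 := ih fun v hv => hne v (by simp [hv])
          have h2 := Multiset.card_pos.2 (hne u (by simp))
          simp only [Multiset.sum_cons, Multiset.card_cons, Prod.fst_add, Multiset.card_add]
          omega
      have := hc.card_right
      rw [hs] at hcard
      simp [ha1] at hcard
      omega
    obtain ⟨W, hW, hW1⟩ := this
    obtain ⟨l, hl, h3, h4⟩ := comp_lift hsw hz hs (w0 := W) ((add_zero W).symm ▸ hW)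
      (hpos W (hz W hW) hW1) (hcol W hW1 (hpos W (hz W hW) hW1))
    exact ⟨l, ha ▸ hl, by omega, h4⟩

end CritPair

end BlockData

/-! ### Critical pairs at a single index: few elements or nonzero sum -/

namespace BlockData

variable {G : Type*} [AddCommGroup G] {ι : Type*} {T : BlockData G ι} {i : ι} [Fintype ι]
  [DecidableEq ι]

theorem le_pair_cases {R : Multiset G} {h₁ h₂ : G} (hR : R ≤ {h₁, h₂}) :
    R = 0 ∨ R = {h₁} ∨ R = {h₂} ∨ R = {h₁, h₂} := by
  have hc := Multiset.card_le_card hR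
  rw [Multiset.card_pair] at hc
  rcases (show Multiset.card R = 0 ∨ Multiset.card R = 1 ∨ Multiset.card R = 2 by omega) with h | h | h
  · exact Or.inl (Multiset.card_eq_zero.1 h)
  · obtain ⟨g, rfl⟩ := Multiset.card_eq_one.1 h
    have := Multiset.singleton_le.1 hR
    simp at this
    rcases this with rfl | rfl <;> simp
  · exact Or.inr (Or.inr (Or.inr (Multiset.eq_of_le_of_card_le hR (by simp [h]))))

theorem comp_atom_of_one {a : T.Comp i} {j : Fin (T.rank i)} (ha : a ∈ T.comp i) (hj : a.2 j = 1)
    (hs : ∀ t ≤ a.1, t.sum = 0 → t = 0) : IsAtomIn (T.comp i) a := by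
  rw [← isAtomIn_embed]
  refine atom_of_one (i := i) (j := j) ((embed_mem a).2 ha) ?_ (fun i' hi => embed_snd_ne a hi) ?_
  · rw [embed_snd_self]; exact hj
  · rw [embed_fst]; exact hs

theorem singleton_no_zero_sum {g : G} (hg : g ≠ 0) : ∀ t ≤ ({g} : Multiset G), t.sum = 0 → t = 0 := by
  intro t ht hts
  rcases Multiset.le_singleton.1 ht with h | h
  · exact h
  · rw [h, Multiset.sum_singleton] at hts; exact absurd hts hg

/-- Trading a prime of an atom for an element of its class. -/
theorem comp_atom_trade {g : G} (hg : g ≠ 0) {ν : Fin (T.rank i) → ℕ} {m : Fin (T.rank i)}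
    (hν : IsAtomIn (T.comp i) (0, ν)) (hm : 2 ≤ ν m) (hcls : T.cls i m = g) :
    IsAtomIn (T.comp i) ({g}, ν - unitVec T i m) := by
  have hpos : ∀ m', 0 < ν m' := comp_pos hν.1 fun h => by
    simp only at h
    rw [h] at hm; simp at hm
  have hpos' : ∀ m', 0 < (ν - unitVec T i m) m' := by
    intro m'
    have := hpos m'
    simp only [Pi.sub_apply]
    by_cases h : m' = m
    · subst h; rw [unitVec_self]; omega
    · rw [unitVec_ne h]; omega
  have hadd : ν - unitVec T i m + unitVec T i m = ν := by
    funext m'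
    have := hpos m'
    have := unitVec_le (T := T) (j := m) (m := m')
    simp only [Pi.add_apply, Pi.sub_apply]; omega
  have hsw : ({g} : Multiset G).sum - (0 : Multiset G).sum - T.cls i m ∈ T.unitCls i := by
    simp [hcls]
  have key : ∀ v : T.Comp i, g ∈ v.1 → v ∈ T.comp i → v.1 ≤ {g} →
      v = (0, v.2) + ({g}, 0) ∧ ∀ m', 0 < v.2 m' := by
    intro v hgv hv hle
    have hv1 : v.1 = {g} := le_antisymm hle (Multiset.singleton_le.2 hgv)
    refine ⟨Prod.ext (by simp [hv1]) (by simp), comp_pos hv fun h => ?_⟩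
    rcases hv with h' | h'
    · apply hg
      have := h'.2
      rwa [hv1, Multiset.sum_singleton] at this
    · have := h'.1 m
      rw [h] at this; simp at this
  have he : (({g}, ν - unitVec T i m) : T.Comp i) = (0, ν - unitVec T i m) + ({g}, 0) :=
    Prod.ext (by simp) (by simp)
  have hB : (({g}, ν - unitVec T i m) : T.Comp i) ∈ T.comp i := by
    rw [he, ← comp_swap (r := (0, ν - unitVec T i m)) hsw hpos']
    have : ((0, ν - unitVec T i m) : T.Comp i) + (0, unitVec T i m) = (0, ν) :=
      Prod.ext (by simp) hadd
    rw [this]; exact hν.1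
  refine ⟨hB, fun h => ?_, ?_⟩
  · have := congrArg Prod.fst h
    simp at this
  have main : ∀ v ∈ T.comp i, ∀ w ∈ T.comp i, g ∈ v.1 → v + w = ({g}, ν - unitVec T i m) → w = 0 := by
    intro v hv w hw hgv hvw
    obtain ⟨h1, h2⟩ := key v hgv hv (by
      have := congrArg Prod.fst hvw
      simp only [Prod.fst_add] at this
      rw [← this]; exact Multiset.le_add_right _ _)
    have hv' : ((0, v.2) : T.Comp i) + (0, unitVec T i m) ∈ T.comp i :=
      (comp_swap (r := (0, v.2)) hsw h2).2 (h1 ▸ hv)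
    refine (hν.2.2 _ hv' w hw ?_).resolve_left (pos_ne_zero (r := (0, v.2)) h2 _)
    rw [h1, he] at hvw
    have : ((0, v.2) : T.Comp i) + w = (0, ν - unitVec T i m) :=
      add_right_cancel (b := (({g}, 0) : T.Comp i)) (by rw [← hvw]; abel)
    calc ((0, v.2) : T.Comp i) + (0, unitVec T i m) + w
        = ((0, v.2) : T.Comp i) + w + (0, unitVec T i m) := by abel
      _ = (0, ν) := by rw [this]; exact Prod.ext (by simp) hadd
  intro v hv w hw hvw
  have hg' : g ∈ v.1 + w.1 := by
    have := congrArg Prod.fst hvw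
    rw [Prod.fst_add] at this
    rw [this]; simp
  rcases Multiset.mem_add.1 hg' with h | h
  exacts [Or.inr (main v hv w hw h hvw), Or.inl (main w hw v hv h (by rw [add_comm, hvw]))]

/-- Giving a prime away for an element of the class group. -/
theorem comp_atom_give {g : G} (hg : g ≠ 0) {ν : Fin (T.rank i) → ℕ} {m m' : Fin (T.rank i)}
    (hν : (0, ν) ∈ T.comp i) (hm : ν m' = 1) (hmm : m' ≠ m) (hcls : T.cls i m = g) :
    IsAtomIn (T.comp i) ({-g}, ν + unitVec T i m) := by
  have hpos : ∀ m', 0 < ν m' := comp_pos hν fun h => by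
    simp only at h
    rw [h] at hm; simp at hm
  refine comp_atom_of_one (j := m') (Or.inr ⟨fun m => ?_, ?_⟩) ?_
    (singleton_no_zero_sum (neg_ne_zero.2 hg))
  · have := hpos m
    simp only [Pi.add_apply]; omega
  · have := comp_cls hν
    simp only [Multiset.sum_zero, zero_add] at this
    simpa [map_add, phi_unitVec, hcls] using this
  · simp only [Pi.add_apply, hm, unitVec_ne hmm]

namespace CritPair

variable {d : ℕ} {U V : T.Comp i} (hc : CritPair d U V)
include hc

/-- Let `U` contain the only possible group element, and choose a prime of exponent at least 2 in
`U`. Its class is nonzero, so `exists_sum_eq_zero` makes it the negative of that element, which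
`lt_two_of_neg` forbids. -/
theorem false_of_card_le_one (hcard : Multiset.card (U.1 + V.1) ≤ 1) : False := by
  wlog hU : Multiset.card V.1 = 0 generalizing U V
  · refine this hc.symm (by rwa [add_comm]) ?_
    rw [Multiset.card_add] at hcard
    omega
  rw [Multiset.card_eq_zero] at hU
  obtain ⟨j, hj⟩ := hc.exists_two
  obtain ⟨R, hR, h0⟩ := hc.exists_sum_eq_zero (c := T.cls i j) (j := j) (by simp)
  rw [hU, add_zero] at hR
  have hcls : T.cls i j ≠ 0 := fun h => hc.cls_notMem j (h ▸ zero_mem _)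
  have hR0 : R ≠ 0 := by
    rintro rfl
    exact hcls (by simpa using h0)
  have hU1 : Multiset.card U.1 = 1 := by
    have h1 := Multiset.card_pos.2 hR0
    have h2 := Multiset.card_le_card hR
    have := hc.card_left
    omega
  obtain ⟨h, hh⟩ := Multiset.card_eq_one.1 hU1
  rw [hh] at hR
  rcases Multiset.le_singleton.1 hR with h1 | h1
  · exact hR0 h1
  rw [h1, Multiset.sum_singleton] at h0
  have := hc.lt_two_of_neg hh (j := j) (by rw [eq_neg_of_add_eq_zero_left h0]; simp)
  omega

variable {h₁ h₂ : G} (hU : U.1 = {h₁}) (hV : V.1 = {h₂})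
include hU hV

theorem left_ne_zero : h₁ ≠ 0 := fun h0 => hc.zero_left (by rw [hU, h0]; simp)

theorem right_ne_zero : h₂ ≠ 0 := fun h0 => hc.zero_right (by rw [hV, h0]; simp)

/-- The element `c` is the negative of a subsum of `h₁`, `h₂`. The empty subsum is excluded because
no prime has the class of a unit. -/
theorem class_cases {c : G} {j : Fin (T.rank i)} (hcj : c - T.cls i j ∈ T.unitCls i) :
    c = -h₁ ∨ c = -h₂ ∨ c = -(h₁ + h₂) := by
  obtain ⟨R, hR, h0⟩ := hc.exists_sum_eq_zero hcj
  have hc0 : c ≠ 0 := by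
    rintro rfl
    rw [zero_sub] at hcj
    exact hc.cls_notMem j (neg_mem_iff.1 hcj)
  rw [hU, hV, Multiset.singleton_add] at hR
  have h1 := eq_neg_of_add_eq_zero_left h0
  rcases le_pair_cases hR with rfl | rfl | rfl | rfl
  · exact absurd (by simpa using h1) hc0
  · left; simpa using h1
  · right; left; simpa using h1
  · right; right; rw [h1, Multiset.sum_pair]

omit hc hU hV in
theorem fst_eq_of_add {P : Multiset G} {q : Fin (T.rank i) → ℕ} {b W : T.Comp i} {s : Multiset G}
    (h : W = b + (P, q)) (hW : W.1 = s + P) : b.1 = s := by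
  have := congrArg Prod.fst h
  rw [hW, Prod.fst_add] at this
  exact (add_right_cancel this).symm

/-- Merging an element with a prime, where the sum of the two elements is nonzero. -/
theorem false_of_class_eq (hne : h₁ + h₂ ≠ 0) {j : Fin (T.rank i)} (hj : 2 ≤ U.2 j)
    (hcj : -h₂ - T.cls i j ∈ T.unitCls i) : False := by
  have hh1 := hc.left_ne_zero hU hV
  have hh2 := hc.right_ne_zero hU hV
  have hsw : ({h₁ + -h₂} : Multiset G).sum - ({h₁} : Multiset G).sum - T.cls i j ∈ T.unitCls i := by
    simpa using hcj
  have h12 : h₁ + -h₂ ≠ 0 := by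
    intro h
    have := hc.lt_two_of_neg hU (j := j) (by rw [add_neg_eq_zero.1 h]; exact hcj)
    omega
  have hR1 : ∀ R ≤ ({h₂} : Multiset G), h₁ + -h₂ + R.sum ≠ 0 := by
    intro R hR
    rcases Multiset.le_singleton.1 hR with rfl | rfl
    · simpa using h12
    · simpa using hh1
  have hR2 : ∀ R ≤ ({h₂} : Multiset G), h₁ + R.sum ≠ 0 := by
    intro R hR
    rcases Multiset.le_singleton.1 hR with rfl | rfl
    · simpa using hh1
    · simpa using hne
  refine hc.false_of_swap (h := h₁) hsw le_rfl (by simp) (by simp [hU]) hj ?_ ?_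
  · intro b hb _ z hz hs
    have hb1 : b.1 = 0 := fst_eq_of_add hb (by simp [hU])
    obtain ⟨w0, h1, h2, h3⟩ := exists_mem_right hz hs fun R hR => hR1 R (hR.trans (by simp [hb1]))
    exact ⟨w0, h1, h2, collapses_one hsw rfl h2 fun R hR => hR2 R (hR.trans (h3.trans (by simp [hb1])))⟩
  · intro a ha _ z hz hs hlt
    have ha1 : a.1 = {h₂} := fst_eq_of_add ha (by rw [Prod.fst_add, hU, hV, add_comm])
    obtain ⟨w0, h1, h2, h3⟩ := exists_mem_right hz hs fun R hR => hR1 R (hR.trans ha1.le)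
    obtain ⟨l, hl, h4, h5⟩ := comp_lift hsw hz hs h1 h2
      (collapses_one hsw rfl h2 fun R hR => hR2 R (hR.trans (h3.trans ha1.le)))
    exact ⟨l, ha ▸ hl, by omega, h5⟩

/-- If `c = -h₁`, then `U` has exponent 1 at `j` by `lt_two_of_neg`, so `V` has exponent at least 2
there, and merging `h₂` with the prime contradicts `false_of_class_eq`. The case `c = -h₂` is
symmetric. -/
theorem class_eq_of_ne (hne : h₁ + h₂ ≠ 0) {c : G} {j : Fin (T.rank i)}
    (hcj : c - T.cls i j ∈ T.unitCls i) : c = -(h₁ + h₂) := by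
  have h3 := hc.three_le j
  rcases hc.class_cases hU hV hcj with rfl | rfl | h
  · exfalso
    have := hc.lt_two_of_neg hU hcj
    exact hc.symm.false_of_class_eq hV hU (by rwa [add_comm]) (j := j) (by omega) hcj
  · exfalso
    have := hc.symm.lt_two_of_neg hV hcj
    exact hc.false_of_class_eq hU hV hne (j := j) (by omega) hcj
  · exact h

/-- Every prime now has class `-(h₁ + h₂)`. So one prime can absorb both group elements, or be
swapped together with `h₁` for `-h₂`. The first move is a descent if its result has length 2; if
not, the second one is. -/
theorem false_of_add_ne_zero (hne : h₁ + h₂ ≠ 0) : False := by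
  have hh1 := hc.left_ne_zero hU hV
  have hh2 := hc.right_ne_zero hU hV
  obtain ⟨j, hj⟩ := hc.exists_two
  have hcls : T.cls i j = -(h₁ + h₂) := hc.class_eq_of_ne hU hV hne (j := j) (by simp)
  set K := U.2 + V.2 with hK
  have hUV : U + V = ({h₁, h₂}, K) := Prod.ext (by rw [Prod.fst_add, hU, hV, Multiset.singleton_add]; rfl) rfl
  have h3 := hc.three_le
  set K' := K - unitVec T i j with hK'
  have hK'pos : ∀ m, 0 < K' m := by
    intro m
    have := h3 m
    have := unitVec_le (T := T) (j := j) (m := m)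
    simp only [hK', hK, Pi.sub_apply, Pi.add_apply]; omega
  have hKadd : K' + unitVec T i j = K := by
    funext m
    have := h3 m
    have := unitVec_le (T := T) (j := j) (m := m)
    simp only [hK', hK, Pi.sub_apply, Pi.add_apply]; omega
  have hsw2 : (0 : Multiset G).sum - ({h₁, h₂} : Multiset G).sum - T.cls i j ∈ T.unitCls i := by
    rw [hcls]; simp
  have hx2 : U + V = (0, K') + ({h₁, h₂}, unitVec T i j) := by
    rw [hUV]; exact Prod.ext (by simp) hKadd.symm
  -- lifting along the simultaneous absorption of both elements
  have lift2 : ∀ z : Multiset (T.Comp i), (∀ u ∈ z, IsAtomIn (T.comp i) u) → z.sum = (0, K') →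
      ∃ l ∈ lengthsIn (T.comp i) (U + V), Multiset.card z ≤ l ∧ l ≤ Multiset.card z + 1 := by
    intro z hz hs
    have hzne : z ≠ 0 := by
      rintro rfl
      have := congrArg (fun u : T.Comp i => u.2 j) hs
      have h1 := hK'pos j
      simp at this; omega
    obtain ⟨W, hW⟩ := Multiset.exists_mem_of_ne_zero hzne
    have hW1 : W.1 = 0 := by
      have := comp_fst_le hW
      rw [hs] at this
      simpa using this
    have hWpos := comp_pos (hz W hW).1 fun h => (hz W hW).2.1 (Prod.ext hW1 h)
    rw [hx2]
    exact comp_lift hsw2 hz (hs.trans (add_zero _).symm) (w0 := W) ((add_zero W).symm ▸ hW) hWpos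
      (collapses_two hsw2 rfl hWpos hW1 hh1 hh2 hne)
  -- After the second move `-h₂` may pair up with `h₂`. The other atoms then factor `(0, K')`, and
  -- lifting them is harmless as soon as there are not exactly two of them.
  by_cases h2 : 2 ∈ lengthsIn (T.comp i) ((0, K') : T.Comp i)
  · refine hc.false_of_move (x' := (0, K')) ?_ ⟨2, h2, le_rfl⟩ ?_ ?_
    · rw [hx2, map_add]
      have hd1 : T.degC i ({h₁, h₂}, unitVec T i j) = 2 + 2 * ∑ m, unitVec T i j m := rfl
      omega
    · obtain ⟨l, hl, hlt⟩ := hc.wide.2.1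
      have h4 := hc.wide.2.2 l hl hlt
      have := hc.two_le
      rw [hx2] at hl
      obtain ⟨l', hl', h5⟩ := (collapses_two (P' := 0) hsw2 rfl hK'pos rfl hh1 hh2 hne).exists_length
        eq_zero_of_degC hl
      rw [show ((0, K') : T.Comp i) + (0, 0) = (0, K') from add_zero _] at hl'
      exact ⟨l', hl', by omega⟩
    · rintro l' ⟨z, hz, hs, rfl⟩ hlt
      obtain ⟨l, hl, h4, h5⟩ := lift2 z hz hs
      exact ⟨l, hl, by omega, h5⟩
  · have hsw : ({-h₂} : Multiset G).sum - ({h₁} : Multiset G).sum - T.cls i j ∈ T.unitCls i := by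
      rw [hcls, Multiset.sum_singleton, Multiset.sum_singleton,
        show -h₂ - h₁ - -(h₁ + h₂) = 0 by abel]
      exact zero_mem _
    have hR2 : ∀ R ≤ ({h₂} : Multiset G), h₁ + R.sum ≠ 0 := by
      intro R hR
      rcases Multiset.le_singleton.1 hR with rfl | rfl
      · simpa using hh1
      · simpa using hne
    refine hc.false_of_swap (h := h₁) hsw le_rfl (by simp) (by simp [hU]) hj ?_ ?_
    · intro b hb _ z hz hs
      have hb1 : b.1 = 0 := fst_eq_of_add hb (by simp [hU])
      obtain ⟨w0, h1, h2, h3⟩ := exists_mem_right hz hs fun R hR => by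
        rw [hb1] at hR
        rw [Multiset.le_zero.1 hR]
        simpa using hh2
      exact ⟨w0, h1, h2, collapses_one hsw rfl h2 fun R hR => hR2 R (hR.trans (h3.trans (by simp [hb1])))⟩
    · intro a ha _ z hz hs hlt
      have ha1 : a.1 = {h₂} := fst_eq_of_add ha (by rw [Prod.fst_add, hU, hV, add_comm])
      obtain ⟨W, hW, hgW⟩ := comp_sum_fst (z := z) (g := -h₂) (by rw [hs]; simp)
      obtain ⟨R, hRW⟩ := Multiset.exists_cons_of_mem hgW
      have hle : R ≤ {h₂} := by
        have := comp_fst_le hW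
        rwa [hs, hRW, Prod.fst_add, add_comm, Multiset.singleton_add, Multiset.cons_le_cons_iff,
          ha1] at this
      have hWe : W = (R, W.2) + ({-h₂}, 0) :=
        Prod.ext (by rw [hRW, Prod.fst_add, add_comm]; rfl) (by simp)
      by_cases hW2 : W.2 = 0
      · obtain ⟨z', rfl⟩ := Multiset.exists_cons_of_mem hW
        have hz' : z'.sum = (0, K') := by
          have hWsum : W.1.sum = 0 := by
            rcases (hz W hW).1 with h | h
            · exact h.2
            · have := h.1 j
              rw [hW2] at this
              simp at this
          have hR : R = {h₂} := by
            rcases Multiset.le_singleton.1 hle with h | h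
            · rw [hRW, h] at hWsum
              simp at hWsum
              exact absurd hWsum hh2
            · exact h
          have ha2 : a.2 = K' := by
            have := congrArg Prod.snd ha
            rw [hUV, Prod.snd_add] at this
            simp only at this
            rw [← hKadd] at this
            exact (add_right_cancel this).symm
          rw [Multiset.sum_cons] at hs
          refine Prod.ext ?_ ?_
          · have := congrArg Prod.fst hs
            rw [Prod.fst_add, Prod.fst_add, hRW, hR, ha1, ← Multiset.singleton_add,
              add_comm {-h₂}] at this
            have := congrArg Multiset.card this
            simp only [Multiset.card_add, Multiset.card_singleton] at this
            exact Multiset.card_eq_zero.1 (by omega)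
          · have := congrArg Prod.snd hs
            rw [Prod.snd_add, Prod.snd_add, hW2, ha2] at this
            simpa using this
        rw [Multiset.card_cons] at hlt ⊢
        have hza : ∀ u ∈ z', IsAtomIn (T.comp i) u := fun u hu => hz u (by simp [hu])
        have hcard : Multiset.card z' ≠ 2 := fun h => h2 ⟨z', hza, hz', h⟩
        obtain ⟨l, hl, h4, h5⟩ := lift2 z' hza hz'
        exact ⟨l, hl, by omega, by omega⟩
      · have hWpos : ∀ m, 0 < ((R, W.2) : T.Comp i).2 m := fun m => comp_pos (hz W hW).1 hW2 m
        obtain ⟨l, hl, h4, h5⟩ := comp_lift hsw hz hs (w0 := (R, W.2)) (hWe ▸ hW) hWpos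
          (collapses_one hsw rfl hWpos fun R' hR' => hR2 R' (hR'.trans hle))
        exact ⟨l, ha ▸ hl, by omega, h5⟩

end CritPair

end BlockData

/-! ### Critical pairs at a single index: opposite elements -/

namespace BlockData

variable {G : Type*} [AddCommGroup G] {ι : Type*} {T : BlockData G ι} {i : ι} [Fintype ι]
  [DecidableEq ι]

theorem pair_eq_of_cls {h g : G} (hg : g = h ∨ g = -h) : ({g, -g} : Multiset G) = {h, -h} := by
  rcases hg with rfl | rfl
  · rfl
  · rw [neg_neg, Multiset.pair_comm]

theorem add_sub_unitVec {ν : Fin (T.rank i) → ℕ} {m : Fin (T.rank i)} (hm : 1 ≤ ν m)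
    (μ : Fin (T.rank i) → ℕ) : ν - unitVec T i m + (μ + unitVec T i m) = ν + μ := by
  funext m'
  by_cases h : m' = m
  · subst h
    simp only [Pi.add_apply, Pi.sub_apply, unitVec_self]; omega
  · simp only [Pi.add_apply, Pi.sub_apply, unitVec_ne h]; omega

/-- Rearranging `h(-h) · Y · Z` to two atoms. -/
theorem comp_exchange {h : G} {m j : Fin (T.rank i)} {μ ν : Fin (T.rank i) → ℕ}
    (hcls : T.cls i m = h ∨ T.cls i m = -h) (h0 : h ≠ 0) (hν : IsAtomIn (T.comp i) (0, ν))
    (hμ : (0, μ) ∈ T.comp i) (hm : 2 ≤ ν m) (hj : μ j = 1) (hjm : j ≠ m) :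
    2 ∈ lengthsIn (T.comp i) (({h, -h}, ν + μ) : T.Comp i) := by
  have hc0 : T.cls i m ≠ 0 := by
    rcases hcls with h | h <;> rw [h]
    exacts [h0, neg_ne_zero.2 h0]
  -- One prime `m` moves from `ν` to `μ`. Its class is `h` or `-h`, so each of the two atoms
  -- receives one of the two group elements; the second one is an atom because of its entry 1 at
  -- `j`.
  have := add_mem_lengthsIn (comp_atom_trade hc0 hν hm rfl).one_mem_lengthsIn
    (comp_atom_give hc0 hμ hj hjm rfl).one_mem_lengthsIn
  convert this using 2
  refine Prod.ext ?_ ?_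
  · rw [Prod.fst_add, ← pair_eq_of_cls hcls]; rfl
  · exact (add_sub_unitVec (by omega) μ).symm

namespace CritPair

variable {d : ℕ} {U V : T.Comp i} (hc : CritPair d U V)
include hc

/-- All primes have class `h` or `-h`, and one of exponent at least 2 in `U` has class `h`. Swapping
it and `h` for `2h` is a descent unless lifting creates the pair `h`, `-h` and two further atoms.
Then the atoms are regrouped, if necessary together with another atom of the factorization. -/
theorem false_of_add_eq_zero {h : G} (hU : U.1 = {h}) (hV : V.1 = {-h}) : False := by
  have h0 := hc.left_ne_zero hU hV
  have hcases : ∀ m, T.cls i m = h ∨ T.cls i m = -h := by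
    intro m
    rcases hc.class_cases hU hV (c := T.cls i m) (j := m) (by simp) with h1 | h1 | h1
    · exact Or.inr h1
    · left; rw [h1, neg_neg]
    · rw [add_neg_cancel, neg_zero] at h1
      exact absurd (h1 ▸ zero_mem _) (hc.cls_notMem m)
  obtain ⟨j, hj⟩ := hc.exists_two
  have hcls : T.cls i j = h := by
    refine (hcases j).resolve_right fun h1 => ?_
    have := hc.lt_two_of_neg hU (j := j) (by rw [h1]; simp)
    omega
  have hhh : h + h ≠ 0 := by
    intro h1
    have := hc.lt_two_of_neg hU (j := j) (by rw [hcls, ← eq_neg_of_add_eq_zero_left h1]; simp)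
    omega
  obtain ⟨j₁, hj₁⟩ := hc.exists_one
  have hsw : ({h + h} : Multiset G).sum - ({h} : Multiset G).sum - T.cls i j ∈ T.unitCls i := by
    rw [hcls]; simp
  have hR1 : ∀ R ≤ ({-h} : Multiset G), h + h + R.sum ≠ 0 := by
    intro R hR
    rcases Multiset.le_singleton.1 hR with rfl | rfl
    · simpa using hhh
    · simpa using h0
  refine hc.false_of_swap (h := h) hsw le_rfl (by simp) (by simp [hU]) hj ?_ ?_
  · intro b hb _ z hz hs
    have hb1 : b.1 = 0 := fst_eq_of_add hb (by simp [hU])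
    obtain ⟨w0, h1, h2, h3⟩ := exists_mem_right hz hs fun R hR => hR1 R (hR.trans (by simp [hb1]))
    refine ⟨w0, h1, h2, collapses_one hsw rfl h2 fun R hR => ?_⟩
    rw [hb1] at h3
    rw [Multiset.le_zero.1 (hR.trans h3)]
    simpa using h0
  intro a ha _ z hz hs hlt
  have ha1 : a.1 = {-h} := fst_eq_of_add ha (by rw [Prod.fst_add, hU, hV, add_comm])
  obtain ⟨w0, h1, h2, h3⟩ := exists_mem_right hz hs fun R hR => hR1 R (hR.trans ha1.le)
  rw [ha1] at h3
  rcases Multiset.le_singleton.1 h3 with hw1 | hw1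
  · obtain ⟨l, hl, h4, h5⟩ := comp_lift hsw hz hs h1 h2 (collapses_one hsw rfl h2 fun R hR => by
      rw [hw1] at hR
      rw [Multiset.le_zero.1 hR]
      simpa using h0)
    exact ⟨l, ha ▸ hl, by omega, h5⟩
  obtain ⟨z', rfl⟩ := Multiset.exists_cons_of_mem h1
  have hza : ∀ u ∈ z', IsAtomIn (T.comp i) u := fun u hu => hz u (by simp [hu])
  rw [Multiset.card_cons] at hlt ⊢
  rw [Multiset.sum_cons] at hs
  have hsum : U + V = w0 + ({h}, unitVec T i j) + z'.sum := by
    have : w0 + z'.sum = a := add_right_cancel (b := (({h + h}, 0) : T.Comp i)) (by rw [← hs]; abel)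
    rw [ha, ← this]; abel
  have hz1 : z'.sum.1 = 0 := by
    have := congrArg (fun u : T.Comp i => Multiset.card u.1) hs
    simp [hw1, ha1] at this
    exact this
  have hWa := hz _ h1
  -- it suffices to factor the inserted atom appropriately
  suffices (∃ l ∈ lengthsIn (T.comp i) (w0 + ({h}, unitVec T i j)), 1 ≤ l ∧ l ≤ 2) ∨
      ∃ W' ∈ z', ∃ l ∈ lengthsIn (T.comp i) (w0 + ({h}, unitVec T i j) + W'), 2 ≤ l ∧ l ≤ 3 by
    rcases this with ⟨l, hl, hl1, hl2⟩ | ⟨W', hW', l, hl, hl1, hl2⟩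
    · exact ⟨_, hsum ▸ add_mem_lengthsIn hl (card_mem_lengthsIn hza), by omega, by omega⟩
    · obtain ⟨t, rfl⟩ := Multiset.exists_cons_of_mem hW'
      rw [Multiset.sum_cons, ← add_assoc] at hsum
      rw [Multiset.card_cons] at hlt ⊢
      exact ⟨_, hsum ▸ add_mem_lengthsIn hl (card_mem_lengthsIn fun u hu => hza u (by simp [hu])),
        by omega, by omega⟩
  have hB := (comp_swap hsw h2).2 hWa.1
  obtain ⟨zz, hzz, hzzs⟩ := exists_factorization eq_zero_of_degC hB
  have hzz1 : zz.sum.1 = {h, -h} := by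
    rw [hzzs, Prod.fst_add, hw1, add_comm, Multiset.singleton_add]; rfl
  have hzz2 : ∀ m, zz.sum.2 m = w0.2 m + unitVec T i j m := by intro m; rw [hzzs]; rfl
  by_cases hcard : Multiset.card zz ≤ 2
  · left
    refine ⟨_, ⟨zz, hzz, hzzs, rfl⟩, ?_, hcard⟩
    rw [Nat.one_le_iff_ne_zero, Ne, Multiset.card_eq_zero]
    rintro rfl
    exact pos_ne_zero h2 _ hzzs.symm
  push Not at hcard
  -- a part in which the swap is possible is everything
  have hcover : ∀ y t, zz = y + t → h ∈ y.sum.1 → 2 ≤ y.sum.2 j → t = 0 := by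
    rintro y t rfl hhy hyj
    have hy : ∀ u ∈ y, u ∈ T.comp i := fun u hu => (hzz u (by simp [hu])).1
    obtain ⟨r, hr, hpos⟩ := exists_swap hy (Multiset.singleton_le.2 hhy) hyj
    by_contra ht
    obtain ⟨X, hX⟩ := Multiset.exists_mem_of_ne_zero ht
    obtain ⟨t', rfl⟩ := Multiset.exists_cons_of_mem hX
    refine not_contract_part (p := ({h}, unitVec T i j)) hWa (hzz X (by simp)) (zz := y + t')
      (r0 := r + t'.sum) ?_ ?_ ?_ ?_
    · rw [← hzzs]; simp only [Multiset.sum_cons, Multiset.sum_add]; abel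
    · rw [Multiset.sum_add, hr]; abel
    · rw [add_right_comm]
      exact add_mem ((comp_swap hsw hpos).1 (hr ▸ (T.comp i).multiset_sum_mem y hy))
        (sum_mem_of_atoms fun u hu => hzz u (by simp [hu]))
    · rw [add_assoc]; exact pos_ne_zero hpos _
  have hzj : 2 ≤ zz.sum.2 j := by
    have := h2 j
    rw [hzz2, unitVec_self]; omega
  obtain ⟨X, hX, hhX⟩ := comp_sum_fst (z := zz) (g := h) (by rw [hzz1]; simp)
  have hX2 : X.2 = 0 := by
    by_contra hX2
    obtain ⟨y, t, rfl, h4, h5, h6⟩ := exists_cover_of_mem (fun u hu => (hzz u hu).1) hzj hX hX2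
    have := hcover y t rfl (Multiset.mem_of_le (comp_fst_le h4) hhX) h6
    subst this
    rw [add_zero] at hcard
    omega
  have hX1 : X.1 = {h, -h} := by
    have hle := comp_fst_le hX
    rw [hzz1] at hle
    have hXs : X.1.sum = 0 := by
      rcases (hzz X hX).1 with h | h
      · exact h.2
      · have := h.1 j
        rw [hX2] at this
        simp at this
    rcases le_pair_cases hle with h4 | h4 | h4 | h4
    · rw [h4] at hhX; simp at hhX
    · rw [h4] at hXs; simp at hXs; exact absurd hXs h0
    · rw [h4] at hXs; simp at hXs; exact absurd hXs h0
    · exact h4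
  obtain ⟨t, rfl⟩ := Multiset.exists_cons_of_mem hX
  have hta : ∀ u ∈ t, IsAtomIn (T.comp i) u := fun u hu => hzz u (by simp [hu])
  have ht1 : t.sum.1 = 0 := by
    rw [Multiset.sum_cons, Prod.fst_add, hX1] at hzz1
    exact left_eq_add.1 hzz1.symm
  have htj : 2 ≤ t.sum.2 j := by
    rw [Multiset.sum_cons, Prod.snd_add, hX2, zero_add] at hzj; exact hzj
  have hu1 : ∀ u ∈ t, u.1 = 0 := by
    intro u hu
    have := comp_fst_le hu
    rw [ht1] at this
    exact Multiset.le_zero.1 this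
  have hupos : ∀ u ∈ t, ∀ m, 0 < u.2 m := fun u hu =>
    comp_pos (hta u hu).1 fun h => (hta u hu).2.1 (Prod.ext (hu1 u hu) h)
  obtain ⟨y, t', hyt, hyc, hyj⟩ := exists_cover (fun u hu => (hta u hu).1) htj
  have ht' : t' = 0 := hcover (X ::ₘ y) t' (by rw [hyt, Multiset.cons_add])
    (by simp [hhX]) (by simp [hX2]; exact hyj)
  subst ht'
  rw [add_zero] at hyt
  subst hyt
  -- This is the critical case: the refactored atom is the pair `h`, `-h` together with `Y` and `Z`.
  -- By `hcover` neither `Y` nor `Z` alone reaches exponent 2 at `j`.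
  obtain ⟨Y, Z, rfl⟩ := Multiset.card_eq_two.1 (show Multiset.card t = 2 by
    rw [Multiset.card_cons] at hcard; omega)
  have hone : ∀ Y Z : T.Comp i, ({Y, Z} : Multiset (T.Comp i)) = {Y, Z} →
      X ::ₘ {Y, Z} = {X, Y} + {Z} := fun Y Z _ => by simp [Multiset.insert_eq_cons]
  have hYj : Y.2 j = 1 := by
    have h4 := hupos Y (by simp) j
    by_contra h5
    have := hcover {X, Y} {Z} (hone Y Z rfl) (by simp [hhX])
      (by simp [hX2]; omega)
    simp at this
  have hZj : Z.2 j = 1 := by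
    have h4 := hupos Z (by simp) j
    by_contra h5
    have := hcover {X, Z} {Y} (by rw [Multiset.pair_comm Y Z]; exact hone Z Y rfl) (by simp [hhX])
      (by simp [hX2]; omega)
    simp at this
  have hYe : Y = (0, Y.2) := Prod.ext (hu1 Y (by simp)) rfl
  have hZe : Z = (0, Z.2) := Prod.ext (hu1 Z (by simp)) rfl
  have hYa : IsAtomIn (T.comp i) (0, Y.2) := hYe ▸ hta Y (by simp)
  have hZa : IsAtomIn (T.comp i) (0, Z.2) := hZe ▸ hta Z (by simp)
  have hin : w0 + ({h}, unitVec T i j) = ({h, -h}, Y.2 + Z.2) := by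
    rw [← hzzs]
    refine Prod.ext hzz1 ?_
    simp [hX2]
  rw [hin]
  by_cases hY2 : ∃ m, 2 ≤ Y.2 m
  · obtain ⟨m, hm⟩ := hY2
    exact Or.inl ⟨2, comp_exchange (hcases m) h0 hYa hZa.1 hm hZj (by rintro rfl; omega), by omega, le_rfl⟩
  by_cases hZ2 : ∃ m, 2 ≤ Z.2 m
  · obtain ⟨m, hm⟩ := hZ2
    rw [add_comm]
    exact Or.inl ⟨2, comp_exchange (hcases m) h0 hZa hYa.1 hm hYj (by rintro rfl; omega), by omega, le_rfl⟩
  -- Now `Y` and `Z` are both all-ones, so no exchange between them is possible. The factorization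
  -- has more than two atoms, which supplies a further atom `W'` without group elements.
  push Not at hY2 hZ2
  have hY1 : Y.2 = fun _ => 1 := by
    funext m; have := hY2 m; have := hupos Y (by simp) m; omega
  have hZ1 : Z.2 = fun _ => 1 := by
    funext m; have := hZ2 m; have := hupos Z (by simp) m; omega
  right
  obtain ⟨W', hW'⟩ := Multiset.card_pos_iff_exists_mem.1 (show 0 < Multiset.card z' by omega)
  have hW'1 : W'.1 = 0 := by
    have := comp_fst_le hW'
    rw [hz1] at this
    exact Multiset.le_zero.1 this
  have hW'e : W' = (0, W'.2) := Prod.ext hW'1 rfl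
  have hW'a : IsAtomIn (T.comp i) (0, W'.2) := hW'e ▸ hza W' hW'
  refine ⟨W', hW', ?_⟩
  have hjj : j ≠ j₁ := by rintro rfl; omega
  by_cases hW2 : ∃ m, 2 ≤ W'.2 m
  · obtain ⟨m, hm⟩ := hW2
    obtain ⟨m', hm'⟩ : ∃ m', m' ≠ m := by
      by_cases h : j = m
      · exact ⟨j₁, by rintro rfl; exact hjj h⟩
      · exact ⟨j, h⟩
    refine ⟨3, ?_, by omega, le_rfl⟩
    have := add_mem_lengthsIn (comp_exchange (hcases m) h0 hW'a hZa.1 hm (j := m') (by rw [hZ1]) hm')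
      hYa.one_mem_lengthsIn
    convert this using 2
    rw [hW'e]
    refine Prod.ext (by simp) ?_
    simp only [Prod.snd_add]; abel
  -- If `W'` is all-ones as well, `Y` and `Z` are combined, one prime `j` is traded for its class,
  -- and that prime is given to `W'`.
  · push Not at hW2
    have hW1 : W'.2 = fun _ => 1 := by
      funext m
      have := hW2 m
      have := comp_pos hW'a.1 (fun h => hW'a.2.1 (Prod.ext rfl h)) m
      simp only at this
      omega
    refine ⟨2, ?_, le_rfl, by omega⟩
    have hc0 : T.cls i j ≠ 0 := hcls ▸ h0
    have hB2 : ((0, Y.2 + Z.2) : T.Comp i) ∈ T.comp i := by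
      have := add_mem hYa.1 hZa.1
      simpa using this
    have hA1 : IsAtomIn (T.comp i) ({T.cls i j}, Y.2 + Z.2 - unitVec T i j) := by
      refine comp_atom_of_one (j := j) (Or.inr ⟨fun m => ?_, ?_⟩) ?_ (singleton_no_zero_sum hc0)
      · have := unitVec_le (T := T) (j := j) (m := m)
        simp only [hY1, hZ1, Pi.sub_apply, Pi.add_apply]; omega
      · have h4 : Y.2 + Z.2 = Y.2 + Z.2 - unitVec T i j + unitVec T i j := by
          funext m
          have := unitVec_le (T := T) (j := j) (m := m)
          simp only [hY1, hZ1, Pi.sub_apply, Pi.add_apply]; omega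
        have h5 := comp_cls hB2
        rw [h4, map_add, phi_unitVec] at h5
        simp only [Multiset.sum_zero, zero_add] at h5
        simp only [Multiset.sum_singleton]
        rwa [add_comm]
      · simp only [hY1, hZ1, Pi.sub_apply, Pi.add_apply, unitVec_self]
    have := add_mem_lengthsIn hA1.one_mem_lengthsIn
      (comp_atom_give hc0 hW'a.1 (m' := j₁) (by rw [hW1]) hjj.symm rfl).one_mem_lengthsIn
    convert this using 2
    rw [hW'e]
    refine Prod.ext ?_ ?_
    · simp only [Prod.fst_add, add_zero]
      rw [← pair_eq_of_cls (hcases j)]; rfl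
    · exact (add_sub_unitVec (by simp [hY1, hZ1]) W'.2).symm

theorem elim : False := by
  by_cases hcard : Multiset.card (U.1 + V.1) ≤ 1
  · exact hc.false_of_card_le_one hcard
  rw [Multiset.card_add] at hcard
  have h1 := hc.card_left
  have h2 := hc.card_right
  obtain ⟨a, ha⟩ := Multiset.card_eq_one.1 (show Multiset.card U.1 = 1 by omega)
  obtain ⟨b, hb⟩ := Multiset.card_eq_one.1 (show Multiset.card V.1 = 1 by omega)
  by_cases hab : a + b = 0
  · refine hc.false_of_add_eq_zero ha ?_
    rw [hb, eq_neg_of_add_eq_zero_right hab]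
  · exact hc.false_of_add_ne_zero ha hb hab

end CritPair

theorem Crit.rank_false {d k : ℕ} {x : T.Amb} (hd : 2 ≤ d)
    (hrank : ∀ i i', 2 ≤ T.rank i → 2 ≤ T.rank i' → i = i') : ¬T.Crit d x k := by
  intro hc
  obtain ⟨i, U, V, h⟩ := hc.exists_critPair hd hrank
  exact h.elim

end BlockData

/-! ### Finite class groups: bounded gaps -/

/-- Covering prescribed values of additive functions by few members of a multiset. -/
theorem exists_le_cover {M K : Type*} [AddCancelCommMonoid M] [Fintype K] (f : K → M →+ ℕ) (m : K → ℕ)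
    {z : Multiset M} (hm : ∀ κ, m κ ≤ f κ z.sum) :
    ∃ P ≤ z, Multiset.card P ≤ ∑ κ, m κ ∧ ∀ κ, m κ ≤ f κ P.sum := by
  classical
  -- Choosing only members with positive value reaches `m κ` after at most `m κ` choices. The union
  -- over all `κ` then works simultaneously.
  have single : ∀ κ, ∃ P ≤ z, Multiset.card P ≤ m κ ∧ m κ ≤ f κ P.sum := by
    intro κ
    have main : ∀ (z : Multiset M) (c : ℕ), c ≤ f κ z.sum →
        ∃ P ≤ z, Multiset.card P ≤ c ∧ c ≤ f κ P.sum := by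
      intro z
      induction z using Multiset.induction_on with
      | empty => exact fun c hc => ⟨0, le_rfl, by simp, hc⟩
      | cons a s ih =>
        intro c hc
        rw [Multiset.sum_cons, map_add] at hc
        by_cases h0 : f κ a = 0
        · obtain ⟨P, h1, h2, h3⟩ := ih c (by omega)
          exact ⟨P, h1.trans (Multiset.le_cons_self s a), h2, h3⟩
        · by_cases hc0 : c = 0
          · exact ⟨0, Multiset.zero_le _, by simp, by omega⟩
          obtain ⟨P, h1, h2, h3⟩ := ih (c - f κ a) (by omega)
          refine ⟨a ::ₘ P, Multiset.cons_le_cons a h1, ?_, ?_⟩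
          · rw [Multiset.card_cons]; omega
          · rw [Multiset.sum_cons, map_add]; omega
    exact main z _ (hm κ)
  choose P h1 h2 h3 using single
  have hmono : ∀ κ {A B : Multiset M}, A ≤ B → f κ A.sum ≤ f κ B.sum := by
    intro κ A B h
    rw [← Multiset.sub_add_cancel h, Multiset.sum_add, map_add]
    omega
  have key : ∀ s : Finset K, ∃ R ≤ z, Multiset.card R ≤ ∑ κ ∈ s, m κ ∧
      ∀ κ ∈ s, m κ ≤ f κ R.sum := by
    intro s
    induction s using Finset.induction_on with
    | empty => exact ⟨0, Multiset.zero_le _, by simp, by simp⟩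
    | insert κ s hκ ih =>
      obtain ⟨R, hR1, hR2, hR3⟩ := ih
      refine ⟨P κ ∪ R, Multiset.union_le (h1 κ) hR1, ?_, ?_⟩
      · rw [Finset.sum_insert hκ]
        have : Multiset.card (P κ ∪ R) ≤ Multiset.card (P κ + R) :=
          Multiset.card_le_card (Multiset.union_le_add _ _)
        rw [Multiset.card_add] at this
        have := h2 κ
        omega
      · intro κ' hκ'
        rcases Finset.mem_insert.1 hκ' with rfl | h
        · exact (h3 κ').trans (hmono κ' Multiset.le_union_left)
        · exact (hR3 κ' h).trans (hmono κ' Multiset.le_union_right)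
  simpa using key Finset.univ

/-- Between a length at most `a` and a length above `a` there is one in `(a, a + N]`, if the gaps
are bounded by `N`. -/
theorem exists_length_gap {L : Set ℕ} {N : ℕ}
    (h : ∀ k ∈ L, ∀ l ∈ L, k < l → ∃ m ∈ L, k < m ∧ m ≤ k + N) {a k l : ℕ} (hk : k ∈ L)
    (hka : k ≤ a) (hl : l ∈ L) (hla : a < l) : ∃ m ∈ L, a < m ∧ m ≤ a + N := by
  induction hd : a - k using Nat.strong_induction_on generalizing k with
  | _ c ih =>
    obtain ⟨m, hm, h1, h2⟩ := h k hk l hl (by omega)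
    by_cases hma : m ≤ a
    · exact ih (a - m) (by omega) hm hma rfl
    · exact ⟨m, hm, by omega, by omega⟩

namespace BlockData

variable {G : Type*} [AddCommGroup G] {ι : Type*} {T : BlockData G ι} [Fintype ι] [DecidableEq ι]
  {n : ℕ}

section Exponent

variable (hn : ∀ g : G, n • g = 0)
include hn

theorem phi_nsmul (i : ι) (e : Fin (T.rank i) → ℕ) : T.phi i (n • e) = 0 := by
  rw [map_nsmul, hn]

theorem add_cel_mem {u : T.Amb} (hu : u ∈ T.block) {i : ι} (hi : u.2 i ≠ 0)
    (e : Fin (T.rank i) → ℕ) : u + T.cel i 0 (n • e) ∈ T.block := by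
  refine mem_of_eq_off i hu (fun i' h => ?_) ?_ ?_
  · rw [Prod.snd_add, Pi.add_apply, cel_snd_ne h, add_zero]
  · rw [map_add, hu.2, tot_cel, add_zero]
  · rw [Prod.snd_add, Pi.add_apply, cel_snd_self]
    refine Or.inr ⟨fun j => ?_, ?_⟩
    · have := (hu.1 i).pos hi j
      simp only [Prod.snd_add, Pi.add_apply]; omega
    · rw [Prod.fst_add, Prod.snd_add, map_add, phi_nsmul hn, add_zero, add_zero]
      exact (hu.1 i).cls_mem

theorem mem_of_add_cel_mem {u : T.Amb} {i : ι} {e : Fin (T.rank i) → ℕ}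
    (h : u + T.cel i 0 (n • e) ∈ T.block) (hi : ∀ j, 0 < (u.2 i).2 j) : u ∈ T.block := by
  refine mem_of_eq_off i h (fun i' h => ?_) ?_ (Or.inr ⟨hi, ?_⟩)
  · rw [Prod.snd_add, Pi.add_apply, cel_snd_ne h, add_zero]
  · have := h.2
    rwa [map_add, tot_cel, add_zero] at this
  · have := (h.1 i).cls_mem
    rwa [Prod.snd_add, Pi.add_apply, cel_snd_self, Prod.fst_add, Prod.snd_add, map_add,
      phi_nsmul hn, add_zero, add_zero] at this

theorem atom_of_add_cel_atom {u : T.Amb} {i : ι} {e : Fin (T.rank i) → ℕ}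
    (h : IsAtomIn T.block (u + T.cel i 0 (n • e))) (hi : ∀ j, 0 < (u.2 i).2 j) :
    IsAtomIn T.block u := by
  have main : ∀ v ∈ T.block, ∀ w ∈ T.block, v + w = u → v.2 i ≠ 0 → w = 0 := by
    intro v hv w hw hvw hvi
    rcases h.2.2 _ (add_cel_mem hn hv hvi e) w hw (by rw [← hvw]; abel) with h1 | h1
    · rw [eq_zero_of_add_eq_zero_in (B := T.block) eq_zero_of_deg hv h1] at hvi
      exact absurd rfl hvi
    · exact h1
  have hui : u.2 i ≠ 0 := fun h0 => by
    have := hi ⟨0, T.rank_pos i⟩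
    rw [h0] at this
    exact absurd this (lt_irrefl _)
  refine ⟨mem_of_add_cel_mem hn h.1 hi, fun h0 => hui (by rw [h0]; rfl), fun v hv w hw hvw => ?_⟩
  by_cases hvi : v.2 i = 0
  · left
    refine main w hw v hv (by rw [add_comm, hvw]) fun hwi => hui ?_
    rw [← hvw, Prod.snd_add, Pi.add_apply, hvi, hwi, add_zero]
  · exact Or.inr (main v hv w hw hvw hvi)

/-- If all entries exceeded `n`, the piece with all entries `n`, which has class 0, would split off.
-/
theorem exists_le_of_atom (hn0 : 0 < n) {u : T.Amb} (hu : IsAtomIn T.block u) (i : ι) :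
    ∃ j, (u.2 i).2 j ≤ n := by
  by_contra hcon
  push Not at hcon
  obtain ⟨a, ha⟩ := exists_eq_add_cel (x := u) (i := i) 0 (k := n • (1 : Fin (T.rank i) → ℕ))
    fun j => by simpa using (hcon j).le
  have hapos : ∀ j, 0 < (a.2 i).2 j := by
    intro j
    have := hcon j
    rw [ha] at this
    simp at this
    omega
  have hab : a ∈ T.block := mem_of_add_cel_mem hn (ha ▸ hu.1) hapos
  have j0 : Fin (T.rank i) := ⟨0, T.rank_pos i⟩
  have hcb : T.cel i 0 (n • (1 : Fin (T.rank i) → ℕ)) ∈ T.block := by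
    refine mem_of_add_mem hab (ha ▸ hu.1) fun i' => ?_
    by_cases h : i' = i
    · subst h
      right
      intro j
      simpa using hn0
    · exact Or.inl (cel_snd_ne h _ _)
  rcases hu.2.2 a hab _ hcb ha.symm with h | h
  · have := hapos j0
    rw [h] at this
    exact absurd this (lt_irrefl _)
  · have : (T.cel i 0 (n • (1 : Fin (T.rank i) → ℕ))).2 i = 0 := by rw [h]; rfl
    rw [cel_snd_self] at this
    have := congrFun (congrArg Prod.snd this) j0
    simp at this
    omega

/-- Already `n` copies of `g` have sum zero and would split off. -/
theorem count_le_of_atom [DecidableEq G] (hn0 : 0 < n) {u : T.Amb} (hu : IsAtomIn T.block u)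
    (g : G) : u.1.count g ≤ n := by
  by_contra hcon
  push Not at hcon
  have hle : Multiset.replicate n g ≤ u.1 := Multiset.le_count_iff_replicate_le.1 hcon.le
  obtain ⟨t, ht⟩ := Multiset.le_iff_exists_add.1 hle
  have hs : ((Multiset.replicate n g, 0) : T.Amb) ∈ T.block :=
    seq_mem (by rw [Multiset.sum_replicate, hn])
  have hu1 : ((Multiset.replicate n g, 0) : T.Amb) + (t, u.2) = u :=
    Prod.ext ht.symm (zero_add _)
  have htb : ((t, u.2) : T.Amb) ∈ T.block :=
    ⟨hu.1.1, by have := hu.1.2; rwa [← hu1, map_add, hs.2, zero_add] at this⟩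
  rcases hu.2.2 _ hs _ htb hu1 with h | h
  · have := congrArg Multiset.card (congrArg Prod.fst h)
    simp at this
    omega
  · have : t = 0 := congrArg Prod.fst h
    rw [ht, this] at hcon
    simp at hcon

theorem card_le_of_atom [Fintype G] (hn0 : 0 < n) {u : T.Amb} (hu : IsAtomIn T.block u) :
    Multiset.card u.1 ≤ Fintype.card G * n := by
  classical
  rw [← Multiset.sum_count_eq_card (s := Finset.univ) (fun a _ => Finset.mem_univ a)]
  calc ∑ g, u.1.count g ≤ ∑ _g : G, n := Finset.sum_le_sum fun g _ => count_le_of_atom hn hn0 hu g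
    _ = _ := by simp

/-- Replace one factor by an atom with smaller exponents, moving multiples of `n` elsewhere. -/
theorem exists_shrink (hn0 : 0 < n) {V : T.Amb} {z : Multiset T.Amb} (hV : IsAtomIn T.block V)
    (hz : ∀ u ∈ z, u ∈ T.block ∧ u ≠ 0) (s : Finset ι) :
    ∃ (V' : T.Amb) (z' : Multiset T.Amb), IsAtomIn T.block V' ∧ (∀ u ∈ z', u ∈ T.block ∧ u ≠ 0) ∧
      Multiset.card z' = Multiset.card z ∧ V' + z'.sum = V + z.sum ∧
      ∀ i ∈ s, (∀ j, (V'.2 i).2 j ≤ n) ∨ z'.sum.2 i = 0 := by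
  induction s using Finset.induction_on with
  | empty => exact ⟨V, z, hV, hz, rfl, rfl, by simp⟩
  | insert i s hi ih =>
    obtain ⟨V', z', hV', hz', hcard, hsum, hs⟩ := ih
    by_cases h0 : z'.sum.2 i = 0
    · refine ⟨V', z', hV', hz', hcard, hsum, fun i' hi' => ?_⟩
      rcases Finset.mem_insert.1 hi' with rfl | h
      exacts [Or.inr h0, hs i' h]
    by_cases hV0 : V'.2 i = 0
    · refine ⟨V', z', hV', hz', hcard, hsum, fun i' hi' => ?_⟩
      rcases Finset.mem_insert.1 hi' with rfl | h
      exacts [Or.inl (by simp [hV0]), hs i' h]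
    obtain ⟨u, hu, hui⟩ := exists_ne_of_sum_ne h0
    obtain ⟨t, rfl⟩ := Multiset.exists_cons_of_mem hu
    -- After subtracting `n • e` the entries lie between 1 and `n`. The surplus goes to a factor `u`
    -- that already meets `i`.
    set e : Fin (T.rank i) → ℕ := fun j => ((V'.2 i).2 j - 1) / n with he
    have hdm : ∀ j, n * e j + ((V'.2 i).2 j - 1) % n = (V'.2 i).2 j - 1 := fun j =>
      Nat.div_add_mod _ _
    have hlt : ∀ j, ((V'.2 i).2 j - 1) % n < n := fun j => Nat.mod_lt _ hn0
    have hpos : ∀ j, 0 < (V'.2 i).2 j := (hV'.1.1 i).pos hV0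
    obtain ⟨W, hW⟩ := exists_eq_add_cel (x := V') (i := i) 0 (k := n • e) fun j => by
      have := hdm j
      have := hpos j
      simp only [Pi.smul_apply, smul_eq_mul]; omega
    have hWj : ∀ j, (W.2 i).2 j = ((V'.2 i).2 j - 1) % n + 1 := by
      intro j
      have h1 := hdm j
      have h2 := hpos j
      have h3 := congrArg (fun y : T.Amb => (y.2 i).2 j) hW
      simp at h3
      omega
    refine ⟨W, (u + T.cel i 0 (n • e)) ::ₘ t, ?_, ?_, by simpa using hcard, ?_, ?_⟩
    · exact atom_of_add_cel_atom hn (hW ▸ hV') fun j => by rw [hWj]; omega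
    · intro v hv
      rcases Multiset.mem_cons.1 hv with rfl | h
      · have hub := hz' u (Multiset.mem_cons_self u t)
        refine ⟨add_cel_mem hn hub.1 hui e, fun h => hub.2 ?_⟩
        exact eq_zero_of_add_eq_zero_in (B := T.block) eq_zero_of_deg hub.1 h
      · exact hz' v (Multiset.mem_cons_of_mem h)
    · rw [← hsum, Multiset.sum_cons, Multiset.sum_cons]
      conv_rhs => rw [hW]
      abel
    · intro i' hi'
      rcases Finset.mem_insert.1 hi' with rfl | h
      · left
        intro j
        rw [hWj]
        exact hlt j
      · have hne : i' ≠ i := fun h' => hi (h' ▸ h)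
        have h1 : W.2 i' = V'.2 i' := by
          conv_rhs => rw [hW]
          rw [Prod.snd_add, Pi.add_apply, cel_snd_ne hne, add_zero]
        have h2 : ((u + T.cel i 0 (n • e)) ::ₘ t).sum.2 i' = (u ::ₘ t).sum.2 i' := by
          rw [Multiset.sum_cons, Multiset.sum_cons]
          simp only [Prod.snd_add, Pi.add_apply]
          rw [cel_snd_ne hne, add_zero]
        rw [h1, h2]
        exact hs i' h

/-- Take multiples of `n` away from prescribed coordinates of a factorization. -/
theorem exists_take {z : Multiset T.Amb} (hz : ∀ u ∈ z, IsAtomIn T.block u) {i : ι}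
    (J : Finset (Fin (T.rank i))) (hJ : ∀ j ∈ J, ∃ u ∈ z, n < (u.2 i).2 j) :
    ∃ (z' : Multiset T.Amb) (e : Fin (T.rank i) → ℕ), (∀ u ∈ z', IsAtomIn T.block u) ∧
      Multiset.card z' = Multiset.card z ∧ z.sum = z'.sum + T.cel i 0 (n • e) ∧
      (∀ j ∈ J, e j = 1) ∧ (∀ j, j ∉ J → e j = 0) ∧
      ∀ j, j ∉ J → (∃ u ∈ z, n < (u.2 i).2 j) → ∃ u ∈ z', n < (u.2 i).2 j := by
  induction J using Finset.induction_on with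
  | empty =>
    refine ⟨z, 0, hz, rfl, ?_, by simp, fun _ _ => rfl, fun _ _ h => h⟩
    rw [smul_zero, show T.cel i 0 0 = 0 by
      refine Prod.ext rfl ?_
      simp only [cel]
      exact Pi.single_zero i, add_zero]
  | insert j J hj ih =>
    obtain ⟨z', e, hz', hcard, hsum, he1, he0, hk⟩ := ih fun j' h => hJ j' (Finset.mem_insert_of_mem h)
    obtain ⟨u, hu, huj⟩ := hk j hj (hJ j (Finset.mem_insert_self j J))
    obtain ⟨t, rfl⟩ := Multiset.exists_cons_of_mem hu
    have hui : u.2 i ≠ 0 := fun h => by rw [h] at huj; exact absurd huj (by simp)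
    have hpos := ((hz' u hu).1.1 i).pos hui
    obtain ⟨a, ha⟩ := exists_eq_add_cel (x := u) (i := i) 0 (k := n • unitVec T i j) fun j' => by
      by_cases h : j' = j
      · subst h; simp [unitVec_self]; omega
      · simp [unitVec_ne h]
    have haj : ∀ j', (u.2 i).2 j' = (a.2 i).2 j' + n * unitVec T i j j' := by
      intro j'
      conv_lhs => rw [ha]
      simp
    have hat : IsAtomIn T.block a := by
      refine atom_of_add_cel_atom hn (ha ▸ hz' u hu) fun j' => ?_
      have h1 := haj j'
      have h2 := hpos j'
      by_cases h : j' = j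
      · subst h; rw [unitVec_self] at h1; omega
      · rw [unitVec_ne h] at h1; omega
    refine ⟨a ::ₘ t, e + unitVec T i j, ?_, by simpa using hcard, ?_, ?_, ?_, ?_⟩
    · intro v hv
      rcases Multiset.mem_cons.1 hv with rfl | h
      · exact hat
      · exact hz' v (Multiset.mem_cons_of_mem h)
    · rw [hsum, Multiset.sum_cons, Multiset.sum_cons, smul_add]
      have : T.cel i 0 (n • e + n • unitVec T i j) =
          T.cel i 0 (n • e) + T.cel i 0 (n • unitVec T i j) := by
        refine Prod.ext (by simp) ?_
        simp only [cel, Prod.snd_add]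
        rw [← Pi.single_add]
        simp
      rw [this]
      conv_lhs => rw [ha]
      abel
    · intro j' hj'
      rcases Finset.mem_insert.1 hj' with rfl | h
      · simp [he0 j' hj, unitVec_self]
      · have : j' ≠ j := fun h' => hj (h' ▸ h)
        simp [he1 j' h, unitVec_ne this]
    · intro j' hj'
      rw [Finset.mem_insert, not_or] at hj'
      simp [he0 j' hj'.2, unitVec_ne hj'.1]
    · intro j' hj' hex
      rw [Finset.mem_insert, not_or] at hj'
      obtain ⟨v, hv, hvj⟩ := hk j' hj'.2 hex
      rcases Multiset.mem_cons.1 hv with rfl | h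
      · refine ⟨a, Multiset.mem_cons_self a t, ?_⟩
        have := haj j'
        rw [unitVec_ne hj'.1] at this
        omega
      · exact ⟨v, Multiset.mem_cons_of_mem h, hvj⟩

end Exponent

/-- Lengths are bounded in terms of one coordinate for each index. -/
theorem length_le_of_choice {x : T.Amb} {l : ℕ} (j : ∀ i, Fin (T.rank i))
    (h : l ∈ lengthsIn T.block x) : l ≤ Multiset.card x.1 + ∑ i, (x.2 i).2 (j i) := by
  let f : T.Amb →+ ℕ :=
    { toFun := fun x => Multiset.card x.1 + ∑ i, (x.2 i).2 (j i)
      map_zero' := by simp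
      map_add' := fun a b => by simp [Finset.sum_add_distrib]; ring }
  refine length_le_deg (f := f) (fun y hy h0 => ?_) h
  have h0' : Multiset.card y.1 + ∑ i, (y.2 i).2 (j i) = 0 := h0
  refine Prod.ext (Multiset.card_eq_zero.1 (by omega)) (funext fun i => ?_)
  have h1 : ∑ i, (y.2 i).2 (j i) = 0 := by omega
  exact (hy.1 i).eq_zero (Finset.sum_eq_zero_iff.1 h1 i (Finset.mem_univ i))

end BlockData

namespace BlockData

variable {G : Type*} [AddCommGroup G] {ι : Type*} {T : BlockData G ι} [Fintype ι] [DecidableEq ι]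
  {n : ℕ}

/-- A multiset of atoms dividing a factorization and covering an atom. -/
theorem exists_cover_atom [Fintype G] (hn : ∀ g : G, n • g = 0) (hn0 : 0 < n) {z : Multiset T.Amb}
    (hz : ∀ u ∈ z, IsAtomIn T.block u) {V R : T.Amb} (hV : IsAtomIn T.block V) (hR : R ∈ T.block)
    (hsum : V + R = z.sum) (hVR : ∀ i, (∀ j, (V.2 i).2 j ≤ n) ∨ R.2 i = 0) :
    ∃ P ≤ z, Multiset.card P ≤ Fintype.card G * n + ∑ i, T.rank i * (n + 1) ∧
      ∃ y ∈ T.block, P.sum = V + y := by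
  classical
  let f : G ⊕ (Σ i, Fin (T.rank i)) → T.Amb →+ ℕ := fun κ => match κ with
    | .inl g => (Multiset.countAddMonoidHom g).comp (AddMonoidHom.fst _ _)
    | .inr p => 
      { toFun := fun x => (x.2 p.1).2 p.2
        map_zero' := rfl
        map_add' := fun _ _ => rfl }
  -- Exponents are only covered up to `n + 1`. This exceeds the entries of `V` where they are
  -- bounded by `n`; and if a total exponent is at most `n`, the cover carries everything at that
  -- index.
  let m : G ⊕ (Σ i, Fin (T.rank i)) → ℕ := fun κ => match κ with
    | .inl g => V.1.count g
    | .inr p => min (n + 1) ((z.sum.2 p.1).2 p.2)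
  obtain ⟨P, hPz, hPc, hPm⟩ := exists_le_cover f m (z := z) (by
    rintro (g | p)
    · change V.1.count g ≤ z.sum.1.count g
      rw [← hsum, Prod.fst_add, Multiset.count_add]
      omega
    · exact min_le_right _ _)
  have hP1 : V.1 ≤ P.sum.1 := Multiset.le_iff_count.2 fun g => hPm (.inl g)
  have hP2 : ∀ i j, min (n + 1) ((z.sum.2 i).2 j) ≤ (P.sum.2 i).2 j := fun i j =>
    hPm (.inr ⟨i, j⟩)
  have hzP : ∀ u ∈ z - P, IsAtomIn T.block u := fun u hu =>
    hz u (Multiset.mem_of_le (Multiset.sub_le_self _ _) hu)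
  have hPb : P.sum ∈ T.block :=
    sum_mem_of_atoms fun u hu => hz u (Multiset.mem_of_le hPz hu)
  have hPsum : (z - P).sum + P.sum = z.sum := by
    rw [← Multiset.sum_add, Multiset.sub_add_cancel hPz]
  have hwhole : ∀ i j, (z.sum.2 i).2 j ≤ n → P.sum.2 i = V.2 i + R.2 i := by
    intro i j hj
    have h1 := hP2 i j
    have h2 : (z.sum.2 i).2 j = ((z - P).sum.2 i).2 j + (P.sum.2 i).2 j := by rw [← hPsum]; rfl
    have h3 : (z - P).sum.2 i = 0 :=
      ((sum_mem_of_atoms hzP).1 i).eq_zero (j := j) (by omega)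
    have h4 : z.sum.2 i = (z - P).sum.2 i + P.sum.2 i := by rw [← hPsum]; rfl
    rw [h3, zero_add, ← hsum] at h4
    exact h4.symm
  have hcov : ∀ i, P.sum.2 i = V.2 i + R.2 i ∨ ∀ j, (V.2 i).2 j < (P.sum.2 i).2 j := by
    intro i
    by_cases hex : ∃ j, (z.sum.2 i).2 j ≤ n
    · obtain ⟨j, hj⟩ := hex
      exact Or.inl (hwhole i j hj)
    · push Not at hex
      right
      intro j
      rcases hVR i with h | h
      · have := hP2 i j
        have := hex j
        have := h j
        omega
      · obtain ⟨j', hj'⟩ := exists_le_of_atom hn hn0 hV i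
        have h1 := hex j'
        rw [← hsum, Prod.snd_add, Pi.add_apply, h, add_zero] at h1
        omega
  refine ⟨P, hPz, hPc.trans ?_, (P.sum.1 - V.1, fun i => ((P.sum.2 i).1 - (V.2 i).1,
    (P.sum.2 i).2 - (V.2 i).2)), ?_, ?_⟩
  · rw [Fintype.sum_sum_type, Fintype.sum_sigma]
    refine add_le_add ?_ (Finset.sum_le_sum fun i _ => ?_)
    · have : ∑ g, m (.inl g) = Multiset.card V.1 :=
        Multiset.sum_count_eq_card (s := Finset.univ) (fun a _ => Finset.mem_univ a)
      rw [this]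
      exact card_le_of_atom hn hn0 hV
    · calc ∑ j, m (.inr ⟨i, j⟩) ≤ ∑ _j : Fin (T.rank i), (n + 1) :=
            Finset.sum_le_sum fun j _ => min_le_left _ _
        _ = _ := by simp
  all_goals
    have hsplit : P.sum = V + (P.sum.1 - V.1, fun i => ((P.sum.2 i).1 - (V.2 i).1,
        (P.sum.2 i).2 - (V.2 i).2)) := by
      refine Prod.ext (add_tsub_cancel_of_le hP1).symm (funext fun i => ?_)
      refine Prod.ext (by simp) (funext fun j => ?_)
      have : (V.2 i).2 j ≤ (P.sum.2 i).2 j := by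
        rcases hcov i with h | h
        · rw [h]; simp
        · exact (h j).le
      simp only [Prod.snd_add, Pi.add_apply, Pi.sub_apply]
      omega
  · refine mem_of_add_mem hV.1 (hsplit ▸ hPb) fun i => ?_
    rcases hcov i with h | h
    · rcases hR.1 i with h0 | h0
      · left
        simp [h, h0]
      · right
        intro j
        have := h0.1 j
        simp only [h, Prod.snd_add, Pi.add_apply, Pi.sub_apply]
        omega
    · right
      intro j
      have := h j
      simp only [Pi.sub_apply]
      omega
  · exact hsplit

/-- Either there is a slightly longer factorization, or all lengths are bounded in terms of the
given one. -/
theorem exists_longer_or_bounded [Fintype G] (hn : ∀ g : G, n • g = 0) (hn0 : 0 < n)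
    {z : Multiset T.Amb} (hz : ∀ u ∈ z, IsAtomIn T.block u) :
    (∃ m ∈ lengthsIn T.block z.sum, Multiset.card z < m ∧
      m ≤ Multiset.card z + (Fintype.card G * n + Fintype.card ι * (2 * n))) ∨
    ∀ l ∈ lengthsIn T.block z.sum,
      l ≤ Multiset.card z * (Fintype.card G * n + Fintype.card ι * n) := by
  classical
  -- A coordinate at each index that is small in all atoms bounds all lengths linearly in `|z|`.
  -- Otherwise some index has, in every coordinate, an atom with exponent above `n`. Multiples of
  -- `n` are then moved to one atom until all its entries exceed `n`; it ceases to be an atom, while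
  -- its lengths stay bounded.
  by_cases hall : ∀ i, ∃ j, ∀ u ∈ z, (u.2 i).2 j ≤ n
  · right
    choose j hj using hall
    intro l hl
    refine (length_le_of_choice j hl).trans ?_
    clear hl
    induction z using Multiset.induction_on with
    | empty => simp
    | cons a s ih =>
      have ha := Multiset.mem_cons_self a s
      have h1 := ih (fun u hu => hz u (Multiset.mem_cons_of_mem hu))
        fun i u hu => hj i u (Multiset.mem_cons_of_mem hu)
      have h2 := card_le_of_atom hn hn0 (hz a ha)
      have h3 : ∑ i, (a.2 i).2 (j i) ≤ Fintype.card ι * n :=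
        calc ∑ i, (a.2 i).2 (j i) ≤ ∑ _i : ι, n := Finset.sum_le_sum fun i _ => hj i a ha
          _ = _ := by simp
      have h4 : ∑ i, ((a ::ₘ s).sum.2 i).2 (j i) =
          ∑ i, (a.2 i).2 (j i) + ∑ i, (s.sum.2 i).2 (j i) := by
        rw [← Finset.sum_add_distrib, Multiset.sum_cons]; rfl
      have h5 : Multiset.card (a ::ₘ s).sum.1 = Multiset.card a.1 + Multiset.card s.sum.1 := by
        rw [Multiset.sum_cons]; simp
      rw [h4, h5, Multiset.card_cons, add_mul, one_mul]
      omega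
  · left
    push Not at hall
    obtain ⟨i, hi⟩ := hall
    obtain ⟨U, hU, hUi⟩ := hi ⟨0, T.rank_pos i⟩
    obtain ⟨t, rfl⟩ := Multiset.exists_cons_of_mem hU
    have hUa := hz U hU
    have hUi0 : U.2 i ≠ 0 := fun h => by rw [h] at hUi; exact absurd hUi (by simp)
    set J : Finset (Fin (T.rank i)) := Finset.univ.filter fun j => (U.2 i).2 j ≤ n with hJ
    obtain ⟨z', e, hz', hcard, hsum, he1, he0, -⟩ := exists_take hn
      (fun u hu => hz u (Multiset.mem_cons_of_mem hu)) (i := i) J (fun j hj => by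
        obtain ⟨u, hu, huj⟩ := hi j
        rcases Multiset.mem_cons.1 hu with rfl | h
        · have := (Finset.mem_filter.1 hj).2
          omega
        · exact ⟨u, h, huj⟩)
    have hU'b : U + T.cel i 0 (n • e) ∈ T.block := add_cel_mem hn hUa.1 hUi0 e
    have hU'i : ∀ j, ((U + T.cel i 0 (n • e)).2 i).2 j = (U.2 i).2 j + n * e j := fun j => by simp
    have hbig : ∀ j, n < ((U + T.cel i 0 (n • e)).2 i).2 j := by
      intro j
      rw [hU'i]
      by_cases hj : j ∈ J
      · rw [he1 j hj]
        have := (hUa.1.1 i).pos hUi0 j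
        omega
      · have : ¬ (U.2 i).2 j ≤ n := fun h => hj (Finset.mem_filter.2 ⟨Finset.mem_univ j, h⟩)
        omega
    obtain ⟨l, hl⟩ := exists_length (B := T.block) eq_zero_of_deg hU'b
    have hl2 : 2 ≤ l := by
      by_contra hlt
      have h0 : U + T.cel i 0 (n • e) ≠ 0 := fun h => by
        have := hbig ⟨0, T.rank_pos i⟩
        rw [h] at this
        exact absurd this (by simp)
      have := length_pos h0 hl
      obtain ⟨w, hw, hws, hwc⟩ := hl
      obtain ⟨v, rfl⟩ := Multiset.card_eq_one.1 (show Multiset.card w = 1 by omega)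
      rw [Multiset.sum_singleton] at hws
      obtain ⟨j, hj⟩ := exists_le_of_atom hn hn0 (hws ▸ hw v (by simp)) i
      have := hbig j
      omega
    choose j hj using fun i => exists_le_of_atom hn hn0 hUa i
    have hlb : l ≤ Fintype.card G * n + Fintype.card ι * (2 * n) := by
      refine (length_le_of_choice j hl).trans (add_le_add ?_ ?_)
      · simpa using card_le_of_atom hn hn0 hUa
      · calc ∑ i', ((U + T.cel i 0 (n • e)).2 i').2 (j i') ≤ ∑ _i : ι, 2 * n := by
              refine Finset.sum_le_sum fun i' _ => ?_
              by_cases h : i' = i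
              · subst h
                rw [hU'i]
                by_cases hj' : j i' ∈ J
                · rw [he1 _ hj']
                  have := hj i'
                  omega
                · rw [he0 _ hj']
                  have := hj i'
                  omega
              · rw [Prod.snd_add, Pi.add_apply, cel_snd_ne h, add_zero]
                have := hj i'
                omega
          _ = _ := by simp
    refine ⟨l + Multiset.card z', ?_, ?_, ?_⟩
    · have := add_mem_lengthsIn hl (card_mem_lengthsIn hz')
      rwa [add_assoc, add_comm (T.cel i 0 (n • e)), ← hsum, ← Multiset.sum_cons] at this
    · rw [Multiset.card_cons]; omega
    · rw [Multiset.card_cons]; omega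

/-- If the class group is finite, then the gaps in sets of lengths are bounded. -/
theorem exists_gap_bound [Finite G] (T : BlockData G ι) : ∃ N, ∀ x ∈ T.block,
    ∀ k ∈ lengthsIn T.block x, ∀ l ∈ lengthsIn T.block x, k < l →
      ∃ m ∈ lengthsIn T.block x, k < m ∧ m ≤ k + N := by
  classical
  have := Fintype.ofFinite G
  set n := Nat.card G with hnG
  have hn : ∀ g : G, n • g = 0 := fun g => card_nsmul_eq_zero'
  have hn0 : 0 < n := Nat.card_pos
  set C₁ := Fintype.card G * n + ∑ i, T.rank i * (n + 1) with hC₁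
  set C₂ := Fintype.card G * n + Fintype.card ι * (2 * n) with hC₂
  set C₃ := C₁ * (Fintype.card G * n + Fintype.card ι * n) with hC₃
  refine ⟨C₂ + C₃, fun x hx => ?_⟩
  induction hd : T.deg x using Nat.strong_induction_on generalizing x with
  | _ D ih =>
    rintro k ⟨z, hz, hzx, rfl⟩ l ⟨w, hw, hwx, rfl⟩ hkl
    by_cases hkC : Multiset.card z ≤ C₁
    · rcases exists_longer_or_bounded hn hn0 hz with ⟨m, hm, h1, h2⟩ | h
      · exact ⟨m, hzx ▸ hm, h1, by omega⟩
      · refine ⟨_, ⟨w, hw, hwx, rfl⟩, hkl, ?_⟩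
        have h1 := h (Multiset.card w) (by rw [hzx, ← hwx]; exact card_mem_lengthsIn hw)
        have h2 := Nat.mul_le_mul_right (Fintype.card G * n + Fintype.card ι * n) hkC
        omega
    push Not at hkC
    -- An atom of the longer factorization is shrunk to `V` and covered by a part `P` of `z` with at
    -- most `C₁` atoms. Since `z` is longer than that, `P` is a proper part.
    obtain ⟨V₀, hV₀⟩ := Multiset.card_pos_iff_exists_mem.1 (show 0 < Multiset.card w by omega)
    obtain ⟨w₀, rfl⟩ := Multiset.exists_cons_of_mem hV₀
    obtain ⟨V, w', hV, hw', hcard, hsum, hVw⟩ := exists_shrink hn hn0 (hw V₀ hV₀)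
      (fun u hu => ⟨(hw u (Multiset.mem_cons_of_mem hu)).1,
        (hw u (Multiset.mem_cons_of_mem hu)).2.1⟩) Finset.univ
    have hR : w'.sum ∈ T.block := T.block.multiset_sum_mem w' fun u hu => (hw' u hu).1
    have hVR : V + w'.sum = x := by rw [hsum, ← Multiset.sum_cons, hwx]
    obtain ⟨P, hPz, hPc, y, hy, hPy⟩ := exists_cover_atom hn hn0 hz hV hR (hVR.trans hzx.symm)
      fun i => hVw i (Finset.mem_univ i)
    have hzP : ∀ u ∈ z - P, IsAtomIn T.block u := fun u hu =>
      hz u (Multiset.mem_of_le (Multiset.sub_le_self _ _) hu)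
    have hzPc : Multiset.card (z - P) = Multiset.card z - Multiset.card P :=
      Multiset.card_sub hPz
    have hPx : P.sum + (z - P).sum = x := by
      rw [← Multiset.sum_add, add_comm, Multiset.sub_add_cancel hPz, hzx]
    have hdeg : ∀ {a b : T.Amb}, a + b = x → b ∈ T.block → b ≠ 0 → T.deg a < D := by
      intro a b hab hb hb0
      have h1 := mt (eq_zero_of_deg b hb) hb0
      rw [← hd, ← hab, map_add]
      omega
    have hz0 : (z - P).sum ≠ 0 := fun h => by
      have := eq_zero_of_mem_of_sum_eq_zero (B := T.block) eq_zero_of_deg hzP h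
      rw [this, Multiset.card_zero] at hzPc
      omega
    obtain ⟨c, hc⟩ := exists_length (B := T.block) eq_zero_of_deg hy
    -- If `V + y` gives a longer factorization of `P.sum`, the induction hypothesis for this proper
    -- part suffices. Otherwise `V` is cancelled: the rest has a length at most `|z| - 1` and one
    -- above it, and the induction hypothesis bounds the step across.
    by_cases hcP : Multiset.card P < 1 + c
    · have hPb : P.sum ∈ T.block := hPy ▸ add_mem hV.1 hy
      obtain ⟨m, hm, h1, h2⟩ := ih _ (hdeg hPx (sum_mem_of_atoms hzP) hz0) _ hPb rfl
        (Multiset.card P) (card_mem_lengthsIn fun u hu => hz u (Multiset.mem_of_le hPz hu))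
        (1 + c) (hPy ▸ add_mem_lengthsIn hV.one_mem_lengthsIn hc) hcP
      refine ⟨m + Multiset.card (z - P), hPx ▸ add_mem_lengthsIn hm (card_mem_lengthsIn hzP), ?_, ?_⟩
      · omega
      · omega
    · have hRy : w'.sum = y + (z - P).sum := by
        have : V + w'.sum = V + (y + (z - P).sum) := by rw [hVR, ← add_assoc, ← hPy, hPx]
        exact add_left_cancel this
      obtain ⟨l', hl', hle⟩ := exists_length_ge (B := T.block) eq_zero_of_deg hw'
      rw [Multiset.card_cons] at hkl
      obtain ⟨m, hm, h1, h2⟩ := exists_length_gap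
        (ih _ (hdeg (a := w'.sum) (b := V) (by rw [add_comm, hVR]) hV.1 hV.2.1) _ hR rfl)
        (a := Multiset.card z - 1)
        (hRy ▸ add_mem_lengthsIn hc (card_mem_lengthsIn hzP)) (by omega) hl' (by omega)
      refine ⟨1 + m, hVR ▸ add_mem_lengthsIn hV.one_mem_lengthsIn hm, by omega, by omega⟩

theorem exists_distance_bound [Finite G] (T : BlockData G ι) :
    ∃ N, ∀ d ∈ distancesIn T.block, d ≤ N := by
  obtain ⟨N, hN⟩ := exists_gap_bound T
  refine ⟨N, fun d hd => ?_⟩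
  simp only [distancesIn, Set.mem_iUnion] at hd
  obtain ⟨x, hx, hd0, k, hk, l, hl, rfl, hI⟩ := hd
  obtain ⟨m, hm, h1, h2⟩ := hN x hx k hk _ hl (by omega)
  by_contra hcon
  have : m ∈ Set.Icc k (k + d) ∩ lengthsIn T.block x := ⟨⟨by omega, by omega⟩, hm⟩
  rw [hI] at this
  simp at this
  omega

end BlockData

/-! ### Infinite class groups: all distances -/

section Independent

variable {G : Type*} [AddCommGroup G]

theorem Multiset.exists_eq_sum_of_le_sum {κ : Type*} (s : Finset κ) (f : κ → Multiset G)
    {t : Multiset G} (h : t ≤ ∑ i ∈ s, f i) :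
    ∃ t' : κ → Multiset G, (∀ i ∈ s, t' i ≤ f i) ∧ t = ∑ i ∈ s, t' i := by
  classical
  induction s using Finset.induction_on generalizing t with
  | empty => exact ⟨0, by simp, by simpa using h⟩
  | insert i s hi ih =>
    rw [Finset.sum_insert hi] at h
    obtain ⟨t', h1, h2⟩ := ih (t := t - f i) (by rwa [tsub_le_iff_left])
    refine ⟨Function.update t' i (t ∩ f i), fun j hj => ?_, ?_⟩
    · by_cases hji : j = i
      · subst hji; simpa using Multiset.inter_le_right
      · rw [Function.update_of_ne hji]
        exact h1 j ((Finset.mem_insert.1 hj).resolve_left hji)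
    · rw [Finset.sum_insert hi, Function.update_self, Finset.sum_congr rfl
        (fun j hj => Function.update_of_ne (ne_of_mem_of_not_mem hj hi) _ _), ← h2, add_comm]
      exact (Multiset.sub_add_inter t (f i)).symm

/-- Otherwise doubling maps the infinite complement of `F` into `F`, so infinitely many elements
share a double. Their differences with one of them are infinitely many elements with double 0, and
one lies outside `F`. -/
theorem exists_next [Infinite G] {F : Set G} (hF : F.Finite) :
    ∃ e, e ∉ F ∧ (2 • e ∉ F ∨ 2 • e = 0) := by
  by_contra hcon
  push Not at hcon
  have hinf : (Fᶜ : Set G).Infinite := hF.infinite_compl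
  obtain ⟨f, -, hf⟩ : ∃ f ∈ F, (Fᶜ ∩ (fun e : G => 2 • e) ⁻¹' {f}).Infinite := by
    by_contra h
    push Not at h
    apply hinf
    refine (hF.biUnion h).subset fun e he => ?_
    exact Set.mem_biUnion (hcon e he).1 ⟨he, rfl⟩
  obtain ⟨e₀, he₀⟩ := hf.nonempty
  have h2 : ((fun e => e - e₀) '' (Fᶜ ∩ (fun e : G => 2 • e) ⁻¹' {f})).Infinite :=
    hf.image (sub_left_injective.injOn)
  obtain ⟨y, ⟨e, he, rfl⟩, hy⟩ := h2.exists_notMem_finite hF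
  refine (hcon _ hy).2 ?_
  have h3 : 2 • e = f := he.2
  have h4 : 2 • e₀ = f := he₀.2
  change 2 • (e - e₀) = 0
  rw [smul_sub, h3, h4, sub_self]

/-- The next element avoids the finite set of all combinations with coefficients between -2 and 2,
and its double avoids it as well or is 0. So it cannot have coefficient 1 or -1, and coefficient 2
or -2 forces the other terms to sum to 0. -/
theorem exists_even_independent [Infinite G] (m : ℕ) : ∃ e : Fin m → G, ∀ a : Fin m → ℤ,
    (∀ i, |a i| ≤ 2) → ∑ i, a i • e i = 0 → ∀ i, Even (a i) := by
  induction m with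
  | zero => exact ⟨Fin.elim0, fun a _ _ i => i.elim0⟩
  | succ m ih =>
    obtain ⟨e, he⟩ := ih
    let F : Set G := (fun a : Fin m → ℤ => ∑ i, a i • e i) ''
      (Set.univ.pi fun _ => Set.Icc (-2) 2)
    have hF : F.Finite := (Set.Finite.pi' fun _ => Set.finite_Icc _ _).image _ |>.subset (by
      rintro _ ⟨a, ha, rfl⟩
      exact ⟨a, fun i => ha i trivial, rfl⟩)
    have hmem : ∀ a : Fin m → ℤ, (∀ i, |a i| ≤ 2) → ∑ i, a i • e i ∈ F := fun a ha =>
      ⟨a, fun i _ => abs_le.1 (ha i), rfl⟩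
    obtain ⟨g, hg1, hg2⟩ := exists_next hF
    refine ⟨Fin.cons g e, fun a ha hsum => ?_⟩
    rw [Fin.sum_univ_succ] at hsum
    simp only [Fin.cons_zero, Fin.cons_succ] at hsum
    have hneg : ∀ i, |(-a (Fin.succ i))| ≤ 2 := fun i => by rw [abs_neg]; exact ha _
    have hpos : ∀ i, |a (Fin.succ i)| ≤ 2 := fun i => ha _
    have h1 := hmem _ hneg
    have h2 := hmem _ hpos
    simp only [neg_smul, Finset.sum_neg_distrib] at h1
    set y := ∑ i : Fin m, a (Fin.succ i) • e i with hy
    have key : Even (a 0) ∧ y = 0 := by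
      have h0 := abs_le.1 (ha 0)
      have hcases : a 0 = -2 ∨ a 0 = -1 ∨ a 0 = 0 ∨ a 0 = 1 ∨ a 0 = 2 := by omega
      rcases hcases with h | h | h | h | h <;> rw [h] at hsum ⊢
      · have hyg : y = 2 • g := by
          rw [← sub_eq_zero, ← hsum]
          rw [neg_smul, ofNat_zsmul]
          abel
        refine ⟨by decide, ?_⟩
        rw [hyg] at h2 ⊢
        exact hg2.resolve_left (not_not.2 h2)
      · have hyg : y = g := by
          rw [← sub_eq_zero, ← hsum, neg_one_smul]; abel
        exact absurd (hyg ▸ h2) hg1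
      · exact ⟨by decide, by simpa using hsum⟩
      · have hyg : -y = g := by
          rw [eq_comm, ← sub_eq_zero, ← hsum, one_smul]; abel
        exact absurd (hyg ▸ h1) hg1
      · have hyg : -y = 2 • g := by
          rw [eq_comm, ← sub_eq_zero, ← hsum, ofNat_zsmul]; abel
        refine ⟨by decide, ?_⟩
        rw [hyg] at h1
        have := hg2.resolve_left (not_not.2 h1)
        rw [this] at hyg
        exact neg_eq_zero.1 hyg
    intro i
    refine Fin.cases key.1 (fun j => ?_) i
    exact he _ hpos key.2 j

/-- Sequences over infinite groups summing up to zero without other signed relations. -/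
theorem exists_signed_independent [Infinite G] (r : ℕ) : ∃ e : Fin (r + 1) → G, ∑ i, e i = 0 ∧
    ∀ c : Fin (r + 1) → ℤ, (∀ i, |c i| ≤ 1) → ∑ i, c i • e i = 0 →
      (∀ i, c i = 0) ∨ ∀ i, c i ≠ 0 := by
  obtain ⟨e, he⟩ := exists_even_independent (G := G) r
  refine ⟨Fin.cons (-∑ i, e i) e, by simp [Fin.sum_univ_succ], fun c hc hsum => ?_⟩
  rw [Fin.sum_univ_succ] at hsum
  simp only [Fin.cons_zero, Fin.cons_succ] at hsum
  have h0 := abs_le.1 (hc 0)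
  -- The first element is minus the sum of the others. Eliminating it leaves coefficients between -2
  -- and 2, whose evenness says that all `c i` have the parity of `c 0`.
  have hev := he (fun i => c (Fin.succ i) - c 0) (fun i => by
      have := abs_le.1 (hc (Fin.succ i))
      exact abs_le.2 ⟨by omega, by omega⟩) (by
      simp only [sub_smul, Finset.sum_sub_distrib, ← Finset.smul_sum]
      rw [← hsum, smul_neg]; abel)
  by_cases h : c 0 = 0
  · left
    intro i
    refine Fin.cases h (fun j => ?_) i
    obtain ⟨b, hb⟩ := hev j
    have := abs_le.1 (hc (Fin.succ j))
    omega
  · right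
    intro i
    refine Fin.cases h (fun j => ?_) i
    obtain ⟨b, hb⟩ := hev j
    omega

/-- From each pair `e i`, `-e i` a subsequence takes none, both or one, which contributes the
coefficient 0, or 1 or -1 in the last case. So a zero-sum subsequence halves all pairs or none. -/
theorem exists_parts_of_signed {r : ℕ} {e : Fin (r + 1) → G}
    (he : ∀ c : Fin (r + 1) → ℤ, (∀ i, |c i| ≤ 1) → ∑ i, c i • e i = 0 →
      (∀ i, c i = 0) ∨ ∀ i, c i ≠ 0) {f : Fin (r + 1) → Multiset G}
    (hf : ∀ i, f i ≤ {e i, -e i}) {t : Multiset G} (ht : t ≤ ∑ i, f i) (h0 : t.sum = 0) :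
    ∃ t' : Fin (r + 1) → Multiset G, (∀ i, t' i ≤ f i) ∧ t = ∑ i, t' i ∧
      ((∀ i, t' i = 0 ∨ t' i = {e i, -e i}) ∨ ∀ i, Multiset.card (t' i) = 1) := by
  obtain ⟨t', h1, h2⟩ := Multiset.exists_eq_sum_of_le_sum Finset.univ f ht
  refine ⟨t', fun i => h1 i (Finset.mem_univ i), h2, ?_⟩
  have hle : ∀ i, t' i ≤ {e i, -e i} := fun i => (h1 i (Finset.mem_univ i)).trans (hf i)
  have hex : ∀ i, ∃ c : ℤ, |c| ≤ 1 ∧ (t' i).sum = c • e i ∧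
      ((c = 0 ∧ (t' i = 0 ∨ t' i = {e i, -e i})) ∨ (c ≠ 0 ∧ Multiset.card (t' i) = 1)) := by
    intro i
    have hc := Multiset.card_le_card (hle i)
    simp only [Multiset.card_pair] at hc
    rcases (show Multiset.card (t' i) = 0 ∨ Multiset.card (t' i) = 1 ∨
      Multiset.card (t' i) = 2 by omega) with h | h | h
    · rw [Multiset.card_eq_zero] at h
      exact ⟨0, by simp, by simp [h], Or.inl ⟨rfl, Or.inl h⟩⟩
    · obtain ⟨g, hg⟩ := Multiset.card_eq_one.1 h
      have hgm : g ∈ ({e i, -e i} : Multiset G) := Multiset.mem_of_le (hle i) (by simp [hg])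
      simp only [Multiset.insert_eq_cons, Multiset.mem_cons, Multiset.mem_singleton] at hgm
      rcases hgm with rfl | rfl
      · exact ⟨1, by simp, by simp [hg], Or.inr ⟨by simp, h⟩⟩
      · exact ⟨-1, by simp, by simp [hg], Or.inr ⟨by simp, h⟩⟩
    · have h3 : t' i = {e i, -e i} := Multiset.eq_of_le_of_card_le (hle i) (by simp [h])
      exact ⟨0, by simp, by simp [h3], Or.inl ⟨rfl, Or.inr h3⟩⟩
  choose c hc1 hc2 hc3 using hex
  have hsum : ∑ i, c i • e i = 0 := by
    rw [← h0, h2, ← Multiset.coe_sumAddMonoidHom, map_sum]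
    exact Finset.sum_congr rfl fun i _ => (hc2 i).symm
  rcases he c hc1 hsum with h | h
  · left
    intro i
    rcases hc3 i with h4 | h4
    exacts [h4.2, absurd (h i) h4.1]
  · right
    intro i
    rcases hc3 i with h4 | h4
    exacts [absurd h4.1 (h i), h4.2]

end Independent

namespace BlockData

variable {G : Type*} [AddCommGroup G] {ι : Type*} {T : BlockData G ι} [Fintype ι]

/-- Take the product of all pairs `e i`, `-e i`. An atom dividing it is a pair or halves every pair.
If one atom halves every pair, so does the complement, which is then a single atom; otherwise all `r
+ 1` factors are pairs. -/
theorem exists_lengths_pair [Infinite G] (T : BlockData G ι) (r : ℕ) (hr : 2 ≤ r) :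
    ∃ x ∈ T.block, lengthsIn T.block x = {2, r + 1} := by
  classical
  obtain ⟨e, hsum, he⟩ := exists_signed_independent (G := G) r
  have hne : ∀ i, e i ≠ 0 := by
    intro i h
    rcases he (Pi.single i 1) (fun j => by
      by_cases hj : j = i
      · subst hj; simp
      · simp [hj]) (by
      rw [Finset.sum_eq_single i]
      · simp [h]
      · intro j _ hj; simp [hj]
      · simp) with h1 | h1
    · simpa using h1 i
    · have : Nontrivial (Fin (r + 1)) := Fin.nontrivial_iff_two_le.2 (by omega)
      obtain ⟨j, hj⟩ := exists_ne i
      exact h1 j (by simp [hj])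
  have hsumB : ∀ u ∈ T.block, u.2 = 0 → u.1.sum = 0 := fun u hu h => by
    have := hu.2
    rwa [show u = (u.1, 0) from Prod.ext rfl h, tot_seq] at this
  have hsplit : ∀ {z : Multiset T.Amb}, (∀ u ∈ z, u ∈ T.block) → z.sum.2 = 0 → ∀ u ∈ z,
      u.2 = 0 ∧ u.1.sum = 0 ∧ u.1 ≤ z.sum.1 := by
    intro z hz h u hu
    have h2 : u.2 = 0 := funext fun i => snd_eq_zero_of_mem hz (by rw [h]; rfl) hu
    refine ⟨h2, hsumB u (hz u hu) h2, ?_⟩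
    obtain ⟨t, rfl⟩ := Multiset.exists_cons_of_mem hu
    rw [Multiset.sum_cons, Prod.fst_add]
    exact Multiset.le_add_right _ _
  have hcard : ∀ {z : Multiset T.Amb} {c : ℕ}, (∀ u ∈ z, Multiset.card u.1 = c) →
      Multiset.card z.sum.1 = Multiset.card z * c := by
    intro z c hz
    induction z using Multiset.induction_on with
    | empty => simp
    | cons a s ih =>
      rw [Multiset.sum_cons, Prod.fst_add, Multiset.card_add, hz a (Multiset.mem_cons_self a s),
        ih fun u hu => hz u (Multiset.mem_cons_of_mem hu), Multiset.card_cons]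
      ring
  have hpair : ∀ i, IsAtomIn T.block (({e i, -e i}, 0) : T.Amb) := fun i =>
    atom_seq (by simp [hne i, (hne i).symm]) (by simp) (by simp) (by simp)
  have hlong : ∀ g : Fin (r + 1) → G, (∀ i, {g i} ≤ ({e i, -e i} : Multiset G)) → ∑ i, g i = 0 →
      IsAtomIn T.block ((∑ i, {g i}, 0) : T.Amb) := by
    intro g hg hg0
    refine ⟨seq_mem ?_, fun h => ?_, fun v hv w hw hvw => ?_⟩
    · rw [← Multiset.coe_sumAddMonoidHom, map_sum]
      simpa using hg0
    · have := congrArg Multiset.card (congrArg Prod.fst h)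
      simp at this
    · have h1 := hsplit (z := {v, w}) (by simp [hv, hw]) (by rw [Multiset.sum_pair, hvw])
      rw [Multiset.sum_pair, hvw] at h1
      obtain ⟨hv2, hv0, hvle⟩ := h1 v (by simp)
      obtain ⟨hw2, -, -⟩ := h1 w (by simp)
      obtain ⟨t', h3, h4, h5⟩ := exists_parts_of_signed he hg hvle hv0
      rcases h5 with h5 | h5
      · left
        refine Prod.ext ?_ hv2
        rw [h4]
        refine Finset.sum_eq_zero fun i _ => (h5 i).resolve_right fun h => ?_
        have := Multiset.card_le_card (h3 i)
        rw [h] at this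
        simp at this
      · right
        refine Prod.ext ?_ hw2
        have h6 : v.1 = ∑ i, {g i} := by
          rw [h4]
          exact Finset.sum_congr rfl fun i _ =>
            Multiset.eq_of_le_of_card_le (h3 i) (by simp [h5 i])
        have h7 : v.1 + w.1 = ∑ i, {g i} := congrArg Prod.fst hvw
        rw [h6] at h7
        exact left_eq_add.1 h7.symm
  have hseq : ∀ g : Fin (r + 1) → Multiset G,
      ∑ i, ((g i, 0) : T.Amb) = (∑ i, g i, 0) := fun g => by
    refine Prod.ext ?_ ?_
    · rw [Prod.fst_sum]
    · rw [Prod.snd_sum]; simp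
  refine ⟨(∑ i, {e i, -e i}, 0), seq_mem ?_, Set.Subset.antisymm ?_ ?_⟩
  · rw [← Multiset.coe_sumAddMonoidHom, map_sum]
    simp
  · rintro _ ⟨z, hz, hzx, rfl⟩
    have h1 := hsplit (fun u hu => (hz u hu).1) (by rw [hzx])
    have hz1 : z.sum.1 = ∑ i, {e i, -e i} := by rw [hzx]
    by_cases hall : ∀ u ∈ z, Multiset.card u.1 = 2
    · right
      have h2 := hcard hall
      rw [hz1, Multiset.card_sum] at h2
      simp at h2
      simp only [Set.mem_singleton_iff]
      omega
    · left
      push Not at hall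
      obtain ⟨u, hu, hu2⟩ := hall
      obtain ⟨hus, hu0, hule⟩ := h1 u hu
      rw [hz1] at hule
      obtain ⟨t', h3, h4, h5⟩ := exists_parts_of_signed he (fun i => le_rfl) hule hu0
      have h6 : ∀ i, Multiset.card (t' i) = 1 := by
        refine h5.resolve_left fun h5 => hu2 ?_
        obtain ⟨i, hi⟩ : ∃ i, t' i ≠ 0 := by
          by_contra hcon
          push Not at hcon
          refine (hz u hu).2.1 (Prod.ext ?_ hus)
          rw [h4]
          exact Finset.sum_eq_zero fun i _ => hcon i
        have hle : ({e i, -e i} : Multiset G) ≤ u.1 := by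
          rw [h4, ← (h5 i).resolve_left hi]
          exact Finset.single_le_sum (f := t') (fun _ _ => Multiset.zero_le _) (Finset.mem_univ i)
        obtain ⟨q, hq⟩ := Multiset.le_iff_exists_add.1 hle
        have hsumu : (({e i, -e i}, 0) : T.Amb) + (q, 0) = u := by
          refine Prod.ext hq.symm ?_
          rw [hus]; exact add_zero _
        have hqb : ((q, 0) : T.Amb) ∈ T.block := by
          refine seq_mem ?_
          rw [hq] at hu0
          simpa using hu0
        rcases (hz u hu).2.2 _ (hpair i).1 _ hqb hsumu with h | h
        · exact absurd h (hpair i).2.1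
        · have : q = 0 := congrArg Prod.fst h
          rw [hq, this]
          simp
      obtain ⟨t, rfl⟩ := Multiset.exists_cons_of_mem hu
      have hts : t.sum.1 = ∑ i, (({e i, -e i} : Multiset G) - t' i) := by
        have h7 : u.1 + t.sum.1 = ∑ i, {e i, -e i} := by rw [← hz1, Multiset.sum_cons]; rfl
        have h8 : u.1 + ∑ i, ({e i, -e i} - t' i) = ∑ i, {e i, -e i} := by
          rw [h4, ← Finset.sum_add_distrib]
          exact Finset.sum_congr rfl fun i _ => add_tsub_cancel_of_le (h3 i)
        exact add_left_cancel (h7.trans h8.symm)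
      have hc1 : ∀ i, Multiset.card ({e i, -e i} - t' i : Multiset G) = 1 := fun i => by
        rw [Multiset.card_sub (h3 i), h6]; simp
      have ht2 : t.sum.2 = 0 := by
        have h9 := congrArg Prod.snd hzx
        rw [Multiset.sum_cons, Prod.snd_add, hus, zero_add] at h9
        exact h9
      have h10 := hsplit (fun v hv => (hz v (Multiset.mem_cons_of_mem hv)).1) ht2
      have h11 : ∀ v ∈ t, Multiset.card v.1 = r + 1 := by
        intro v hv
        obtain ⟨hvs, hv0, hvle⟩ := h10 v hv
        rw [hts] at hvle
        obtain ⟨t'', h12, h13, h14⟩ := exists_parts_of_signed he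
          (fun i => (Multiset.sub_le_self _ _)) hvle hv0
        rcases h14 with h14 | h14
        · refine absurd (Prod.ext ?_ hvs) (hz v (Multiset.mem_cons_of_mem hv)).2.1
          rw [h13]
          refine Finset.sum_eq_zero fun i _ => (h14 i).resolve_right fun h => ?_
          have := Multiset.card_le_card (h12 i)
          rw [h, hc1] at this
          simp at this
        · rw [h13, Multiset.card_sum]
          simp [h14]
      have h15 := hcard h11
      rw [hts, Multiset.card_sum] at h15
      simp only [hc1, Finset.sum_const, Finset.card_univ, Fintype.card_fin, smul_eq_mul,
        mul_one] at h15
      have : Multiset.card t = 1 := Nat.eq_of_mul_eq_mul_right (Nat.succ_pos r)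
        (by rw [← h15, one_mul])
      rw [Multiset.card_cons, this]
  · rintro k (rfl | hk)
    · have h1 := hlong e (fun i => by simp) hsum
      have h2 := hlong (fun i => -e i) (fun i => by simp) (by simp [hsum])
      have := add_mem_lengthsIn h1.one_mem_lengthsIn h2.one_mem_lengthsIn
      convert this using 2
      refine Prod.ext ?_ (add_zero _).symm
      rw [Prod.fst_add, ← Finset.sum_add_distrib]
      rfl
    · rw [Set.mem_singleton_iff.1 hk]
      refine ⟨Finset.univ.val.map fun i => (({e i, -e i}, 0) : T.Amb), ?_, hseq _, by simp⟩
      intro u hu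
      obtain ⟨i, -, rfl⟩ := Multiset.mem_map.1 hu
      exact hpair i

theorem mem_distances_of_infinite [Infinite G] {d : ℕ} (hd : 0 < d) : d ∈ distancesIn T.block := by
  obtain ⟨x, hx, hL⟩ := exists_lengths_pair T (d + 1) (by omega)
  simp only [distancesIn, Set.mem_iUnion]
  refine ⟨x, hx, hd, 2, by simp [hL], d + 1 + 1, by simp [hL], by omega, ?_⟩
  rw [hL]
  refine Set.inter_eq_right.2 ?_
  rintro k (rfl | hk)
  · exact ⟨le_rfl, by omega⟩
  · rw [Set.mem_singleton_iff.1 hk]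
    exact ⟨by omega, le_rfl⟩

end BlockData

/-! ### The sets of distances of block monoids -/

namespace BlockData

variable {G : Type*} [AddCommGroup G] {ι : Type*} [Fintype ι] [DecidableEq ι]

theorem zero_notMem_distancesIn (T : BlockData G ι) : 0 ∉ distancesIn T.block := by
  intro h
  simp only [distancesIn, Set.mem_iUnion] at h
  obtain ⟨x, -, h, -⟩ := h
  exact absurd h (lt_irrefl 0)

theorem distances_eq_empty_or_isLeast (T : BlockData G ι) :
    distancesIn T.block = ∅ ∨ IsLeast (distancesIn T.block) 1 := by
  rcases (distancesIn T.block).eq_empty_or_nonempty with h | ⟨D, hD⟩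
  · exact Or.inl h
  · refine Or.inr ⟨one_mem_of_mem hD, fun d hd => Nat.one_le_iff_ne_zero.2 ?_⟩
    rintro rfl
    exact zero_notMem_distancesIn T hd

theorem distances_of_infinite [Infinite G] (T : BlockData G ι) :
    distancesIn T.block = {d | 0 < d} := by
  refine Set.Subset.antisymm (fun d hd => Nat.pos_of_ne_zero ?_) fun d hd =>
    mem_distances_of_infinite hd
  rintro rfl
  exact zero_notMem_distancesIn T hd

theorem distances_eq_Icc [Finite G] (T : BlockData G ι)
    (h : (∀ i i', 2 ≤ T.rank i → 2 ≤ T.rank i' → i = i') ∨ ∀ g : G, g + g = 0) :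
    ∃ a b, distancesIn T.block = Set.Icc a b := by
  have hcrit : ∀ d x k, 2 ≤ d → ¬ T.Crit d x k := fun d x k hd => by
    rcases h with h | h
    · exact Crit.rank_false hd h
    · exact Crit.two_torsion h hd
  obtain ⟨N, hN⟩ := exists_distance_bound T
  rcases (distancesIn T.block).eq_empty_or_nonempty with h0 | hne
  · exact ⟨1, 0, by simp [h0]⟩
  · obtain ⟨M, hM, hmax⟩ := ((Set.finite_Iic N).subset hN).exists_maximal hne
    refine ⟨1, M, Set.Subset.antisymm (fun d hd => ⟨?_, ?_⟩) fun d hd =>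
      mem_of_mem_of_lt hcrit hM hd.1 hd.2⟩
    · refine Nat.one_le_iff_ne_zero.2 ?_
      rintro rfl
      exact zero_notMem_distancesIn T hd
    · by_contra hcon
      exact hcon (hmax hd (not_le.1 hcon).le)

end BlockData

/-! ### Exponents of seminormal finitely primary monoids -/

section Exponents

variable {Q : Type*} [CommGroup Q]

/-- The exponents of a seminormal finitely primary monoid with quotient group `Q`. -/
structure ExponentData (D : Submonoid Q) where
  /-- the number of primes -/
  rank : ℕ
  rank_pos : 0 < rank
  /-- the exponents -/
  val : Fin rank → Q → ℤ
  val_mul : ∀ j x y, val j (x * y) = val j x + val j y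
  exists_val : ∀ m : Fin rank → ℤ, ∃ x, ∀ j, val j x = m j
  val_unit : ∀ {x}, x ∈ D → x⁻¹ ∈ D → ∀ j, val j x = 0
  val_pos : ∀ {x}, x ∈ D → x⁻¹ ∉ D → ∀ j, 0 < val j x
  mem_of_pos : ∀ {x}, (∀ j, 0 < val j x) → x ∈ D

namespace ExponentData

variable {D : Submonoid Q} (V : ExponentData D)

theorem val_one (j : Fin V.rank) : V.val j 1 = 0 := by
  have := V.val_mul j 1 1
  rw [one_mul] at this
  omega

theorem val_inv (j : Fin V.rank) (x : Q) : V.val j x⁻¹ = -V.val j x := by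
  have := V.val_mul j x x⁻¹
  rw [mul_inv_cancel, V.val_one] at this
  omega

theorem val_div (j : Fin V.rank) (x y : Q) : V.val j (x / y) = V.val j x - V.val j y := by
  rw [div_eq_mul_inv, V.val_mul, V.val_inv]; ring

theorem val_pow (j : Fin V.rank) (x : Q) (n : ℕ) : V.val j (x ^ n) = n * V.val j x := by
  induction n with
  | zero => simp [V.val_one]
  | succ n ih => rw [pow_succ, V.val_mul, ih]; push_cast; ring

theorem val_nonneg {x : Q} (hx : x ∈ D) (j : Fin V.rank) : 0 ≤ V.val j x := by
  by_cases h : x⁻¹ ∈ D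
  · exact (V.val_unit hx h j).ge
  · exact (V.val_pos hx h j).le

theorem inv_mem_of_val_eq_zero {x : Q} (hx : x ∈ D) {j : Fin V.rank} (h : V.val j x = 0) :
    x⁻¹ ∈ D := by
  by_contra hcon
  exact (V.val_pos hx hcon j).ne' h

end ExponentData

section FinitelyPrimary

variable {F : Submonoid Q} {s : ℕ} {q : Fin s → Q} (hq : ∀ i, q i ∈ F)
  (hdec : ∀ x ∈ F, ∃! y : Q × (Fin s → ℕ), y.1 ∈ F ∧ y.1⁻¹ ∈ F ∧ x = y.1 * ∏ i, q i ^ y.2 i)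
include hq hdec

/-- Multiplying both sides by large powers of the primes makes all exponents nonnegative, where
uniqueness in `F` applies. -/
theorem zpow_decomposition_unique {e e' : Q} (he : e ∈ F) (hei : e⁻¹ ∈ F) (he' : e' ∈ F)
    (hei' : e'⁻¹ ∈ F) {m m' : Fin s → ℤ} (h : e * ∏ i, q i ^ m i = e' * ∏ i, q i ^ m' i) :
    m = m' := by
  set N : Fin s → ℕ := fun i => (m i).natAbs + (m' i).natAbs with hN
  have key : ∀ (f : Q) (l : Fin s → ℤ), (∀ i, 0 ≤ l i + N i) →
      f * ∏ i, q i ^ (l i + N i).toNat = (f * ∏ i, q i ^ l i) * ∏ i, q i ^ N i := by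
    intro f l hl
    rw [mul_assoc, ← Finset.prod_mul_distrib]
    congr 1
    refine Finset.prod_congr rfl fun i _ => ?_
    rw [← zpow_natCast, Int.toNat_of_nonneg (hl i), zpow_add, zpow_natCast]
  have h1 := key e m fun i => by simp only [hN]; omega
  have h2 := key e' m' fun i => by simp only [hN]; omega
  have hF : e * ∏ i, q i ^ (m i + N i).toNat ∈ F :=
    F.mul_mem he (F.prod_mem fun i _ => F.pow_mem (hq i) _)
  have h3 := (hdec _ hF).unique (y₁ := (e, fun i => (m i + N i).toNat))
    (y₂ := (e', fun i => (m' i + N i).toNat)) ⟨he, hei, rfl⟩ ⟨he', hei', by rw [h1, h2, h]⟩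
  funext i
  have h4 := congrFun (congrArg Prod.snd h3) i
  simp only [hN] at h4
  omega

theorem exists_zpow_decomposition {x : Q} (hx : ∃ a ∈ F, ∃ b ∈ F, x = a / b) :
    ∃ (e : Q) (m : Fin s → ℤ), e ∈ F ∧ e⁻¹ ∈ F ∧ x = e * ∏ i, q i ^ m i := by
  obtain ⟨a, ha, b, hb, rfl⟩ := hx
  obtain ⟨⟨e, k⟩, ⟨h1, h2, h3⟩, -⟩ := hdec a ha
  obtain ⟨⟨e', k'⟩, ⟨h1', h2', h3'⟩, -⟩ := hdec b hb
  refine ⟨e / e', fun i => (k i : ℤ) - k' i, ?_, ?_, ?_⟩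
  · rw [div_eq_mul_inv]; exact F.mul_mem h1 h2'
  · rw [inv_div, div_eq_mul_inv]; exact F.mul_mem h1' h2
  · simp only at h3 h3'
    rw [h3, h3', mul_div_mul_comm, ← Finset.prod_div_distrib]
    congr 1
    refine Finset.prod_congr rfl fun i _ => ?_
    rw [zpow_sub, zpow_natCast, zpow_natCast, div_eq_mul_inv]

end FinitelyPrimary

/-- The exponents of a seminormal finitely primary monoid. -/
theorem IsFinitelyPrimary.nonempty_exponentData {D : Submonoid Q} (h : IsFinitelyPrimary D)
    (hsn : IsSeminormalMonoid D) (hquot : ∀ x : Q, ∃ a ∈ D, ∃ b ∈ D, x = a / b) :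
    Nonempty (ExponentData D) := by
  obtain ⟨F, s, α, q, hDF, hs, hα, hq, hdec, hnu, hcon⟩ := h
  have hquotF : ∀ x : Q, ∃ a ∈ F, ∃ b ∈ F, x = a / b := fun x => by
    obtain ⟨a, ha, b, hb, h⟩ := hquot x
    exact ⟨a, hDF ha, b, hDF hb, h⟩
  choose e m he hei hx using fun x => exists_zpow_decomposition hq hdec (hquotF x)
  have huniq : ∀ {x f : Q} {l : Fin s → ℤ}, f ∈ F → f⁻¹ ∈ F → x = f * ∏ i, q i ^ l i → m x = l :=
    fun {x f l} hf hfi h => zpow_decomposition_unique hq hdec (he x) (hei x) hf hfi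
      ((hx x).symm.trans h)
  have hmul : ∀ x y, m (x * y) = m x + m y := fun x y => by
    refine huniq (f := e x * e y) (F.mul_mem (he x) (he y)) ?_ ?_
    · rw [mul_inv]; exact F.mul_mem (hei x) (hei y)
    · conv_lhs => rw [hx x, hx y]
      rw [mul_mul_mul_comm, ← Finset.prod_mul_distrib]
      congr 1
      refine Finset.prod_congr rfl fun i _ => ?_
      rw [Pi.add_apply, zpow_add]
  have hnonneg : ∀ {x}, x ∈ F → ∀ j, 0 ≤ m x j := by
    intro x hxF j
    obtain ⟨⟨f, k⟩, ⟨h1, h2, h3⟩, -⟩ := hdec x hxF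
    have := huniq (x := x) (f := f) (l := fun i => (k i : ℤ)) h1 h2 (by simpa using h3)
    rw [this]
    exact Int.natCast_nonneg _
  have hprod : m (∏ i, q i) = 1 := by
    refine huniq (f := 1) F.one_mem (by simp [F.one_mem]) ?_
    simp
  have hmemF : ∀ {x}, (∀ j, 0 ≤ m x j) → x ∈ F := by
    intro x h
    rw [hx x]
    refine F.mul_mem (he x) (F.prod_mem fun i _ => ?_)
    rw [← Int.toNat_of_nonneg (h i), zpow_natCast]
    exact F.pow_mem (hq i) _
  have hone : m 1 = 0 := by
    have := hmul 1 1
    rw [one_mul] at this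
    simpa using this
  have hinv : ∀ x, m x⁻¹ = -m x := fun x => by
    have := hmul x x⁻¹
    rw [mul_inv_cancel, hone] at this
    exact eq_neg_of_add_eq_zero_right this.symm
  have hpow : ∀ x (n : ℕ), m (x ^ n) = n • m x := fun x n => by
    induction n with
    | zero => simp [hone]
    | succ n ih => rw [pow_succ, hmul, ih, succ_nsmul]
  refine ⟨⟨s, hs, fun j x => m x j, fun j x y => by rw [hmul]; rfl, fun l => ?_, ?_, ?_, ?_⟩⟩
  · refine ⟨∏ i, q i ^ l i, fun j => ?_⟩
    rw [huniq (x := ∏ i, q i ^ l i) (f := 1) (l := l) F.one_mem (by simp [F.one_mem]) (by simp)]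
  · intro x h1 h2 j
    have h3 := hnonneg (hDF h1) j
    have h4 := hnonneg (hDF h2) j
    rw [hinv, Pi.neg_apply] at h4
    omega
  · intro x h1 h2 j
    obtain ⟨y, hy, hxy⟩ := hnu x h1 h2
    have h3 := hnonneg hy j
    rw [hxy, hmul, hprod, Pi.add_apply, Pi.one_apply]
    omega
  · intro x hpos
    -- Seminormality enters here: if all exponents of `x` are positive, then $x^n\in(q_1\cdots
    -- q_s)^\alpha F\subset D$ for all $n\ge\alpha$.
    have : x ∈ seminormalClosure D := by
      refine ⟨α, fun n hn => ?_⟩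
      have h1 : x ^ n = (∏ i, q i) ^ α * (x ^ n / (∏ i, q i) ^ α) := by simp
      rw [h1]
      refine hcon _ (hmemF fun j => ?_)
      rw [div_eq_mul_inv, hmul, hinv, hpow, hpow, hprod]
      have h2 : (α : ℤ) ≤ n := by exact_mod_cast hn
      have h3 := hpos j
      simp only [Pi.add_apply, Pi.neg_apply, Pi.smul_apply, Pi.one_apply, nsmul_eq_mul]
      simp only [Pi.mul_apply, Pi.natCast_apply, Pi.one_apply, mul_one]
      nlinarith
    rw [← hsn] at this
    exact this

end Exponents

/-! ### Localizations at prime ideals -/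

section Localization

variable {Q : Type*} [CommGroup Q] {S : Submonoid Q} {p : Set Q} (hp : IsPrimeSIdeal S p)
include hp

theorem one_notMem_of_prime : (1 : Q) ∉ p := fun h1 => hp.2.1 (by
  refine Set.Subset.antisymm hp.1.1 fun x hx => ?_
  simpa using hp.1.2 x hx 1 h1)

theorem le_localizationAtPrime : S ≤ localizationAtPrime S p hp := fun a ha =>
  ⟨a, ha, 1, S.one_mem, one_notMem_of_prime hp, by simp⟩

theorem mem_prime_iff {x : Q} (hx : x ∈ S) : x ∈ p ↔ x⁻¹ ∉ localizationAtPrime S p hp := by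
  constructor
  · rintro hxp ⟨a, ha, t, ht, htp, h⟩
    apply htp
    have : t = a * x := by
      rw [inv_eq_iff_mul_eq_one, mul_div_assoc', div_eq_one] at h
      rw [← h, mul_comm]
    rw [this]
    exact hp.1.2 a ha x hxp
  · intro h
    by_contra hxp
    exact h ⟨1, S.one_mem, x, hx, hxp, by simp⟩

theorem mul_notMem_of_prime {x y : Q} (hx : x ∈ S) (hy : y ∈ S) (hxp : x ∉ p) (hyp : y ∉ p) :
    x * y ∉ p := fun h => (hp.2.2 x hx y hy h).elim hxp hyp

theorem pow_notMem_of_prime {x : Q} (hx : x ∈ S) (hxp : x ∉ p) (n : ℕ) : x ^ n ∉ p := by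
  induction n with
  | zero => simpa using one_notMem_of_prime hp
  | succ n ih =>
    rw [pow_succ]
    exact mul_notMem_of_prime hp (S.pow_mem hx n) hx ih hxp

/-- Two consecutive large powers of `x` have a common denominator `c`. All large numbers are
combinations of these two exponents, so large powers of `c * x` lie in `S`, and seminormality of `S`
gives `c * x ∈ S`. -/
theorem localizationAtPrime_seminormal (hsn : IsSeminormalMonoid S) :
    IsSeminormalMonoid (localizationAtPrime S p hp) := by
  refine Set.Subset.antisymm (fun x hx => ⟨0, fun n _ => Submonoid.pow_mem _ hx n⟩) ?_
  rintro x ⟨N, hN⟩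
  obtain ⟨a, ha, t, ht, htp, h1⟩ := hN (N + 1) (by omega)
  obtain ⟨b, hb, r, hr, hrp, h2⟩ := hN (N + 1 + 1) (by omega)
  set c := t * r with hc
  have hcS : c ∈ S := S.mul_mem ht hr
  have hcx1 : c * x ^ (N + 1) ∈ S := by
    have : c * x ^ (N + 1) = r * a := by rw [h1, hc, mul_comm t r, mul_assoc, mul_div_cancel]
    rw [this]; exact S.mul_mem hr ha
  have hcx2 : c * x ^ (N + 1 + 1) ∈ S := by
    have : c * x ^ (N + 1 + 1) = t * b := by rw [h2, hc, mul_assoc, mul_div_cancel]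
    rw [this]; exact S.mul_mem ht hb
  refine ⟨c * x, ?_, c, hcS, mul_notMem_of_prime hp ht hr htp hrp, by simp⟩
  have : c * x ∈ seminormalClosure S := by
    -- Write $n=(N+1)u+v$ with $v\le N<u$. Then $n=(N+1)(u-v)+(N+2)v$ uses only $u\le n$ factors
    -- `c`.
    refine ⟨(N + 1) * (N + 1), fun n hn => ?_⟩
    set u := n / (N + 1) with hu
    set v := n % (N + 1) with hv
    have hdm : (N + 1) * u + v = n := Nat.div_add_mod n (N + 1)
    have hv1 : v < N + 1 := Nat.mod_lt _ (by omega)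
    have hu1 : N + 1 ≤ u := (Nat.le_div_iff_mul_le (by omega)).2 hn
    obtain ⟨w, hw⟩ := Nat.exists_eq_add_of_le (show v ≤ u by omega)
    have hn2 : n = (N + 1) * w + (N + 1 + 1) * v := by rw [← hdm, hw]; ring
    have hnw : n = (w + v) + (n - (w + v)) := by
      have : w + v ≤ n := by rw [hn2]; nlinarith
      omega
    have hfin : (c * x) ^ n =
        c ^ (n - (w + v)) * ((c * x ^ (N + 1)) ^ w * (c * x ^ (N + 1 + 1)) ^ v) := by
      rw [mul_pow c x n, mul_pow c _ w, mul_pow c _ v, ← pow_mul, ← pow_mul, mul_mul_mul_comm, ← pow_add, ← pow_add,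
        ← hn2, ← mul_assoc, ← pow_add]
      congr 2
      omega
    rw [hfin]
    exact S.mul_mem (S.pow_mem hcS _) (S.mul_mem (S.pow_mem hcx1 _) (S.pow_mem hcx2 _))
  rw [← hsn] at this
  exact this

end Localization

/-! ### Weakly Krull monoids with exponents at all minimal primes -/

section WeaklyKrull

variable {Q : Type*} [CommGroup Q] {S : Submonoid Q}

/-- The localization at a minimal prime. -/
abbrev loc (p : minimalPrimeSIdeals S) : Submonoid Q :=
  localizationAtPrime S p (isPrimeSIdeal_of_mem p.2)

/-- The units of the localization at a minimal prime. -/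
def locUnits (p : minimalPrimeSIdeals S) : Subgroup Q where
  carrier := {x | x ∈ loc p ∧ x⁻¹ ∈ loc p}
  one_mem' := ⟨Submonoid.one_mem _, by simp [Submonoid.one_mem]⟩
  mul_mem' ha hb := ⟨Submonoid.mul_mem _ ha.1 hb.1, by
    rw [mul_inv]; exact Submonoid.mul_mem _ ha.2 hb.2⟩
  inv_mem' ha := ⟨ha.2, by rw [inv_inv]; exact ha.1⟩

variable (S) in
/-- A weakly Krull monoid with quotient group `Q`, together with exponents for all localizations
at minimal primes. -/
structure WeaklyKrullData where
  quot : ∀ x : Q, ∃ a ∈ S, ∃ b ∈ S, x = a / b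
  mem_of_forall : ∀ {x : Q}, (∀ p : minimalPrimeSIdeals S, x ∈ loc p) → x ∈ S
  finite : ∀ {a : Q}, a ∈ S → {p : minimalPrimeSIdeals S | a ∈ (p : Set Q)}.Finite
  exps : ∀ p : minimalPrimeSIdeals S, ExponentData (loc p)

theorem mem_loc {x : Q} (hx : x ∈ S) (p : minimalPrimeSIdeals S) : x ∈ loc p :=
  le_localizationAtPrime _ hx

theorem mem_locUnits_of_notMem {x : Q} (hx : x ∈ S) {p : minimalPrimeSIdeals S}
    (h : x ∉ (p : Set Q)) : x ∈ locUnits p :=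
  ⟨mem_loc hx p, not_not.1 (mt (mem_prime_iff (isPrimeSIdeal_of_mem p.2) hx).2 h)⟩

theorem prime_nonempty (p : minimalPrimeSIdeals S) : (p : Set Q).Nonempty := by
  have h : Minimal (fun I => I.Nonempty ∧ IsPrimeSIdeal S I) (p : Set Q) := p.2
  exact h.prop.1

theorem eq_of_prime_subset {p : minimalPrimeSIdeals S} {I : Set Q} (h0 : I.Nonempty)
    (hI : IsPrimeSIdeal S I) (h : I ⊆ p) : (p : Set Q) ⊆ I := by
  have hm : Minimal (fun I => I.Nonempty ∧ IsPrimeSIdeal S I) (p : Set Q) := p.2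
  exact hm.le_of_le ⟨h0, hI⟩ h

theorem exists_mem_notMem {p p' : minimalPrimeSIdeals S} (h : p' ≠ p) :
    ∃ t ∈ S, t ∈ (p' : Set Q) ∧ t ∉ (p : Set Q) := by
  by_contra hcon
  push Not at hcon
  have hsub : (p' : Set Q) ⊆ p := fun t ht =>
    hcon t ((isPrimeSIdeal_of_mem p'.2).1.1 ht) ht
  exact h (Subtype.ext (Set.Subset.antisymm hsub
    (eq_of_prime_subset (prime_nonempty p') (isPrimeSIdeal_of_mem p'.2) hsub)))

namespace WeaklyKrullData

variable (W : WeaklyKrullData S)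
include W

theorem finite_notMem_locUnits (x : Q) : {p : minimalPrimeSIdeals S | x ∉ locUnits p}.Finite := by
  obtain ⟨a, ha, b, hb, rfl⟩ := W.quot x
  refine ((W.finite ha).union (W.finite hb)).subset fun p hp => ?_
  by_contra hcon
  rw [Set.mem_union, not_or] at hcon
  exact hp (Subgroup.div_mem _ (mem_locUnits_of_notMem ha hcon.1)
    (mem_locUnits_of_notMem hb hcon.2))

theorem val_pos_of_mem {p : minimalPrimeSIdeals S} {x : Q} (hx : x ∈ (p : Set Q))
    (j : Fin (W.exps p).rank) : 0 < (W.exps p).val j x := by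
  have hxS := (isPrimeSIdeal_of_mem p.2).1.1 hx
  exact (W.exps p).val_pos (mem_loc hxS p) ((mem_prime_iff (isPrimeSIdeal_of_mem p.2) hxS).1 hx) j

/-- An element of another minimal prime that lies outside `p` has positive exponents there, so a
high power clears the denominator without touching `p`. Finitely many such powers are multiplied. -/
theorem exists_approx (p : minimalPrimeSIdeals S) {y : minimalPrimeSIdeals S → Q}
    (hy : {p' | p' ≠ p ∧ y p' ∉ loc p'}.Finite) :
    ∃ t ∈ S, t ∉ (p : Set Q) ∧ ∀ p', p' ≠ p → t * y p' ∈ loc p' := by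
  have hprime := isPrimeSIdeal_of_mem p.2
  have single : ∀ p' : minimalPrimeSIdeals S, p' ≠ p →
      ∃ t ∈ S, t ∉ (p : Set Q) ∧ t * y p' ∈ loc p' := by
    intro p' hne
    obtain ⟨t, htS, htp', htp⟩ := exists_mem_notMem hne
    set N : ℕ := ∑ j, ((W.exps p').val j (y p')).natAbs + 1 with hN
    refine ⟨t ^ N, S.pow_mem htS N, pow_notMem_of_prime hprime htS htp N,
      (W.exps p').mem_of_pos fun j => ?_⟩
    rw [ExponentData.val_mul, ExponentData.val_pow]
    have h1 := W.val_pos_of_mem htp' j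
    have h2 : ((W.exps p').val j (y p')).natAbs ≤ ∑ j, ((W.exps p').val j (y p')).natAbs :=
      Finset.single_le_sum (f := fun j => ((W.exps p').val j (y p')).natAbs)
        (fun _ _ => Nat.zero_le _) (Finset.mem_univ j)
    have h3 : (N : ℤ) ≤ N * (W.exps p').val j t := le_mul_of_one_le_right (by positivity) (by omega)
    omega
  have key : ∀ E : Finset (minimalPrimeSIdeals S), (∀ p' ∈ E, p' ≠ p) →
      ∃ t ∈ S, t ∉ (p : Set Q) ∧ ∀ p' ∈ E, t * y p' ∈ loc p' := by
    classical
    intro E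
    induction E using Finset.induction_on with
    | empty => exact fun _ => ⟨1, S.one_mem, one_notMem_of_prime hprime, by simp⟩
    | insert q E _ ih =>
      intro hE
      obtain ⟨t, ht, htp, h⟩ := ih fun p' hp' => hE p' (Finset.mem_insert_of_mem hp')
      obtain ⟨r, hr, hrp, h'⟩ := single q (hE q (Finset.mem_insert_self q E))
      refine ⟨t * r, S.mul_mem ht hr, mul_notMem_of_prime hprime ht hr htp hrp, fun p' hp' => ?_⟩
      rcases Finset.mem_insert.1 hp' with rfl | hmem
      · rw [mul_assoc]
        exact Submonoid.mul_mem _ (mem_loc ht _) h'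
      · rw [mul_comm t r, mul_assoc]
        exact Submonoid.mul_mem _ (mem_loc hr _) (h p' hmem)
  obtain ⟨t, ht, htp, h⟩ := key hy.toFinset fun p' hp' => (hy.mem_toFinset.1 hp').1
  refine ⟨t, ht, htp, fun p' hne => ?_⟩
  by_cases hmem : y p' ∈ loc p'
  · exact Submonoid.mul_mem _ (mem_loc ht _) hmem
  · exact h p' (hy.mem_toFinset.2 ⟨hne, hmem⟩)

theorem finite_notMem_loc (x : Q) (p : minimalPrimeSIdeals S) :
    {p' : minimalPrimeSIdeals S | p' ≠ p ∧ x ∉ loc p'}.Finite :=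
  (W.finite_notMem_locUnits x).subset fun _ hp h => hp.2 h.1

/-- Any `d ∈ p` serves as common denominator: `d * x ^ n` has positive exponents at `p` and is
integral at the other primes. -/
theorem mem_completeIntClosure {p : minimalPrimeSIdeals S} {x : Q}
    (hx : ∀ p', p' ≠ p → x ∈ loc p') (hxp : ∀ j, 0 ≤ (W.exps p).val j x) :
    x ∈ completeIntClosure S := by
  obtain ⟨d, hd⟩ := prime_nonempty p
  have hdS := (isPrimeSIdeal_of_mem p.2).1.1 hd
  refine ⟨d, hdS, fun n _ => W.mem_of_forall fun p' => ?_⟩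
  by_cases h : p' = p
  · subst h
    refine (W.exps p').mem_of_pos fun j => ?_
    rw [ExponentData.val_mul, ExponentData.val_pow]
    have h1 := W.val_pos_of_mem hd j
    have h2 : 0 ≤ (n : ℤ) * (W.exps p').val j x := mul_nonneg (by positivity) (hxp j)
    omega
  · exact Submonoid.mul_mem _ (mem_loc hdS p') (Submonoid.pow_mem _ (hx p' h) n)

theorem val_nonneg_of_mem_completeIntClosure {x : Q} (hx : x ∈ completeIntClosure S)
    (p : minimalPrimeSIdeals S) (j : Fin (W.exps p).rank) : 0 ≤ (W.exps p).val j x := by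
  obtain ⟨c, hc, h⟩ := hx
  by_contra hneg
  push Not at hneg
  have h1 := (W.exps p).val_nonneg (mem_loc hc p) j
  have h2 := (W.exps p).val_nonneg
    (mem_loc (h (((W.exps p).val j c).toNat + 1) (by omega)) p) j
  rw [ExponentData.val_mul, ExponentData.val_pow] at h2
  push_cast at h2
  rw [Int.toNat_of_nonneg h1] at h2
  nlinarith

/-- An element `t` outside `p` moves `x` into the complete integral closure, and an element `c` of
the conductor outside `p` moves `t * x` into `S`. Both are local units at `p`. -/
theorem mem_loc_of_regular {p : minimalPrimeSIdeals S} (hreg : ¬ conductorSet S ⊆ p) {x : Q}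
    (hx : ∀ j, 0 ≤ (W.exps p).val j x) : x ∈ loc p := by
  obtain ⟨c, hc, hcp⟩ := Set.not_subset.1 hreg
  have hcS : c ∈ S := by simpa using hc 1 (Submonoid.one_mem _)
  obtain ⟨t, ht, htp, htx⟩ := W.exists_approx p (y := fun _ => x) (W.finite_notMem_loc x p)
  have htu := mem_locUnits_of_notMem ht htp
  have htxc : t * x ∈ completeIntClosure S := W.mem_completeIntClosure htx fun j => by
    rw [ExponentData.val_mul, (W.exps p).val_unit htu.1 htu.2, zero_add]
    exact hx j
  have h1 : c * (t * x) ∈ S := hc _ htxc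
  have h2 : c * t ∈ locUnits p := mul_mem (mem_locUnits_of_notMem hcS hcp) htu
  have h3 : x = (c * t)⁻¹ * (c * (t * x)) := by rw [← mul_assoc c, inv_mul_cancel_left]
  rw [h3]
  exact Submonoid.mul_mem _ h2.2 (mem_loc h1 p)

theorem mem_locUnits_of_regular {p : minimalPrimeSIdeals S} (hreg : ¬ conductorSet S ⊆ p) {x : Q}
    (hx : ∀ j, (W.exps p).val j x = 0) : x ∈ locUnits p :=
  ⟨W.mem_loc_of_regular hreg fun j => (hx j).ge, W.mem_loc_of_regular hreg fun j => by
    rw [ExponentData.val_inv, hx j]; rfl⟩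

/-- With two exponents, an element with values 1 and 0 would be local by `mem_loc_of_regular`, yet
neither a unit nor positive throughout. -/
theorem rank_eq_one_of_regular {p : minimalPrimeSIdeals S} (hreg : ¬ conductorSet S ⊆ p) :
    (W.exps p).rank = 1 := by
  by_contra hne
  have h0 := (W.exps p).rank_pos
  obtain ⟨x, hx⟩ := (W.exps p).exists_val fun j => if j.1 = 0 then 1 else 0
  have h1 : x ∈ loc p := W.mem_loc_of_regular hreg fun j => by rw [hx]; split_ifs <;> omega
  have h2 := (W.exps p).inv_mem_of_val_eq_zero h1 (j := ⟨1, by omega⟩) (by simp [hx])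
  have h3 := (W.exps p).val_unit h1 h2 ⟨0, h0⟩
  rw [hx] at h3
  simp at h3

end WeaklyKrullData

/-! ### Minimal primes of the complete integral closure -/

namespace WeaklyKrullData

variable (W : WeaklyKrullData S)

/-- The prime of the complete integral closure belonging to an exponent. -/
def closurePrime (p : minimalPrimeSIdeals S) (j : Fin (W.exps p).rank) : Set Q :=
  {x | x ∈ completeIntClosure S ∧ 0 < (W.exps p).val j x}

theorem closurePrime_isPrime (p : minimalPrimeSIdeals S) (j : Fin (W.exps p).rank) :
    IsPrimeSIdeal (completeIntClosure S) (W.closurePrime p j) := by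
  refine ⟨⟨fun x hx => hx.1, fun a ha x hx => ⟨Submonoid.mul_mem _ ha hx.1, ?_⟩⟩, fun h => ?_,
    fun a ha b hb hab => ?_⟩
  · rw [ExponentData.val_mul]
    have := W.val_nonneg_of_mem_completeIntClosure ha p j
    have := hx.2
    omega
  · have : (1 : Q) ∈ W.closurePrime p j := by rw [h]; exact Submonoid.one_mem _
    exact absurd this.2 (by rw [ExponentData.val_one]; exact lt_irrefl _)
  · have h := hab.2
    rw [ExponentData.val_mul] at h
    have := W.val_nonneg_of_mem_completeIntClosure ha p j
    have := W.val_nonneg_of_mem_completeIntClosure hb p j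
    rcases (show 0 < (W.exps p).val j a ∨ 0 < (W.exps p).val j b by omega) with h1 | h1
    exacts [Or.inl ⟨ha, h1⟩, Or.inr ⟨hb, h1⟩]

theorem le_completeIntClosure : S ≤ completeIntClosure S := fun x hx =>
  ⟨1, S.one_mem, fun n _ => by rw [one_mul]; exact S.pow_mem hx n⟩

theorem closurePrime_inter (p : minimalPrimeSIdeals S) (j : Fin (W.exps p).rank) :
    W.closurePrime p j ∩ S = p := by
  ext x
  constructor
  · rintro ⟨⟨-, h⟩, hxS⟩
    by_contra hxp
    have hu := mem_locUnits_of_notMem hxS hxp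
    exact h.ne' ((W.exps p).val_unit hu.1 hu.2 j)
  · intro hx
    have hxS := (isPrimeSIdeal_of_mem p.2).1.1 hx
    exact ⟨⟨le_completeIntClosure hxS, W.val_pos_of_mem hx j⟩, hxS⟩

/-- Let `a` lie in a smaller nonempty prime `I`. For `x` with positive `j`-th exponent, a power of
`x` times some element outside `I` is a multiple of `a`, whence `x ∈ I`. -/
theorem closurePrime_mem (p : minimalPrimeSIdeals S) (j : Fin (W.exps p).rank) :
    W.closurePrime p j ∈ minimalPrimeSIdeals (completeIntClosure S) := by
  refine ⟨⟨?_, W.closurePrime_isPrime p j⟩, fun I hI hle x hx => ?_⟩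
  · obtain ⟨x, hx⟩ := prime_nonempty p
    rw [← W.closurePrime_inter p j] at hx
    exact ⟨x, hx.1⟩
  obtain ⟨⟨a, ha⟩, hIp⟩ := hI
  have haC := hIp.1.1 ha
  set n : ℕ := ((W.exps p).val j a).toNat with hn
  -- The element `y` has exponent 0 at `j`, which keeps it out of `I`, and dominates `a` at the
  -- other exponents; at `j` this is left to `x ^ n`. The factors `t₁`, `t₂` repair the remaining
  -- primes.
  obtain ⟨y, hy⟩ := (W.exps p).exists_val fun j' =>
    if j' = j then 0 else max 0 ((W.exps p).val j' a)
  obtain ⟨t₁, ht₁, htp₁, h₁⟩ := W.exists_approx p (y := fun _ => y) (W.finite_notMem_loc _ p)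
  obtain ⟨t₂, ht₂, htp₂, h₂⟩ := W.exists_approx p (y := fun _ => y * x ^ n / a)
    (W.finite_notMem_loc _ p)
  have hu₁ := mem_locUnits_of_notMem ht₁ htp₁
  have hu₂ := mem_locUnits_of_notMem ht₂ htp₂
  have hv₁ := (W.exps p).val_unit hu₁.1 hu₁.2
  have hv₂ := (W.exps p).val_unit hu₂.1 hu₂.2
  have ht : t₁ * t₂ * y ∈ completeIntClosure S := by
    refine W.mem_completeIntClosure (p := p) (fun p' hp' => ?_) fun j' => ?_
    · rw [mul_comm t₁, mul_assoc]
      exact Submonoid.mul_mem _ (mem_loc ht₂ _) (h₁ p' hp')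
    · rw [ExponentData.val_mul, ExponentData.val_mul, hv₁, hv₂, hy]
      split_ifs
      · simp
      · simp
  have htn : t₁ * t₂ * y ∉ I := fun hI => by
    have := (hle hI).2
    rw [ExponentData.val_mul, ExponentData.val_mul, hv₁, hv₂, hy] at this
    simp at this
  have hb : t₁ * t₂ * (y * x ^ n / a) ∈ completeIntClosure S := by
    refine W.mem_completeIntClosure (p := p) (fun p' hp' => ?_) fun j' => ?_
    · rw [mul_assoc]
      exact Submonoid.mul_mem _ (mem_loc ht₁ _) (h₂ p' hp')
    · rw [ExponentData.val_mul, ExponentData.val_mul, hv₁, hv₂, ExponentData.val_div,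
        ExponentData.val_mul, ExponentData.val_pow, hy]
      have hxj := W.val_nonneg_of_mem_completeIntClosure hx.1 p j'
      have h3 : 0 ≤ (n : ℤ) * (W.exps p).val j' x := mul_nonneg (by positivity) hxj
      split_ifs with hjj
      · subst hjj
        have h4 : (n : ℤ) ≤ n * (W.exps p).val j' x :=
          le_mul_of_one_le_right (by positivity) hx.2
        have h5 := W.val_nonneg_of_mem_completeIntClosure haC p j'
        omega
      · have := le_max_right 0 ((W.exps p).val j' a)
        omega
  have hmem : t₁ * t₂ * y * x ^ n ∈ I := by
    have := hIp.1.2 _ hb a ha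
    have heq : t₁ * t₂ * (y * x ^ n / a) * a = t₁ * t₂ * y * x ^ n := by
      rw [mul_assoc (t₁ * t₂), div_mul_cancel, ← mul_assoc]
    rwa [heq] at this
  by_contra hxI
  exact mul_notMem_of_prime hIp ht (Submonoid.pow_mem _ hx.1 n) htn
    (pow_notMem_of_prime hIp hx.1 hxI n) hmem

theorem closurePrime_injective {p : minimalPrimeSIdeals S} {j j' : Fin (W.exps p).rank}
    (h : j ≠ j') : W.closurePrime p j ≠ W.closurePrime p j' := by
  intro heq
  obtain ⟨y, hy⟩ := (W.exps p).exists_val fun i => if i = j then 1 else 0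
  obtain ⟨t, ht, htp, hty⟩ := W.exists_approx p (y := fun _ => y) (W.finite_notMem_loc y p)
  have hu := mem_locUnits_of_notMem ht htp
  have hv := (W.exps p).val_unit hu.1 hu.2
  have hmem : t * y ∈ W.closurePrime p j := by
    refine ⟨W.mem_completeIntClosure hty fun i => ?_, ?_⟩
    · rw [ExponentData.val_mul, hv, hy]
      split_ifs <;> simp
    · rw [ExponentData.val_mul, hv, hy]
      simp
  rw [heq] at hmem
  have := hmem.2
  rw [ExponentData.val_mul, hv, hy] at this
  simp [h.symm] at this

theorem nontrivial_of_two_le_rank {p : minimalPrimeSIdeals S} (h : 2 ≤ (W.exps p).rank) :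
    {P ∈ minimalPrimeSIdeals (completeIntClosure S) | P ∩ (S : Set _) = p}.Nontrivial := by
  refine ⟨W.closurePrime p ⟨0, by omega⟩, ⟨W.closurePrime_mem p _, W.closurePrime_inter p _⟩,
    W.closurePrime p ⟨1, by omega⟩, ⟨W.closurePrime_mem p _, W.closurePrime_inter p _⟩,
    W.closurePrime_injective ?_⟩
  simp

end WeaklyKrullData

end WeaklyKrull

/-! ### Families of local elements and the $v$-class group -/

section Ideles

variable {Q : Type*} [CommGroup Q] {S : Submonoid Q}

variable (S) in
/-- Families of elements which are local units at almost all minimal primes. -/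
def ideles : Subgroup (minimalPrimeSIdeals S → Q) where
  carrier := {x | {p | x p ∉ locUnits p}.Finite}
  one_mem' := by
    refine Set.finite_empty.subset fun p hp => hp ?_
    exact one_mem (locUnits p)
  mul_mem' ha hb := (ha.union hb).subset fun p hp => by
    by_contra hcon
    rw [Set.mem_union, not_or] at hcon
    exact hp (mul_mem (not_not.1 hcon.1) (not_not.1 hcon.2))
  inv_mem' ha := ha.subset fun p hp h => hp (inv_mem h)

theorem mem_ideles {x : minimalPrimeSIdeals S → Q} :
    x ∈ ideles S ↔ {p | x p ∉ locUnits p}.Finite := Iff.rfl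

/-- The fractional ideal of a family of elements. -/
def ideleIdeal (x : minimalPrimeSIdeals S → Q) : Set Q := {z | ∀ p, z / x p ∈ loc p}

theorem mul_mem_ideleIdeal {x : minimalPrimeSIdeals S → Q} {a z : Q} (ha : a ∈ S)
    (hz : z ∈ ideleIdeal x) : a * z ∈ ideleIdeal x := fun p => by
  rw [mul_div_assoc]
  exact Submonoid.mul_mem _ (mem_loc ha p) (hz p)

namespace WeaklyKrullData

variable (W : WeaklyKrullData S)
include W

/-- By approximation, `x p` times an element outside `p` satisfies the conditions at all other
primes. So the ideal is locally generated by `x p`. -/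
theorem exists_mem_ideleIdeal {x : minimalPrimeSIdeals S → Q} (hx : x ∈ ideles S)
    (p : minimalPrimeSIdeals S) : ∃ z ∈ ideleIdeal x, z / x p ∈ locUnits p := by
  have hfin : {p' | p' ≠ p ∧ x p / x p' ∉ loc p'}.Finite := by
    refine ((mem_ideles.1 hx).union (W.finite_notMem_locUnits (x p))).subset fun p' hp' => ?_
    by_contra hcon
    rw [Set.mem_union, not_or] at hcon
    exact hp'.2 (div_mem (not_not.1 hcon.2) (not_not.1 hcon.1)).1
  obtain ⟨t, ht, htp, h⟩ := W.exists_approx p hfin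
  have htu := mem_locUnits_of_notMem ht htp
  refine ⟨t * x p, fun p' => ?_, by rwa [mul_div_cancel_right]⟩
  by_cases hp' : p' = p
  · subst hp'
    rw [mul_div_cancel_right]
    exact htu.1
  · rw [mul_div_assoc]
    exact h p' hp'

theorem mem_of_mul_subset {x : minimalPrimeSIdeals S → Q} (hx : x ∈ ideles S) {w : Q}
    {p : minimalPrimeSIdeals S} (h : ∀ z ∈ ideleIdeal x, w * z ∈ loc p) : w * x p ∈ loc p := by
  obtain ⟨z, hz, hu⟩ := W.exists_mem_ideleIdeal hx p
  have : w * x p = w * z * (z / x p)⁻¹ := by rw [inv_div, mul_assoc, mul_div_cancel]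
  rw [this]
  exact Submonoid.mul_mem _ (h z hz) hu.2

/-- The condition can be tested at each prime, where both ideals contain local generators. -/
theorem colonSet_ideleIdeal_mul {x y : minimalPrimeSIdeals S → Q} (hx : x ∈ ideles S)
    (hy : y ∈ ideles S) :
    colonSet (S : Set Q) (ideleIdeal x * ideleIdeal y) = ideleIdeal (x * y)⁻¹ := by
  ext w
  constructor
  · intro h p
    have h1 : w * x p * y p ∈ loc p := by
      refine W.mem_of_mul_subset hy fun z hz => ?_
      rw [mul_right_comm]
      refine W.mem_of_mul_subset hx fun z' hz' => ?_
      have := h (z' * z) ⟨z', hz', z, hz, rfl⟩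
      rw [mul_assoc, mul_comm z z']
      exact mem_loc this p
    change w / (x p * y p)⁻¹ ∈ loc p
    rwa [div_inv_eq_mul, ← mul_assoc]
  · rintro h _ ⟨z, hz, z', hz', rfl⟩
    refine W.mem_of_forall fun p => ?_
    have h1 := Submonoid.mul_mem _ (h p) (Submonoid.mul_mem _ (hz p) (hz' p))
    convert h1 using 1
    simp only [Pi.inv_apply, Pi.mul_apply, div_mul_div_comm]
    rw [inv_mul_cancel, div_one]

theorem ideleIdeal_one : ideleIdeal (1 : minimalPrimeSIdeals S → Q) = S := by
  ext z
  refine ⟨fun h => W.mem_of_forall fun p => ?_, fun h p => ?_⟩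
  · simpa using h p
  · simpa using mem_loc h p

theorem colonSet_ideleIdeal {x : minimalPrimeSIdeals S → Q} (hx : x ∈ ideles S) :
    colonSet (S : Set Q) (ideleIdeal x) = ideleIdeal x⁻¹ := by
  have h := W.colonSet_ideleIdeal_mul hx (one_mem _)
  rw [mul_one, W.ideleIdeal_one] at h
  rw [← h]
  ext w
  constructor
  · rintro hw _ ⟨z, hz, s, hs, rfl⟩
    have := S.mul_mem (hw z hz) hs
    rwa [mul_assoc] at this
  · intro hw z hz
    simpa using hw _ ⟨z, hz, 1, S.one_mem, rfl⟩

theorem ideleIdeal_nonempty {x : minimalPrimeSIdeals S → Q} (hx : x ∈ ideles S) :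
    (ideleIdeal x).Nonempty := by
  rcases isEmpty_or_nonempty (minimalPrimeSIdeals S) with h | ⟨⟨p⟩⟩
  · exact ⟨1, fun p => h.elim p⟩
  · obtain ⟨z, hz, -⟩ := W.exists_mem_ideleIdeal hx p
    exact ⟨z, hz⟩

/-- The fractional `v`-ideal of a family of elements. -/
def ideleFrac (x : ideles S) : FracVIdeal S where
  carrier := ideleIdeal x.1
  nonempty := W.ideleIdeal_nonempty x.2
  fractional := by
    obtain ⟨w, hw⟩ := W.ideleIdeal_nonempty (inv_mem x.2)
    obtain ⟨a, ha, b, hb, rfl⟩ := W.quot w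
    refine ⟨a, ha, fun z hz => ?_⟩
    have h := mul_mem_ideleIdeal hb hw
    rw [mul_div_cancel, ← W.colonSet_ideleIdeal x.2] at h
    exact h z hz
  vClosure_eq := by
    rw [vClosure, W.colonSet_ideleIdeal x.2, W.colonSet_ideleIdeal (inv_mem x.2), inv_inv]

/-- The `v`-invertible fractional `v`-ideal of a family of elements. -/
def ideleUnits : ideles S →* (FracVIdeal S)ˣ :=
  MonoidHom.toHomUnits
    { toFun := W.ideleFrac
      map_one' := FracVIdeal.ext W.ideleIdeal_one
      map_mul' := fun x y => FracVIdeal.ext (by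
        change ideleIdeal (x.1 * y.1) = vClosure S (ideleIdeal x.1 * ideleIdeal y.1)
        rw [vClosure, W.colonSet_ideleIdeal_mul x.2 y.2,
          W.colonSet_ideleIdeal (inv_mem (mul_mem x.2 y.2)), inv_inv]) }

theorem carrier_ideleUnits (x : ideles S) :
    (W.ideleUnits x : FracVIdeal S).carrier = ideleIdeal x.1 := rfl

/-- The class of a family of elements. -/
def ideleClass : ideles S →* VClassGroup S := (QuotientGroup.mk' _).comp W.ideleUnits

theorem ideleIdeal_const (a : Q) : ideleIdeal (fun _ : minimalPrimeSIdeals S => a) =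
    a • (S : Set Q) := by
  ext z
  rw [Set.mem_smul_set_iff_inv_smul_mem, smul_eq_mul, mul_comm, ← div_eq_mul_inv]
  exact ⟨fun h => W.mem_of_forall h, fun h p => mem_loc h p⟩

theorem const_mem_ideles (a : Q) : (fun _ => a) ∈ ideles S := W.finite_notMem_locUnits a

theorem div_mem_locUnits_of_eq {x y : minimalPrimeSIdeals S → Q} (hx : x ∈ ideles S)
    (hy : y ∈ ideles S) (h : ideleIdeal x = ideleIdeal y) (p : minimalPrimeSIdeals S) :
    x p / y p ∈ locUnits p := by
  have main : ∀ {x y : minimalPrimeSIdeals S → Q}, x ∈ ideles S → ideleIdeal x = ideleIdeal y →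
      x p / y p ∈ loc p := by
    intro x y hx h
    rw [div_eq_inv_mul]
    refine W.mem_of_mul_subset hx fun z hz => ?_
    rw [h] at hz
    rw [← div_eq_inv_mul]
    exact hz p
  exact ⟨main hx h, by rw [inv_div]; exact main hy h.symm⟩

/-- The ideal determines its family up to local units, so it is principal exactly if the family is
constant up to local units. -/
theorem ideleClass_eq_one_iff (x : ideles S) :
    W.ideleClass x = 1 ↔ ∃ a : Q, ∀ p, x.1 p / a ∈ locUnits p := by
  change ((W.ideleUnits x : (FracVIdeal S)ˣ) : VClassGroup S) = 1 ↔ _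
  rw [QuotientGroup.eq_one_iff]
  change (∃ a : Q, (W.ideleUnits x : FracVIdeal S).carrier = a • (S : Set Q)) ↔ _
  refine exists_congr fun a => ?_
  rw [W.carrier_ideleUnits, ← W.ideleIdeal_const]
  constructor
  · exact fun h => W.div_mem_locUnits_of_eq x.2 (W.const_mem_ideles a) h
  · intro h
    ext z
    refine forall_congr' fun p => ⟨fun hz => ?_, fun hz => ?_⟩
    · have := Submonoid.mul_mem _ hz (h p).1
      rwa [div_mul_div_cancel] at this
    · have := Submonoid.mul_mem _ hz (h p).2
      rwa [inv_div, div_mul_div_cancel] at this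

theorem ideleClass_eq_of_units {x y : ideles S} (h : ∀ p, x.1 p / y.1 p ∈ locUnits p) :
    W.ideleClass x = W.ideleClass y := by
  rw [← div_eq_one, ← map_div, W.ideleClass_eq_one_iff]
  exact ⟨1, fun p => by simpa using h p⟩

open Classical in
omit W in
theorem mulSingle_mem_ideles (p : minimalPrimeSIdeals S) (a : Q) :
    Pi.mulSingle p a ∈ ideles S := by
  refine (Set.finite_singleton p).subset fun p' hp' => ?_
  by_contra h
  refine hp' ?_
  rw [Pi.mulSingle_eq_of_ne h]
  exact one_mem _

open Classical in
/-- The family concentrated at one minimal prime. -/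
noncomputable def singleIdele (p : minimalPrimeSIdeals S) : Q →* ideles S where
  toFun a := ⟨Pi.mulSingle p a, mulSingle_mem_ideles p a⟩
  map_one' := Subtype.ext (Pi.mulSingle_one (M := fun _ => Q) p)
  map_mul' a b := Subtype.ext (Pi.mulSingle_mul (f := fun _ => Q) p a b)

/-- The class of an element at a minimal prime. -/
noncomputable def localClass (p : minimalPrimeSIdeals S) : Q →* VClassGroup S :=
  W.ideleClass.comp (singleIdele p)

theorem localClass_eq_one {p : minimalPrimeSIdeals S} {u : Q} (hu : u ∈ locUnits p) :
    W.localClass p u = 1 := by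
  classical
  refine (W.ideleClass_eq_one_iff _).2 ⟨1, fun p' => ?_⟩
  change (Pi.mulSingle p u : minimalPrimeSIdeals S → Q) p' / 1 ∈ locUnits p'
  rw [div_one]
  by_cases h : p' = p
  · subst h; rwa [Pi.mulSingle_eq_same]
  · rw [Pi.mulSingle_eq_of_ne h]; exact one_mem _

theorem ideleClass_eq_prod (x : ideles S) {E : Finset (minimalPrimeSIdeals S)}
    (hE : ∀ p, p ∉ E → x.1 p ∈ locUnits p) :
    W.ideleClass x = ∏ p ∈ E, W.localClass p (x.1 p) := by
  classical
  have : ∏ p ∈ E, W.localClass p (x.1 p) =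
      W.ideleClass (∏ p ∈ E, singleIdele p (x.1 p)) := by
    rw [map_prod]; rfl
  rw [this]
  refine W.ideleClass_eq_of_units fun p => ?_
  have hval : (∏ p ∈ E, singleIdele p (x.1 p)).1 p = if p ∈ E then x.1 p else 1 := by
    rw [Subgroup.val_finsetProd, Finset.prod_apply]
    exact Finset.prod_pi_mulSingle p x.1 E
  rw [hval]
  split_ifs with h
  · rw [div_self']; exact one_mem _
  · rw [div_one]; exact hE p h

/-- The class of a regular minimal prime. -/
theorem localClass_of_regular {p : minimalPrimeSIdeals S} (hreg : ¬ conductorSet S ⊆ p)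
    {u : (FracVIdeal S)ˣ} (hu : (u : FracVIdeal S).carrier = p) {x : Q}
    (hx : ∀ j, (W.exps p).val j x = 1) : W.localClass p x = (u : VClassGroup S) := by
  classical
  have : W.ideleUnits (singleIdele p x) = u := by
    refine Units.ext (FracVIdeal.ext ?_)
    rw [hu, W.carrier_ideleUnits]
    change ideleIdeal (Pi.mulSingle p x : minimalPrimeSIdeals S → Q) = p
    have hj : 0 < (W.exps p).rank := (W.exps p).rank_pos
    ext z
    constructor
    · intro hz
      have hzp := hz p
      rw [Pi.mulSingle_eq_same] at hzp
      have hpos : ∀ j, 0 < (W.exps p).val j z := fun j => by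
        have := (W.exps p).val_nonneg hzp j
        rw [ExponentData.val_div, hx] at this
        omega
      have hzS : z ∈ S := W.mem_of_forall fun p' => by
        by_cases h : p' = p
        · subst h; exact (W.exps p').mem_of_pos hpos
        · have := hz p'
          rwa [Pi.mulSingle_eq_of_ne h, div_one] at this
      by_contra hzp'
      have hzu := mem_locUnits_of_notMem hzS hzp'
      have := (W.exps p).val_unit hzu.1 hzu.2 ⟨0, hj⟩
      have := hpos ⟨0, hj⟩
      omega
    · intro hz p'
      have hzS := (isPrimeSIdeal_of_mem p.2).1.1 hz
      by_cases h : p' = p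
      · subst h
        rw [Pi.mulSingle_eq_same]
        refine W.mem_loc_of_regular hreg fun j => ?_
        have := W.val_pos_of_mem hz j
        rw [ExponentData.val_div, hx]
        omega
      · rw [Pi.mulSingle_eq_of_ne h, div_one]
        exact mem_loc hzS p'
  change ((W.ideleUnits (singleIdele p x) : (FracVIdeal S)ˣ) : VClassGroup S) = _
  rw [this]

end WeaklyKrullData

end Ideles

/-! ### Transfer homomorphisms -/

section TransferPrinciple

variable {H M : Type*} [CancelCommMonoid H] [AddCancelCommMonoid M] {B : AddSubmonoid M} {θ : H → M}
  (hadd : ∀ a b, θ (a * b) = θ a + θ b) (hunit : ∀ a, θ a = 0 ↔ IsUnit a) (hmem : ∀ a, θ a ∈ B)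
  (hsplit : ∀ a, ∀ v ∈ B, ∀ w ∈ B, v + w = θ a → ∃ b c, a = b * c ∧ θ b = v ∧ θ c = w)
include hadd hunit hmem hsplit

theorem irreducible_iff_isAtomIn (a : H) : Irreducible a ↔ IsAtomIn B (θ a) := by
  constructor
  · intro h
    refine ⟨hmem a, fun h0 => h.not_isUnit ((hunit a).1 h0), fun v hv w hw hvw => ?_⟩
    obtain ⟨b, c, rfl, rfl, rfl⟩ := hsplit a v hv w hw hvw
    rw [hunit, hunit]
    exact h.isUnit_or_isUnit rfl
  · intro h
    refine ⟨fun hu => h.2.1 ((hunit a).2 hu), fun b c hbc => ?_⟩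
    rw [← hunit, ← hunit]
    exact h.2.2 _ (hmem b) _ (hmem c) (by rw [← hadd, hbc])

/-- Factorizations map forward atom by atom; conversely `hsplit` peels off preimages of the atoms of
`θ a` one after another. -/
theorem lengthSet_eq_lengthsIn (a : H) : lengthSet a = lengthsIn B (θ a) := by
  have h1 : θ 1 = 0 := (hunit 1).2 isUnit_one
  have hprod : ∀ z : Multiset H, θ z.prod = (z.map θ).sum := fun z => by
    induction z using Multiset.induction_on with
    | empty => simpa using h1
    | cons a s ih => rw [Multiset.prod_cons, hadd, Multiset.map_cons, Multiset.sum_cons, ih]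
  ext k
  constructor
  · rintro ⟨z, hz, ⟨u, hu⟩, rfl⟩
    refine ⟨z.map θ, fun v hv => ?_, ?_, by simp⟩
    · obtain ⟨b, hb, rfl⟩ := Multiset.mem_map.1 hv
      exact (irreducible_iff_isAtomIn hadd hunit hmem hsplit b).1 (hz b hb)
    · rw [← hu, hadd, hprod, (hunit u).2 u.isUnit, add_zero]
  · rintro ⟨z, hz, hza, rfl⟩
    induction z using Multiset.induction_on generalizing a with
    | empty =>
      have hu := (hunit a).1 (by simpa using hza.symm)
      exact ⟨0, by simp, by simpa using (associated_one_iff_isUnit.2 hu).symm, by simp⟩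
    | cons v s ih =>
      rw [Multiset.sum_cons] at hza
      obtain ⟨b, c, rfl, hb, hc⟩ := hsplit a v (hz v (Multiset.mem_cons_self v s)).1 s.sum
        (sum_mem_of_atoms fun u hu => hz u (Multiset.mem_cons_of_mem hu)) hza
      obtain ⟨y, hy, hyc, hcard⟩ := ih c (fun u hu => hz u (Multiset.mem_cons_of_mem hu)) hc.symm
      refine ⟨b ::ₘ y, fun u hu => ?_, ?_, by simp [hcard]⟩
      · rcases Multiset.mem_cons.1 hu with rfl | h
        · exact (irreducible_iff_isAtomIn hadd hunit hmem hsplit u).2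
            (hb ▸ hz v (Multiset.mem_cons_self v s))
        · exact hy u h
      · rw [Multiset.prod_cons]
        exact hyc.mul_left b

theorem distances_eq_distancesIn (honto : ∀ x ∈ B, ∃ a, θ a = x) :
    distances H = distancesIn B := by
  ext d
  simp only [distances, distancesIn, Set.mem_iUnion]
  constructor
  · rintro ⟨a, ha⟩
    rw [lengthSet_eq_lengthsIn hadd hunit hmem hsplit] at ha
    exact ⟨_, hmem a, ha⟩
  · rintro ⟨x, hx, hd⟩
    obtain ⟨a, rfl⟩ := honto x hx
    rw [← lengthSet_eq_lengthsIn hadd hunit hmem hsplit] at hd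
    exact ⟨a, hd⟩

end TransferPrinciple

/-! ### Local elements as classes and exponent vectors -/

section LocalToBlock

variable {Q : Type*} [CommGroup Q] {S : Submonoid Q}

namespace ExponentData

variable {D : Submonoid Q} (V : ExponentData D)

theorem val_prod {κ : Type*} (s : Finset κ) (f : κ → Q) (j : Fin V.rank) :
    V.val j (∏ k ∈ s, f k) = ∑ k ∈ s, V.val j (f k) := by
  classical
  induction s using Finset.induction_on with
  | empty => simp [V.val_one]
  | insert a s ha ih => rw [Finset.prod_insert ha, Finset.sum_insert ha, V.val_mul, ih]

/-- An element with one exponent equal to one and the others equal to zero. -/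
noncomputable def prime (j : Fin V.rank) : Q :=
  (V.exists_val fun j' => if j' = j then 1 else 0).choose

theorem val_prime (j j' : Fin V.rank) : V.val j' (V.prime j) = if j' = j then 1 else 0 :=
  (V.exists_val fun j' => if j' = j then 1 else 0).choose_spec j'

/-- An element with all exponents equal to one. -/
noncomputable def unif : Q := (V.exists_val fun _ => 1).choose

theorem val_unif (j : Fin V.rank) : V.val j V.unif = 1 := (V.exists_val fun _ => 1).choose_spec j

/-- A product of powers of primes. -/
noncomputable def monomial (k : Fin V.rank → ℕ) : Q := ∏ j, V.prime j ^ k j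

theorem val_monomial (k : Fin V.rank → ℕ) (j : Fin V.rank) : V.val j (V.monomial k) = k j := by
  rw [monomial, val_prod]
  simp [val_pow, val_prime]

end ExponentData

namespace WeaklyKrullData

variable (W : WeaklyKrullData S)

/-- The set of singular minimal primes. -/
abbrev Sing (S : Submonoid Q) : Type _ := {p : minimalPrimeSIdeals S // conductorSet S ⊆ p}

/-- The classes of elements with trivial exponents. -/
def unitClasses (p : minimalPrimeSIdeals S) : AddSubgroup (Additive (VClassGroup S)) where
  carrier := {g | ∃ x, (∀ j, (W.exps p).val j x = 0) ∧ Additive.ofMul (W.localClass p x) = g}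
  zero_mem' := ⟨1, fun j => (W.exps p).val_one j, by rw [map_one]; rfl⟩
  add_mem' := by
    rintro _ _ ⟨x, hx, rfl⟩ ⟨y, hy, rfl⟩
    exact ⟨x * y, fun j => by rw [ExponentData.val_mul, hx, hy]; rfl, by rw [map_mul]; rfl⟩
  neg_mem' := by
    rintro _ ⟨x, hx, rfl⟩
    exact ⟨x⁻¹, fun j => by rw [ExponentData.val_inv, hx]; rfl, by rw [map_inv]; rfl⟩

/-- The block monoid data of a weakly Krull monoid. -/
noncomputable def blockData : BlockData (Additive (VClassGroup S)) (Sing S) where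
  rank i := (W.exps i.1).rank
  rank_pos i := (W.exps i.1).rank_pos
  cls i j := Additive.ofMul (W.localClass i.1 ((W.exps i.1).prime j))
  unitCls i := W.unitClasses i.1

theorem phi_eq (i : Sing S) (k : Fin (W.exps i.1).rank → ℕ) :
    W.blockData.phi i k = Additive.ofMul (W.localClass i.1 ((W.exps i.1).monomial k)) := by
  change ∑ j, k j • Additive.ofMul (W.localClass i.1 ((W.exps i.1).prime j)) = _
  rw [ExponentData.monomial, map_prod, ofMul_prod]
  exact Finset.sum_congr rfl fun j _ => by rw [map_pow, ofMul_pow]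

/-- The local part of the image of an element in the block monoid. -/
noncomputable def localPart (i : Sing S) (x : Q) :
    Additive (VClassGroup S) × (Fin (W.exps i.1).rank → ℕ) :=
  (Additive.ofMul (W.localClass i.1 x), fun j => ((W.exps i.1).val j x).toNat)

theorem localPart_mul (i : Sing S) {x y : Q} (hx : x ∈ loc i.1) (hy : y ∈ loc i.1) :
    W.localPart i (x * y) = W.localPart i x + W.localPart i y := by
  refine Prod.ext ?_ (funext fun j => ?_)
  · simp only [localPart, map_mul, ofMul_mul, Prod.fst_add]
  · simp only [localPart, Prod.snd_add, Pi.add_apply, ExponentData.val_mul]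
    exact Int.toNat_add ((W.exps i.1).val_nonneg hx j) ((W.exps i.1).val_nonneg hy j)

theorem localPart_of_unit (i : Sing S) {x : Q} (hx : x ∈ locUnits i.1) : W.localPart i x = 0 := by
  refine Prod.ext ?_ (funext fun j => ?_)
  · simp only [localPart, W.localClass_eq_one hx]; rfl
  · simp [localPart, (W.exps i.1).val_unit hx.1 hx.2 j]

theorem mem_locUnits_of_localPart {i : Sing S} {x : Q} (hx : x ∈ loc i.1)
    (h : W.localPart i x = 0) : x ∈ locUnits i.1 := by
  have j : Fin (W.exps i.1).rank := ⟨0, (W.exps i.1).rank_pos⟩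
  have h1 := congrFun (congrArg Prod.snd h) j
  have h2 := (W.exps i.1).val_nonneg hx j
  simp only [localPart, Prod.snd_zero, Pi.zero_apply] at h1
  exact ⟨hx, (W.exps i.1).inv_mem_of_val_eq_zero hx (j := j) (by omega)⟩

theorem val_localPart (i : Sing S) {x : Q} (hx : x ∈ loc i.1) :
    W.blockData.Val i (W.localPart i x) := by
  by_cases hu : x⁻¹ ∈ loc i.1
  · exact Or.inl (W.localPart_of_unit i ⟨hx, hu⟩)
  · have hpos := (W.exps i.1).val_pos hx hu
    refine Or.inr ⟨fun j => ?_, ?_⟩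
    · have := hpos j
      simp only [localPart]
      omega
    · rw [phi_eq]
      refine ⟨x / (W.exps i.1).monomial (W.localPart i x).2, fun j => ?_, by rw [map_div]; rfl⟩
      rw [ExponentData.val_div, ExponentData.val_monomial]
      simp only [localPart]
      have := hpos j
      omega

theorem exists_localPart_eq {i : Sing S} {t : Additive (VClassGroup S) × (Fin (W.exps i.1).rank → ℕ)}
    (ht : W.blockData.Val i t) : ∃ y ∈ loc i.1, W.localPart i y = t ∧
      ∀ j, (W.exps i.1).val j y = t.2 j := by
  rcases ht with rfl | ⟨hpos, x, hx, hxt⟩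
  · refine ⟨1, Submonoid.one_mem _, W.localPart_of_unit i (one_mem _), fun j => ?_⟩
    rw [ExponentData.val_one]; rfl
  · have hval : ∀ j, (W.exps i.1).val j (x * (W.exps i.1).monomial t.2) = t.2 j := fun j => by
      rw [ExponentData.val_mul, hx, ExponentData.val_monomial, zero_add]
    refine ⟨x * (W.exps i.1).monomial t.2, (W.exps i.1).mem_of_pos fun j => ?_, ?_, hval⟩
    · rw [hval]
      exact_mod_cast hpos j
    · refine Prod.ext ?_ (funext fun j => ?_)
      · simp only [localPart, map_mul, ofMul_mul]
        rw [hxt, ← phi_eq, sub_add_cancel]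
      · simp [localPart, hval]

/-- If both parts are nonzero, any lift `y` of `t` works: the exponents of `x / y` are those of
`t'`, hence positive, and positivity alone makes `x / y` local. -/
theorem exists_localPart_split {i : Sing S} {x : Q} (hx : x ∈ loc i.1)
    {t t' : Additive (VClassGroup S) × (Fin (W.exps i.1).rank → ℕ)} (ht : W.blockData.Val i t)
    (ht' : W.blockData.Val i t') (h : t + t' = W.localPart i x) :
    ∃ y ∈ loc i.1, x / y ∈ loc i.1 ∧ W.localPart i y = t := by
  by_cases h0 : t' = 0
  · refine ⟨x, hx, by rw [div_self']; exact Submonoid.one_mem _, ?_⟩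
    rw [← h, h0, add_zero]
  by_cases h1 : t = 0
  · exact ⟨1, Submonoid.one_mem _, by rwa [div_one], by
      rw [h1]; exact W.localPart_of_unit i (one_mem _)⟩
  obtain ⟨y, hy, hyt, hval⟩ := W.exists_localPart_eq ht
  refine ⟨y, hy, (W.exps i.1).mem_of_pos fun j => ?_, hyt⟩
  have h2 := congrFun (congrArg Prod.snd h) j
  have h3 := ht'.pos h0 j
  simp only [localPart, Prod.snd_add, Pi.add_apply] at h2
  have h4 := (W.exps i.1).val_nonneg hx j
  rw [ExponentData.val_div, hval]
  change 0 < t'.2 j at h3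
  omega

/-! ### The regular part -/

/-- The exponent at a minimal prime. -/
def regVal (p : minimalPrimeSIdeals S) (x : Q) : ℕ :=
  ((W.exps p).val ⟨0, (W.exps p).rank_pos⟩ x).toNat

/-- The class of a minimal prime. -/
noncomputable def primeClass (p : minimalPrimeSIdeals S) : Additive (VClassGroup S) :=
  Additive.ofMul (W.localClass p (W.exps p).unif)

theorem val_eq_of_regular {p : minimalPrimeSIdeals S} (hreg : ¬ conductorSet S ⊆ p) {x : Q}
    (hx : x ∈ loc p) (j : Fin (W.exps p).rank) : (W.exps p).val j x = W.regVal p x := by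
  have hj : j = ⟨0, (W.exps p).rank_pos⟩ := Fin.ext (by
    have := W.rank_eq_one_of_regular hreg
    have := j.2
    simp only
    omega)
  rw [hj, regVal, Int.toNat_of_nonneg ((W.exps p).val_nonneg hx _)]

theorem regVal_mul {p : minimalPrimeSIdeals S} {x y : Q} (hx : x ∈ loc p) (hy : y ∈ loc p) :
    W.regVal p (x * y) = W.regVal p x + W.regVal p y := by
  rw [regVal, ExponentData.val_mul]
  exact Int.toNat_add ((W.exps p).val_nonneg hx _) ((W.exps p).val_nonneg hy _)

theorem regVal_of_unit {p : minimalPrimeSIdeals S} {x : Q} (hx : x ∈ locUnits p) :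
    W.regVal p x = 0 := by
  rw [regVal, (W.exps p).val_unit hx.1 hx.2]
  rfl

theorem regVal_unif_pow (p : minimalPrimeSIdeals S) (n : ℕ) :
    W.regVal p ((W.exps p).unif ^ n) = n := by
  rw [regVal, ExponentData.val_pow, ExponentData.val_unif]
  simp

theorem unif_pow_mem {p : minimalPrimeSIdeals S} (hreg : ¬ conductorSet S ⊆ p) (n : ℕ) :
    (W.exps p).unif ^ n ∈ loc p := W.mem_loc_of_regular hreg fun j => by
  rw [ExponentData.val_pow, ExponentData.val_unif]; simp

theorem div_unif_pow_mem {p : minimalPrimeSIdeals S} (hreg : ¬ conductorSet S ⊆ p) {x : Q}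
    (hx : x ∈ loc p) {n : ℕ} (hn : n ≤ W.regVal p x) : x / (W.exps p).unif ^ n ∈ loc p :=
  W.mem_loc_of_regular hreg fun j => by
    rw [ExponentData.val_div, ExponentData.val_pow, ExponentData.val_unif,
      W.val_eq_of_regular hreg hx]
    omega

theorem localClass_regular {p : minimalPrimeSIdeals S} (hreg : ¬ conductorSet S ⊆ p) {x : Q}
    (hx : x ∈ loc p) : Additive.ofMul (W.localClass p x) = W.regVal p x • W.primeClass p := by
  have hu : x / (W.exps p).unif ^ W.regVal p x ∈ locUnits p :=
    W.mem_locUnits_of_regular hreg fun j => by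
      rw [ExponentData.val_div, ExponentData.val_pow, ExponentData.val_unif,
        W.val_eq_of_regular hreg hx]
      omega
  have h1 := W.localClass_eq_one hu
  rw [map_div, div_eq_one, map_pow] at h1
  rw [h1]; rfl

end WeaklyKrullData

end LocalToBlock

/-! ### The map from families of local elements to the block monoid -/

section LocalToBlock

variable {Q : Type*} [CommGroup Q] {S : Submonoid Q}

namespace WeaklyKrullData

variable (W : WeaklyKrullData S)

open Classical in
/-- The sequence of classes of regular primes with given multiplicities. -/
noncomputable def primeSeq (n : minimalPrimeSIdeals S → ℕ) (p : minimalPrimeSIdeals S) :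
    Multiset (Additive (VClassGroup S)) :=
  if conductorSet S ⊆ p then 0 else Multiset.replicate (n p) (W.primeClass p)

theorem primeSeq_of_sing {n : minimalPrimeSIdeals S → ℕ} {p : minimalPrimeSIdeals S}
    (h : conductorSet S ⊆ p) : W.primeSeq n p = 0 := if_pos h

theorem primeSeq_of_reg {n : minimalPrimeSIdeals S → ℕ} {p : minimalPrimeSIdeals S}
    (h : ¬ conductorSet S ⊆ p) : W.primeSeq n p = Multiset.replicate (n p) (W.primeClass p) :=
  if_neg h

theorem primeSeq_of_eq_zero {n : minimalPrimeSIdeals S → ℕ} {p : minimalPrimeSIdeals S}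
    (h : n p = 0) : W.primeSeq n p = 0 := by
  rw [primeSeq, h]
  split_ifs <;> rfl

/-- The image in the ambient monoid of a family of local elements. -/
noncomputable def toAmb (x : minimalPrimeSIdeals S → Q) : W.blockData.Amb :=
  (∑ᶠ p, W.primeSeq (fun p => W.regVal p (x p)) p, fun i => W.localPart i (x i.1))

variable {W}

theorem support_primeSeq {x : minimalPrimeSIdeals S → Q} (hx : x ∈ ideles S) :
    (Function.support (W.primeSeq fun p => W.regVal p (x p))).Finite :=
  (mem_ideles.1 hx).subset fun _ hp hu => hp (W.primeSeq_of_eq_zero (W.regVal_of_unit hu))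

theorem toAmb_fst_eq_sum {x : minimalPrimeSIdeals S → Q} (hx : x ∈ ideles S) :
    (W.toAmb x).1 = ∑ p ∈ (mem_ideles.1 hx).toFinset,
      W.primeSeq (fun p => W.regVal p (x p)) p := by
  refine finsum_eq_sum_of_support_subset _ fun p hp => ?_
  rw [Set.Finite.coe_toFinset]
  exact fun hu => hp (W.primeSeq_of_eq_zero (W.regVal_of_unit hu))

theorem toAmb_mul {x y : minimalPrimeSIdeals S → Q} (hx : x ∈ ideles S) (hy : y ∈ ideles S)
    (hxl : ∀ p, x p ∈ loc p) (hyl : ∀ p, y p ∈ loc p) :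
    W.toAmb (x * y) = W.toAmb x + W.toAmb y := by
  refine Prod.ext ?_ (funext fun i => W.localPart_mul i (hxl _) (hyl _))
  rw [Prod.fst_add]
  simp only [toAmb]
  rw [← finsum_add_distrib (support_primeSeq hx) (support_primeSeq hy)]
  refine finsum_congr fun p => ?_
  by_cases h : conductorSet S ⊆ p
  · simp only [W.primeSeq_of_sing h, add_zero]
  · simp only [W.primeSeq_of_reg h, ← Multiset.replicate_add, Pi.mul_apply,
      W.regVal_mul (hxl p) (hyl p)]

theorem toAmb_of_units {x : minimalPrimeSIdeals S → Q} (hx : ∀ p, x p ∈ locUnits p) :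
    W.toAmb x = 0 := by
  refine Prod.ext ?_ (funext fun i => W.localPart_of_unit i (hx _))
  simp only [toAmb]
  refine finsum_eq_zero_of_forall_eq_zero fun p => W.primeSeq_of_eq_zero (W.regVal_of_unit (hx p))

theorem toAmb_eq_of_units {x y : minimalPrimeSIdeals S → Q} (hy : y ∈ ideles S)
    (hyl : ∀ p, y p ∈ loc p) (h : ∀ p, x p / y p ∈ locUnits p) : W.toAmb x = W.toAmb y := by
  have hu : x / y ∈ ideles S := by
    refine Set.finite_empty.subset fun p hp => hp ?_
    exact h p
  have := toAmb_mul (W := W) hu hy (fun p => (h p).1) hyl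
  rw [div_mul_cancel, toAmb_of_units (x := x / y) h, zero_add] at this
  exact this

theorem units_of_toAmb_eq_zero {x : minimalPrimeSIdeals S → Q} (hx : x ∈ ideles S)
    (hxl : ∀ p, x p ∈ loc p) (h : W.toAmb x = 0) (p : minimalPrimeSIdeals S) :
    x p ∈ locUnits p := by
  by_cases hp : conductorSet S ⊆ p
  · exact W.mem_locUnits_of_localPart (i := ⟨p, hp⟩) (hxl p)
      (congrFun (congrArg Prod.snd h) ⟨p, hp⟩)
  · by_contra hu
    have h1 : (W.toAmb x).1 = 0 := congrArg Prod.fst h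
    rw [toAmb_fst_eq_sum hx, Finset.sum_eq_zero_iff] at h1
    have h2 := h1 p ((Set.Finite.mem_toFinset _).2 hu)
    rw [W.primeSeq_of_reg hp] at h2
    have h3 := congrArg Multiset.card h2
    simp only [Multiset.card_replicate, Multiset.card_zero] at h3
    refine hu (W.mem_locUnits_of_regular hp fun j => ?_)
    rw [W.val_eq_of_regular hp (hxl p), h3]
    rfl

variable [Fintype (Sing S)]

/-- The class of a family is the product of its local classes. The singular ones are recorded as
they are, and a regular one is the multiplicity times the class of the prime. -/
theorem tot_toAmb {x : minimalPrimeSIdeals S → Q} (hx : x ∈ ideles S) (hxl : ∀ p, x p ∈ loc p) :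
    W.blockData.tot (W.toAmb x) = Additive.ofMul (W.ideleClass ⟨x, hx⟩) := by
  classical
  set E := (mem_ideles.1 hx).toFinset ∪ Finset.univ.map
    (Function.Embedding.subtype fun p : minimalPrimeSIdeals S => conductorSet S ⊆ p) with hE
  have hEu : ∀ p, p ∉ E → x p ∈ locUnits p := by
    intro p hp
    by_contra hu
    exact hp (Finset.mem_union_left _ ((Set.Finite.mem_toFinset _).2 hu))
  rw [W.ideleClass_eq_prod ⟨x, hx⟩ hEu, ofMul_prod, BlockData.tot_apply,
    ← Finset.sum_filter_add_sum_filter_not E (fun p => conductorSet S ⊆ p), add_comm]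
  congr 1
  · exact (Finset.sum_subtype (p := fun p : minimalPrimeSIdeals S => conductorSet S ⊆ p) _
      (fun p => by simpa [hE] using fun h => Or.inr h) fun p => Additive.ofMul (W.localClass p (x p))).symm
  · have h1 : (W.toAmb x).1 = ∑ p ∈ E, W.primeSeq (fun p => W.regVal p (x p)) p := by
      refine finsum_eq_sum_of_support_subset _ fun p hp => ?_
      by_contra hpE
      exact hp (W.primeSeq_of_eq_zero (W.regVal_of_unit (hEu p hpE)))
    rw [h1, ← Multiset.coe_sumAddMonoidHom, map_sum,
      ← Finset.sum_filter_add_sum_filter_not E (fun p => conductorSet S ⊆ p),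
      Finset.sum_eq_zero (s := E.filter fun p : minimalPrimeSIdeals S => conductorSet S ⊆ p)
        fun p hp => ?_, zero_add]
    · refine Finset.sum_congr rfl fun p hp => ?_
      have hreg := (Finset.mem_filter.1 hp).2
      rw [W.primeSeq_of_reg hreg, Multiset.coe_sumAddMonoidHom, Multiset.sum_replicate,
        W.localClass_regular hreg (hxl p)]
    · rw [W.primeSeq_of_sing (Finset.mem_filter.1 hp).2, map_zero]

-- The subsequence `t.1` is distributed over the regular primes and prescribes the exponents of `y`
-- there; at singular primes `exists_localPart_split` is used.
omit [Fintype (Sing S)] in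
theorem exists_toAmb_split {x : minimalPrimeSIdeals S → Q} (hx : x ∈ ideles S)
    (hxl : ∀ p, x p ∈ loc p) {t t' : W.blockData.Amb} (ht : ∀ i, W.blockData.Val i (t.2 i))
    (ht' : ∀ i, W.blockData.Val i (t'.2 i)) (h : t + t' = W.toAmb x) :
    ∃ y ∈ ideles S, (∀ p, y p ∈ loc p) ∧ (∀ p, x p / y p ∈ loc p) ∧ W.toAmb y = t := by
  classical
  set E := (mem_ideles.1 hx).toFinset with hE
  have hle : t.1 ≤ ∑ p ∈ E, W.primeSeq (fun p => W.regVal p (x p)) p := by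
    rw [← toAmb_fst_eq_sum hx, ← h]
    exact Multiset.le_add_right _ _
  obtain ⟨s, hs1, hs2⟩ := Multiset.exists_eq_sum_of_le_sum E _ hle
  set m : minimalPrimeSIdeals S → ℕ := fun p => if p ∈ E then Multiset.card (s p) else 0 with hm
  have hmE : ∀ p, p ∉ E → m p = 0 := fun p hp => if_neg hp
  have hsm : ∀ p ∈ E, s p = W.primeSeq m p := by
    intro p hp
    have h1 := hs1 p hp
    by_cases hreg : conductorSet S ⊆ p
    · rw [W.primeSeq_of_sing hreg] at h1 ⊢
      exact Multiset.le_zero.1 h1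
    · rw [W.primeSeq_of_reg hreg] at h1 ⊢
      obtain ⟨k, -, hk⟩ := Multiset.le_replicate_iff.1 h1
      simp only [hm, if_pos hp, hk, Multiset.card_replicate]
  have hmle : ∀ p : minimalPrimeSIdeals S, ¬ conductorSet S ⊆ p → m p ≤ W.regVal p (x p) := by
    intro p hreg
    by_cases hp : p ∈ E
    · have := Multiset.card_le_card (hs1 p hp)
      rw [W.primeSeq_of_reg hreg, Multiset.card_replicate] at this
      simpa only [hm, if_pos hp] using this
    · rw [hmE p hp]; exact Nat.zero_le _
  have hloc : ∀ p, ∃ y ∈ loc p, x p / y ∈ loc p ∧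
      (∀ hp : conductorSet S ⊆ p, W.localPart ⟨p, hp⟩ y = t.2 ⟨p, hp⟩) ∧
      (¬ conductorSet S ⊆ p → W.regVal p y = m p) ∧ (p ∉ E → y ∈ locUnits p) := by
    intro p
    by_cases hp : conductorSet S ⊆ p
    · obtain ⟨y, hy, hxy, hyt⟩ := W.exists_localPart_split (i := ⟨p, hp⟩) (hxl p) (ht _) (ht' _)
        (congrFun (congrArg Prod.snd h) ⟨p, hp⟩)
      refine ⟨y, hy, hxy, fun _ => hyt, fun h => absurd hp h, fun hpE => ⟨hy, ?_⟩⟩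
      have hu : x p ∈ locUnits p := by
        by_contra hu
        exact hpE ((Set.Finite.mem_toFinset _).2 hu)
      have := Submonoid.mul_mem _ hxy hu.2
      rwa [div_mul_eq_mul_div, mul_inv_cancel, one_div] at this
    · refine ⟨(W.exps p).unif ^ m p, W.unif_pow_mem hp _,
        W.div_unif_pow_mem hp (hxl p) (hmle p hp), fun h => absurd h hp,
        fun _ => W.regVal_unif_pow p _, fun hpE => ?_⟩
      rw [hmE p hpE, pow_zero]
      exact one_mem _
  choose y hy hxy hyt hym hyE using hloc
  have hyi : y ∈ ideles S := E.finite_toSet.subset fun p hp => by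
    by_contra h
    exact hp (hyE p h)
  refine ⟨y, hyi, hy, hxy, Prod.ext ?_ (funext fun i => hyt i.1 i.2)⟩
  rw [hs2, Finset.sum_congr rfl hsm]
  have hfun : ∀ p, W.primeSeq (fun p => W.regVal p (y p)) p = W.primeSeq m p := by
    intro p
    by_cases hp : conductorSet S ⊆ p
    · rw [W.primeSeq_of_sing hp, W.primeSeq_of_sing hp]
    · rw [W.primeSeq_of_reg hp, W.primeSeq_of_reg hp, hym p hp]
  simp only [toAmb, hfun]
  refine finsum_eq_sum_of_support_subset _ fun p hp => ?_
  by_contra hpE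
  exact hp (W.primeSeq_of_eq_zero (hmE p hpE))

/-- The singular components are prescribed directly. Each term of the sequence is realized by an
element of exponent 1 at a regular prime of that class. -/
theorem exists_toAmb_eq
    (hclass : ∀ g, ∃ p : minimalPrimeSIdeals S, ¬ conductorSet S ⊆ p ∧ W.primeClass p = g)
    {t : W.blockData.Amb} (ht : ∀ i, W.blockData.Val i (t.2 i)) :
    ∃ y ∈ ideles S, (∀ p, y p ∈ loc p) ∧ W.toAmb y = t := by
  classical
  obtain ⟨s, t₂⟩ := t
  induction s using Multiset.induction_on with
  | empty =>
    have hloc : ∀ p : minimalPrimeSIdeals S, ∃ y ∈ loc p,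
        (∀ hp : conductorSet S ⊆ p, W.localPart ⟨p, hp⟩ y = t₂ ⟨p, hp⟩) ∧
        (¬ conductorSet S ⊆ p → y = 1) := by
      intro p
      by_cases hp : conductorSet S ⊆ p
      · obtain ⟨y, hy, hyt, -⟩ := W.exists_localPart_eq (i := ⟨p, hp⟩) (ht ⟨p, hp⟩)
        exact ⟨y, hy, fun _ => hyt, fun h => absurd hp h⟩
      · exact ⟨1, Submonoid.one_mem _, fun h => absurd h hp, fun _ => rfl⟩
    choose y hy hyt hy1 using hloc
    refine ⟨y, ?_, hy, Prod.ext ?_ (funext fun i => hyt i.1 i.2)⟩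
    · refine (Set.finite_range (Subtype.val : Sing S → minimalPrimeSIdeals S)).subset
        fun p hp => ?_
      by_contra hsing
      refine hp ?_
      rw [hy1 p fun h => hsing ⟨⟨p, h⟩, rfl⟩]
      exact one_mem _
    · refine finsum_eq_zero_of_forall_eq_zero fun p => ?_
      by_cases hp : conductorSet S ⊆ p
      · exact W.primeSeq_of_sing hp
      · exact W.primeSeq_of_eq_zero (by
          rw [hy1 p hp]; exact W.regVal_of_unit (one_mem _))
  | cons g s ih =>
    obtain ⟨y, hyi, hy, hyt⟩ := ih ht
    obtain ⟨p, hp, hpg⟩ := hclass g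
    have hzl : ∀ p', (Pi.mulSingle p (W.exps p).unif : minimalPrimeSIdeals S → Q) p' ∈ loc p' := by
      intro p'
      by_cases h : p' = p
      · subst h
        rw [Pi.mulSingle_eq_same]
        simpa using W.unif_pow_mem hp 1
      · rw [Pi.mulSingle_eq_of_ne h]
        exact Submonoid.one_mem _
    refine ⟨Pi.mulSingle p (W.exps p).unif * y, mul_mem (mulSingle_mem_ideles p _) hyi,
      fun p' => Submonoid.mul_mem _ (hzl p') (hy p'), ?_⟩
    rw [toAmb_mul (mulSingle_mem_ideles p _) hyi hzl hy, hyt, ← Multiset.singleton_add]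
    have : W.toAmb (Pi.mulSingle p (W.exps p).unif) = ({g}, 0) := by
      refine Prod.ext ?_ (funext fun i => W.localPart_of_unit i ?_)
      · simp only [toAmb]
        rw [finsum_eq_single _ p fun p' h => W.primeSeq_of_eq_zero (by
          rw [Pi.mulSingle_eq_of_ne h]; exact W.regVal_of_unit (one_mem _)), W.primeSeq_of_reg hp,
          Pi.mulSingle_eq_same, hpg]
        have h1 := W.regVal_unif_pow p 1
        rw [pow_one] at h1
        rw [h1, Multiset.replicate_one]
      · rw [Pi.mulSingle_eq_of_ne (ne_of_apply_ne Subtype.val fun h => hp (by rw [← h]; exact i.2))]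
        exact one_mem _
    rw [this]
    exact Prod.ext rfl (zero_add _)

theorem toAmb_const_mem {a : Q} (ha : a ∈ S) : W.toAmb (fun _ => a) ∈ W.blockData.block := by
  refine ⟨fun i => W.val_localPart i (mem_loc ha _), ?_⟩
  rw [tot_toAmb (W.const_mem_ideles a) fun p => mem_loc ha p,
    (W.ideleClass_eq_one_iff _).2 ⟨a, fun p => ?_⟩]
  · rfl
  · change a / a ∈ locUnits p
    rw [div_self']; exact one_mem _

/-- Total class zero makes the family constant up to local units, and the constant lies in every
localization. -/
theorem exists_const_of_mem {y : minimalPrimeSIdeals S → Q} (hy : y ∈ ideles S)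
    (hyl : ∀ p, y p ∈ loc p) (h : W.blockData.tot (W.toAmb y) = 0) :
    ∃ b ∈ S, (∀ p, y p / b ∈ locUnits p) ∧ W.toAmb (fun _ => b) = W.toAmb y := by
  rw [tot_toAmb hy hyl] at h
  obtain ⟨b, hb⟩ := (W.ideleClass_eq_one_iff ⟨y, hy⟩).1 h
  have hb' : ∀ p, b / y p ∈ locUnits p := fun p => by
    have := inv_mem (hb p)
    rwa [inv_div] at this
  refine ⟨b, W.mem_of_forall fun p => ?_, hb, toAmb_eq_of_units hy hyl hb'⟩
  have := Submonoid.mul_mem _ (hb' p).1 (hyl p)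
  rwa [div_mul_cancel] at this

/-- The transfer of factorizations to the block monoid. -/
theorem distances_eq_block {H : Type*} [CancelCommMonoid H] {φ : H →* Q}
    (hφ : Function.Injective φ) (hS : S = MonoidHom.mrange φ)
    (hclass : ∀ g, ∃ p : minimalPrimeSIdeals S, ¬ conductorSet S ⊆ p ∧ W.primeClass p = g) :
    distances H = distancesIn W.blockData.block := by
  have hmem : ∀ a, φ a ∈ S := fun a => by rw [hS]; exact ⟨a, rfl⟩
  have hex : ∀ x ∈ S, ∃ a, φ a = x := fun x hx => by rw [hS] at hx; exact hx
  refine distances_eq_distancesIn (θ := fun a => W.toAmb fun _ => φ a) (fun a b => ?_) (fun a => ?_)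
    (fun a => toAmb_const_mem (hmem a)) (fun a v hv w hw hvw => ?_) fun x hx => ?_
  · rw [← toAmb_mul (W.const_mem_ideles _) (W.const_mem_ideles _) (fun p => mem_loc (hmem a) p)
      fun p => mem_loc (hmem b) p]
    congr 1
    funext p
    rw [map_mul]; rfl
  · constructor
    · intro h
      have hu := units_of_toAmb_eq_zero (W.const_mem_ideles _) (fun p => mem_loc (hmem a) p) h
      obtain ⟨b, hb⟩ := hex _ (W.mem_of_forall fun p => (hu p).2)
      refine IsUnit.of_mul_eq_one b (hφ ?_)
      rw [map_mul, hb, mul_inv_cancel, map_one]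
    · rintro ⟨u, rfl⟩
      refine toAmb_of_units fun p => ⟨mem_loc (hmem _) p, ?_⟩
      have h1 : (φ u)⁻¹ = φ ((u⁻¹ : Hˣ) : H) := by
        rw [inv_eq_iff_mul_eq_one, ← map_mul, Units.mul_inv, map_one]
      rw [h1]
      exact mem_loc (hmem _) p
  -- A decomposition is first lifted to families. Since `v` has total class zero, the family over
  -- `v` may be replaced by an element `b` of the monoid, which divides `a`.
  · obtain ⟨y, hyi, hyl, hay, hyv⟩ := exists_toAmb_split (W.const_mem_ideles (φ a))
      (fun p => mem_loc (hmem a) p) hv.1 hw.1 hvw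
    obtain ⟨b', hb', hyb, hbv⟩ := exists_const_of_mem hyi hyl (by rw [hyv]; exact hv.2)
    obtain ⟨b, rfl⟩ := hex b' hb'
    obtain ⟨c, hc⟩ := hex (φ a / φ b) (W.mem_of_forall fun p => by
      have := Submonoid.mul_mem _ (hay p) (hyb p).1
      rwa [div_mul_div_cancel] at this)
    have habc : a = b * c := hφ (by rw [map_mul, hc, mul_div_cancel])
    refine ⟨b, c, habc, hbv.trans hyv, ?_⟩
    have hadd := toAmb_mul (W := W) (W.const_mem_ideles (φ b)) (W.const_mem_ideles (φ c))
      (fun p => mem_loc (hmem b) p) fun p => mem_loc (hmem c) p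
    rw [hbv.trans hyv, show ((fun _ => φ b) * fun _ => φ c : minimalPrimeSIdeals S → Q) =
      fun _ => φ a by funext p; rw [habc, map_mul]; rfl, ← hvw] at hadd
    exact (add_left_cancel hadd).symm
  · obtain ⟨y, hyi, hyl, hyx⟩ := exists_toAmb_eq hclass hx.1
    obtain ⟨b', hb', -, hbv⟩ := exists_const_of_mem hyi hyl (by rw [hyx]; exact hx.2)
    obtain ⟨b, rfl⟩ := hex b' hb'
    exact ⟨b, hbv.trans hyx⟩

end WeaklyKrullData

end LocalToBlock

/-! ### Assembling the theorem -/

theorem exists_div_of_mrange {H : Type*} [CancelCommMonoid H] (x : Algebra.GrothendieckGroup H) :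
    ∃ a ∈ insideQuotientGroup H, ∃ b ∈ insideQuotientGroup H, x = a / b := by
  obtain ⟨⟨a, b⟩, hab⟩ := (Localization.monoidOf (⊤ : Submonoid H)).surj x
  refine ⟨_, ⟨a, rfl⟩, _, ⟨b.1, rfl⟩, ?_⟩
  rw [eq_div_iff_mul_eq']
  exact hab

/-- All singular primes contain one fixed element of the conductor. -/
theorem finite_singular {Q : Type*} [CommGroup Q] {S : Submonoid Q} (hwk : IsWeaklyKrull S)
    (hcond : (conductorSet S).Nonempty) : Finite (WeaklyKrullData.Sing S) := by
  obtain ⟨c, hc⟩ := hcond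
  have hcS : c ∈ S := by simpa using hc 1 (Submonoid.one_mem _)
  have := (hwk.2 c hcS).to_subtype
  refine Finite.of_injective (β := {p ∈ minimalPrimeSIdeals S | c ∈ p})
    (fun p => ⟨p.1.1, p.1.2, p.2 hc⟩) fun p p' h => ?_
  exact Subtype.ext (Subtype.ext (Subtype.mk.inj h))

theorem exists_weaklyKrullData {Q : Type*} [CommGroup Q] {S : Submonoid Q}
    (hquot : ∀ x : Q, ∃ a ∈ S, ∃ b ∈ S, x = a / b) (hsn : IsSeminormalMonoid S)
    (hwk : IsWeaklyKrull S)
    (hfp : ∀ (p : Set Q) (hp : p ∈ minimalPrimeSIdeals S),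
      IsFinitelyPrimary (localizationAtPrime S p (isPrimeSIdeal_of_mem hp))) :
    Nonempty (WeaklyKrullData S) := by
  have hexp : ∀ p : minimalPrimeSIdeals S, Nonempty (ExponentData (loc p)) := fun p =>
    (hfp p p.2).nonempty_exponentData (localizationAtPrime_seminormal _ hsn) fun x => by
      obtain ⟨a, ha, b, hb, h⟩ := hquot x
      exact ⟨a, mem_loc ha p, b, mem_loc hb p, h⟩
  exact ⟨⟨hquot, fun {x} h => (hwk.1 x).2 fun p hp => h ⟨p, hp⟩,
    fun {a} ha => (hwk.2 a ha).preimage Subtype.val_injective.injOn |>.subset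
      fun p hp => ⟨p.2, hp⟩, fun p => (hexp p).some⟩⟩

theorem theorem1p1 {H : Type*} [CancelCommMonoid H]
    (S : Submonoid (Algebra.GrothendieckGroup H)) (hS : S = insideQuotientGroup H)
    (hsn : IsSeminormalMonoid S)
    (hvn : IsVNoetherian S)
    (hwk : IsWeaklyKrull S)
    (hcond : (conductorSet S).Nonempty)
    (hfp : ∀ (p : Set (Algebra.GrothendieckGroup H)) (hp : p ∈ minimalPrimeSIdeals S),
      IsFinitelyPrimary (localizationAtPrime S p (isPrimeSIdeal_of_mem hp)))
    (hclass : ∀ g : VClassGroup S, ∃ p ∈ minimalPrimeSIdeals S, ¬ conductorSet S ⊆ p ∧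
      ∃ u : (FracVIdeal S)ˣ, (u : FracVIdeal S).carrier = p ∧ (u : VClassGroup S) = g) :
    (distances H = ∅ ∨ IsLeast (distances H) 1) ∧
    (Nat.card (VClassGroup S) = 1 → distances H ⊆ {1}) ∧
    (Infinite (VClassGroup S) → distances H = {d : ℕ | 0 < d}) ∧
    (Finite (VClassGroup S) →
      ({p ∈ minimalPrimeSIdeals S |
          {P ∈ minimalPrimeSIdeals (completeIntClosure S) | P ∩ (S : Set _) = p}.Nontrivial
        }.Subsingleton ∨
        ∀ g : VClassGroup S, g ^ 2 = 1) →
      ∃ a b : ℕ, distances H = Set.Icc a b) := by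
  classical
  have hquot : ∀ x : Algebra.GrothendieckGroup H, ∃ a ∈ S, ∃ b ∈ S, x = a / b := by
    rw [hS]; exact exists_div_of_mrange
  obtain ⟨W⟩ := exists_weaklyKrullData hquot hsn hwk hfp
  have := finite_singular hwk hcond
  have := Fintype.ofFinite (WeaklyKrullData.Sing S)
  have hcls : ∀ g, ∃ p : minimalPrimeSIdeals S, ¬ conductorSet S ⊆ p ∧ W.primeClass p = g := by
    intro g
    obtain ⟨p, hp, hreg, u, hu, hg⟩ := hclass g.toMul
    refine ⟨⟨p, hp⟩, hreg, ?_⟩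
    rw [WeaklyKrullData.primeClass,
      W.localClass_of_regular (p := ⟨p, hp⟩) hreg hu (W.exps ⟨p, hp⟩).val_unif, hg]
    rfl
  rw [WeaklyKrullData.distances_eq_block (W := W) (φ := Algebra.GrothendieckGroup.of)
    Algebra.GrothendieckGroup.of_injective hS hcls]
  refine ⟨BlockData.distances_eq_empty_or_isLeast _, fun h1 d hd => ?_, fun hinf => ?_,
    fun hfin hor => ?_⟩
  · have : Subsingleton (Additive (VClassGroup S)) :=
      (Nat.card_eq_one_iff_unique.1 h1).1
    exact BlockData.distances_of_subsingleton hd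
  · have : Infinite (Additive (VClassGroup S)) := hinf
    exact BlockData.distances_of_infinite _
  · have : Finite (Additive (VClassGroup S)) := hfin
    refine BlockData.distances_eq_Icc _ (hor.imp (fun h i i' hi hi' => ?_) fun h g => ?_)
    -- Two exponents at a prime give two minimal primes of the complete integral closure above it,
    -- so at most one index has rank at least 2.
    · exact Subtype.ext (Subtype.ext (h ⟨i.1.2, W.nontrivial_of_two_le_rank hi⟩
        ⟨i'.1.2, W.nontrivial_of_two_le_rank hi'⟩))
    · have := h g.toMul
      rw [pow_two] at this
      exact this
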